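/- Let $R=\mathbb{C}[x]$ with $\deg x=1$ and $R^s=\mathbb{C}[x^2]$. All bimodules are graded $R$-bimodules, $q$ denotes the shift of the internal grading by $1$ (so the generator of $qR$ has degree $1$), $s$ the shift of the homological (cochain) degree by $1$, $t=s^2q^{-1}$, and $\otimes=\otimes_R$. Let $\mathbf 1=R$ and $B=q^{-1/2}R\otimes_{R^s}R$. (Reduced two-strand) Soergel bimodules are the bimodules obtained from $R$ and $B$ by tensor products over $R$, grading shifts, finite direct sums and direct summands. Let $$\sigma=\Big[B\xrightarrow{1\otimes1\mapsto1}s\,q^{-1/2}R\Big],\qquad \sigma^{-1}=\Big[s^{-1}q^{1/2}R\xrightarrow{1\mapsto x\otimes1+1\otimes x}B\Big],$$ $$\mathbf{FT}=\Big[q^{1/2}B\xrightarrow{\ \delta\ }s\,q^{-1/2}B\xrightarrow{\ 1\otimes 1\mapsto 1\ }s^2q^{-1}R\Big],\qquad \mathbf{FT}^{-1}=\Big[s^{-2}qR\xrightarrow{1\mapsto x\otimes1+1\otimes x}s^{-1}q^{1/2}B\xrightarrow{\ \delta\ }q^{-1/2}B\Big],$$ where $\delta$ is multiplication by $\tfrac12(x\otimes1-1\otimes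 x)$, and let $\mathbf{FT}^{-k}=(\mathbf{FT}^{-1})^{\otimes k}$. Then $\mathbf{FT}\simeq\sigma\otimes\sigma$, $\mathbf{FT}^{-1}\simeq\sigma^{-1}\otimes\sigma^{-1}$ and $\mathbf{FT}\otimes\mathbf{FT}^{-1}\simeq\mathbf 1$ (homotopy equivalences of complexes of graded bimodules). The two eigenmaps $$z:q\mathbf 1\to\mathbf{FT},\quad 1\mapsto x\otimes1+1\otimes x\in q^{1/2}B,\qquad\qquad w:t\mathbf 1\to\mathbf{FT},\quad w=\mathrm{Id}:tR\to s^2q^{-1}R,$$ are morphisms of complexes. Fix any homotopy equivalence $\varepsilon:\mathbf{FT}\otimes\mathbf{FT}^{-1}\simeq\mathbf 1$; tensoring $z$ and $w$ with $\mathbf{FT}^{-k-1}$ on the right and applying $\varepsilon$ gives maps $z:q\mathbf{FT}^{-k-1}\to\mathbf{FT}^{-k}$ and $w:t\mathbf{FT}^{-k-1}\to\mathbf{FT}^{-k}$. Let $x$ denote left multiplication by $x$. Consider the sequence of bounded complexes of Soergel bimodules $$\cdots\xrightarrow{\alpha_1}qt\,\big(q\mathbf{FT}^{-2}\oplus t\mathbf{FT}^{-2}\big)\xrightarrow{\alpha_2}qt\,\big(\mathbf{FT}^{-2}\oplus\mathbf{FT}^{-1}\big)\xrightarrow{\alpha_1}q\mathbf{FT}^{-1}\oplus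 t\mathbf{FT}^{-1}\xrightarrow{(z,w)}\mathbf 1,$$ with $(qt)^j(\mathbf{FT}^{-j-1}\oplus\mathbf{FT}^{-j})$ in position $-2j$ for $j\ge1$, $(qt)^j(q\mathbf{FT}^{-j-1}\oplus t\mathbf{FT}^{-j-1})$ in position $-2j-1$ for $j\ge0$, $\mathbf 1$ in position $0$, and $$\alpha_1=\begin{pmatrix}w&0\\-z&x\end{pmatrix},\qquad\alpha_2=\begin{pmatrix}x&0\\z&w\end{pmatrix}.$$ This sequence is a complex up to coherent homotopy: it has a total complex (convolution), that is, on the direct sum of all terms, each placed in its position, there is a bigraded bimodule differential which does not move to the left, whose diagonal entries are the differentials of the (shifted) terms, and whose entries between consecutive positions are homotopic to the given maps. Every such total complex is contractible, i.e. homotopy equivalent to $0$ as a complex of graded bimodules. -/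

import Mathlib

open scoped TensorProduct Polynomial

noncomputable section

namespace SBim2

/-! ## Complexes of graded bimodules over `ℂ[x]`

The reduced polynomial ring is `R = ℂ[x]` with `deg x = 1`. An `R`-bimodule is a complex vector
space with two commuting operators, the left and the right multiplication by `x`. All degrees are
pairs `(i, a)`, where `i` is the homological degree (cohomological convention) and `a` is *twice*
the internal degree, so that the half-integral shifts of the theory become integral. -/

/-- The sign `(-1) ^ i`. -/
def parity (i : ℤ) : ℂ := ((i.negOnePow : ℤˣ) : ℤ)

theorem parity_zero : parity 0 = 1 := by simp [parity]

theorem parity_add (i j : ℤ) : parity (i + j) = parity i * parity j := by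
  simp [parity, Int.negOnePow_add]

theorem parity_succ (i : ℤ) : parity (i + 1) = - parity i := by
  simp [parity, Int.negOnePow_succ]

theorem parity_mul_self (i : ℤ) : parity i * parity i = 1 := by
  rw [parity, ← Int.cast_mul, ← Units.val_mul]; simp

/-- A cochain complex of graded `R`-bimodules, given by its total space `V`, which is the direct
sum of its bihomogeneous pieces `gr (i, a)`. The operator `sgn` is the parity operator
`v ↦ (-1) ^ i v`. Such an object with `d = 0` is a (homologically graded) graded bimodule. -/
structure BimCpx where
  V : Type
  [acg : AddCommGroup V]
  [mod : Module ℂ V]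
  lx : V →ₗ[ℂ] V
  rx : V →ₗ[ℂ] V
  d : V →ₗ[ℂ] V
  sgn : V →ₗ[ℂ] V
  gr : ℤ × ℤ → Submodule ℂ V
  internal : DirectSum.IsInternal gr
  lx_mem : ∀ p v, v ∈ gr p → lx v ∈ gr (p + (0, 2))
  rx_mem : ∀ p v, v ∈ gr p → rx v ∈ gr (p + (0, 2))
  d_mem : ∀ p v, v ∈ gr p → d v ∈ gr (p + (1, 0))
  sgn_eq : ∀ p v, v ∈ gr p → sgn v = parity p.1 • v
  lx_rx : ∀ v, lx (rx v) = rx (lx v)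
  d_lx : ∀ v, d (lx v) = lx (d v)
  d_rx : ∀ v, d (rx v) = rx (d v)
  d_d : ∀ v, d (d v) = 0

attribute [instance] BimCpx.acg BimCpx.mod

/-! ### Auxiliary facts on gradings -/

theorem iSup_gr (M : BimCpx) : (⨆ p, M.gr p) = ⊤ := M.internal.submodule_iSup_eq_top

/-- Two linear maps that agree on homogeneous elements are equal. -/
theorem hom_ext {M : BimCpx} {W : Type*} [AddCommGroup W] [Module ℂ W] {f g : M.V →ₗ[ℂ] W}
    (h : ∀ p v, v ∈ M.gr p → f v = g v) : f = g := by
  ext v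
  have hv : v ∈ ⨆ p, M.gr p := by rw [iSup_gr]; trivial
  induction hv using Submodule.iSup_induction' with
  | mem p x hx => exact h p x hx
  | zero => simp
  | add x y _ _ hx hy => simp [hx, hy]

theorem internal_of {V : Type*} [AddCommGroup V] [Module ℂ V] {gr : ℤ × ℤ → Submodule ℂ V}
    (htop : ∀ v, v ∈ ⨆ p, gr p) (c : V →ₗ[ℂ] (ℤ × ℤ →₀ V))
    (hc : ∀ p v, v ∈ gr p → c v = Finsupp.single p v) : DirectSum.IsInternal gr := by
  classical
  have key : ∀ x : DirectSum (ℤ × ℤ) (fun p => gr p), ∀ p,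
      c (DirectSum.coeLinearMap gr x) p = x p := by
    intro x p
    induction x using DirectSum.induction_on with
    | zero => simp
    | of i y =>
      rw [← DirectSum.lof_eq_of ℂ, DirectSum.coeLinearMap_lof, hc i _ y.2, DirectSum.lof_eq_of]
      by_cases h : i = p
      · subst h; simp
      · rw [Finsupp.single_eq_of_ne (Ne.symm h), DirectSum.of_eq_of_ne _ _ _ (Ne.symm h)]; rfl
    | add x y hx hy => simp [hx, hy]
  constructor
  · intro x y hxy
    have hxy' : DirectSum.coeLinearMap gr x = DirectSum.coeLinearMap gr y := hxy
    refine DFinsupp.ext fun p => Subtype.ext ?_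
    have h1 := key x p
    rw [hxy'] at h1
    exact h1.symm.trans (key y p)
  · have hs := DirectSum.isInternal_submodule_iff_iSupIndep_and_iSup_eq_top gr
    have : LinearMap.range (DirectSum.coeLinearMap gr) = ⊤ := by
      rw [DirectSum.range_coeLinearMap]
      exact eq_top_iff.2 fun v _ => htop v
    exact LinearMap.range_eq_top.1 this

/-- The map that sends `v` to the family of its homogeneous components. -/
def comps (M : BimCpx) : M.V →ₗ[ℂ] (ℤ × ℤ →₀ M.V) :=
  (DirectSum.toModule ℂ (ℤ × ℤ) (ℤ × ℤ →₀ M.V)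
      (fun p => Finsupp.lsingle p ∘ₗ (M.gr p).subtype)) ∘ₗ
    (LinearEquiv.ofBijective (DirectSum.coeLinearMap M.gr) M.internal).symm.toLinearMap

theorem comps_eq (M : BimCpx) {p : ℤ × ℤ} {v : M.V} (hv : v ∈ M.gr p) :
    comps M v = Finsupp.single p v := by
  have : (LinearEquiv.ofBijective (DirectSum.coeLinearMap M.gr) M.internal).symm v
      = DirectSum.lof ℂ (ℤ × ℤ) (fun p => M.gr p) p ⟨v, hv⟩ := by
    rw [LinearEquiv.symm_apply_eq]
    exact (DirectSum.coeLinearMap_lof M.gr p ⟨v, hv⟩).symm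
  simp only [comps, LinearMap.comp_apply, LinearEquiv.coe_coe]
  rw [this, DirectSum.toModule_lof]
  rfl

theorem sgn_lx (M : BimCpx) (v : M.V) : M.sgn (M.lx v) = M.lx (M.sgn v) := by
  refine LinearMap.congr_fun (f := M.sgn ∘ₗ M.lx) (g := M.lx ∘ₗ M.sgn) (hom_ext ?_) v
  intro p v hv
  simp [M.sgn_eq _ _ (M.lx_mem _ _ hv), M.sgn_eq _ _ hv]

theorem sgn_rx (M : BimCpx) (v : M.V) : M.sgn (M.rx v) = M.rx (M.sgn v) := by
  refine LinearMap.congr_fun (f := M.sgn ∘ₗ M.rx) (g := M.rx ∘ₗ M.sgn) (hom_ext ?_) v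
  intro p v hv
  simp [M.sgn_eq _ _ (M.rx_mem _ _ hv), M.sgn_eq _ _ hv]

theorem sgn_d (M : BimCpx) (v : M.V) : M.sgn (M.d v) = - M.d (M.sgn v) := by
  refine LinearMap.congr_fun (f := M.sgn ∘ₗ M.d) (g := -(M.d ∘ₗ M.sgn)) (hom_ext ?_) v
  intro p v hv
  simp [M.sgn_eq _ _ (M.d_mem _ _ hv), M.sgn_eq _ _ hv, parity_succ]

theorem sgn_sgn (M : BimCpx) (v : M.V) : M.sgn (M.sgn v) = v := by
  refine LinearMap.congr_fun (f := M.sgn ∘ₗ M.sgn) (g := LinearMap.id) (hom_ext ?_) v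
  intro p v hv
  simp [M.sgn_eq _ _ hv, smul_smul, parity_mul_self]

/-! ### Basic constructions -/

/-- The unit object: `R = ℂ[x]` in homological degree `0`, with `x ^ n` in internal degree `n`. -/
abbrev unit : BimCpx where
  V := ℂ[X]
  lx := LinearMap.mulLeft ℂ Polynomial.X
  rx := LinearMap.mulLeft ℂ Polynomial.X
  d := 0
  sgn := LinearMap.id
  gr p :=
    { carrier := {f | ∀ n, f.coeff n ≠ 0 → p = (0, 2 * (n : ℤ))}
      add_mem' := by
        intro f g hf hg n hn
        by_cases h : f.coeff n = 0
        · exact hg n (by simpa [h] using hn)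
        · exact hf n h
      zero_mem' := by simp
      smul_mem' := by
        intro c f hf n hn
        exact hf n (by intro h; simp [h] at hn) }
  internal := by
    refine internal_of ?_
      (Polynomial.lsum fun n => Finsupp.lsingle (0, 2 * (n : ℤ)) ∘ₗ Polynomial.monomial n) ?_
    · intro f
      induction f using Polynomial.induction_on' with
      | add f g hf hg => exact Submodule.add_mem _ hf hg
      | monomial n a =>
        refine Submodule.mem_iSup_of_mem (0, 2 * (n : ℤ)) ?_
        intro m hm
        rw [Polynomial.coeff_monomial] at hm
        split_ifs at hm with h
        · rw [h]
        · simp at hm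
    · intro p f hf
      rw [Polynomial.lsum_apply, Polynomial.sum_def]
      conv_rhs => rw [f.as_sum_support, Finsupp.single_finsetSum]
      refine Finset.sum_congr rfl fun n hn => ?_
      rw [hf n (Polynomial.mem_support_iff.1 hn)]
      rfl
  lx_mem := by
    intro p f hf n hn
    cases n with
    | zero => simp at hn
    | succ n =>
      have := hf n (by simpa [Polynomial.coeff_X_mul] using hn)
      subst this
      ext <;> simp; ring
  rx_mem := by
    intro p f hf n hn
    cases n with
    | zero => simp at hn
    | succ n =>
      have := hf n (by simpa [Polynomial.coeff_X_mul] using hn)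
      subst this
      ext <;> simp; ring
  d_mem := by intro p v _; exact Submodule.zero_mem _
  sgn_eq := by
    intro p f hf
    by_cases h : f = 0
    · simp [h]
    · obtain ⟨n, hn⟩ : ∃ n, f.coeff n ≠ 0 := by
        by_contra! hc
        exact h (Polynomial.ext (by simpa using hc))
      rw [hf n hn]
      simp [parity_zero]
  lx_rx := by intro v; rfl
  d_lx := by intro v; simp
  d_rx := by intro v; simp
  d_d := by intro v; simp

/-- The shift `s^i q^(a/2) M` for `k = (i, a)`; an element of degree `p` gets degree `p + k`. -/
abbrev shift (k : ℤ × ℤ) (M : BimCpx) : BimCpx where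
  V := M.V
  lx := M.lx
  rx := M.rx
  d := parity k.1 • M.d
  sgn := parity k.1 • M.sgn
  gr p := M.gr (p - k)
  internal := by
    refine internal_of ?_ (Finsupp.lmapDomain M.V ℂ (· + k) ∘ₗ comps M) ?_
    · intro v
      have h : (⨆ p, M.gr (p - k)) = ⨆ p, M.gr p := (Equiv.subRight k).iSup_comp (g := M.gr)
      rw [h, iSup_gr]; trivial
    · intro p v hv
      simp [comps_eq M hv, Finsupp.mapDomain_single]
  lx_mem := by
    intro p v hv
    rw [show p + (0, 2) - k = p - k + (0, 2) by abel]; exact M.lx_mem _ _ hv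
  rx_mem := by
    intro p v hv
    rw [show p + (0, 2) - k = p - k + (0, 2) by abel]; exact M.rx_mem _ _ hv
  d_mem := by
    intro p v hv
    rw [show p + (1, 0) - k = p - k + (1, 0) by abel]
    exact Submodule.smul_mem _ _ (M.d_mem _ _ hv)
  sgn_eq := by
    intro p v hv
    rw [LinearMap.smul_apply, M.sgn_eq _ _ hv, smul_smul, ← parity_add]
    simp
  lx_rx := M.lx_rx
  d_lx := by intro v; simp [M.d_lx]
  d_rx := by intro v; simp [M.d_rx]
  d_d := by intro v; simp [M.d_d]

/-- The direct sum of two complexes. -/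
abbrev dirSum (M N : BimCpx) : BimCpx where
  V := M.V × N.V
  lx := M.lx.prodMap N.lx
  rx := M.rx.prodMap N.rx
  d := M.d.prodMap N.d
  sgn := M.sgn.prodMap N.sgn
  gr p := (M.gr p).prod (N.gr p)
  internal := by
    refine internal_of ?_
      (Finsupp.mapRange.linearMap (LinearMap.inl ℂ M.V N.V) ∘ₗ comps M ∘ₗ LinearMap.fst ℂ M.V N.V +
       Finsupp.mapRange.linearMap (LinearMap.inr ℂ M.V N.V) ∘ₗ comps N ∘ₗ LinearMap.snd ℂ M.V N.V)
      ?_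
    · rintro ⟨v, w⟩
      have hv : v ∈ ⨆ p, M.gr p := by rw [iSup_gr]; trivial
      have hw : w ∈ ⨆ p, N.gr p := by rw [iSup_gr]; trivial
      have h1 : LinearMap.inl ℂ M.V N.V v ∈ ⨆ p, (M.gr p).prod (N.gr p) := by
        have := Submodule.mem_map_of_mem (f := LinearMap.inl ℂ M.V N.V) hv
        rw [Submodule.map_iSup] at this
        refine SetLike.le_def.1 (iSup_le fun p => ?_) this
        refine le_iSup_of_le p ?_
        rintro _ ⟨x, hx, rfl⟩
        exact ⟨hx, Submodule.zero_mem _⟩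
      have h2 : LinearMap.inr ℂ M.V N.V w ∈ ⨆ p, (M.gr p).prod (N.gr p) := by
        have := Submodule.mem_map_of_mem (f := LinearMap.inr ℂ M.V N.V) hw
        rw [Submodule.map_iSup] at this
        refine SetLike.le_def.1 (iSup_le fun p => ?_) this
        refine le_iSup_of_le p ?_
        rintro _ ⟨x, hx, rfl⟩
        exact ⟨Submodule.zero_mem _, hx⟩
      have := Submodule.add_mem _ h1 h2
      simpa using this
    · rintro p ⟨v, w⟩ ⟨hv, hw⟩
      simp only [LinearMap.add_apply, LinearMap.comp_apply, LinearMap.fst_apply,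
        LinearMap.snd_apply]
      rw [comps_eq M hv, comps_eq N hw]
      simp [← Finsupp.single_add]
  lx_mem := fun p v hv => ⟨M.lx_mem _ _ hv.1, N.lx_mem _ _ hv.2⟩
  rx_mem := fun p v hv => ⟨M.rx_mem _ _ hv.1, N.rx_mem _ _ hv.2⟩
  d_mem := fun p v hv => ⟨M.d_mem _ _ hv.1, N.d_mem _ _ hv.2⟩
  sgn_eq := fun p v hv => Prod.ext (M.sgn_eq _ _ hv.1) (N.sgn_eq _ _ hv.2)
  lx_rx := fun v => Prod.ext (M.lx_rx _) (N.lx_rx _)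
  d_lx := fun v => Prod.ext (M.d_lx _) (N.d_lx _)
  d_rx := fun v => Prod.ext (M.d_rx _) (N.d_rx _)
  d_d := fun v => Prod.ext (M.d_d _) (N.d_d _)

/-- The direct sum of a countable family of complexes. -/
abbrev bigSum (P : ℕ → BimCpx) : BimCpx where
  V := DirectSum ℕ fun m => (P m).V
  lx := DFinsupp.mapRange.linearMap fun m => (P m).lx
  rx := DFinsupp.mapRange.linearMap fun m => (P m).rx
  d := DFinsupp.mapRange.linearMap fun m => (P m).d
  sgn := DFinsupp.mapRange.linearMap fun m => (P m).sgn
  gr p :=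
    { carrier := {v | ∀ m, v m ∈ (P m).gr p}
      add_mem' := fun hv hw m => Submodule.add_mem _ (hv m) (hw m)
      zero_mem' := fun m => Submodule.zero_mem _
      smul_mem' := fun c v hv m => Submodule.smul_mem _ c (hv m) }
  internal := by
    classical
    refine internal_of ?_
      (DirectSum.toModule ℂ ℕ _ fun m =>
        Finsupp.mapRange.linearMap (DirectSum.lof ℂ ℕ (fun m => (P m).V) m) ∘ₗ comps (P m)) ?_
    · intro v
      induction v using DirectSum.induction_on with
      | zero => exact Submodule.zero_mem _
      | add x y hx hy => exact Submodule.add_mem _ hx hy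
      | of m x =>
        have hx : x ∈ ⨆ p, (P m).gr p := by rw [iSup_gr]; trivial
        have := Submodule.mem_map_of_mem (f := DirectSum.lof ℂ ℕ (fun m => (P m).V) m) hx
        rw [Submodule.map_iSup] at this
        refine SetLike.le_def.1 (iSup_le fun p => ?_) this
        refine le_iSup_of_le p ?_
        rintro _ ⟨y, hy, rfl⟩ n
        rw [DirectSum.lof_eq_of]
        by_cases h : m = n
        · subst h; simpa using hy
        · rw [DirectSum.of_eq_of_ne _ _ _ (Ne.symm h)]; exact Submodule.zero_mem _
    · intro p v hv
      have hs : v = ∑ m ∈ DFinsupp.support v, DirectSum.lof ℂ ℕ (fun m => (P m).V) m (v m) := by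
        exact (DirectSum.sum_support_of v).symm
      conv_rhs => rw [hs, Finsupp.single_finsetSum]
      conv_lhs => rw [hs, map_sum]
      refine Finset.sum_congr rfl fun m _ => ?_
      rw [DirectSum.toModule_lof, LinearMap.comp_apply, comps_eq (P m) (hv m)]
      simp
  lx_mem := fun p v hv m => (P m).lx_mem _ _ (hv m)
  rx_mem := fun p v hv m => (P m).rx_mem _ _ (hv m)
  d_mem := fun p v hv m => (P m).d_mem _ _ (hv m)
  sgn_eq := fun p v hv => DFinsupp.ext fun m => (P m).sgn_eq _ _ (hv m)
  lx_rx := fun v => DFinsupp.ext fun m => (P m).lx_rx _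
  d_lx := fun v => DFinsupp.ext fun m => (P m).d_lx _
  d_rx := fun v => DFinsupp.ext fun m => (P m).d_rx _
  d_d := fun v => DFinsupp.ext fun m => (P m).d_d _

/-- The underlying bigraded bimodule of `M`, with the new differential `D`. -/
abbrev withD (M : BimCpx) (D : M.V →ₗ[ℂ] M.V) (hlx : ∀ v, D (M.lx v) = M.lx (D v))
    (hrx : ∀ v, D (M.rx v) = M.rx (D v)) (hmem : ∀ p v, v ∈ M.gr p → D v ∈ M.gr (p + (1, 0)))
    (hD : ∀ v, D (D v) = 0) : BimCpx where
  V := M.V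
  lx := M.lx
  rx := M.rx
  d := D
  sgn := M.sgn
  gr := M.gr
  internal := M.internal
  lx_mem := M.lx_mem
  rx_mem := M.rx_mem
  d_mem := hmem
  sgn_eq := M.sgn_eq
  lx_rx := M.lx_rx
  d_lx := hlx
  d_rx := hrx
  d_d := hD

/-! ### Tensor products -/

/-- The operator `m ⊗ n ↦ m x^e ⊗ n - m ⊗ x^e n`. -/
def balance (e : ℕ) (M N : BimCpx) : (M.V ⊗[ℂ] N.V) →ₗ[ℂ] (M.V ⊗[ℂ] N.V) :=
  TensorProduct.map (M.rx ^ e) LinearMap.id - TensorProduct.map LinearMap.id (N.lx ^ e)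

/-- The total space of the tensor product over the subring `ℂ[x^e]` of `R`. -/
abbrev TensorV (e : ℕ) (M N : BimCpx) : Type :=
  (M.V ⊗[ℂ] N.V) ⧸ LinearMap.range (balance e M N)

/-- The class of the pure tensor `m ⊗ n`. -/
abbrev tmul (e : ℕ) {M N : BimCpx} (m : M.V) (n : N.V) : TensorV e M N :=
  Submodule.Quotient.mk (m ⊗ₜ[ℂ] n)

theorem pow_comm {V : Type*} [AddCommGroup V] [Module ℂ V] {f g : V →ₗ[ℂ] V}
    (h : ∀ v, f (g v) = g (f v)) (e : ℕ) (v : V) : f ((g ^ e) v) = (g ^ e) (f v) :=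
  LinearMap.congr_fun (((show Commute f g from LinearMap.ext h).pow_right e).eq) v

theorem range_le_comap (e : ℕ) (M N : BimCpx) (f : (M.V ⊗[ℂ] N.V) →ₗ[ℂ] (M.V ⊗[ℂ] N.V))
    (h : ∀ m n, f (balance e M N (m ⊗ₜ n)) = balance e M N (f (m ⊗ₜ n))) :
    LinearMap.range (balance e M N) ≤ (LinearMap.range (balance e M N)).comap f := by
  rintro _ ⟨t, rfl⟩
  refine ⟨f t, ?_⟩
  have : balance e M N ∘ₗ f = f ∘ₗ balance e M N :=
    TensorProduct.ext' fun m n => (h m n).symm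
  exact LinearMap.congr_fun this t

theorem tensorV_ext {e : ℕ} {M N : BimCpx} {W : Type*} [AddCommGroup W] [Module ℂ W]
    {f g : TensorV e M N →ₗ[ℂ] W} (h : ∀ m n, f (tmul e m n) = g (tmul e m n)) : f = g :=
  Submodule.linearMap_qext _ (TensorProduct.ext' h)

theorem tmul_balance (e : ℕ) {M N : BimCpx} (m : M.V) (n : N.V) :
    tmul e ((M.rx ^ e) m) n = tmul e m ((N.lx ^ e) n) := by
  rw [tmul, tmul, Submodule.Quotient.eq]
  exact ⟨m ⊗ₜ n, by simp [balance]⟩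

/-- The degree `p` part of the tensor product. -/
def tensorGr (e : ℕ) (M N : BimCpx) (p : ℤ × ℤ) : Submodule ℂ (TensorV e M N) :=
  Submodule.span ℂ {v | ∃ a b : ℤ × ℤ, a + b = p ∧ ∃ m ∈ M.gr a, ∃ n ∈ N.gr b, tmul e m n = v}

theorem tmul_mem (e : ℕ) {M N : BimCpx} {a b : ℤ × ℤ} {m : M.V} {n : N.V} (hm : m ∈ M.gr a)
    (hn : n ∈ N.gr b) : tmul e m n ∈ tensorGr e M N (a + b) :=
  Submodule.subset_span ⟨a, b, rfl, m, hm, n, hn, rfl⟩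

theorem tmul_mem' (e : ℕ) {M N : BimCpx} {a b p : ℤ × ℤ} {m : M.V} {n : N.V} (hm : m ∈ M.gr a)
    (hn : n ∈ N.gr b) (hp : a + b = p) : tmul e m n ∈ tensorGr e M N p := hp ▸ tmul_mem e hm hn

theorem tensorGr_map {e : ℕ} {M N : BimCpx} {p : ℤ × ℤ} {W : Type*} [AddCommGroup W] [Module ℂ W]
    {f : TensorV e M N →ₗ[ℂ] W} {S : Submodule ℂ W}
    (h : ∀ a b, a + b = p → ∀ m ∈ M.gr a, ∀ n ∈ N.gr b, f (tmul e m n) ∈ S)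
    {v : TensorV e M N} (hv : v ∈ tensorGr e M N p) : f v ∈ S := by
  have : tensorGr e M N p ≤ S.comap f := by
    refine Submodule.span_le.2 ?_
    rintro _ ⟨a, b, hab, m, hm, n, hn, rfl⟩
    exact h a b hab m hm n hn
  exact this hv

/-- The family of homogeneous components on `M ⊗ N` before passing to the quotient. -/
def tensorComps₀ (e : ℕ) (M N : BimCpx) : (M.V ⊗[ℂ] N.V) →ₗ[ℂ] (ℤ × ℤ →₀ TensorV e M N) :=
  Finsupp.mapRange.linearMap (Submodule.mkQ _) ∘ₗ
    Finsupp.lmapDomain (M.V ⊗[ℂ] N.V) ℂ (fun ab : (ℤ × ℤ) × (ℤ × ℤ) => ab.1 + ab.2) ∘ₗ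
    (finsuppTensorFinsupp ℂ ℂ M.V N.V (ℤ × ℤ) (ℤ × ℤ)).toLinearMap ∘ₗ
    TensorProduct.map (comps M) (comps N)

theorem tensorComps₀_tmul (e : ℕ) {M N : BimCpx} {a b : ℤ × ℤ} {m : M.V} {n : N.V}
    (hm : m ∈ M.gr a) (hn : n ∈ N.gr b) :
    tensorComps₀ e M N (m ⊗ₜ n) = Finsupp.single (a + b) (tmul e m n) := by
  simp only [tensorComps₀, LinearMap.comp_apply, TensorProduct.map_tmul, LinearEquiv.coe_coe]
  rw [comps_eq M hm, comps_eq N hn, finsuppTensorFinsupp_single, Finsupp.lmapDomain_apply,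
    Finsupp.mapDomain_single]
  simp

theorem tensor_hom_ext {M N : BimCpx} {W : Type*} [AddCommGroup W] [Module ℂ W]
    {f g : (M.V ⊗[ℂ] N.V) →ₗ[ℂ] W}
    (h : ∀ a b, ∀ m ∈ M.gr a, ∀ n ∈ N.gr b, f (m ⊗ₜ n) = g (m ⊗ₜ n)) : f = g := by
  apply TensorProduct.ext
  refine hom_ext fun a m hm => ?_
  refine hom_ext fun b n hn => ?_
  exact h a b m hm n hn

theorem pow_mem {M : BimCpx} {f : M.V →ₗ[ℂ] M.V}
    (hf : ∀ p v, v ∈ M.gr p → f v ∈ M.gr (p + (0, 2))) (e : ℕ) {p : ℤ × ℤ} {v : M.V}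
    (hv : v ∈ M.gr p) : (f ^ e) v ∈ M.gr (p + e • ((0, 2) : ℤ × ℤ)) := by
  induction e with
  | zero => simpa using hv
  | succ e ih =>
    rw [pow_succ', succ_nsmul, ← add_assoc]
    exact hf _ _ ih

theorem tensorComps_aux (e : ℕ) (M N : BimCpx) :
    LinearMap.range (balance e M N) ≤ LinearMap.ker (tensorComps₀ e M N) := by
  rintro _ ⟨t, rfl⟩
  have : tensorComps₀ e M N ∘ₗ balance e M N = 0 := by
    refine tensor_hom_ext fun a b m hm n hn => ?_
    simp only [LinearMap.comp_apply, balance, LinearMap.sub_apply, TensorProduct.map_tmul,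
      LinearMap.id_apply, map_sub, LinearMap.zero_apply]
    rw [tensorComps₀_tmul e (pow_mem M.rx_mem e hm) hn,
      tensorComps₀_tmul e hm (pow_mem N.lx_mem e hn), tmul_balance, sub_eq_zero]
    congr 1
    abel
  exact LinearMap.congr_fun this t

theorem tensor_internal (e : ℕ) (M N : BimCpx) : DirectSum.IsInternal (tensorGr e M N) := by
  refine internal_of ?_ (Submodule.liftQ _ (tensorComps₀ e M N) (tensorComps_aux e M N)) ?_
  · intro v
    have h : Submodule.mkQ (⨆ p, tensorGr e M N p) ∘ₗ Submodule.mkQ (LinearMap.range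
        (balance e M N)) = 0 := by
      refine tensor_hom_ext fun a b m hm n hn => ?_
      simp only [LinearMap.comp_apply, Submodule.mkQ_apply, LinearMap.zero_apply]
      rw [Submodule.Quotient.mk_eq_zero]
      exact Submodule.mem_iSup_of_mem (a + b) (tmul_mem e hm hn)
    obtain ⟨t, rfl⟩ := Submodule.Quotient.mk_surjective _ v
    have := LinearMap.congr_fun h t
    simpa [Submodule.Quotient.mk_eq_zero] using this
  · intro p v hv
    have := tensorGr_map (f := Submodule.liftQ _ (tensorComps₀ e M N) (tensorComps_aux e M N)
      - Finsupp.lsingle p) (S := ⊥) (p := p) ?_ hv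
    · simpa [sub_eq_zero] using this
    · rintro a b rfl m hm n hn
      simp only [LinearMap.sub_apply, Submodule.mem_bot, sub_eq_zero]
      exact tensorComps₀_tmul e hm hn

/-- Left multiplication by `x` on the tensor product. -/
def tensorLx (e : ℕ) (M N : BimCpx) : TensorV e M N →ₗ[ℂ] TensorV e M N :=
  Submodule.mapQ _ _ (TensorProduct.map M.lx LinearMap.id) <| by
    refine range_le_comap e M N _ fun m n => ?_
    simp [balance, pow_comm M.lx_rx]

/-- Right multiplication by `x` on the tensor product. -/
def tensorRx (e : ℕ) (M N : BimCpx) : TensorV e M N →ₗ[ℂ] TensorV e M N :=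
  Submodule.mapQ _ _ (TensorProduct.map LinearMap.id N.rx) <| by
    refine range_le_comap e M N _ fun m n => ?_
    simp [balance, pow_comm fun v => (N.lx_rx v).symm]

/-- The differential of the tensor product:
`d (m ⊗ n) = d m ⊗ n + (-1)^i m ⊗ d n` for `m` of homological degree `i`. -/
def tensorD (e : ℕ) (M N : BimCpx) : TensorV e M N →ₗ[ℂ] TensorV e M N :=
  Submodule.mapQ _ _ (TensorProduct.map M.d LinearMap.id + TensorProduct.map M.sgn N.d) <| by
    refine range_le_comap e M N _ fun m n => ?_
    simp [balance, pow_comm M.d_rx, pow_comm N.d_lx, pow_comm (sgn_rx M)]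
    abel

/-- The parity operator of the tensor product. -/
def tensorSgn (e : ℕ) (M N : BimCpx) : TensorV e M N →ₗ[ℂ] TensorV e M N :=
  Submodule.mapQ _ _ (TensorProduct.map M.sgn N.sgn) <| by
    refine range_le_comap e M N _ fun m n => ?_
    simp [balance, pow_comm (sgn_rx M), pow_comm (sgn_lx N)]

theorem tensorLx_tmul (e : ℕ) {M N : BimCpx} (m : M.V) (n : N.V) :
    tensorLx e M N (tmul e m n) = tmul e (M.lx m) n := rfl

theorem tensorRx_tmul (e : ℕ) {M N : BimCpx} (m : M.V) (n : N.V) :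
    tensorRx e M N (tmul e m n) = tmul e m (N.rx n) := rfl

theorem tensorD_tmul (e : ℕ) {M N : BimCpx} (m : M.V) (n : N.V) :
    tensorD e M N (tmul e m n) = tmul e (M.d m) n + tmul e (M.sgn m) (N.d n) := rfl

theorem tensorSgn_tmul (e : ℕ) {M N : BimCpx} (m : M.V) (n : N.V) :
    tensorSgn e M N (tmul e m n) = tmul e (M.sgn m) (N.sgn n) := rfl

theorem tmul_zero (e : ℕ) {M N : BimCpx} (m : M.V) : tmul e m (0 : N.V) = 0 := by
  simp [tmul]

theorem zero_tmul (e : ℕ) {M N : BimCpx} (n : N.V) : tmul e (0 : M.V) n = 0 := by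
  simp [tmul]

theorem neg_tmul (e : ℕ) {M N : BimCpx} (m : M.V) (n : N.V) :
    tmul e (-m) n = - tmul e m n := by
  rw [tmul, TensorProduct.neg_tmul]; rfl

theorem smul_tmul_smul (e : ℕ) {M N : BimCpx} (a b : ℂ) (m : M.V) (n : N.V) :
    tmul e (a • m) (b • n) = (a * b) • tmul e m n := by
  rw [tmul, TensorProduct.smul_tmul_smul]; rfl

/-- The tensor product `M ⊗ N` over the subring `ℂ[x^e]` of `R`, that is over `R` for `e = 1` and
over the subring `R^s = ℂ[x^2]` of invariants of `x ↦ -x` for `e = 2`. -/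
abbrev tensorOver (e : ℕ) (M N : BimCpx) : BimCpx where
  V := TensorV e M N
  lx := tensorLx e M N
  rx := tensorRx e M N
  d := tensorD e M N
  sgn := tensorSgn e M N
  gr := tensorGr e M N
  internal := tensor_internal e M N
  lx_mem := fun p v hv => tensorGr_map (fun a b hab m hm n hn =>
    tmul_mem' e (M.lx_mem _ _ hm) hn (by rw [← hab]; abel)) hv
  rx_mem := fun p v hv => tensorGr_map (fun a b hab m hm n hn =>
    tmul_mem' e hm (N.rx_mem _ _ hn) (by rw [← hab]; abel)) hv
  d_mem := fun p v hv => tensorGr_map (fun a b hab m hm n hn =>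
    Submodule.add_mem _
      (tmul_mem' e (M.d_mem _ _ hm) hn (by rw [← hab]; abel))
      (tmul_mem' e (by rw [M.sgn_eq _ _ hm]; exact Submodule.smul_mem _ _ hm) (N.d_mem _ _ hn)
        (by rw [← hab]; abel))) hv
  sgn_eq := by
    intro p v hv
    have := tensorGr_map (p := p) (S := ⊥)
      (f := tensorSgn e M N - parity p.1 • LinearMap.id) ?_ hv
    · simpa [sub_eq_zero] using this
    · rintro a b rfl m hm n hn
      rw [Submodule.mem_bot, LinearMap.sub_apply, sub_eq_zero, tensorSgn_tmul, M.sgn_eq _ _ hm,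
        N.sgn_eq _ _ hn, smul_tmul_smul, Prod.fst_add, parity_add]
      rfl
  lx_rx := LinearMap.congr_fun (f := tensorLx e M N ∘ₗ tensorRx e M N)
    (g := tensorRx e M N ∘ₗ tensorLx e M N) (tensorV_ext fun m n => rfl)
  d_lx := LinearMap.congr_fun (f := tensorD e M N ∘ₗ tensorLx e M N)
    (g := tensorLx e M N ∘ₗ tensorD e M N) (tensorV_ext fun m n => by
      simp only [LinearMap.comp_apply, tensorLx_tmul, tensorD_tmul, map_add, M.d_lx, sgn_lx])
  d_rx := LinearMap.congr_fun (f := tensorD e M N ∘ₗ tensorRx e M N)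
    (g := tensorRx e M N ∘ₗ tensorD e M N) (tensorV_ext fun m n => by
      simp only [LinearMap.comp_apply, tensorRx_tmul, tensorD_tmul, map_add, N.d_rx])
  d_d := LinearMap.congr_fun (f := tensorD e M N ∘ₗ tensorD e M N)
    (g := 0) (tensorV_ext fun m n => by
      simp only [LinearMap.comp_apply, tensorD_tmul, map_add, M.d_d, N.d_d, sgn_d, neg_tmul,
        zero_tmul, tmul_zero, LinearMap.zero_apply]
      abel)

/-- The monoidal structure on complexes of `R`-bimodules: the tensor product over `R`. -/
abbrev tensor (M N : BimCpx) : BimCpx := tensorOver 1 M N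

/-! ### Morphisms and homotopies -/

/-- `f` is a homomorphism of graded bimodules which raises the degree by `p`. -/
structure IsBimodMap (M N : BimCpx) (p : ℤ × ℤ) (f : M.V →ₗ[ℂ] N.V) : Prop where
  map_lx : ∀ v, f (M.lx v) = N.lx (f v)
  map_rx : ∀ v, f (M.rx v) = N.rx (f v)
  map_gr : ∀ a v, v ∈ M.gr a → f v ∈ N.gr (a + p)

/-- `f` is a morphism of complexes of graded bimodules (of degree zero). -/
structure IsChainMap (M N : BimCpx) (f : M.V →ₗ[ℂ] N.V) : Prop extends IsBimodMap M N 0 f where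
  map_d : ∀ v, f (M.d v) = N.d (f v)

/-- `f` and `g` differ by the boundary of a homotopy of graded bimodules. -/
def Homotopic (M N : BimCpx) (f g : M.V →ₗ[ℂ] N.V) : Prop :=
  ∃ h : M.V →ₗ[ℂ] N.V, IsBimodMap M N (-1, 0) h ∧ f - g = N.d ∘ₗ h + h ∘ₗ M.d

/-- `f` is a homotopy equivalence of complexes of graded bimodules. -/
def IsHomotopyEquiv (M N : BimCpx) (f : M.V →ₗ[ℂ] N.V) : Prop :=
  IsChainMap M N f ∧ ∃ g : N.V →ₗ[ℂ] M.V, IsChainMap N M g ∧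
    Homotopic M M (g ∘ₗ f) LinearMap.id ∧ Homotopic N N (f ∘ₗ g) LinearMap.id

/-- `M` is homotopy equivalent to zero. -/
def Contractible (M : BimCpx) : Prop := Homotopic M M LinearMap.id 0

/-! ### Soergel bimodules for two strands (reduced) -/

/-- The Bott-Samelson bimodule `B = q^(-1/2) R ⊗_{R^s} R`. -/
abbrev B : BimCpx := shift (0, -1) (tensorOver 2 unit unit)

/-- `M` is, in each homological degree, a Soergel bimodule, and bounded: the underlying bigraded
bimodule of `M` lies in the smallest class of bigraded bimodules that contains `R` and `B` and is
closed under `⊗_R`, shifts, finite direct sums and direct summands. (The maps `i`, `p` below are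
maps of bigraded bimodules; they need not commute with the differentials.) -/
inductive IsSoergel : BimCpx → Prop
  | unit : IsSoergel unit
  | bottSamelson : IsSoergel B
  | tensor (M N : BimCpx) : IsSoergel M → IsSoergel N → IsSoergel (tensor M N)
  | shift (k : ℤ × ℤ) (M : BimCpx) : IsSoergel M → IsSoergel (shift k M)
  | dirSum (M N : BimCpx) : IsSoergel M → IsSoergel N → IsSoergel (dirSum M N)
  | summand (M N : BimCpx) (i : N.V →ₗ[ℂ] M.V) (p : M.V →ₗ[ℂ] N.V) : IsBimodMap N M 0 i →
      IsBimodMap M N 0 p → p ∘ₗ i = LinearMap.id → IsSoergel M → IsSoergel N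

/-- The multiplication `B → R`, `f ⊗ g ↦ f g`. -/
def mult : B.V →ₗ[ℂ] unit.V :=
  Submodule.liftQ _ (LinearMap.mul' ℂ ℂ[X]) <| by
    rintro _ ⟨t, rfl⟩
    have : LinearMap.mul' ℂ ℂ[X] ∘ₗ balance 2 unit unit = 0 := by
      refine TensorProduct.ext' fun f g => ?_
      simp [balance, pow_two]
      ring
    exact LinearMap.congr_fun this t

/-- The map `R → B`, `1 ↦ x ⊗ 1 + 1 ⊗ x`. -/
def comult : unit.V →ₗ[ℂ] B.V :=
  (B.lx + B.rx) ∘ₗ Submodule.mkQ _ ∘ₗ (TensorProduct.mk ℂ ℂ[X] ℂ[X]).flip 1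

/-- Multiplication by `(x ⊗ 1 - 1 ⊗ x) / 2` on `B`. -/
def delta : B.V →ₗ[ℂ] B.V := (1 / 2 : ℂ) • (B.lx - B.rx)

theorem comult_apply (f : ℂ[X]) :
    comult f = (tmul 2 (Polynomial.X * f) 1 + tmul 2 f Polynomial.X : TensorV 2 unit unit) := by
  change tensorLx 2 unit unit (tmul 2 f 1) + tensorRx 2 unit unit (tmul 2 f 1) = _
  rw [tensorLx_tmul, tensorRx_tmul]
  simp

theorem mult_tmul (f g : ℂ[X]) :
    mult (tmul 2 f g : TensorV 2 unit unit) = (f * g : ℂ[X]) := rfl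

theorem B_sq (v : B.V) : B.lx (B.lx v) = B.rx (B.rx v) := by
  refine LinearMap.congr_fun (f := tensorLx 2 unit unit ∘ₗ tensorLx 2 unit unit)
    (g := tensorRx 2 unit unit ∘ₗ tensorRx 2 unit unit) (tensorV_ext fun f g => ?_) v
  have h := tmul_balance 2 (M := unit) (N := unit) f g
  simp only [pow_two] at h
  exact h

theorem mult_lx (v : B.V) : mult (B.lx v) = unit.lx (mult v) := by
  refine LinearMap.congr_fun (f := mult ∘ₗ tensorLx 2 unit unit)
    (g := unit.lx ∘ₗ mult) (tensorV_ext fun f g => ?_) v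
  change (Polynomial.X * f * g : ℂ[X]) = Polynomial.X * (f * g)
  ring

theorem mult_rx (v : B.V) : mult (B.rx v) = unit.rx (mult v) := by
  refine LinearMap.congr_fun (f := mult ∘ₗ tensorRx 2 unit unit)
    (g := unit.rx ∘ₗ mult) (tensorV_ext fun f g => ?_) v
  change (f * (Polynomial.X * g) : ℂ[X]) = Polynomial.X * (f * g)
  ring

theorem comult_lx (f : ℂ[X]) : comult (Polynomial.X * f : ℂ[X]) = B.lx (comult f) := by
  rw [comult_apply, comult_apply]
  have h : tensorLx 2 unit unit (tmul 2 (Polynomial.X * f) 1 + tmul 2 f Polynomial.X) = _ :=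
    map_add (tensorLx 2 unit unit) _ _
  rw [tensorLx_tmul, tensorLx_tmul] at h
  exact h.symm

theorem comult_rx (f : ℂ[X]) : comult (Polynomial.X * f : ℂ[X]) = B.rx (comult f) := by
  rw [comult_apply, comult_apply]
  have h : tensorRx 2 unit unit (tmul 2 (Polynomial.X * f) 1 + tmul 2 f Polynomial.X) = _ :=
    map_add (tensorRx 2 unit unit) _ _
  rw [tensorRx_tmul, tensorRx_tmul] at h
  refine Eq.trans ?_ h.symm
  have h1 := tmul_balance 2 (M := unit) (N := unit) f (1 : ℂ[X])
  have h2 : ∀ g : ℂ[X], (LinearMap.mulLeft ℂ (Polynomial.X : ℂ[X]) ^ 2) g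
      = Polynomial.X * (Polynomial.X * g) := fun g => by rw [pow_two]; rfl
  rw [h2, h2, mul_one] at h1
  have h3 : (LinearMap.mulLeft ℂ (Polynomial.X : ℂ[X])) 1 = Polynomial.X := by simp
  rw [h1, h3, add_comm]
  rfl

theorem unit_X_mem {p : ℤ × ℤ} {f : unit.V} (hf : f ∈ unit.gr p) :
    (Polynomial.X * f : ℂ[X]) ∈ unit.gr (p + (0, 2)) := unit.lx_mem p f hf

theorem one_mem : (1 : ℂ[X]) ∈ unit.gr 0 := by
  intro n hn
  have : n = 0 := by
    by_contra h
    exact hn (by simp [Polynomial.coeff_one, h])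
  subst this; rfl

theorem mul_mem {a b : ℤ × ℤ} {f g : ℂ[X]} (hf : f ∈ unit.gr a) (hg : g ∈ unit.gr b) :
    f * g ∈ unit.gr (a + b) := by
  intro n hn
  rw [Polynomial.coeff_mul] at hn
  obtain ⟨⟨i, j⟩, hij, h⟩ := Finset.exists_ne_zero_of_sum_ne_zero hn
  rw [hf i (left_ne_zero_of_mul h), hg j (right_ne_zero_of_mul h),
    show n = i + j from (Finset.HasAntidiagonal.mem_antidiagonal.1 hij).symm]
  ext <;> simp
  ring

theorem mult_mem {p : ℤ × ℤ} {v : B.V} (hv : v ∈ B.gr p) : mult v ∈ unit.gr (p + (0, 1)) := by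
  refine tensorGr_map (e := 2) (M := unit) (N := unit) (p := p - (0, -1)) ?_ hv
  rintro a b hab f hf g hg
  rw [mult_tmul, show p + (0, 1) = a + b by rw [hab]; ext <;> simp]
  exact mul_mem hf hg

theorem comult_mem {p : ℤ × ℤ} {f : unit.V} (hf : f ∈ unit.gr p) :
    comult f ∈ B.gr (p + (0, 1)) := by
  have h : comult f ∈ tensorGr 2 unit unit (p + (0, 2)) := by
    rw [comult_apply]
    refine Submodule.add_mem _ (tmul_mem' 2 (unit_X_mem hf) one_mem (by simp)) ?_
    refine tmul_mem' 2 hf (b := (0, 2)) ?_ rfl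
    simpa using unit_X_mem one_mem
  change comult f ∈ tensorGr 2 unit unit (p + (0, 1) - (0, -1))
  rw [show p + (0, 1) - (0, -1) = p + ((0, 2) : ℤ × ℤ) by ext <;> simp; ring]
  exact h

theorem delta_mem {p : ℤ × ℤ} {v : B.V} (hv : v ∈ B.gr p) : delta v ∈ B.gr (p + (0, 2)) :=
  Submodule.smul_mem _ _ (Submodule.sub_mem _ (B.lx_mem _ _ hv) (B.rx_mem _ _ hv))

theorem delta_lx (v : B.V) : delta (B.lx v) = B.lx (delta v) := by
  simp only [delta, LinearMap.smul_apply, LinearMap.sub_apply, map_smul, map_sub]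
  rw [← B.lx_rx]

theorem delta_rx (v : B.V) : delta (B.rx v) = B.rx (delta v) := by
  simp only [delta, LinearMap.smul_apply, LinearMap.sub_apply, map_smul, map_sub]
  rw [B.lx_rx]

theorem mult_delta (v : B.V) : mult (delta v) = 0 := by
  simp only [delta, LinearMap.smul_apply, LinearMap.sub_apply, map_smul, map_sub]
  rw [mult_lx, mult_rx, sub_self, smul_zero]

theorem delta_comult (f : unit.V) : delta (comult f) = 0 := by
  simp only [delta, LinearMap.smul_apply, LinearMap.sub_apply]
  rw [← comult_lx, ← comult_rx, sub_self, smul_zero]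

/-- The positive crossing `σ = [B → s q^(-1/2) R]`, `1 ⊗ 1 ↦ 1`. -/
def sigma : BimCpx :=
  withD (dirSum B (shift (1, -1) unit))
    (LinearMap.inr ℂ B.V unit.V ∘ₗ mult ∘ₗ LinearMap.fst ℂ B.V unit.V)
    (fun v => Prod.ext (map_zero B.lx).symm (mult_lx _))
    (fun v => Prod.ext (map_zero B.rx).symm (mult_rx _))
    (fun p v hv => ⟨Submodule.zero_mem _, by
      change mult v.1 ∈ unit.gr (p + (1, 0) - (1, -1))
      rw [show p + (1, 0) - (1, -1) = p + ((0, 1) : ℤ × ℤ) by ext <;> simp]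
      exact mult_mem hv.1⟩)
    (fun v => Prod.ext rfl (map_zero mult))

/-- The negative crossing `σ⁻¹ = [s⁻¹ q^(1/2) R → B]`, `1 ↦ x ⊗ 1 + 1 ⊗ x`. -/
def sigmaInv : BimCpx :=
  withD (dirSum (shift (-1, 1) unit) B)
    (LinearMap.inr ℂ unit.V B.V ∘ₗ comult ∘ₗ LinearMap.fst ℂ unit.V B.V)
    (fun v => Prod.ext (map_zero unit.lx).symm (comult_lx _))
    (fun v => Prod.ext (map_zero unit.rx).symm (comult_rx _))
    (fun p v hv => ⟨Submodule.zero_mem _, by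
      have := comult_mem hv.1
      rwa [show p - (-1, 1) + (0, 1) = p + ((1, 0) : ℤ × ℤ) by ext <;> simp] at this⟩)
    (fun v => Prod.ext rfl (map_zero comult))

/-- The full twist `FT = [q^(1/2) B → s q^(-1/2) B → s² q⁻¹ R]`, with first map `delta` and second
map `mult`. -/
def FT : BimCpx :=
  withD (dirSum (shift (0, 1) B) (dirSum (shift (1, -1) B) (shift (2, -2) unit)))
    (LinearMap.prod 0 (LinearMap.prod
      (delta ∘ₗ LinearMap.fst ℂ B.V (B.V × unit.V))
      (mult ∘ₗ LinearMap.fst ℂ B.V unit.V ∘ₗ LinearMap.snd ℂ B.V (B.V × unit.V))))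
    (fun v => Prod.ext (map_zero B.lx).symm (Prod.ext (delta_lx _) (mult_lx _)))
    (fun v => Prod.ext (map_zero B.rx).symm (Prod.ext (delta_rx _) (mult_rx _)))
    (fun p v hv => ⟨Submodule.zero_mem _, by
        have := delta_mem hv.1
        rwa [show p - (0, 1) + (0, 2) = p + (1, 0) - ((1, -1) : ℤ × ℤ) by
          ext <;> simp; ring] at this, by
        have := mult_mem hv.2.1
        rwa [show p - (1, -1) + (0, 1) = p + (1, 0) - ((2, -2) : ℤ × ℤ) by
          ext <;> simp <;> ring] at this⟩)
    (fun v => Prod.ext rfl (Prod.ext (map_zero delta) (mult_delta _)))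

/-- The inverse full twist `FT⁻¹ = [s⁻² q R → s⁻¹ q^(1/2) B → q^(-1/2) B]`, with first map `comult`
and second map `delta`. -/
def FTinv : BimCpx :=
  withD (dirSum (shift (-2, 2) unit) (dirSum (shift (-1, 1) B) (shift (0, -1) B)))
    (LinearMap.prod 0 (LinearMap.prod
      (comult ∘ₗ LinearMap.fst ℂ unit.V (B.V × B.V))
      (delta ∘ₗ LinearMap.fst ℂ B.V B.V ∘ₗ LinearMap.snd ℂ unit.V (B.V × B.V))))
    (fun v => Prod.ext (map_zero unit.lx).symm (Prod.ext (comult_lx _) (delta_lx _)))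
    (fun v => Prod.ext (map_zero unit.rx).symm (Prod.ext (comult_rx _) (delta_rx _)))
    (fun p v hv => ⟨Submodule.zero_mem _, by
        have := comult_mem hv.1
        rwa [show p - (-2, 2) + (0, 1) = p + (1, 0) - ((-1, 1) : ℤ × ℤ) by
          ext <;> simp <;> ring] at this, by
        have := delta_mem hv.2.1
        rwa [show p - (-1, 1) + (0, 2) = p + (1, 0) - ((0, -1) : ℤ × ℤ) by
          ext <;> simp; ring] at this⟩)
    (fun v => Prod.ext rfl (Prod.ext (map_zero comult) (delta_comult _)))

/-- The powers `FT^(-k)`: iterated tensor products over `R` of `FT⁻¹`. -/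
def FTpow : ℕ → BimCpx
  | 0 => unit
  | k + 1 => tensor FTinv (FTpow k)

/-- The degree of the equivariant parameter `q`. -/
abbrev qdeg : ℤ × ℤ := (0, 2)

/-- The degree of the equivariant parameter `t = s² q⁻¹`. -/
abbrev tdeg : ℤ × ℤ := (2, -2)

/-- The eigenmap `z : q 1 → FT`, which maps `1` to `x ⊗ 1 + 1 ⊗ x` in the first term. -/
def eigenZ : unit.V →ₗ[ℂ] FT.V :=
  LinearMap.prod comult (0 : unit.V →ₗ[ℂ] B.V × unit.V)

/-- The eigenmap `w : t 1 → FT`, the identity of `R` onto the last term. -/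
def eigenW : unit.V →ₗ[ℂ] FT.V :=
  LinearMap.prod (0 : unit.V →ₗ[ℂ] B.V)
    (LinearMap.prod (0 : unit.V →ₗ[ℂ] B.V) (LinearMap.id : unit.V →ₗ[ℂ] unit.V))

/-! ### The maps between powers of the full twist

Let `a : 1 → FT` be one of the maps `z`, `w`. Tensoring with `FT^(-k-1)` and using an identification
`ε : FT ⊗ FT⁻¹ ≃ 1` one gets `FT^(-k-1) → FT ⊗ FT^(-k-1) = FT ⊗ FT⁻¹ ⊗ FT^(-k) ≃ FT^(-k)`. -/

/-- The map `FT⁻¹ = 1 ⊗ FT⁻¹ → FT ⊗ FT⁻¹ → 1`, `u ↦ ε (a 1 ⊗ u)`. -/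
def mate (ε : (tensor FT FTinv).V →ₗ[ℂ] unit.V) (a : unit.V →ₗ[ℂ] FT.V) :
    FTinv.V →ₗ[ℂ] unit.V :=
  ε ∘ₗ Submodule.mkQ _ ∘ₗ TensorProduct.mk ℂ FT.V FTinv.V (a (1 : ℂ[X]))

theorem mate_rx {ε : (tensor FT FTinv).V →ₗ[ℂ] unit.V} (hε : IsHomotopyEquiv _ _ ε)
    (a : unit.V →ₗ[ℂ] FT.V) (u : FTinv.V) :
    mate ε a (FTinv.rx u) = unit.rx (mate ε a u) :=
  hε.1.map_rx (tmul 1 (a (1 : ℂ[X])) u)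

/-- For a right linear `φ : FT⁻¹ → R`, the map `φ ⊗ id : FT⁻¹ ⊗ N → R ⊗ N = N`, that is
`u ⊗ n ↦ φ(u) n`. -/
def contract (φ : FTinv.V →ₗ[ℂ] unit.V) (hφ : ∀ u, φ (FTinv.rx u) = unit.rx (φ u)) (N : BimCpx) :
    (tensor FTinv N).V →ₗ[ℂ] N.V :=
  Submodule.liftQ _ (TensorProduct.lift ((Polynomial.aeval N.lx).toLinearMap ∘ₗ φ)) <| by
    rintro _ ⟨t, rfl⟩
    have : TensorProduct.lift ((Polynomial.aeval N.lx).toLinearMap ∘ₗ φ) ∘ₗ balance 1 FTinv N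
        = 0 := by
      refine TensorProduct.ext' fun u n => ?_
      simp only [LinearMap.comp_apply, balance, pow_one, LinearMap.sub_apply,
        TensorProduct.map_tmul, LinearMap.id_apply, map_sub, TensorProduct.lift.tmul, hφ,
        LinearMap.zero_apply, sub_eq_zero, AlgHom.toLinearMap_apply]
      change Polynomial.aeval N.lx (Polynomial.X * φ u) n = _
      rw [mul_comm, map_mul, Polynomial.aeval_X]
      rfl
    exact LinearMap.congr_fun this t

/-- The map `FT^(-k-1) → FT^(-k)` induced by `a : 1 → FT`. -/
def eigenStep {ε : (tensor FT FTinv).V →ₗ[ℂ] unit.V} (hε : IsHomotopyEquiv _ _ ε)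
    (a : unit.V →ₗ[ℂ] FT.V) (k : ℕ) : (FTpow (k + 1)).V →ₗ[ℂ] (FTpow k).V :=
  contract (mate ε a) (mate_rx hε a) (FTpow k)

/-! ### The infinite Koszul-type complex -/

/-- The homological positions: `ev j` is the position `-2j` and `od j` is the position `-2j-1`. -/
inductive Pos
  | ev (j : ℕ)
  | od (j : ℕ)

/-- One step to the left. -/
def Pos.next : Pos → Pos
  | ev j => od j
  | od j => ev (j + 1)

/-- The position `-m`. -/
def Pos.of : ℕ → Pos
  | 0 => ev 0
  | m + 1 => (Pos.of m).next

/-- The objects of the complex: `1` in position `0`, `(qt)^j (FT^(-j-1) ⊕ FT^(-j))` in position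
`-2j` for `j ≥ 1` and `(qt)^j (q FT^(-j-1) ⊕ t FT^(-j-1))` in position `-2j-1`. -/
def koszulAt : Pos → BimCpx
  | .ev 0 => unit
  | .ev (j + 1) => dirSum (shift ((j + 1) • (qdeg + tdeg)) (FTpow (j + 2)))
      (shift ((j + 1) • (qdeg + tdeg)) (FTpow (j + 1)))
  | .od j => dirSum (shift (j • (qdeg + tdeg) + qdeg) (FTpow (j + 1)))
      (shift (j • (qdeg + tdeg) + tdeg) (FTpow (j + 1)))

/-- The linear map with matrix `(a b; c e)`, that is `(u, v) ↦ (a u + b v, c u + e v)`. -/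
def mat {V₁ V₂ W₁ W₂ : Type} [AddCommGroup V₁] [Module ℂ V₁] [AddCommGroup V₂] [Module ℂ V₂]
    [AddCommGroup W₁] [Module ℂ W₁] [AddCommGroup W₂] [Module ℂ W₂]
    (a : V₁ →ₗ[ℂ] W₁) (b : V₂ →ₗ[ℂ] W₁) (c : V₁ →ₗ[ℂ] W₂) (e : V₂ →ₗ[ℂ] W₂) :
    V₁ × V₂ →ₗ[ℂ] W₁ × W₂ :=
  LinearMap.prod (LinearMap.coprod a b) (LinearMap.coprod c e)

/-- The maps of the complex: `(z, w)`, then alternately `α₁ = (w 0; -z x)` and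
`α₂ = (x 0; z w)`. Here `x` is the left multiplication by `x`. -/
def koszulMapAt {ε : (tensor FT FTinv).V →ₗ[ℂ] unit.V} (hε : IsHomotopyEquiv _ _ ε) :
    (i : Pos) → (koszulAt i.next).V →ₗ[ℂ] (koszulAt i).V
  | .ev 0 => LinearMap.coprod (eigenStep hε eigenZ 0) (eigenStep hε eigenW 0)
  | .od j => mat (eigenStep hε eigenW (j + 1)) 0 (-eigenStep hε eigenZ (j + 1)) (FTpow (j + 1)).lx
  | .ev (j + 1) => mat (FTpow (j + 2)).lx 0 (eigenStep hε eigenZ (j + 1)) (eigenStep hε eigenW (j + 1))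

/-- The object in position `-m`. -/
def koszul (m : ℕ) : BimCpx := koszulAt (Pos.of m)

/-- The map from position `-m-1` to position `-m`. -/
def koszulMap {ε : (tensor FT FTinv).V →ₗ[ℂ] unit.V} (hε : IsHomotopyEquiv _ _ ε) (m : ℕ) :
    (koszul (m + 1)).V →ₗ[ℂ] (koszul m).V := koszulMapAt hε (Pos.of m)

/-! ### Total complexes of complexes in the homotopy category -/

/-- The direct sum of all `P m`, placed in position `-m`. -/
abbrev totalSum (P : ℕ → BimCpx) : BimCpx := bigSum fun m => shift (-(m : ℤ), 0) (P m)

/-- The component from position `-m` to position `-n` of an operator on the direct sum. -/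
def entry (P : ℕ → BimCpx) (D : (totalSum P).V →ₗ[ℂ] (totalSum P).V) (m n : ℕ) :
    (P m).V →ₗ[ℂ] (P n).V :=
  DirectSum.component ℂ ℕ (fun m => (P m).V) n ∘ₗ D ∘ₗ DirectSum.lof ℂ ℕ (fun m => (P m).V) m

/-- A sequence `… → P 2 → P 1 → P 0` of objects and of morphisms `f m` in the homotopy category is
in general only a complex up to homotopy. A total complex (convolution) of it is a differential `D`
on the direct sum of the `P m`, placed in position `-m`, which never moves to the left,
whose diagonal entries are the differentials of the shifted complexes, and whose entries
`P (m + 1) → P m` represent the homotopy classes of the given `f m`. The remaining entries of `D`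
are the higher homotopies. -/
structure Convolution (P : ℕ → BimCpx) (f : ∀ m, (P (m + 1)).V →ₗ[ℂ] (P m).V) where
  D : (totalSum P).V →ₗ[ℂ] (totalSum P).V
  bimod : IsBimodMap (totalSum P) (totalSum P) (1, 0) D
  sq_zero : ∀ v, D (D v) = 0
  entry_lt : ∀ m n, m < n → entry P D m n = 0
  entry_diag : ∀ m, entry P D m m = (shift (-(m : ℤ), 0) (P m)).d
  entry_succ : ∀ m, Homotopic (P (m + 1)) (P m) (entry P D (m + 1) m) (f m)

/-- The complex of graded bimodules underlying a convolution. -/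
def Convolution.total {P : ℕ → BimCpx} {f : ∀ m, (P (m + 1)).V →ₗ[ℂ] (P m).V}
    (T : Convolution P f) : BimCpx :=
  withD (totalSum P) T.D T.bimod.map_lx T.bimod.map_rx T.bimod.map_gr T.sq_zero

end SBim2

end

/-! Minimal models. The complex `B ⊗ M` is `R ⊗ M` over `R^s` up to a shift, so it sees only the
left `R^s`-structure of `M`. By induction, `FT^(-k)` retracts onto a small complex `M_k` with an
augmentation `lam` to `U_k = q^(-k) R`, and `lam` has a contraction that is linear over `R^s` on the
left and over `R` on the right. Hence `FT⁻¹ ⊗ M_k = [M_k → B ⊗ M_k → B ⊗ M_k]` retracts onto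
`M_(k+1) = [M_k → B ⊗ U_k → B ⊗ U_k]`. This is the content of `Model.step` and `Model.retract`. On
these models `w : M_(k+1) → M_k` is the projection onto the first term, and `z` starts as the
multiplication `M_1 → R` on the last term and is extended by the identity on the two new terms. Now
`z` and `w` commute strictly.

Contractible blocks. The sequence `M_(k+2) → M_(k+1) ⊕ M_(k+1) → M_k` with maps `(w, -z)` and `(z,
w)` splits as a sequence of bigraded bimodules: `w` has the section `inl`, and `z` identifies the
two terms killed by `w` with the two last terms of the target. The splittings are not chain maps,
but the error is nilpotent, so the total complex of the sequence is contractible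
(`BlockData.standard_contractible`).

Independence of `ε`. On generators, degrees leave room for very few values of the pairing `(l, u) ↦
ε (l ⊗ u)`, and the chain map equation identifies the relevant ones with a single scalar `c`. It is
nonzero, since otherwise `ε = 0` and the identity of `R` would be null-homotopic. So both eigenmaps
are, up to homotopy, `c` times the maps of the models (`exists_scalar`, `eigenStep_homotopic`).

Every convolution is contractible. Regroup the total complex: block `j` consists of the first
summand in position `-2j-2`, both summands in position `-2j-1` and the last summand in position
`-2j`. The entries `z`, `w` of the given matrices stay inside a block, the entries `x` go from block
`j+1` to block `j`, and no entry of the differential raises the block index. Elements of a direct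
sum have finite support, so contracting the diagonal blocks contracts everything
(`contractible_of_triangular`). A diagonal block `FT^(-j-2) → FT^(-j-1) ⊕ FT^(-j-1) → FT^(-j)` has
maps that are merely homotopic to `(w, -z)` and `(z, w)`, and an unknown long entry `u`. A unipotent
change of coordinates restores the standard maps and turns `u` into a cocycle of degree `(1, 0)`.
Such a cocycle is a boundary because every bimodule map `M_(k+2) → M_k` of that degree vanishes:
with the weight `2i + a` in bidegree `(i, a)`, the source is generated in weight `-2k-4`, so the
image of a generator has weight `-2k-2`, while the target is zero below weight `-2k`.

Existence. On the models, `x w` is the boundary of an explicit `kap`, which commutes with `z`, `w`,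
`x` and satisfies `kap² = z w / 2`. The products of consecutive matrices are `x w` times a scalar
matrix, so `kap` gives the first homotopies; their square is cancelled by one further correction, a
multiple of `z` in a corner. The resulting strict relations are transported to `FT^(-k)` by the
retracts, where `p i = id` holds on the nose. The equivalences `FT ≃ σ²`, `FT⁻¹ ≃ σ⁻²` and `σ σ⁻¹ ≃
1` are Gaussian eliminations in explicit coordinates. -/

open scoped TensorProduct Polynomial

noncomputable section

namespace SBim2

/-! ### Calculus of bimodule maps -/

namespace IsBimodMap

variable {K L M N : BimCpx} {p q : ℤ × ℤ}

theorem congr_deg {f : M.V →ₗ[ℂ] N.V} (hf : IsBimodMap M N p f) (h : p = q) :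
    IsBimodMap M N q f := h ▸ hf

theorem comp {g : M.V →ₗ[ℂ] N.V} {f : L.V →ₗ[ℂ] M.V} (hg : IsBimodMap M N q g)
    (hf : IsBimodMap L M p f) : IsBimodMap L N (p + q) (g ∘ₗ f) where
  map_lx v := by simp [hf.map_lx, hg.map_lx]
  map_rx v := by simp [hf.map_rx, hg.map_rx]
  map_gr a v hv := by rw [← add_assoc]; exact hg.map_gr _ _ (hf.map_gr _ _ hv)

theorem add {f g : M.V →ₗ[ℂ] N.V} (hf : IsBimodMap M N p f) (hg : IsBimodMap M N p g) :
    IsBimodMap M N p (f + g) where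
  map_lx v := by simp [hf.map_lx, hg.map_lx]
  map_rx v := by simp [hf.map_rx, hg.map_rx]
  map_gr a v hv := Submodule.add_mem _ (hf.map_gr _ _ hv) (hg.map_gr _ _ hv)

theorem smul {f : M.V →ₗ[ℂ] N.V} (c : ℂ) (hf : IsBimodMap M N p f) :
    IsBimodMap M N p (c • f) where
  map_lx v := by simp [hf.map_lx]
  map_rx v := by simp [hf.map_rx]
  map_gr a v hv := Submodule.smul_mem _ _ (hf.map_gr _ _ hv)

theorem neg {f : M.V →ₗ[ℂ] N.V} (hf : IsBimodMap M N p f) : IsBimodMap M N p (-f) := by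
  simpa using hf.smul (-1)

theorem sub {f g : M.V →ₗ[ℂ] N.V} (hf : IsBimodMap M N p f) (hg : IsBimodMap M N p g) :
    IsBimodMap M N p (f - g) := by
  rw [sub_eq_add_neg]; exact hf.add hg.neg

theorem zero : IsBimodMap M N p 0 where
  map_lx v := by simp
  map_rx v := by simp
  map_gr a v hv := Submodule.zero_mem _

theorem id : IsBimodMap M M 0 LinearMap.id where
  map_lx _ := rfl
  map_rx _ := rfl
  map_gr a v hv := by simpa using hv

theorem lx : IsBimodMap M M (0, 2) M.lx where
  map_lx _ := rfl
  map_rx v := M.lx_rx v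
  map_gr a v hv := M.lx_mem a v hv

theorem d : IsBimodMap M M (1, 0) M.d where
  map_lx v := M.d_lx v
  map_rx v := M.d_rx v
  map_gr a v hv := M.d_mem a v hv

end IsBimodMap

/-! ### Homogeneous components and inverses of graded maps -/

theorem comps_mem (M : BimCpx) (v : M.V) (p : ℤ × ℤ) : comps M v p ∈ M.gr p := by
  have hv : v ∈ ⨆ p, M.gr p := by rw [iSup_gr]; trivial
  induction hv using Submodule.iSup_induction' with
  | mem q x hx =>
    rw [comps_eq M hx]
    by_cases h : q = p
    · subst h; simpa using hx
    · rw [Finsupp.single_eq_of_ne (Ne.symm h)]; exact Submodule.zero_mem _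
  | zero => simp
  | add x y _ _ hx hy => simpa using Submodule.add_mem _ hx hy

theorem comps_map {M N : BimCpx} {k : ℤ × ℤ} {f : M.V →ₗ[ℂ] N.V}
    (hf : ∀ p v, v ∈ M.gr p → f v ∈ N.gr (p + k)) (v : M.V) (p : ℤ × ℤ) :
    comps N (f v) (p + k) = f (comps M v p) := by
  refine LinearMap.congr_fun (f := Finsupp.lapply (p + k) ∘ₗ comps N ∘ₗ f)
    (g := f ∘ₗ Finsupp.lapply p ∘ₗ comps M) (hom_ext fun q w hw => ?_) v
  simp only [LinearMap.comp_apply, Finsupp.lapply_apply]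
  rw [comps_eq N (hf _ _ hw), comps_eq M hw]
  by_cases h : q = p
  · subst h; simp
  · rw [Finsupp.single_eq_of_ne (Ne.symm h),
      Finsupp.single_eq_of_ne (fun h' => h (add_right_cancel h').symm), map_zero]

/-- The inverse of a bijective graded map is graded. -/
theorem IsBimodMap.symm {M N : BimCpx} {k : ℤ × ℤ} {e : M.V ≃ₗ[ℂ] N.V}
    (he : IsBimodMap M N k e.toLinearMap) : IsBimodMap N M (-k) e.symm.toLinearMap where
  map_lx v := by
    have := he.map_lx (e.symm v)
    simp only [LinearEquiv.coe_coe, LinearEquiv.apply_symm_apply] at this ⊢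
    rw [← this]; simp
  map_rx v := by
    have := he.map_rx (e.symm v)
    simp only [LinearEquiv.coe_coe, LinearEquiv.apply_symm_apply] at this ⊢
    rw [← this]; simp
  map_gr p v hv := by
    simp only [LinearEquiv.coe_coe]
    have h : e.symm v = comps M (e.symm v) (p + -k) := by
      apply e.injective
      have := comps_map he.map_gr (e.symm v) (p + -k)
      simp only [LinearEquiv.coe_coe, LinearEquiv.apply_symm_apply] at this
      rw [← this, comps_eq N hv]
      simp
    rw [h]; exact comps_mem _ _ _

/-! ### Chain maps and homotopies -/

namespace IsChainMap

variable {L M N : BimCpx}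

theorem of {f : M.V →ₗ[ℂ] N.V} (hf : IsBimodMap M N 0 f) (hd : ∀ v, f (M.d v) = N.d (f v)) :
    IsChainMap M N f := { hf with map_d := hd }

theorem comp {g : M.V →ₗ[ℂ] N.V} {f : L.V →ₗ[ℂ] M.V} (hg : IsChainMap M N g)
    (hf : IsChainMap L M f) : IsChainMap L N (g ∘ₗ f) :=
  of ((hg.toIsBimodMap.comp hf.toIsBimodMap).congr_deg (add_zero _)) fun v => by
    simp [hf.map_d, hg.map_d]

theorem id : IsChainMap M M LinearMap.id := of .id fun _ => rfl

theorem symm {e : M.V ≃ₗ[ℂ] N.V} (he : IsChainMap M N e.toLinearMap) :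
    IsChainMap N M e.symm.toLinearMap :=
  of (he.toIsBimodMap.symm.congr_deg neg_zero) fun v => by
    apply e.injective
    have := he.map_d (e.symm v)
    simp only [LinearEquiv.coe_coe, LinearEquiv.apply_symm_apply] at this ⊢
    exact this.symm

end IsChainMap

namespace Homotopic

variable {L M N : BimCpx} {f g k : M.V →ₗ[ℂ] N.V}

theorem refl (f : M.V →ₗ[ℂ] N.V) : Homotopic M N f f := ⟨0, .zero, by simp⟩

theorem of_eq (h : f = g) : Homotopic M N f g := h ▸ refl f

theorem symm (h : Homotopic M N f g) : Homotopic M N g f := by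
  obtain ⟨s, hs, e⟩ := h
  refine ⟨-s, hs.neg, ?_⟩
  rw [← neg_sub, e, LinearMap.comp_neg, LinearMap.neg_comp]; abel

theorem trans (h : Homotopic M N f g) (h' : Homotopic M N g k) : Homotopic M N f k := by
  obtain ⟨s, hs, e⟩ := h
  obtain ⟨t, ht, e'⟩ := h'
  refine ⟨s + t, hs.add ht, ?_⟩
  rw [← sub_add_sub_cancel f g k, e, e', LinearMap.comp_add, LinearMap.add_comp]; abel

theorem comp_left {u : N.V →ₗ[ℂ] L.V} (h : Homotopic M N f g) (hu : IsChainMap N L u) :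
    Homotopic M L (u ∘ₗ f) (u ∘ₗ g) := by
  obtain ⟨s, hs, e⟩ := h
  refine ⟨u ∘ₗ s, (hu.toIsBimodMap.comp hs).congr_deg (add_zero _), ?_⟩
  ext v
  have := LinearMap.congr_fun e v
  simp only [LinearMap.sub_apply, LinearMap.add_apply, LinearMap.comp_apply] at this ⊢
  rw [← map_sub, this, map_add, hu.map_d]

theorem comp_right {u : L.V →ₗ[ℂ] M.V} (h : Homotopic M N f g) (hu : IsChainMap L M u) :
    Homotopic L N (f ∘ₗ u) (g ∘ₗ u) := by
  obtain ⟨s, hs, e⟩ := h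
  refine ⟨s ∘ₗ u, (hs.comp hu.toIsBimodMap).congr_deg (zero_add _), ?_⟩
  ext v
  have := LinearMap.congr_fun e (u v)
  simp only [LinearMap.sub_apply, LinearMap.add_apply, LinearMap.comp_apply] at this ⊢
  rw [this, hu.map_d]

end Homotopic

namespace IsHomotopyEquiv

variable {L M N : BimCpx}

theorem comp {g : M.V →ₗ[ℂ] N.V} {f : L.V →ₗ[ℂ] M.V} (hg : IsHomotopyEquiv M N g)
    (hf : IsHomotopyEquiv L M f) : IsHomotopyEquiv L N (g ∘ₗ f) := by
  obtain ⟨cg, g', cg', h1, h2⟩ := hg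
  obtain ⟨cf, f', cf', h3, h4⟩ := hf
  refine ⟨cg.comp cf, f' ∘ₗ g', cf'.comp cg', ?_, ?_⟩
  · exact (((h1.comp_left cf').comp_right cf).trans (.of_eq (by ext; rfl))).trans h3
  · exact (((h4.comp_left cg).comp_right cg').trans (.of_eq (by ext; rfl))).trans h2

theorem of_equiv {e : M.V ≃ₗ[ℂ] N.V} (he : IsChainMap M N e.toLinearMap) :
    IsHomotopyEquiv M N e.toLinearMap :=
  ⟨he, e.symm.toLinearMap, he.symm, .of_eq (by ext; simp), .of_eq (by ext; simp)⟩

end IsHomotopyEquiv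

/-- Two complexes are homotopy equivalent. -/
def HEquiv (M N : BimCpx) : Prop := ∃ f : M.V →ₗ[ℂ] N.V, IsHomotopyEquiv M N f

theorem HEquiv.symm {M N : BimCpx} (h : HEquiv M N) : HEquiv N M := by
  obtain ⟨f, cf, g, cg, h1, h2⟩ := h
  exact ⟨g, cg, f, cf, h2, h1⟩

theorem HEquiv.trans {L M N : BimCpx} (h : HEquiv L M) (h' : HEquiv M N) : HEquiv L N := by
  obtain ⟨f, hf⟩ := h
  obtain ⟨g, hg⟩ := h'
  exact ⟨_, hg.comp hf⟩

theorem HEquiv.of_equiv {M N : BimCpx} {e : M.V ≃ₗ[ℂ] N.V} (he : IsChainMap M N e.toLinearMap) :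
    HEquiv M N := ⟨_, IsHomotopyEquiv.of_equiv he⟩

/-! ### Contractibility criteria -/

/-- If `d s + s d` is bijective for some `s` of degree `-1`, the complex is contractible. -/
theorem contractible_of_bijective {M : BimCpx} (s : M.V →ₗ[ℂ] M.V) (hs : IsBimodMap M M (-1, 0) s)
    (hb : Function.Bijective (M.d ∘ₗ s + s ∘ₗ M.d)) : Contractible M := by
  -- Because `d² = 0`, the operator `d s + s d` always commutes with `d`. So does its inverse, and
  -- `s` composed with this inverse is a true contraction.
  have hT : IsChainMap M M (M.d ∘ₗ s + s ∘ₗ M.d) :=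
    .of (((IsBimodMap.d.comp hs).congr_deg (by simp)).add
      ((hs.comp IsBimodMap.d).congr_deg (by simp))) fun v => by simp [M.d_d]
  let e := LinearEquiv.ofBijective _ hb
  have he : IsChainMap M M e.toLinearMap := hT
  refine ⟨s ∘ₗ e.symm.toLinearMap,
    (hs.comp he.symm.toIsBimodMap).congr_deg (zero_add _), ?_⟩
  ext v
  have h1 : M.d (s (e.symm v)) + s (M.d (e.symm v)) = v := e.apply_symm_apply v
  have h2 := he.symm.map_d v
  simp only [LinearEquiv.coe_coe] at h2
  simp [h2, h1]

/-- Geometric series: on each vector only finitely many terms of `1 - n + n² - …` act, although no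
power of `n` need vanish globally. Local nilpotency is all that is available on an infinite direct
sum. -/
theorem bijective_one_add {V : Type*} [AddCommGroup V] [Module ℂ V] (n : V →ₗ[ℂ] V)
    (h : ∀ v, ∃ k, (n ^ k) v = 0) : Function.Bijective ((LinearMap.id : V →ₗ[ℂ] V) + n) := by
  have key : ∀ k : ℕ, ((1 : V →ₗ[ℂ] V) + n) * ∑ i ∈ Finset.range k, (-n) ^ i = 1 - (-n) ^ k := by
    intro k
    have := mul_neg_geom_sum (-n) k
    rwa [sub_neg_eq_add] at this
  have key' : ∀ k : ℕ, (∑ i ∈ Finset.range k, (-n) ^ i) * ((1 : V →ₗ[ℂ] V) + n) = 1 - (-n) ^ k := by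
    intro k
    have := geom_sum_mul_neg (-n) k
    rwa [sub_neg_eq_add] at this
  have hz : ∀ v, ∃ k, ((-n) ^ k) v = 0 := by
    intro v
    obtain ⟨k, hk⟩ := h v
    refine ⟨k, ?_⟩
    rw [neg_pow, Module.End.mul_apply, hk, map_zero]
  constructor
  · rw [injective_iff_map_eq_zero]
    intro v hv
    obtain ⟨k, hk⟩ := hz v
    have := LinearMap.congr_fun (key' k) v
    change ((1 : V →ₗ[ℂ] V) + n) v = 0 at hv
    rw [Module.End.mul_apply, hv, map_zero, LinearMap.sub_apply, hk] at this
    simpa using this.symm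
  · intro v
    obtain ⟨k, hk⟩ := hz v
    refine ⟨(∑ i ∈ Finset.range k, (-n) ^ i) v, ?_⟩
    have := LinearMap.congr_fun (key k) v
    rw [LinearMap.sub_apply, hk] at this
    simpa using this

theorem Contractible.of_hequiv {M N : BimCpx} (h : HEquiv M N) (hN : Contractible N) :
    Contractible M := by
  obtain ⟨f, cf, g, cg, h1, -⟩ := h
  refine h1.symm.trans ?_
  have := ((hN.comp_left cg).comp_right cf)
  exact (Homotopic.of_eq (by ext; simp)).trans (this.trans (.of_eq (by ext; simp)))

/-! ### Tensoring with `B`, `σ^±1` and `FT^±1` in coordinates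

The elements of `B ⊗ M` are written uniquely as `1 ⊗ m₀ + x ⊗ m₁` with `m₀`, `m₁` in `M`. -/

theorem parity_one : parity 1 = -1 := by simp [parity]

theorem parity_neg_one : parity (-1) = -1 := by simp [parity]

theorem parity_two : parity 2 = 1 := by
  rw [show (2 : ℤ) = 1 + 1 by norm_num, parity_succ, parity_one]; simp

theorem parity_neg_two : parity (-2) = 1 := by
  rw [show (-2 : ℤ) = -1 + -1 by norm_num, parity_add, parity_neg_one]; simp

/-- Left multiplication by `x` on `B ⊗ M`. -/
def btLx (M : BimCpx) : M.V × M.V →ₗ[ℂ] M.V × M.V :=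
  LinearMap.prod (M.lx ∘ₗ M.lx ∘ₗ LinearMap.snd ℂ M.V M.V) (LinearMap.fst ℂ M.V M.V)

theorem btLx_apply (M : BimCpx) (v : M.V × M.V) : btLx M v = (M.lx (M.lx v.2), v.1) := rfl

/-- The map `mult ⊗ M : B ⊗ M → M`. -/
def btMult (M : BimCpx) : M.V × M.V →ₗ[ℂ] M.V := LinearMap.coprod LinearMap.id M.lx

theorem btMult_apply (M : BimCpx) (v : M.V × M.V) : btMult M v = v.1 + M.lx v.2 := rfl

/-- The map `comult ⊗ M : M → B ⊗ M`. -/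
def btComult (M : BimCpx) : M.V →ₗ[ℂ] M.V × M.V := LinearMap.prod M.lx LinearMap.id

theorem btComult_apply (M : BimCpx) (v : M.V) : btComult M v = (M.lx v, v) := rfl

/-- The map `delta ⊗ M : B ⊗ M → B ⊗ M`. -/
def btDelta (M : BimCpx) : M.V × M.V →ₗ[ℂ] M.V × M.V :=
  (1 / 2 : ℂ) • (btLx M - M.lx.prodMap M.lx)

theorem btDelta_apply (M : BimCpx) (v : M.V × M.V) :
    btDelta M v = ((1 / 2 : ℂ) • (M.lx (M.lx v.2) - M.lx v.1), (1 / 2 : ℂ) • (v.1 - M.lx v.2)) :=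
  rfl

/-- The complex `B ⊗ M`. -/
abbrev BT (M : BimCpx) : BimCpx where
  V := M.V × M.V
  lx := btLx M
  rx := M.rx.prodMap M.rx
  d := M.d.prodMap M.d
  sgn := M.sgn.prodMap M.sgn
  -- In doubled degrees the basis elements `1 ⊗ 1` and `x ⊗ 1` of `B` have degrees `-1` and `1`.
  gr := (dirSum (shift (0, -1) M) (shift (0, 1) M)).gr
  internal := (dirSum (shift (0, -1) M) (shift (0, 1) M)).internal
  lx_mem := by
    rintro p ⟨v, w⟩ ⟨hv, hw⟩
    refine ⟨?_, ?_⟩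
    · have := M.lx_mem _ _ (M.lx_mem _ _ hw)
      rwa [show p - (0, 1) + (0, 2) + (0, 2) = p + (0, 2) - ((0, -1) : ℤ × ℤ) by
        ext <;> simp; ring] at this
    · change v ∈ M.gr (p + (0, 2) - (0, 1))
      rwa [show p + (0, 2) - (0, 1) = p - ((0, -1) : ℤ × ℤ) by ext <;> simp; ring]
  rx_mem := (dirSum (shift (0, -1) M) (shift (0, 1) M)).rx_mem
  d_mem := by
    rintro p ⟨v, w⟩ ⟨hv, hw⟩
    refine ⟨?_, ?_⟩
    · have := M.d_mem _ _ hv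
      rwa [show p - (0, -1) + (1, 0) = p + (1, 0) - ((0, -1) : ℤ × ℤ) by ext <;> simp] at this
    · have := M.d_mem _ _ hw
      rwa [show p - (0, 1) + (1, 0) = p + (1, 0) - ((0, 1) : ℤ × ℤ) by ext <;> simp] at this
  sgn_eq := by
    rintro p ⟨v, w⟩ ⟨hv, hw⟩
    have h1 := M.sgn_eq _ _ hv
    have h2 := M.sgn_eq _ _ hw
    simp only [Prod.fst_sub, sub_zero] at h1 h2
    simp [h1, h2]
  lx_rx v := by simp [btLx_apply, M.lx_rx]
  d_lx v := by simp [btLx_apply, M.d_lx]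
  d_rx v := by simp [M.d_rx]
  d_d v := by simp [M.d_d]

theorem btMult_bimod (M : BimCpx) : IsBimodMap (BT M) M (0, 1) (btMult M) where
  map_lx v := by simp [btMult_apply, btLx_apply, add_comm]
  map_rx v := by simp [btMult_apply, M.lx_rx]
  map_gr p v hv := by
    refine Submodule.add_mem _ ?_ ?_
    · have := hv.1
      rwa [show p + (0, 1) = p - ((0, -1) : ℤ × ℤ) by ext <;> simp]
    · have := M.lx_mem _ _ hv.2
      rwa [show p - (0, 1) + (0, 2) = p + ((0, 1) : ℤ × ℤ) by ext <;> simp; ring] at this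

theorem btComult_bimod (M : BimCpx) : IsBimodMap M (BT M) (0, 1) (btComult M) where
  map_lx v := by simp [btComult_apply, btLx_apply]
  map_rx v := by simp [btComult_apply, M.lx_rx]
  map_gr p v hv := by
    refine ⟨?_, ?_⟩
    · have := M.lx_mem _ _ hv
      rwa [show p + (0, 2) = p + (0, 1) - ((0, -1) : ℤ × ℤ) by ext <;> simp; ring] at this
    · rwa [show p = p + (0, 1) - ((0, 1) : ℤ × ℤ) by ext <;> simp] at hv

theorem btDelta_bimod (M : BimCpx) : IsBimodMap (BT M) (BT M) (0, 2) (btDelta M) where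
  map_lx v := by
    ext <;> simp [btDelta_apply, btLx_apply]
  map_rx v := by simp [btDelta_apply, M.lx_rx]
  map_gr p v hv := by
    have h1 := (BT M).lx_mem _ _ hv
    refine Submodule.smul_mem _ _ (Submodule.sub_mem _ h1 ⟨?_, ?_⟩)
    · have := M.lx_mem _ _ hv.1
      rwa [show p - (0, -1) + (0, 2) = p + (0, 2) - ((0, -1) : ℤ × ℤ) by ext <;> simp; ring] at this
    · have := M.lx_mem _ _ hv.2
      rwa [show p - (0, 1) + (0, 2) = p + (0, 2) - ((0, 1) : ℤ × ℤ) by ext <;> simp; ring] at this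

/-- `σ ⊗ M` in coordinates. -/
abbrev sigmaT (M : BimCpx) : BimCpx :=
  withD (dirSum (BT M) (shift (1, -1) M))
    (LinearMap.prod (M.d.prodMap M.d ∘ₗ LinearMap.fst ℂ (M.V × M.V) M.V)
      -- The Koszul sign: the second term of `σ` sits in homological degree `1`. The coordinate
      -- complexes below carry a minus sign on each term of odd degree for the same reason.
      (LinearMap.coprod (btMult M) (-M.d)))
    (fun v => by
      have := (btMult_bimod M).map_lx v.1
      ext <;> simp_all [btLx_apply, M.d_lx, add_comm])
    (fun v => by
      have := (btMult_bimod M).map_rx v.1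
      ext <;> simp_all [M.d_rx, add_comm])
    (fun p v hv => ⟨(BT M).d_mem _ _ hv.1, Submodule.add_mem _ (by
        have := (btMult_bimod M).map_gr _ _ hv.1
        rwa [show p + (0, 1) = p + (1, 0) - ((1, -1) : ℤ × ℤ) by ext <;> simp] at this)
      (Submodule.neg_mem _ (by
        have := M.d_mem _ _ hv.2
        rwa [show p - (1, -1) + (1, 0) = p + (1, 0) - ((1, -1) : ℤ × ℤ) by
          ext <;> simp] at this))⟩)
    (fun v => by ext <;> simp [M.d_d, btMult_apply, M.d_lx])

theorem sigmaT_d (M : BimCpx) (v : (M.V × M.V) × M.V) :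
    (sigmaT M).d v = ((M.d v.1.1, M.d v.1.2), v.1.1 + M.lx v.1.2 + -M.d v.2) := rfl

/-- `σ⁻¹ ⊗ M` in coordinates. -/
abbrev sigmaInvT (M : BimCpx) : BimCpx :=
  withD (dirSum (shift (-1, 1) M) (BT M))
    (LinearMap.prod (-M.d ∘ₗ LinearMap.fst ℂ M.V (M.V × M.V))
      (LinearMap.coprod (btComult M) (M.d.prodMap M.d)))
    (fun v => by
      ext <;> simp [btLx_apply, btComult_apply, M.d_lx])
    (fun v => by
      ext <;> simp [M.d_rx, btComult_apply, M.lx_rx])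
    (fun p v hv => ⟨Submodule.neg_mem _ (by
        have := M.d_mem _ _ hv.1
        rwa [show p - (-1, 1) + (1, 0) = p + (1, 0) - ((-1, 1) : ℤ × ℤ) by
          ext <;> simp] at this), Submodule.add_mem _ (by
        have := (btComult_bimod M).map_gr _ _ hv.1
        rwa [show p - (-1, 1) + (0, 1) = p + ((1, 0) : ℤ × ℤ) by ext <;> simp] at this)
      ((BT M).d_mem _ _ hv.2)⟩)
    (fun v => by ext <;> simp [M.d_d, btComult_apply, M.d_lx])

theorem sigmaInvT_d (M : BimCpx) (v : M.V × (M.V × M.V)) :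
    (sigmaInvT M).d v = (-M.d v.1, (M.lx v.1 + M.d v.2.1, v.1 + M.d v.2.2)) := rfl

/-- `FT ⊗ M` in coordinates. -/
abbrev ftT (M : BimCpx) : BimCpx :=
  withD (dirSum (shift (0, 1) (BT M)) (dirSum (shift (1, -1) (BT M)) (shift (2, -2) M)))
    (LinearMap.prod (M.d.prodMap M.d ∘ₗ LinearMap.fst ℂ (M.V × M.V) ((M.V × M.V) × M.V))
      (LinearMap.prod
        (LinearMap.coprod (btDelta M) (-(M.d.prodMap M.d) ∘ₗ LinearMap.fst ℂ (M.V × M.V) M.V))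
        (LinearMap.coprod (btMult M) M.d ∘ₗ LinearMap.snd ℂ (M.V × M.V) ((M.V × M.V) × M.V))))
    (fun v => by
      have h1 := (btMult_bimod M).map_lx v.2.1
      have h2 := (btDelta_bimod M).map_lx v.1
      have h3 := (BT M).d_lx v.1
      have h4 := (BT M).d_lx v.2.1
      simp_all [M.d_lx]
      simp [btLx_apply])
    (fun v => by
      have h1 := (btMult_bimod M).map_rx v.2.1
      have h2 := (btDelta_bimod M).map_rx v.1
      ext <;> simp_all [M.d_rx])
    (fun p v hv => ⟨by
        have := (BT M).d_mem _ _ hv.1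
        rwa [show p - (0, 1) + (1, 0) = p + (1, 0) - ((0, 1) : ℤ × ℤ) by
          ext <;> simp] at this,
      Submodule.add_mem _ (by
        have := (btDelta_bimod M).map_gr _ _ hv.1
        rwa [show p - (0, 1) + (0, 2) = p + (1, 0) - ((1, -1) : ℤ × ℤ) by
          ext <;> simp; ring] at this)
        (Submodule.neg_mem _ (by
          have := (BT M).d_mem _ _ hv.2.1
          rwa [show p - (1, -1) + (1, 0) = p + (1, 0) - ((1, -1) : ℤ × ℤ) by
            ext <;> simp] at this)),
      Submodule.add_mem _ (by
        have := (btMult_bimod M).map_gr _ _ hv.2.1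
        rwa [show p - (1, -1) + (0, 1) = p + (1, 0) - ((2, -2) : ℤ × ℤ) by
          ext <;> simp <;> ring] at this) (by
        have := M.d_mem _ _ hv.2.2
        rwa [show p - (2, -2) + (1, 0) = p + (1, 0) - ((2, -2) : ℤ × ℤ) by
          ext <;> simp; ring] at this)⟩)
    (fun v => by
      ext <;> simp [M.d_d, btDelta_apply, btMult_apply, M.d_lx] <;> module)

/-- `FT⁻¹ ⊗ M` in coordinates. -/
abbrev ftInvT (M : BimCpx) : BimCpx :=
  withD (dirSum (shift (-2, 2) M) (dirSum (shift (-1, 1) (BT M)) (shift (0, -1) (BT M))))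
    (LinearMap.prod (M.d ∘ₗ LinearMap.fst ℂ M.V ((M.V × M.V) × (M.V × M.V)))
      (LinearMap.prod
        (LinearMap.coprod (btComult M)
          (-(M.d.prodMap M.d) ∘ₗ LinearMap.fst ℂ (M.V × M.V) (M.V × M.V)))
        (LinearMap.coprod (btDelta M) (M.d.prodMap M.d) ∘ₗ
          LinearMap.snd ℂ M.V ((M.V × M.V) × (M.V × M.V)))))
    (fun v => by
      have h1 := (btComult_bimod M).map_lx v.1
      have h2 := (btDelta_bimod M).map_lx v.2.1
      have h3 := (BT M).d_lx v.2.1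
      have h4 := (BT M).d_lx v.2.2
      simp_all [M.d_lx]
      simp [btLx_apply])
    (fun v => by
      have h1 := (btComult_bimod M).map_rx v.1
      have h2 := (btDelta_bimod M).map_rx v.2.1
      ext <;> simp_all [M.d_rx])
    (fun p v hv => ⟨by
        have := M.d_mem _ _ hv.1
        rwa [show p - (-2, 2) + (1, 0) = p + (1, 0) - ((-2, 2) : ℤ × ℤ) by
          ext <;> simp; ring] at this,
      Submodule.add_mem _ (by
        have := (btComult_bimod M).map_gr _ _ hv.1
        rwa [show p - (-2, 2) + (0, 1) = p + (1, 0) - ((-1, 1) : ℤ × ℤ) by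
          ext <;> simp <;> ring] at this)
        (Submodule.neg_mem _ (by
          have := (BT M).d_mem _ _ hv.2.1
          rwa [show p - (-1, 1) + (1, 0) = p + (1, 0) - ((-1, 1) : ℤ × ℤ) by
            ext <;> simp] at this)),
      Submodule.add_mem _ (by
        have := (btDelta_bimod M).map_gr _ _ hv.2.1
        rwa [show p - (-1, 1) + (0, 2) = p + (1, 0) - ((0, -1) : ℤ × ℤ) by
          ext <;> simp; ring] at this) (by
        have := (BT M).d_mem _ _ hv.2.2
        rwa [show p - (0, -1) + (1, 0) = p + (1, 0) - ((0, -1) : ℤ × ℤ) by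
          ext <;> simp] at this)⟩)
    (fun v => by
      ext <;> simp [M.d_d, btDelta_apply, btComult_apply, M.d_lx] <;> module)

theorem ftInvT_d (M : BimCpx) (v : M.V × (M.V × M.V) × (M.V × M.V)) :
    (ftInvT M).d v = (M.d v.1,
      (M.lx v.1 + -M.d v.2.1.1, v.1 + -M.d v.2.1.2),
      ((1 / 2 : ℂ) • (M.lx (M.lx v.2.1.2) - M.lx v.2.1.1) + M.d v.2.2.1,
        (1 / 2 : ℂ) • (v.2.1.1 - M.lx v.2.1.2) + M.d v.2.2.2)) := rfl

/-! ### Polynomials acting by operators -/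

theorem aeval_intertwine {V W : Type*} [AddCommGroup V] [Module ℂ V] [AddCommGroup W] [Module ℂ W]
    {S : V →ₗ[ℂ] V} {S' : W →ₗ[ℂ] W} {T : V →ₗ[ℂ] W} (h : ∀ v, T (S v) = S' (T v)) (f : ℂ[X])
    (v : V) : T (Polynomial.aeval S f v) = Polynomial.aeval S' f (T v) := by
  induction f using Polynomial.induction_on' generalizing v with
  | add f g hf hg => simp [hf, hg]
  | monomial n a =>
    simp only [Polynomial.aeval_monomial, Module.algebraMap_end_eq_smul_id, Module.End.mul_apply,
      LinearMap.smul_apply, LinearMap.id_apply, map_smul]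
    congr 1
    induction n generalizing v with
    | zero => simp
    | succ n ih => rw [pow_succ, pow_succ, Module.End.mul_apply, Module.End.mul_apply, ih, h]

theorem aeval_mulLeft (f g : ℂ[X]) :
    Polynomial.aeval (LinearMap.mulLeft ℂ (Polynomial.X : ℂ[X])) f g = f * g := by
  have := Polynomial.aeval_algHom_apply (Algebra.lmul ℂ ℂ[X]) Polynomial.X f
  rw [Polynomial.aeval_X_left_apply] at this
  exact LinearMap.congr_fun this g

theorem aeval_lx_mem {M : BimCpx} {a b : ℤ × ℤ} {f : ℂ[X]} {m : M.V} (hf : f ∈ unit.gr a)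
    (hm : m ∈ M.gr b) : Polynomial.aeval M.lx f m ∈ M.gr (a + b) := by
  rw [Polynomial.aeval_eq_sum_range, LinearMap.sum_apply]
  refine Submodule.sum_mem _ fun n _ => ?_
  by_cases h : f.coeff n = 0
  · simp [h]
  · rw [hf n h, LinearMap.smul_apply]
    refine Submodule.smul_mem _ _ ?_
    have := pow_mem M.lx_mem n hm
    rwa [show b + n • ((0, 2) : ℤ × ℤ) = (0, 2 * (n : ℤ)) + b by ext <;> simp; ring] at this

/-! ### The action of `B` on a complex -/

/-- The map `b ⊗ m ↦ b ⊗ m` from `B × M` to the coordinates of `B ⊗ M`. -/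
def actB (M : BimCpx) : B.V →ₗ[ℂ] M.V →ₗ[ℂ] M.V × M.V :=
  Submodule.liftQ _ (TensorProduct.lift (LinearMap.mk₂ ℂ (fun f g : ℂ[X] =>
    (Polynomial.aeval (btLx M) f : M.V × M.V →ₗ[ℂ] M.V × M.V) ∘ₗ LinearMap.inl ℂ M.V M.V ∘ₗ
      (Polynomial.aeval M.lx g : M.V →ₗ[ℂ] M.V))
    (fun _ _ _ => by ext <;> simp) (fun _ _ _ => by ext <;> simp)
    (fun _ _ _ => by
      apply LinearMap.ext; intro v
      simp only [LinearMap.comp_apply, LinearMap.add_apply, map_add])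
    (fun _ _ _ => by
      apply LinearMap.ext; intro v
      simp only [LinearMap.comp_apply, LinearMap.smul_apply, map_smul]))) <| by
    rintro _ ⟨t, rfl⟩
    refine LinearMap.congr_fun (f := TensorProduct.lift _ ∘ₗ balance 2 unit unit) (g := 0)
      (TensorProduct.ext' fun f g => ?_) t
    have h2 : ∀ g : ℂ[X], (LinearMap.mulLeft ℂ (Polynomial.X : ℂ[X]) ^ 2) g
      = Polynomial.X * (Polynomial.X * g) := fun g => by rw [pow_two]; rfl
    simp only [LinearMap.comp_apply, balance, LinearMap.sub_apply, TensorProduct.map_tmul,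
      LinearMap.id_apply, map_sub, TensorProduct.lift.tmul, LinearMap.mk₂_apply, h2,
      LinearMap.zero_apply, sub_eq_zero]
    apply LinearMap.ext; intro v
    simp only [LinearMap.comp_apply, LinearMap.inl_apply]
    rw [show (Polynomial.X * (Polynomial.X * f) : ℂ[X]) = f * Polynomial.X * Polynomial.X by ring]
    simp [btLx_apply]

theorem actB_tmul (M : BimCpx) (f g : ℂ[X]) (m : M.V) :
    actB M (tmul 2 f g : TensorV 2 unit unit) m
      = Polynomial.aeval (btLx M) f (Polynomial.aeval M.lx g m, 0) := rfl

/-- Bilinear identities on `B` can be checked on pure tensors. -/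
theorem B_ext {W : Type*} [AddCommGroup W] [Module ℂ W] {f g : B.V →ₗ[ℂ] W}
    (h : ∀ a b : ℂ[X], f (tmul 2 a b : TensorV 2 unit unit) = g (tmul 2 a b : TensorV 2 unit unit))
    (v : B.V) : f v = g v :=
  LinearMap.congr_fun (tensorV_ext h) v

theorem B_lx_tmul (f g : ℂ[X]) : B.lx (tmul 2 f g : TensorV 2 unit unit)
    = (tmul 2 (Polynomial.X * f : ℂ[X]) g : TensorV 2 unit unit) := rfl

theorem B_rx_tmul (f g : ℂ[X]) : B.rx (tmul 2 f g : TensorV 2 unit unit)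
    = (tmul 2 f (Polynomial.X * g : ℂ[X]) : TensorV 2 unit unit) := rfl

theorem B_sgn (b : B.V) : B.sgn b = b := by
  refine B_ext (f := B.sgn) (g := LinearMap.id) (fun f g => ?_) b
  change parity 0 • (tmul 2 f g : TensorV 2 unit unit) = _
  rw [parity_zero, one_smul]; rfl

theorem actB_lx (M : BimCpx) (b : B.V) (m : M.V) : actB M (B.lx b) m = btLx M (actB M b m) := by
  refine B_ext (f := (actB M).flip m ∘ₗ B.lx) (g := btLx M ∘ₗ (actB M).flip m) (fun f g => ?_) b
  simp only [LinearMap.comp_apply, LinearMap.flip_apply]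
  rw [B_lx_tmul, actB_tmul, actB_tmul]
  simp

theorem actB_rx (M : BimCpx) (b : B.V) (m : M.V) : actB M (B.rx b) m = actB M b (M.lx m) := by
  refine B_ext (f := (actB M).flip m ∘ₗ B.rx) (g := (actB M).flip (M.lx m)) (fun f g => ?_) b
  simp only [LinearMap.comp_apply, LinearMap.flip_apply]
  rw [B_rx_tmul, actB_tmul, actB_tmul, mul_comm Polynomial.X g]
  simp

theorem actB_map {M N : BimCpx} {T : M.V →ₗ[ℂ] N.V} (hT : ∀ v, T (M.lx v) = N.lx (T v))
    (b : B.V) (m : M.V) : actB N b (T m) = T.prodMap T (actB M b m) := by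
  refine B_ext (f := (actB N).flip (T m)) (g := T.prodMap T ∘ₗ (actB M).flip m) (fun f g => ?_) b
  simp only [LinearMap.comp_apply, LinearMap.flip_apply]
  rw [actB_tmul, actB_tmul, aeval_intertwine (S' := btLx N) (T := T.prodMap T),
    ← aeval_intertwine (T := T) hT]
  · simp
  · intro v; simp [btLx_apply, hT]

theorem actB_mem {M : BimCpx} {p q : ℤ × ℤ} {b : B.V} {m : M.V} (hb : b ∈ B.gr p)
    (hm : m ∈ M.gr q) : actB M b m ∈ (BT M).gr (p + q) := by
  refine tensorGr_map (e := 2) (M := unit) (N := unit) (p := p - (0, -1))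
    (f := (actB M).flip m) ?_ hb
  rintro a b hab f hf g hg
  rw [LinearMap.flip_apply, actB_tmul]
  have h1 : ((Polynomial.aeval M.lx g m, 0) : M.V × M.V) ∈ (BT M).gr (b + q + (0, -1)) := by
    refine ⟨?_, Submodule.zero_mem _⟩
    change _ ∈ M.gr (b + q + (0, -1) - (0, -1))
    rw [add_sub_cancel_right]
    exact aeval_lx_mem hg hm
  have := aeval_lx_mem (M := BT M) hf h1
  rwa [show a + (b + q + (0, -1)) = p + q by
    rw [eq_sub_iff_add_eq] at hab; rw [← hab]; abel] at this

/-- This lemma and the next two justify the names `btMult`, `btComult` and `btDelta`: they are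
`mult`, `comult` and `delta` tensored with `M`, read in coordinates. They supply the off-diagonal
parts of the tensor differentials. -/
theorem aeval_mult (M : BimCpx) (b : B.V) (m : M.V) :
    Polynomial.aeval M.lx (mult b : ℂ[X]) m = btMult M (actB M b m) := by
  refine B_ext (f := (Polynomial.aeval M.lx).toLinearMap.flip m ∘ₗ mult)
    (g := btMult M ∘ₗ (actB M).flip m) (fun f g => ?_) b
  simp only [LinearMap.comp_apply, LinearMap.flip_apply, AlgHom.toLinearMap_apply]
  rw [mult_tmul, actB_tmul, aeval_intertwine (S' := M.lx) (btMult_bimod M).map_lx]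
  simp [btMult_apply]

theorem actB_comult (M : BimCpx) (f : ℂ[X]) (m : M.V) :
    actB M (comult f) m = btComult M (Polynomial.aeval M.lx f m) := by
  have h := aeval_intertwine (btComult_bimod M).map_lx f m
  rw [h, comult_apply, map_add, LinearMap.add_apply, actB_tmul, actB_tmul,
    mul_comm Polynomial.X f]
  simp only [map_mul, Polynomial.aeval_X, Module.End.mul_apply, ← map_add, map_one]
  congr 1
  simp [btLx_apply, btComult_apply]

theorem actB_delta (M : BimCpx) (b : B.V) (m : M.V) :
    actB M (delta b) m = btDelta M (actB M b m) := by
  have h := actB_map (T := M.lx) (M := M) (N := M) (fun _ => rfl) b m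
  change actB M ((1 / 2 : ℂ) • (B.lx b - B.rx b)) m
    = (1 / 2 : ℂ) • (btLx M (actB M b m) - M.lx.prodMap M.lx (actB M b m))
  rw [map_smul, map_sub, LinearMap.smul_apply, LinearMap.sub_apply, actB_lx, actB_rx, h]

/-! ### Coordinates on tensor products -/

/-- The map `m ↦ l ⊗ m`. -/
def tmulL {L : BimCpx} (M : BimCpx) (l : L.V) : M.V →ₗ[ℂ] TensorV 1 L M :=
  Submodule.mkQ _ ∘ₗ TensorProduct.mk ℂ L.V M.V l

theorem tmulL_apply {L M : BimCpx} (l : L.V) (m : M.V) : tmulL M l m = tmul 1 l m := rfl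

theorem add_tmul' {L M : BimCpx} (l l' : L.V) (m : M.V) :
    (tmul 1 (l + l') m : TensorV 1 L M) = tmul 1 l m + tmul 1 l' m := by
  rw [tmul, TensorProduct.add_tmul]; rfl

theorem tmul_add' {L M : BimCpx} (l : L.V) (m m' : M.V) :
    (tmul 1 l (m + m') : TensorV 1 L M) = tmul 1 l m + tmul 1 l m' := (tmulL M l).map_add m m'

theorem tmul_smul' {L M : BimCpx} (c : ℂ) (l : L.V) (m : M.V) :
    (tmul 1 l (c • m) : TensorV 1 L M) = c • tmul 1 l m := (tmulL M l).map_smul c m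

theorem tmul_rx {L M : BimCpx} (l : L.V) (m : M.V) :
    (tmul 1 (L.rx l) m : TensorV 1 L M) = tmul 1 l (M.lx m) := by
  have := tmul_balance 1 (M := L) (N := M) l m
  rwa [pow_one, pow_one] at this

theorem tmul_aeval {L M : BimCpx} (f : ℂ[X]) (l : L.V) (m : M.V) :
    (tmul 1 l (Polynomial.aeval M.lx f m) : TensorV 1 L M)
      = tmul 1 (Polynomial.aeval L.rx f l) m := by
  induction f using Polynomial.induction_on' with
  | add f g hf hg => simp only [map_add, LinearMap.add_apply, add_tmul', tmul_add', hf, hg]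
  | monomial n a =>
    have h : ∀ (n : ℕ) (m : M.V) (l : L.V),
        (tmul 1 l ((M.lx ^ n) m) : TensorV 1 L M) = tmul 1 ((L.rx ^ n) l) m := by
      intro n
      induction n with
      | zero => intros; rfl
      | succ n ih =>
        intro m l
        rw [pow_succ', pow_succ, Module.End.mul_apply, Module.End.mul_apply, ← tmul_rx, ih]
    simp only [Polynomial.aeval_monomial, Module.algebraMap_end_eq_smul_id, Module.End.mul_apply,
      LinearMap.smul_apply, LinearMap.id_apply]
    rw [tmul_smul', h]
    rfl

/-- The coordinates of the summand of `L ⊗ M` given by an inclusion of `B` into `L`. -/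
def invB {L : BimCpx} (M : BimCpx) (j : B.V →ₗ[ℂ] L.V) : M.V × M.V →ₗ[ℂ] TensorV 1 L M :=
  LinearMap.coprod (tmulL M (j (tmul 2 (1 : ℂ[X]) (1 : ℂ[X]) : TensorV 2 unit unit)))
    (tmulL M (j (tmul 2 (Polynomial.X : ℂ[X]) (1 : ℂ[X]) : TensorV 2 unit unit)))

/-- The relation of `R^s` enters here: `x² ⊗ 1 = 1 ⊗ x²` in `B`, so the second left multiplication
returns to the coordinate of `1 ⊗ 1` and the factor `x²` passes through the tensor sign to `M`. -/
theorem invB_lx {L M : BimCpx} {j : B.V →ₗ[ℂ] L.V} (hl : ∀ b, j (B.lx b) = L.lx (j b))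
    (hr : ∀ b, j (B.rx b) = L.rx (j b)) (v : M.V × M.V) :
    invB M j (btLx M v) = tensorLx 1 L M (invB M j v) := by
  simp only [invB, LinearMap.coprod_apply, tmulL_apply, map_add, tensorLx_tmul, btLx_apply]
  rw [← hl, ← hl, B_lx_tmul, mul_one, add_comm]
  congr 1
  rw [← tmul_rx, ← tmul_rx, ← hr, ← hr, ← B_sq, B_lx_tmul, mul_one]

/-- An element `f ⊗ g` of `B` arises from `1 ⊗ 1` by right multiplication with `g`, which `M`
absorbs, and left multiplication with `f`, which `invB_lx` carries through. -/
theorem invB_actB {L M : BimCpx} {j : B.V →ₗ[ℂ] L.V} (hl : ∀ b, j (B.lx b) = L.lx (j b))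
    (hr : ∀ b, j (B.rx b) = L.rx (j b)) (b : B.V) (m : M.V) :
    invB M j (actB M b m) = tmul 1 (j b) m := by
  refine B_ext (f := invB M j ∘ₗ (actB M).flip m)
    (g := Submodule.mkQ _ ∘ₗ (TensorProduct.mk ℂ L.V M.V).flip m ∘ₗ j) (fun f g => ?_) b
  simp only [LinearMap.comp_apply, LinearMap.flip_apply]
  rw [actB_tmul, aeval_intertwine (invB_lx hl hr)]
  have h1 : invB M j (Polynomial.aeval M.lx g m, 0)
      = tmul 1 (j (tmul 2 (1 : ℂ[X]) g : TensorV 2 unit unit)) m := by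
    simp only [invB, LinearMap.coprod_apply, map_zero, add_zero, tmulL_apply, tmul_aeval]
    rw [← aeval_intertwine hr]
    congr 3
    have := aeval_intertwine (T := Submodule.mkQ (LinearMap.range (balance 2 unit unit)) ∘ₗ
      TensorProduct.mk ℂ ℂ[X] ℂ[X] 1) (S := LinearMap.mulLeft ℂ Polynomial.X) (S' := B.rx)
      (fun v => rfl) g 1
    rw [aeval_mulLeft, mul_one] at this
    exact this.symm
  rw [h1]
  have h2 := aeval_intertwine (T := Submodule.mkQ (LinearMap.range (balance 1 L M)) ∘ₗ
    (TensorProduct.mk ℂ L.V M.V).flip m) (S := L.lx) (S' := tensorLx 1 L M) (fun v => rfl) f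
    (j (tmul 2 (1 : ℂ[X]) g : TensorV 2 unit unit))
  refine h2.symm.trans ?_
  simp only [LinearMap.comp_apply, LinearMap.flip_apply]
  rw [← aeval_intertwine hl]
  have := aeval_intertwine (T := Submodule.mkQ (LinearMap.range (balance 2 unit unit)) ∘ₗ
    (TensorProduct.mk ℂ ℂ[X] ℂ[X]).flip g) (S := LinearMap.mulLeft ℂ Polynomial.X) (S' := B.lx)
    (fun v => rfl) f 1
  rw [aeval_mulLeft, mul_one] at this
  exact congrArg (fun b => (tmul 1 (j b) m : TensorV 1 L M)) this.symm

theorem tmul_unit {L M : BimCpx} {j : unit.V →ₗ[ℂ] L.V} (hr : ∀ b, j (unit.rx b) = L.rx (j b))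
    (f : ℂ[X]) (m : M.V) :
    tmul 1 (j (1 : ℂ[X])) (Polynomial.aeval M.lx f m) = (tmul 1 (j f) m : TensorV 1 L M) := by
  rw [tmul_aeval, ← aeval_intertwine hr, aeval_mulLeft, mul_one]

theorem actB_one (M : BimCpx) (m : M.V) :
    actB M (tmul 2 (1 : ℂ[X]) (1 : ℂ[X]) : TensorV 2 unit unit) m = (m, 0) := by
  rw [actB_tmul]; simp

theorem actB_X (M : BimCpx) (m : M.V) :
    actB M (tmul 2 (Polynomial.X : ℂ[X]) (1 : ℂ[X]) : TensorV 2 unit unit) m = (0, m) := by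
  rw [actB_tmul]; simp [btLx_apply]

/-- A biadditive map which satisfies the universal property of the complex `L ⊗ M`. -/
structure TensorModel (L M T : BimCpx) where
  act : L.V →ₗ[ℂ] M.V →ₗ[ℂ] T.V
  act_bal : ∀ l m, act (L.rx l) m = act l (M.lx m)
  act_lx : ∀ l m, act (L.lx l) m = T.lx (act l m)
  act_rx : ∀ l m, act l (M.rx m) = T.rx (act l m)
  act_mem : ∀ p q l m, l ∈ L.gr p → m ∈ M.gr q → act l m ∈ T.gr (p + q)
  act_d : ∀ l m, act (L.d l) m + act (L.sgn l) (M.d m) = T.d (act l m)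
  -- Only one composite is required here, which makes the comparison map injective. That `inv` is
  -- also a right inverse is checked separately for each coordinate complex.
  inv : T.V →ₗ[ℂ] TensorV 1 L M
  inv_act : ∀ l m, inv (act l m) = tmul 1 l m

namespace TensorModel

variable {L M T : BimCpx} (A : TensorModel L M T)

/-- The comparison map from the tensor product. -/
def desc : TensorV 1 L M →ₗ[ℂ] T.V :=
  Submodule.liftQ _ (TensorProduct.lift A.act) <| by
    rintro _ ⟨t, rfl⟩
    refine LinearMap.congr_fun (f := TensorProduct.lift A.act ∘ₗ balance 1 L M) (g := 0)
      (TensorProduct.ext' fun l m => ?_) t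
    simp [balance, A.act_bal]

theorem desc_tmul (l : L.V) (m : M.V) : A.desc (tmul 1 l m) = A.act l m := rfl

theorem inv_desc (v : TensorV 1 L M) : A.inv (A.desc v) = v :=
  LinearMap.congr_fun (f := A.inv ∘ₗ A.desc) (g := LinearMap.id)
    (tensorV_ext fun l m => A.inv_act l m) v

theorem desc_chain : IsChainMap (tensor L M) T A.desc :=
  .of
    { map_lx := LinearMap.congr_fun (f := A.desc ∘ₗ tensorLx 1 L M) (g := T.lx ∘ₗ A.desc)
        (tensorV_ext fun l m => A.act_lx l m)
      map_rx := LinearMap.congr_fun (f := A.desc ∘ₗ tensorRx 1 L M) (g := T.rx ∘ₗ A.desc)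
        (tensorV_ext fun l m => A.act_rx l m)
      map_gr := fun p v hv => tensorGr_map (fun a b hab m hm n hn => by
        rw [add_zero, ← hab]; exact A.act_mem a b m n hm hn) hv }
    (LinearMap.congr_fun (f := A.desc ∘ₗ tensorD 1 L M) (g := T.d ∘ₗ A.desc)
        (tensorV_ext fun l m => by
          simp only [LinearMap.comp_apply, tensorD_tmul, map_add, desc_tmul]
          exact A.act_d l m))

/-- The isomorphism `L ⊗ M = T`. -/
def equiv (h : ∀ v, A.desc (A.inv v) = v) : (tensor L M).V ≃ₗ[ℂ] T.V :=
  LinearEquiv.ofLinearMap A.desc A.inv (LinearMap.ext h) (LinearMap.ext A.inv_desc)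

theorem equiv_chain (h : ∀ v, A.desc (A.inv v) = v) :
    IsChainMap (tensor L M) T (A.equiv h).toLinearMap := A.desc_chain

end TensorModel

theorem aeval_X_mul (M : BimCpx) (f : ℂ[X]) (m : M.V) :
    Polynomial.aeval M.lx (Polynomial.X * f : ℂ[X]) m = M.lx (Polynomial.aeval M.lx f m) := by
  simp

theorem aeval_X_mul' (M : BimCpx) (f : ℂ[X]) (m : M.V) :
    Polynomial.aeval M.lx (Polynomial.X * f : ℂ[X]) m = Polynomial.aeval M.lx f (M.lx m) := by
  rw [mul_comm]; simp

theorem aeval_mem' {M : BimCpx} {k p q : ℤ × ℤ} {f : ℂ[X]} {m : M.V} (hf : f ∈ unit.gr (p - k))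
    (hm : m ∈ M.gr q) : Polynomial.aeval M.lx f m ∈ M.gr (p + q - k) := by
  have := aeval_lx_mem hf hm
  rwa [sub_add_eq_add_sub] at this

theorem actB_mem' {M : BimCpx} {k p q : ℤ × ℤ} {b : B.V} {m : M.V} (hb : b ∈ B.gr (p - k))
    (hm : m ∈ M.gr q) : actB M b m ∈ (BT M).gr (p + q - k) := by
  have := actB_mem hb hm
  rwa [sub_add_eq_add_sub] at this

theorem aeval_d (M : BimCpx) (i : ℤ) (f : ℂ[X]) (m : M.V) :
    Polynomial.aeval M.lx (parity i • f) (M.d m) = parity i • M.d (Polynomial.aeval M.lx f m) := by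
  rw [aeval_intertwine M.d_lx]
  simp

theorem actB_sgn_d (M : BimCpx) (i : ℤ) (b : B.V) (m : M.V) :
    actB M (parity i • B.sgn b) (M.d m) = parity i • M.d.prodMap M.d (actB M b m) := by
  rw [B_sgn, map_smul, LinearMap.smul_apply, actB_map M.d_lx]

theorem eq_mk {α β : Type*} {x : α × β} {a : α} {b : β} (h₁ : x.1 = a) (h₂ : x.2 = b) :
    x = (a, b) := Prod.ext h₁ h₂

/-! ### `σ` -/

/-- The first component of `σ`. -/
def sigmaP0 : sigma.V →ₗ[ℂ] B.V := LinearMap.fst ℂ B.V unit.V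

/-- The second component of `σ`. -/
def sigmaP1 : sigma.V →ₗ[ℂ] unit.V := LinearMap.snd ℂ B.V unit.V

/-- The first term of `σ`. -/
def sigmaI0 : B.V →ₗ[ℂ] sigma.V := LinearMap.inl ℂ B.V unit.V

/-- The second term of `σ`. -/
def sigmaI1 : unit.V →ₗ[ℂ] sigma.V := LinearMap.inr ℂ B.V unit.V

theorem sigma_eta (l : sigma.V) : sigmaI0 (sigmaP0 l) + sigmaI1 (sigmaP1 l) = l :=
  Prod.fst_add_snd (M := B.V) (N := unit.V) l

theorem sigmaI0_lx (b : B.V) : sigmaI0 (B.lx b) = sigma.lx (sigmaI0 b) :=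
  Prod.ext rfl (map_zero unit.lx).symm

theorem sigmaI0_rx (b : B.V) : sigmaI0 (B.rx b) = sigma.rx (sigmaI0 b) :=
  Prod.ext rfl (map_zero unit.lx).symm

theorem sigmaI1_rx (b : unit.V) : sigmaI1 (unit.rx b) = sigma.rx (sigmaI1 b) :=
  Prod.ext (map_zero B.rx).symm rfl

/-- `σ ⊗ M` in coordinates. -/
def sigmaModel (M : BimCpx) : TensorModel sigma M (sigmaT M) where
  act := LinearMap.mk₂ ℂ
    (fun l m => (actB M (sigmaP0 l) m, Polynomial.aeval M.lx (sigmaP1 l : ℂ[X]) m))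
    (fun _ _ _ => by simp) (fun _ _ _ => by simp) (fun _ _ _ => by simp) (fun _ _ _ => by simp)
  act_bal l m := Prod.ext (actB_rx M _ _) (aeval_X_mul' M _ _)
  act_lx l m := Prod.ext (actB_lx M _ _) (aeval_X_mul M _ _)
  act_rx l m := Prod.ext (actB_map (fun v => (M.lx_rx v).symm) _ _)
    (aeval_intertwine (fun v => (M.lx_rx v).symm) _ _).symm
  act_mem p q l m hl hm := ⟨actB_mem hl.1 hm, aeval_mem' hl.2 hm⟩
  act_d l m := Prod.ext
    (by
      refine (congrArg₂ (· + ·) ((congrArg (actB M · m) rfl).trans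
        (LinearMap.congr_fun (map_zero (actB M)) m))
        ((congrArg (actB M · (M.d m)) (B_sgn (sigmaP0 l))).trans
          (actB_map M.d_lx (sigmaP0 l) m))).trans ?_
      · exact zero_add _)
    (by
      refine (congrArg₂ (· + ·) (aeval_mult M (sigmaP0 l) m) (aeval_d M 1 (sigmaP1 l) m)).trans ?_
      rw [parity_one, neg_one_smul]; rfl)
  inv := LinearMap.coprod (invB M sigmaI0) (tmulL M (sigmaI1 (1 : ℂ[X])))
  inv_act l m := by
    refine (congrArg₂ (· + ·) (invB_actB sigmaI0_lx sigmaI0_rx (sigmaP0 l) m)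
      (tmul_unit (j := sigmaI1) sigmaI1_rx (sigmaP1 l) m)).trans ?_
    rw [← add_tmul', sigma_eta]

theorem sigma_desc_inv (M : BimCpx) (v : (sigmaT M).V) :
    (sigmaModel M).desc ((sigmaModel M).inv v) = v := by
  obtain ⟨⟨b0, b1⟩, n⟩ := v
  change (sigmaModel M).desc (((tmul 1 _ b0 : TensorV 1 sigma M)
    + (tmul 1 _ b1 : TensorV 1 sigma M)) + (tmul 1 _ n : TensorV 1 sigma M)) = _
  rw [map_add, map_add, TensorModel.desc_tmul, TensorModel.desc_tmul, TensorModel.desc_tmul]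
  refine (congrArg₂ (· + ·) (congrArg₂ (· + ·)
    (eq_mk (actB_one M b0) (LinearMap.congr_fun (map_zero (Polynomial.aeval M.lx)) b0))
    (eq_mk (actB_X M b1) (LinearMap.congr_fun (map_zero (Polynomial.aeval M.lx)) b1)))
    (eq_mk (LinearMap.congr_fun (map_zero (actB M)) n)
      (LinearMap.congr_fun (map_one (Polynomial.aeval M.lx)) n))).trans ?_
  simp

theorem sigma_tensor (M : BimCpx) : HEquiv (tensor sigma M) (sigmaT M) :=
  .of_equiv ((sigmaModel M).equiv_chain (sigma_desc_inv M))

/-! ### `σ⁻¹` -/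

/-- The first component of `σ⁻¹`. -/
def sigmaInvP0 : sigmaInv.V →ₗ[ℂ] unit.V := LinearMap.fst ℂ unit.V B.V

/-- The second component of `σ⁻¹`. -/
def sigmaInvP1 : sigmaInv.V →ₗ[ℂ] B.V := LinearMap.snd ℂ unit.V B.V

/-- The first term of `σ⁻¹`. -/
def sigmaInvI0 : unit.V →ₗ[ℂ] sigmaInv.V := LinearMap.inl ℂ unit.V B.V

/-- The second term of `σ⁻¹`. -/
def sigmaInvI1 : B.V →ₗ[ℂ] sigmaInv.V := LinearMap.inr ℂ unit.V B.V

theorem sigmaInv_eta (l : sigmaInv.V) :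
    sigmaInvI0 (sigmaInvP0 l) + sigmaInvI1 (sigmaInvP1 l) = l :=
  Prod.fst_add_snd (M := unit.V) (N := B.V) l

theorem sigmaInvI1_lx (b : B.V) : sigmaInvI1 (B.lx b) = sigmaInv.lx (sigmaInvI1 b) :=
  Prod.ext (map_zero unit.lx).symm rfl

theorem sigmaInvI1_rx (b : B.V) : sigmaInvI1 (B.rx b) = sigmaInv.rx (sigmaInvI1 b) :=
  Prod.ext (map_zero unit.lx).symm rfl

theorem sigmaInvI0_rx (b : unit.V) : sigmaInvI0 (unit.rx b) = sigmaInv.rx (sigmaInvI0 b) :=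
  Prod.ext rfl (map_zero B.rx).symm

/-- `σ⁻¹ ⊗ M` in coordinates. -/
def sigmaInvModel (M : BimCpx) : TensorModel sigmaInv M (sigmaInvT M) where
  act := LinearMap.mk₂ ℂ
    (fun l m => (Polynomial.aeval M.lx (sigmaInvP0 l : ℂ[X]) m, actB M (sigmaInvP1 l) m))
    (fun _ _ _ => by simp) (fun _ _ _ => by simp) (fun _ _ _ => by simp) (fun _ _ _ => by simp)
  act_bal l m := Prod.ext (aeval_X_mul' M _ _) (actB_rx M _ _)
  act_lx l m := Prod.ext (aeval_X_mul M _ _) (actB_lx M _ _)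
  act_rx l m := Prod.ext (aeval_intertwine (fun v => (M.lx_rx v).symm) _ _).symm
    (actB_map (fun v => (M.lx_rx v).symm) _ _)
  act_mem p q l m hl hm := ⟨aeval_mem' hl.1 hm, actB_mem hl.2 hm⟩
  act_d l m := Prod.ext
    (by
      refine (congrArg₂ (· + ·) (LinearMap.congr_fun (map_zero (Polynomial.aeval M.lx)) m)
        (aeval_d M (-1) (sigmaInvP0 l) m)).trans ?_
      rw [parity_neg_one, neg_one_smul]; exact zero_add _)
    (congrArg₂ (· + ·) (actB_comult M (sigmaInvP0 l) m)
      ((congrArg (actB M · (M.d m)) (B_sgn (sigmaInvP1 l))).trans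
        (actB_map M.d_lx (sigmaInvP1 l) m)))
  inv := LinearMap.coprod (tmulL M (sigmaInvI0 (1 : ℂ[X]))) (invB M sigmaInvI1)
  inv_act l m := by
    refine (congrArg₂ (· + ·) (tmul_unit (j := sigmaInvI0) sigmaInvI0_rx (sigmaInvP0 l) m)
      (invB_actB sigmaInvI1_lx sigmaInvI1_rx (sigmaInvP1 l) m)).trans ?_
    rw [← add_tmul', sigmaInv_eta]

theorem sigmaInv_desc_inv (M : BimCpx) (v : (sigmaInvT M).V) :
    (sigmaInvModel M).desc ((sigmaInvModel M).inv v) = v := by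
  obtain ⟨n, b0, b1⟩ := v
  change (sigmaInvModel M).desc ((tmul 1 _ n : TensorV 1 sigmaInv M)
    + ((tmul 1 _ b0 : TensorV 1 sigmaInv M) + (tmul 1 _ b1 : TensorV 1 sigmaInv M))) = _
  rw [map_add, map_add, TensorModel.desc_tmul, TensorModel.desc_tmul, TensorModel.desc_tmul]
  refine (congrArg₂ (· + ·) (eq_mk (LinearMap.congr_fun (map_one (Polynomial.aeval M.lx)) n)
      (LinearMap.congr_fun (map_zero (actB M)) n)) (congrArg₂ (· + ·)
    (eq_mk (LinearMap.congr_fun (map_zero (Polynomial.aeval M.lx)) b0) (actB_one M b0))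
    (eq_mk (LinearMap.congr_fun (map_zero (Polynomial.aeval M.lx)) b1) (actB_X M b1)))).trans ?_
  simp

theorem sigmaInv_tensor (M : BimCpx) : HEquiv (tensor sigmaInv M) (sigmaInvT M) :=
  .of_equiv ((sigmaInvModel M).equiv_chain (sigmaInv_desc_inv M))

/-! ### `FT` -/

/-- The first projection of `FT`. -/
def ftP0 : FT.V →ₗ[ℂ] B.V := LinearMap.fst ℂ B.V (B.V × unit.V)

/-- The second projection of `FT`. -/
def ftP1 : FT.V →ₗ[ℂ] B.V := LinearMap.fst ℂ B.V unit.V ∘ₗ LinearMap.snd ℂ B.V (B.V × unit.V)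

/-- The third projection of `FT`. -/
def ftP2 : FT.V →ₗ[ℂ] unit.V := LinearMap.snd ℂ B.V unit.V ∘ₗ LinearMap.snd ℂ B.V (B.V × unit.V)

/-- The first inclusion into `FT`. -/
def ftI0 : B.V →ₗ[ℂ] FT.V := LinearMap.inl ℂ B.V (B.V × unit.V)

/-- The second inclusion into `FT`. -/
def ftI1 : B.V →ₗ[ℂ] FT.V := LinearMap.inr ℂ B.V (B.V × unit.V) ∘ₗ LinearMap.inl ℂ B.V unit.V

/-- The third inclusion into `FT`. -/
def ftI2 : unit.V →ₗ[ℂ] FT.V := LinearMap.inr ℂ B.V (B.V × unit.V) ∘ₗ LinearMap.inr ℂ B.V unit.V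

theorem ft_eta (l : FT.V) : ftI0 (ftP0 l) + (ftI1 (ftP1 l) + ftI2 (ftP2 l)) = l :=
  Prod.ext (by exact (congrArg (_ + ·) (zero_add _)).trans (add_zero _))
    (Prod.ext (by exact (zero_add _).trans (add_zero _)) (by exact (zero_add _).trans (zero_add _)))

theorem ftI0_lx (b : B.V) : ftI0 (B.lx b) = FT.lx (ftI0 b) :=
  Prod.ext rfl (Prod.ext (map_zero B.lx).symm (map_zero unit.lx).symm)

theorem ftI0_rx (b : B.V) : ftI0 (B.rx b) = FT.rx (ftI0 b) :=
  Prod.ext rfl (Prod.ext (map_zero B.rx).symm (map_zero unit.lx).symm)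

theorem ftI1_lx (b : B.V) : ftI1 (B.lx b) = FT.lx (ftI1 b) :=
  Prod.ext (map_zero B.lx).symm (Prod.ext rfl (map_zero unit.lx).symm)

theorem ftI1_rx (b : B.V) : ftI1 (B.rx b) = FT.rx (ftI1 b) :=
  Prod.ext (map_zero B.rx).symm (Prod.ext rfl (map_zero unit.lx).symm)

theorem ftI2_lx (b : unit.V) : ftI2 (unit.lx b) = FT.lx (ftI2 b) :=
  Prod.ext (map_zero B.lx).symm (Prod.ext (map_zero B.lx).symm rfl)

theorem ftI2_rx (b : unit.V) : ftI2 (unit.rx b) = FT.rx (ftI2 b) :=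
  Prod.ext (map_zero B.rx).symm (Prod.ext (map_zero B.rx).symm rfl)

/-- `FT ⊗ M` in coordinates. -/
def ftModel (M : BimCpx) : TensorModel FT M (ftT M) where
  act := LinearMap.mk₂ ℂ
    (fun l m => (actB M (ftP0 l) m, actB M (ftP1 l) m, Polynomial.aeval M.lx (ftP2 l : ℂ[X]) m))
    (fun _ _ _ => by simp) (fun _ _ _ => by simp) (fun _ _ _ => by simp) (fun _ _ _ => by simp)
  act_bal l m := Prod.ext (actB_rx M _ _) (Prod.ext (actB_rx M _ _) (aeval_X_mul' M _ _))
  act_lx l m := Prod.ext (actB_lx M _ _) (Prod.ext (actB_lx M _ _) (aeval_X_mul M _ _))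
  act_rx l m := Prod.ext (actB_map (fun v => (M.lx_rx v).symm) _ _)
    (Prod.ext (actB_map (fun v => (M.lx_rx v).symm) _ _)
      (aeval_intertwine (fun v => (M.lx_rx v).symm) _ _).symm)
  act_mem p q l m hl hm := ⟨actB_mem' hl.1 hm, actB_mem' hl.2.1 hm, aeval_mem' hl.2.2 hm⟩
  act_d l m := Prod.ext
    (by
      refine (congrArg₂ (· + ·) (LinearMap.congr_fun (map_zero (actB M)) m)
        (actB_sgn_d M 0 (ftP0 l) m)).trans ?_
      rw [parity_zero, one_smul]; exact zero_add _)
    (Prod.ext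
      (by
        refine (congrArg₂ (· + ·) (actB_delta M (ftP0 l) m)
          (actB_sgn_d M 1 (ftP1 l) m)).trans ?_
        rw [parity_one, neg_one_smul]; rfl)
      (by
        refine (congrArg₂ (· + ·) (aeval_mult M (ftP1 l) m) (aeval_d M 2 (ftP2 l) m)).trans ?_
        rw [parity_two, one_smul]; rfl))
  inv := LinearMap.coprod (invB M ftI0)
    (LinearMap.coprod (invB M ftI1) (tmulL M (ftI2 (1 : ℂ[X]))))
  inv_act l m := by
    refine (congrArg₂ (· + ·) (invB_actB ftI0_lx ftI0_rx (ftP0 l) m)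
      (congrArg₂ (· + ·) (invB_actB ftI1_lx ftI1_rx (ftP1 l) m)
        (tmul_unit (j := ftI2) ftI2_rx (ftP2 l) m))).trans ?_
    rw [← add_tmul', ← add_tmul', ft_eta]

theorem ft_desc_inv (M : BimCpx) (v : (ftT M).V) :
    (ftModel M).desc ((ftModel M).inv v) = v := by
  obtain ⟨⟨p0, p1⟩, ⟨q0, q1⟩, r⟩ := v
  change (ftModel M).desc
    (((tmul 1 _ p0 : TensorV 1 FT M) + (tmul 1 _ p1 : TensorV 1 FT M))
      + (((tmul 1 _ q0 : TensorV 1 FT M) + (tmul 1 _ q1 : TensorV 1 FT M)) + (tmul 1 _ r : TensorV 1 FT M)))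
    = _
  simp only [map_add]
  have hz := fun m => LinearMap.congr_fun (map_zero (actB M)) m
  have hz' := fun m => LinearMap.congr_fun (map_zero (Polynomial.aeval (R := ℂ) M.lx)) m
  refine (congrArg₂ (· + ·) (congrArg₂ (· + ·)
      (eq_mk (actB_one M p0) (eq_mk (hz p0) (hz' p0)))
      (eq_mk (actB_X M p1) (eq_mk (hz p1) (hz' p1)))) (congrArg₂ (· + ·) (congrArg₂ (· + ·)
      (eq_mk (hz q0) (eq_mk (actB_one M q0) (hz' q0)))
      (eq_mk (hz q1) (eq_mk (actB_X M q1) (hz' q1))))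
    (eq_mk (hz r) (eq_mk (hz r)
      (LinearMap.congr_fun (map_one (Polynomial.aeval M.lx)) r))))).trans ?_
  simp

theorem ft_tensor (M : BimCpx) : HEquiv (tensor FT M) (ftT M) :=
  .of_equiv ((ftModel M).equiv_chain (ft_desc_inv M))

/-! ### `FT⁻¹` -/

/-- The first projection of `FT⁻¹`. -/
def ftInvP0 : FTinv.V →ₗ[ℂ] unit.V := LinearMap.fst ℂ unit.V (B.V × B.V)

/-- The second projection of `FT⁻¹`. -/
def ftInvP1 : FTinv.V →ₗ[ℂ] B.V := LinearMap.fst ℂ B.V B.V ∘ₗ LinearMap.snd ℂ unit.V (B.V × B.V)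

/-- The third projection of `FT⁻¹`. -/
def ftInvP2 : FTinv.V →ₗ[ℂ] B.V := LinearMap.snd ℂ B.V B.V ∘ₗ LinearMap.snd ℂ unit.V (B.V × B.V)

/-- The first inclusion into `FT⁻¹`. -/
def ftInvI0 : unit.V →ₗ[ℂ] FTinv.V := LinearMap.inl ℂ unit.V (B.V × B.V)

/-- The second inclusion into `FT⁻¹`. -/
def ftInvI1 : B.V →ₗ[ℂ] FTinv.V := LinearMap.inr ℂ unit.V (B.V × B.V) ∘ₗ LinearMap.inl ℂ B.V B.V

/-- The third inclusion into `FT⁻¹`. -/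
def ftInvI2 : B.V →ₗ[ℂ] FTinv.V := LinearMap.inr ℂ unit.V (B.V × B.V) ∘ₗ LinearMap.inr ℂ B.V B.V

theorem ftInv_eta (l : FTinv.V) :
    ftInvI0 (ftInvP0 l) + (ftInvI1 (ftInvP1 l) + ftInvI2 (ftInvP2 l)) = l :=
  Prod.ext (by exact (congrArg (_ + ·) (zero_add _)).trans (add_zero _))
    (Prod.ext (by exact (zero_add _).trans (add_zero _)) (by exact (zero_add _).trans (zero_add _)))

theorem ftInvI0_rx (b : unit.V) : ftInvI0 (unit.rx b) = FTinv.rx (ftInvI0 b) :=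
  Prod.ext rfl (Prod.ext (map_zero B.rx).symm (map_zero B.rx).symm)

theorem ftInvI1_lx (b : B.V) : ftInvI1 (B.lx b) = FTinv.lx (ftInvI1 b) :=
  Prod.ext (map_zero unit.lx).symm (Prod.ext rfl (map_zero B.lx).symm)

theorem ftInvI1_rx (b : B.V) : ftInvI1 (B.rx b) = FTinv.rx (ftInvI1 b) :=
  Prod.ext (map_zero unit.lx).symm (Prod.ext rfl (map_zero B.rx).symm)

theorem ftInvI2_lx (b : B.V) : ftInvI2 (B.lx b) = FTinv.lx (ftInvI2 b) :=
  Prod.ext (map_zero unit.lx).symm (Prod.ext (map_zero B.lx).symm rfl)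

theorem ftInvI2_rx (b : B.V) : ftInvI2 (B.rx b) = FTinv.rx (ftInvI2 b) :=
  Prod.ext (map_zero unit.lx).symm (Prod.ext (map_zero B.rx).symm rfl)

/-- `FT⁻¹ ⊗ M` in coordinates. -/
def ftInvModel (M : BimCpx) : TensorModel FTinv M (ftInvT M) where
  act := LinearMap.mk₂ ℂ (fun l m =>
      (Polynomial.aeval M.lx (ftInvP0 l : ℂ[X]) m, actB M (ftInvP1 l) m, actB M (ftInvP2 l) m))
    (fun _ _ _ => by simp) (fun _ _ _ => by simp) (fun _ _ _ => by simp) (fun _ _ _ => by simp)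
  act_bal l m := Prod.ext (aeval_X_mul' M _ _) (Prod.ext (actB_rx M _ _) (actB_rx M _ _))
  act_lx l m := Prod.ext (aeval_X_mul M _ _) (Prod.ext (actB_lx M _ _) (actB_lx M _ _))
  act_rx l m := Prod.ext (aeval_intertwine (fun v => (M.lx_rx v).symm) _ _).symm
    (Prod.ext (actB_map (fun v => (M.lx_rx v).symm) _ _)
      (actB_map (fun v => (M.lx_rx v).symm) _ _))
  act_mem p q l m hl hm := ⟨aeval_mem' hl.1 hm, actB_mem' hl.2.1 hm, actB_mem' hl.2.2 hm⟩
  act_d l m := Prod.ext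
    (by
      refine (congrArg₂ (· + ·) (LinearMap.congr_fun (map_zero (Polynomial.aeval M.lx)) m)
        (aeval_d M (-2) (ftInvP0 l) m)).trans ?_
      rw [parity_neg_two, one_smul]; exact zero_add _)
    (Prod.ext
      (by
        refine (congrArg₂ (· + ·) (actB_comult M (ftInvP0 l) m)
          (actB_sgn_d M (-1) (ftInvP1 l) m)).trans ?_
        rw [parity_neg_one, neg_one_smul]; rfl)
      (by
        refine (congrArg₂ (· + ·) (actB_delta M (ftInvP1 l) m)
          (actB_sgn_d M 0 (ftInvP2 l) m)).trans ?_
        rw [parity_zero, one_smul]; rfl))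
  inv := LinearMap.coprod (tmulL M (ftInvI0 (1 : ℂ[X])))
    (LinearMap.coprod (invB M ftInvI1) (invB M ftInvI2))
  inv_act l m := by
    refine (congrArg₂ (· + ·) (tmul_unit (j := ftInvI0) ftInvI0_rx (ftInvP0 l) m)
      (congrArg₂ (· + ·) (invB_actB ftInvI1_lx ftInvI1_rx (ftInvP1 l) m)
        (invB_actB ftInvI2_lx ftInvI2_rx (ftInvP2 l) m))).trans ?_
    rw [← add_tmul', ← add_tmul', ftInv_eta]

theorem ftInv_desc_inv (M : BimCpx) (v : (ftInvT M).V) :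
    (ftInvModel M).desc ((ftInvModel M).inv v) = v := by
  obtain ⟨r, ⟨p0, p1⟩, ⟨q0, q1⟩⟩ := v
  change (ftInvModel M).desc
    ((tmul 1 _ r : TensorV 1 FTinv M) +
    (((tmul 1 _ p0 : TensorV 1 FTinv M) + (tmul 1 _ p1 : TensorV 1 FTinv M)) +
      ((tmul 1 _ q0 : TensorV 1 FTinv M) + (tmul 1 _ q1 : TensorV 1 FTinv M)))) = _
  simp only [map_add]
  have hz := fun m => LinearMap.congr_fun (map_zero (actB M)) m
  have hz' := fun m => LinearMap.congr_fun (map_zero (Polynomial.aeval (R := ℂ) M.lx)) m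
  refine (congrArg₂ (· + ·) (eq_mk (LinearMap.congr_fun (map_one (Polynomial.aeval M.lx)) r)
      (eq_mk (hz r) (hz r))) (congrArg₂ (· + ·) (congrArg₂ (· + ·)
      (eq_mk (hz' p0) (eq_mk (actB_one M p0) (hz p0)))
      (eq_mk (hz' p1) (eq_mk (actB_X M p1) (hz p1)))) (congrArg₂ (· + ·)
      (eq_mk (hz' q0) (eq_mk (hz q0) (actB_one M q0)))
      (eq_mk (hz' q1) (eq_mk (hz q1) (actB_X M q1)))))).trans ?_
  simp

/-- The isomorphism from `FT⁻¹ ⊗ M` to its coordinates. -/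
def ftInvEquiv (M : BimCpx) : (tensor FTinv M).V ≃ₗ[ℂ] (ftInvT M).V :=
  (ftInvModel M).equiv (ftInv_desc_inv M)

theorem ftInvEquiv_chain (M : BimCpx) :
    IsChainMap (tensor FTinv M) (ftInvT M) (ftInvEquiv M).toLinearMap :=
  (ftInvModel M).equiv_chain (ftInv_desc_inv M)

theorem ftInv_tensor (M : BimCpx) : HEquiv (tensor FTinv M) (ftInvT M) :=
  .of_equiv (ftInvEquiv_chain M)

/-! ### The right unit -/

theorem tensor_unit (L : BimCpx) : HEquiv (tensor L unit) L := by
  let A : TensorModel L unit L :=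
    { act := LinearMap.mk₂ ℂ (fun l f => Polynomial.aeval L.rx (f : ℂ[X]) l)
        (fun _ _ _ => by simp) (fun _ _ _ => by simp) (fun _ _ _ => by simp) (fun _ _ _ => by simp)
      act_bal := fun l f => by
        change Polynomial.aeval L.rx f (L.rx l) = Polynomial.aeval L.rx (Polynomial.X * f : ℂ[X]) l
        rw [mul_comm]; simp
      act_lx := fun l f => (aeval_intertwine L.lx_rx f l).symm
      act_rx := fun l f => by
        change Polynomial.aeval L.rx (Polynomial.X * f : ℂ[X]) l = L.rx (Polynomial.aeval L.rx f l)
        simp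
      act_mem := fun p q l f hl hf => by
        change Polynomial.aeval L.rx f l ∈ L.gr (p + q)
        rw [Polynomial.aeval_eq_sum_range, LinearMap.sum_apply]
        refine Submodule.sum_mem _ fun n _ => ?_
        by_cases h : f.coeff n = 0
        · simp [h]
        · rw [hf n h, LinearMap.smul_apply]
          refine Submodule.smul_mem _ _ ?_
          have := pow_mem L.rx_mem n hl
          rwa [show p + n • ((0, 2) : ℤ × ℤ) = p + (0, 2 * (n : ℤ)) by
            ext <;> simp; ring] at this
      act_d := fun l f => by
        change Polynomial.aeval L.rx f (L.d l) + Polynomial.aeval L.rx (0 : ℂ[X]) (L.sgn l)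
          = L.d (Polynomial.aeval L.rx f l)
        rw [aeval_intertwine L.d_rx]; simp
      inv := Submodule.mkQ _ ∘ₗ (TensorProduct.mk ℂ L.V ℂ[X]).flip 1
      inv_act := fun l f => by
        change (tmul 1 (Polynomial.aeval L.rx f l) (1 : ℂ[X]) : TensorV 1 L unit) = tmul 1 l f
        rw [← tmul_aeval, aeval_mulLeft, mul_one] }
  exact .of_equiv (A.equiv_chain fun v => by
    change Polynomial.aeval L.rx (1 : ℂ[X]) v = v
    simp)

/-! ### Transport along equalities of degrees -/

theorem gr_cast {M : BimCpx} {a b : ℤ × ℤ} {v : M.V} (hv : v ∈ M.gr a) (h : a = b) :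
    v ∈ M.gr b := h ▸ hv

theorem IsBimodMap.map_gr' {M N : BimCpx} {p k a : ℤ × ℤ} {f : M.V →ₗ[ℂ] N.V}
    (hf : IsBimodMap M N p f) {v : M.V} (hv : v ∈ M.gr (a - k)) : f v ∈ N.gr (a + p - k) :=
  gr_cast (hf.map_gr _ _ hv) (by abel)

/-- Pairs of elements. -/
abbrev V2 (V : Type) : Type := V × V

/-- Triples of elements. -/
abbrev V3 (V : Type) : Type := V × V × V

/-! ### Functoriality -/

theorem btMap_bimod {M N : BimCpx} {p : ℤ × ℤ} {f : M.V →ₗ[ℂ] N.V} (hf : IsBimodMap M N p f) :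
    IsBimodMap (BT M) (BT N) p (f.prodMap f) where
  map_lx v := by simp [btLx_apply, hf.map_lx]
  map_rx v := by simp [hf.map_rx]
  map_gr _ _ hv := ⟨hf.map_gr' hv.1, hf.map_gr' hv.2⟩

/-- The map `σ ⊗ f`, with a scalar on the second term. -/
def sigmaTMap {M N : BimCpx} (c : ℂ) (f : M.V →ₗ[ℂ] N.V) :
    (sigmaT M).V →ₗ[ℂ] (sigmaT N).V := (f.prodMap f).prodMap (c • f)

theorem sigmaTMap_bimod {M N : BimCpx} {p : ℤ × ℤ} {f : M.V →ₗ[ℂ] N.V} (c : ℂ)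
    (hf : IsBimodMap M N p f) : IsBimodMap (sigmaT M) (sigmaT N) p (sigmaTMap c f) where
  map_lx v := Prod.ext ((btMap_bimod hf).map_lx v.1) ((hf.smul c).map_lx v.2)
  map_rx v := Prod.ext ((btMap_bimod hf).map_rx v.1) ((hf.smul c).map_rx v.2)
  map_gr _ _ hv := ⟨(btMap_bimod hf).map_gr _ _ hv.1, (hf.smul c).map_gr' hv.2⟩

theorem sigmaT_hequiv {M N : BimCpx} (h : HEquiv M N) : HEquiv (sigmaT M) (sigmaT N) := by
  have hc : ∀ {M N : BimCpx} {f : M.V →ₗ[ℂ] N.V}, IsChainMap M N f →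
      IsChainMap (sigmaT M) (sigmaT N) (sigmaTMap 1 f) := fun hf =>
    .of (sigmaTMap_bimod 1 hf.toIsBimodMap) fun v => by
      rw [sigmaT_d, sigmaT_d]
      simp [sigmaTMap, hf.map_d, hf.map_lx]
  have hh : ∀ {M N : BimCpx} {f g : M.V →ₗ[ℂ] N.V}, Homotopic M N f g →
      Homotopic (sigmaT M) (sigmaT N) (sigmaTMap 1 f) (sigmaTMap 1 g) := by
    rintro M N f g ⟨s, hs, e⟩
    -- A homotopy has odd degree, so it picks up a sign on the odd term of `σ`.
    refine ⟨sigmaTMap (-1) s, sigmaTMap_bimod _ hs, ?_⟩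
    have e' : ∀ v, f v - g v = N.d (s v) + s (M.d v) := LinearMap.congr_fun e
    apply LinearMap.ext; intro v
    rw [LinearMap.sub_apply, LinearMap.add_apply, LinearMap.comp_apply, LinearMap.comp_apply,
      sigmaT_d, sigmaT_d]
    ext <;> simp [sigmaTMap, e', hs.map_lx] <;> abel
  obtain ⟨f, cf, g, cg, h1, h2⟩ := h
  refine ⟨_, hc cf, _, hc cg, ?_, ?_⟩
  · exact (Homotopic.of_eq (by ext <;> simp [sigmaTMap])).trans
      ((hh h1).trans (.of_eq (by ext <;> simp [sigmaTMap])))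
  · exact (Homotopic.of_eq (by ext <;> simp [sigmaTMap])).trans
      ((hh h2).trans (.of_eq (by ext <;> simp [sigmaTMap])))

/-- The map `σ⁻¹ ⊗ f`, with a scalar on the first term. -/
def sigmaInvTMap {M N : BimCpx} (c : ℂ) (f : M.V →ₗ[ℂ] N.V) :
    (sigmaInvT M).V →ₗ[ℂ] (sigmaInvT N).V := (c • f).prodMap (f.prodMap f)

theorem sigmaInvTMap_bimod {M N : BimCpx} {p : ℤ × ℤ} {f : M.V →ₗ[ℂ] N.V} (c : ℂ)
    (hf : IsBimodMap M N p f) : IsBimodMap (sigmaInvT M) (sigmaInvT N) p (sigmaInvTMap c f) where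
  map_lx v := Prod.ext ((hf.smul c).map_lx v.1) ((btMap_bimod hf).map_lx v.2)
  map_rx v := Prod.ext ((hf.smul c).map_rx v.1) ((btMap_bimod hf).map_rx v.2)
  map_gr _ _ hv := ⟨(hf.smul c).map_gr' hv.1, (btMap_bimod hf).map_gr _ _ hv.2⟩

theorem sigmaInvT_hequiv {M N : BimCpx} (h : HEquiv M N) :
    HEquiv (sigmaInvT M) (sigmaInvT N) := by
  have hc : ∀ {M N : BimCpx} {f : M.V →ₗ[ℂ] N.V}, IsChainMap M N f →
      IsChainMap (sigmaInvT M) (sigmaInvT N) (sigmaInvTMap 1 f) := fun hf =>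
    .of (sigmaInvTMap_bimod 1 hf.toIsBimodMap) fun v => by
      rw [sigmaInvT_d, sigmaInvT_d]
      simp [sigmaInvTMap, hf.map_d, hf.map_lx]
  have hh : ∀ {M N : BimCpx} {f g : M.V →ₗ[ℂ] N.V}, Homotopic M N f g →
      Homotopic (sigmaInvT M) (sigmaInvT N) (sigmaInvTMap 1 f) (sigmaInvTMap 1 g) := by
    rintro M N f g ⟨s, hs, e⟩
    refine ⟨sigmaInvTMap (-1) s, sigmaInvTMap_bimod _ hs, ?_⟩
    have e' : ∀ v, f v - g v = N.d (s v) + s (M.d v) := LinearMap.congr_fun e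
    apply LinearMap.ext; intro v
    rw [LinearMap.sub_apply, LinearMap.add_apply, LinearMap.comp_apply, LinearMap.comp_apply,
      sigmaInvT_d, sigmaInvT_d]
    ext <;> simp [sigmaInvTMap, e', hs.map_lx] <;> abel
  obtain ⟨f, cf, g, cg, h1, h2⟩ := h
  refine ⟨_, hc cf, _, hc cg, ?_, ?_⟩
  · exact (Homotopic.of_eq (by ext <;> simp [sigmaInvTMap])).trans
      ((hh h1).trans (.of_eq (by ext <;> simp [sigmaInvTMap])))
  · exact (Homotopic.of_eq (by ext <;> simp [sigmaInvTMap])).trans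
      ((hh h2).trans (.of_eq (by ext <;> simp [sigmaInvTMap])))

/-! ### `σ ⊗ σ⁻¹ ≃ 1` -/

/-- Gaussian elimination in `B N → B B N ⊕ N → B N`. Since `B B` is the sum of two shifted copies of
`B`, one copy cancels the term on the left and the other the term on the right, and `N` remains. The
map `H` inverts the cancelled identity components; `F` and `G` are the inclusion and projection of
`N` with the corrections that the elimination produces. -/
theorem sigmaT_sigmaInvT (N : BimCpx) : HEquiv (sigmaT (sigmaInvT N)) N := by
  let lx : V2 (V3 N.V) × V3 N.V → V2 (V3 N.V) × V3 N.V := fun v =>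
    (((N.lx (N.lx v.1.2.1), (N.lx (N.lx v.1.2.2.1), N.lx (N.lx v.1.2.2.2))), v.1.1),
      (N.lx v.2.1, (N.lx (N.lx v.2.2.2), v.2.2.1)))
  let rx : V2 (V3 N.V) × V3 N.V → V2 (V3 N.V) × V3 N.V := fun v =>
    (((N.rx v.1.1.1, (N.rx v.1.1.2.1, N.rx v.1.1.2.2)),
      (N.rx v.1.2.1, (N.rx v.1.2.2.1, N.rx v.1.2.2.2))),
      (N.rx v.2.1, (N.rx v.2.2.1, N.rx v.2.2.2)))
  let d : V2 (V3 N.V) × V3 N.V → V2 (V3 N.V) × V3 N.V := fun v =>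
    (((-N.d v.1.1.1, N.lx v.1.1.1 + N.d v.1.1.2.1, v.1.1.1 + N.d v.1.1.2.2),
      (-N.d v.1.2.1, N.lx v.1.2.1 + N.d v.1.2.2.1, v.1.2.1 + N.d v.1.2.2.2)),
      (v.1.1.1 + N.lx v.1.2.1 + - -N.d v.2.1,
        v.1.1.2.1 + N.lx (N.lx v.1.2.2.2) + -(N.lx v.2.1 + N.d v.2.2.1),
        v.1.1.2.2 + v.1.2.2.1 + -(v.2.1 + N.d v.2.2.2)))
  have hlx : ∀ v : V2 (V3 N.V) × V3 N.V, (sigmaT (sigmaInvT N)).lx v = lx v := fun v => rfl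
  have hrx : ∀ v : V2 (V3 N.V) × V3 N.V, (sigmaT (sigmaInvT N)).rx v = rx v := fun v => rfl
  have hd : ∀ v : V2 (V3 N.V) × V3 N.V, (sigmaT (sigmaInvT N)).d v = d v := fun v => rfl
  let G : V2 (V3 N.V) × V3 N.V →ₗ[ℂ] N.V :=
    { toFun := fun v => v.2.1 - v.1.1.2.2 - N.lx v.1.2.2.2
      map_add' := fun v w => by simp; abel
      map_smul' := fun c v => by simp [smul_sub] }
  let F : N.V →ₗ[ℂ] V2 (V3 N.V) × V3 N.V :=
    { toFun := fun v => (((0, (N.lx v, 0)), (0, (v, 0))), (v, (0, 0)))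
      map_add' := fun v w => by simp
      map_smul' := fun c v => by simp }
  let H : V2 (V3 N.V) × V3 N.V →ₗ[ℂ] V2 (V3 N.V) × V3 N.V :=
    { toFun := fun v => (((v.1.1.2.2, (v.2.2.1, 0)), (v.1.2.2.2, (v.2.2.2, 0))), (0, (0, 0)))
      map_add' := fun v w => by simp
      map_smul' := fun c v => by simp }
  have hG : IsChainMap (sigmaT (sigmaInvT N)) N G := by
    refine .of ⟨fun v => ?_, fun v => ?_, fun p v hv => ?_⟩ fun v => ?_
    · rw [hlx]; simp [G, lx]; abel
    · rw [hrx]; simp [G, rx, N.lx_rx]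
    · refine Submodule.sub_mem _ (Submodule.sub_mem _ ?_ ?_) ?_
      · exact gr_cast (M := N) hv.2.1 (by ext <;> simp)
      · exact gr_cast (M := N) hv.1.1.2.2 (by ext <;> simp)
      · exact gr_cast (M := N) (N.lx_mem _ _ hv.1.2.2.2) (by ext <;> simp <;> omega)
    · rw [hd]; simp [G, d, N.d_lx]; abel
  have hF : IsChainMap N (sigmaT (sigmaInvT N)) F := by
    refine .of ⟨fun v => ?_, fun v => ?_, fun p v hv => ?_⟩ fun v => ?_
    · rw [hlx]; simp [F, lx]
    · rw [hrx]; simp [F, rx, N.lx_rx]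
    · refine ⟨⟨⟨Submodule.zero_mem _, ?_, Submodule.zero_mem _⟩, ⟨Submodule.zero_mem _, ?_,
        Submodule.zero_mem _⟩⟩, ⟨?_, Submodule.zero_mem _, Submodule.zero_mem _⟩⟩
      · exact gr_cast (M := N) (N.lx_mem _ _ hv) (by ext <;> simp <;> omega)
      · exact gr_cast (M := N) hv (by ext <;> simp)
      · exact gr_cast (M := N) hv (by ext <;> simp)
    · rw [hd]; simp [F, d, N.d_lx]
  refine ⟨G, hG, F, hF, ?_, .of_eq (by ext; simp [F, G])⟩
  refine ⟨-H, IsBimodMap.neg ⟨fun v => ?_, fun v => ?_, fun p v hv => ?_⟩, ?_⟩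
  · rw [hlx, hlx]; simp [H, lx]
  · rw [hrx, hrx]; simp [H, rx]
  · refine ⟨⟨⟨?_, ?_, Submodule.zero_mem _⟩, ⟨?_, ?_,
        Submodule.zero_mem _⟩⟩, ⟨Submodule.zero_mem _, Submodule.zero_mem _, Submodule.zero_mem _⟩⟩
    · exact gr_cast (M := N) hv.1.1.2.2 (by ext <;> simp)
    · exact gr_cast (M := N) hv.2.2.1 (by ext <;> simp <;> omega)
    · exact gr_cast (M := N) hv.1.2.2.2 (by ext <;> simp)
    · exact gr_cast (M := N) hv.2.2.2 (by ext <;> simp <;> omega)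
  · apply LinearMap.ext; intro v
    change F (G v) - v = (sigmaT (sigmaInvT N)).d (-H v) + -H ((sigmaT (sigmaInvT N)).d v)
    rw [hd, hd]
    ext <;> simp [F, G, H, d, N.d_lx] <;> abel

/-! ### `FT ≃ σ ⊗ σ` -/

-- In `B B N → B N ⊕ B N → N` one of the two copies of `B` inside `B B` cancels one of the middle
-- terms. What remains is a chain `B N → B N → N`, whose first map is `delta` up to a scalar.
set_option maxHeartbeats 2000000 in
theorem ftT_sigmaT_sigmaT (N : BimCpx) : HEquiv (ftT N) (sigmaT (sigmaT N)) := by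
  let lx : V2 (V2 N.V × N.V) × (V2 N.V × N.V) → V2 (V2 N.V × N.V) × (V2 N.V × N.V) := fun v =>
    ((((N.lx (N.lx v.1.2.1.1), N.lx (N.lx v.1.2.1.2)), N.lx (N.lx v.1.2.2)), v.1.1),
      ((N.lx (N.lx v.2.1.2), v.2.1.1), N.lx v.2.2))
  let rx : V2 (V2 N.V × N.V) × (V2 N.V × N.V) → V2 (V2 N.V × N.V) × (V2 N.V × N.V) := fun v =>
    ((((N.rx v.1.1.1.1, N.rx v.1.1.1.2), N.rx v.1.1.2),
      ((N.rx v.1.2.1.1, N.rx v.1.2.1.2), N.rx v.1.2.2)), ((N.rx v.2.1.1, N.rx v.2.1.2), N.rx v.2.2))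
  let d : V2 (V2 N.V × N.V) × (V2 N.V × N.V) → V2 (V2 N.V × N.V) × (V2 N.V × N.V) := fun v =>
    ((((N.d v.1.1.1.1, N.d v.1.1.1.2), v.1.1.1.1 + N.lx v.1.1.1.2 + -N.d v.1.1.2),
      ((N.d v.1.2.1.1, N.d v.1.2.1.2), v.1.2.1.1 + N.lx v.1.2.1.2 + -N.d v.1.2.2)),
      ((v.1.1.1.1 + N.lx (N.lx v.1.2.1.2) + -N.d v.2.1.1, v.1.1.1.2 + v.1.2.1.1 + -N.d v.2.1.2),
        v.1.1.2 + N.lx v.1.2.2 + -(v.2.1.1 + N.lx v.2.1.2 + -N.d v.2.2)))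
  let lx' : V2 N.V × V2 N.V × N.V → V2 N.V × V2 N.V × N.V := fun v =>
    ((N.lx (N.lx v.1.2), v.1.1), (N.lx (N.lx v.2.1.2), v.2.1.1), N.lx v.2.2)
  let rx' : V2 N.V × V2 N.V × N.V → V2 N.V × V2 N.V × N.V := fun v =>
    ((N.rx v.1.1, N.rx v.1.2), (N.rx v.2.1.1, N.rx v.2.1.2), N.rx v.2.2)
  let d' : V2 N.V × V2 N.V × N.V → V2 N.V × V2 N.V × N.V := fun v =>
    ((N.d v.1.1, N.d v.1.2),
      ((1 / 2 : ℂ) • (N.lx (N.lx v.1.2) - N.lx v.1.1) + -N.d v.2.1.1,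
        (1 / 2 : ℂ) • (v.1.1 - N.lx v.1.2) + -N.d v.2.1.2),
      v.2.1.1 + N.lx v.2.1.2 + N.d v.2.2)
  have hlx : ∀ v : V2 (V2 N.V × N.V) × (V2 N.V × N.V),
      (sigmaT (sigmaT N)).lx v = lx v := fun v => rfl
  have hrx : ∀ v : V2 (V2 N.V × N.V) × (V2 N.V × N.V),
      (sigmaT (sigmaT N)).rx v = rx v := fun v => rfl
  have hd : ∀ v : V2 (V2 N.V × N.V) × (V2 N.V × N.V), (sigmaT (sigmaT N)).d v = d v := fun v => rfl
  have hlx' : ∀ v : V2 N.V × V2 N.V × N.V, (ftT N).lx v = lx' v := fun v => rfl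
  have hrx' : ∀ v : V2 N.V × V2 N.V × N.V, (ftT N).rx v = rx' v := fun v => rfl
  have hd' : ∀ v : V2 N.V × V2 N.V × N.V, (ftT N).d v = d' v := fun v => rfl
  -- The first term is embedded into `B B N` as the kernel of the map onto the cancelled copy of `B
  -- N`. The scalars `2` here and `1/2` in `G` compensate the factor `1/2` in `delta`.
  let F : V2 N.V × V2 N.V × N.V →ₗ[ℂ] V2 (V2 N.V × N.V) × (V2 N.V × N.V) :=
    { toFun := fun v => ((((N.lx (N.lx v.1.2), -v.1.1), (2 : ℂ) • v.2.1.1),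
        ((v.1.1, -v.1.2), (2 : ℂ) • v.2.1.2)), ((0, 0), (2 : ℂ) • v.2.2))
      map_add' := fun v w => by ext <;> simp <;> abel
      map_smul' := fun c v => by ext <;> simp <;> module }
  let G : V2 (V2 N.V × N.V) × (V2 N.V × N.V) →ₗ[ℂ] V2 N.V × V2 N.V × N.V :=
    { toFun := fun v => ((-v.1.1.1.2, -v.1.2.1.2), ((1 / 2 : ℂ) • (v.1.1.2 - v.2.1.1),
        (1 / 2 : ℂ) • (v.1.2.2 - v.2.1.2)), (1 / 2 : ℂ) • v.2.2)
      map_add' := fun v w => by ext <;> simp <;> module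
      map_smul' := fun c v => by ext <;> simp <;> module }
  let H : V2 (V2 N.V × N.V) × (V2 N.V × N.V) →ₗ[ℂ] V2 (V2 N.V × N.V) × (V2 N.V × N.V) :=
    { toFun := fun v => ((((v.2.1.1, 0), 0), ((v.2.1.2, 0), 0)), ((0, 0), 0))
      map_add' := fun v w => by simp
      map_smul' := fun c v => by simp }
  have hG : IsChainMap (sigmaT (sigmaT N)) (ftT N) G := by
    refine .of ⟨fun v => ?_, fun v => ?_, fun p v hv => ?_⟩ fun v => ?_
    · rw [hlx, hlx']; ext <;> simp [G, lx, lx']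
    · rw [hrx, hrx']; ext <;> simp [G, rx, rx']
    · refine ⟨⟨Submodule.neg_mem _ ?_, Submodule.neg_mem _ ?_⟩,
        ⟨Submodule.smul_mem _ _ (Submodule.sub_mem _ ?_ ?_),
          Submodule.smul_mem _ _ (Submodule.sub_mem _ ?_ ?_)⟩, Submodule.smul_mem _ _ ?_⟩
      · exact gr_cast (M := N) hv.1.1.1.2 (by ext <;> simp)
      · exact gr_cast (M := N) hv.1.2.1.2 (by ext <;> simp)
      · exact gr_cast (M := N) hv.1.1.2 (by ext <;> simp)
      · exact gr_cast (M := N) hv.2.1.1 (by ext <;> simp)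
      · exact gr_cast (M := N) hv.1.2.2 (by ext <;> simp)
      · exact gr_cast (M := N) hv.2.1.2 (by ext <;> simp)
      · exact gr_cast (M := N) hv.2.2 (by ext <;> simp <;> omega)
    · rw [hd, hd']
      ext <;> simp [G, d, d'] <;> module
  have hF : IsChainMap (ftT N) (sigmaT (sigmaT N)) F := by
    refine .of ⟨fun v => ?_, fun v => ?_, fun p v hv => ?_⟩ fun v => ?_
    · rw [hlx, hlx']; ext <;> simp [F, lx, lx']
    · rw [hrx, hrx']; ext <;> simp [F, rx, rx', N.lx_rx]
    · refine ⟨⟨⟨⟨?_, Submodule.neg_mem _ ?_⟩, Submodule.smul_mem _ _ ?_⟩,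
        ⟨⟨?_, Submodule.neg_mem _ ?_⟩, Submodule.smul_mem _ _ ?_⟩⟩,
        ⟨Submodule.zero_mem _, Submodule.zero_mem _⟩, Submodule.smul_mem _ _ ?_⟩
      · exact gr_cast (M := N) (N.lx_mem _ _ (N.lx_mem _ _ hv.1.2)) (by ext <;> simp <;> omega)
      · exact gr_cast (M := N) hv.1.1 (by ext <;> simp)
      · exact gr_cast (M := N) hv.2.1.1 (by ext <;> simp)
      · exact gr_cast (M := N) hv.1.1 (by ext <;> simp)
      · exact gr_cast (M := N) hv.1.2 (by ext <;> simp)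
      · exact gr_cast (M := N) hv.2.1.2 (by ext <;> simp)
      · exact gr_cast (M := N) hv.2.2 (by ext <;> simp <;> omega)
    · rw [hd, hd']
      ext <;> simp [F, d, d', N.d_lx] <;> module
  refine ⟨F, hF, G, hG, .of_eq (by ext <;> simp [F, G]), ?_⟩
  refine ⟨-H, IsBimodMap.neg ⟨fun v => ?_, fun v => ?_, fun p v hv => ?_⟩, ?_⟩
  · rw [hlx, hlx]; simp [H, lx]
  · rw [hrx, hrx]; simp [H, rx]
  · refine ⟨⟨⟨⟨?_, Submodule.zero_mem _⟩, Submodule.zero_mem _⟩, ⟨⟨?_, Submodule.zero_mem _⟩,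
        Submodule.zero_mem _⟩⟩, ⟨Submodule.zero_mem _, Submodule.zero_mem _⟩, Submodule.zero_mem _⟩
    · exact gr_cast (M := N) hv.2.1.1 (by ext <;> simp <;> omega)
    · exact gr_cast (M := N) hv.2.1.2 (by ext <;> simp <;> omega)
  · apply LinearMap.ext; intro v
    change F (G v) - v = (sigmaT (sigmaT N)).d (-H v) + -H ((sigmaT (sigmaT N)).d v)
    rw [hd, hd]
    ext <;> simp [F, G, H, d] <;> module

/-! ### `FT⁻¹ ≃ σ⁻¹ ⊗ σ⁻¹` -/

-- The dual elimination, in `N → B N ⊕ B N → B B N`: the middle term that comes from the first term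
-- of the left factor `σ⁻¹` cancels against a summand of `B B N`, and `H` inverts the cancelled
-- components.
set_option maxHeartbeats 2000000 in
theorem ftInvT_sigmaInvT_sigmaInvT (N : BimCpx) :
    HEquiv (ftInvT N) (sigmaInvT (sigmaInvT N)) := by
  let lx : (V3 N.V) × V2 (V3 N.V) → (V3 N.V) × V2 (V3 N.V) := fun v =>
    ((N.lx v.1.1, (N.lx (N.lx v.1.2.2), v.1.2.1)),
      ((N.lx (N.lx v.2.2.1), (N.lx (N.lx v.2.2.2.1), N.lx (N.lx v.2.2.2.2))), v.2.1))
  let rx : (V3 N.V) × V2 (V3 N.V) → (V3 N.V) × V2 (V3 N.V) := fun v =>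
    ((N.rx v.1.1, (N.rx v.1.2.1, N.rx v.1.2.2)),
      ((N.rx v.2.1.1, (N.rx v.2.1.2.1, N.rx v.2.1.2.2)),
        (N.rx v.2.2.1, (N.rx v.2.2.2.1, N.rx v.2.2.2.2))))
  let d : (V3 N.V) × V2 (V3 N.V) → (V3 N.V) × V2 (V3 N.V) := fun v =>
    ((- -N.d v.1.1, (-(N.lx v.1.1 + N.d v.1.2.1), -(v.1.1 + N.d v.1.2.2))),
      ((N.lx v.1.1 + -N.d v.2.1.1, (N.lx (N.lx v.1.2.2) + (N.lx v.2.1.1 + N.d v.2.1.2.1),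
          v.1.2.1 + (v.2.1.1 + N.d v.2.1.2.2))),
        (v.1.1 + -N.d v.2.2.1, (v.1.2.1 + (N.lx v.2.2.1 + N.d v.2.2.2.1),
          v.1.2.2 + (v.2.2.1 + N.d v.2.2.2.2)))))
  let lx' : N.V × V2 N.V × V2 N.V → N.V × V2 N.V × V2 N.V := fun v =>
    (N.lx v.1, (N.lx (N.lx v.2.1.2), v.2.1.1), (N.lx (N.lx v.2.2.2), v.2.2.1))
  let rx' : N.V × V2 N.V × V2 N.V → N.V × V2 N.V × V2 N.V := fun v =>
    (N.rx v.1, (N.rx v.2.1.1, N.rx v.2.1.2), (N.rx v.2.2.1, N.rx v.2.2.2))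
  let d' : N.V × V2 N.V × V2 N.V → N.V × V2 N.V × V2 N.V := fun v =>
    (N.d v.1, (N.lx v.1 + -N.d v.2.1.1, v.1 + -N.d v.2.1.2),
      ((1 / 2 : ℂ) • (N.lx (N.lx v.2.1.2) - N.lx v.2.1.1) + N.d v.2.2.1,
        (1 / 2 : ℂ) • (v.2.1.1 - N.lx v.2.1.2) + N.d v.2.2.2))
  have hlx : ∀ v : (V3 N.V) × V2 (V3 N.V), (sigmaInvT (sigmaInvT N)).lx v = lx v := fun v => rfl
  have hrx : ∀ v : (V3 N.V) × V2 (V3 N.V), (sigmaInvT (sigmaInvT N)).rx v = rx v := fun v => rfl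
  have hd : ∀ v : (V3 N.V) × V2 (V3 N.V), (sigmaInvT (sigmaInvT N)).d v = d v := fun v => rfl
  have hlx' : ∀ v : N.V × V2 N.V × V2 N.V, (ftInvT N).lx v = lx' v := fun v => rfl
  have hrx' : ∀ v : N.V × V2 N.V × V2 N.V, (ftInvT N).rx v = rx' v := fun v => rfl
  have hd' : ∀ v : N.V × V2 N.V × V2 N.V, (ftInvT N).d v = d' v := fun v => rfl
  let F : N.V × V2 N.V × V2 N.V →ₗ[ℂ] (V3 N.V) × V2 (V3 N.V) :=
    { toFun := fun v => ((v.1, (-v.2.1.1, -v.2.1.2)),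
        ((v.2.1.1, (-(2 : ℂ) • v.2.2.1, 0)), (v.2.1.2, (-(2 : ℂ) • v.2.2.2, 0))))
      map_add' := fun v w => by ext <;> simp <;> abel
      map_smul' := fun c v => by ext <;> simp <;> module }
  let G : (V3 N.V) × V2 (V3 N.V) →ₗ[ℂ] N.V × V2 N.V × V2 N.V :=
    { toFun := fun v => (v.1.1, (v.2.1.1, v.2.2.1),
        ((-1 / 2 : ℂ) • (v.2.1.2.1 - N.lx (N.lx v.2.2.2.2)),
          (1 / 2 : ℂ) • (v.2.1.2.2 - v.2.2.2.1)))
      map_add' := fun v w => by ext <;> simp <;> module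
      map_smul' := fun c v => by ext <;> simp <;> module }
  let H : (V3 N.V) × V2 (V3 N.V) →ₗ[ℂ] (V3 N.V) × V2 (V3 N.V) :=
    { toFun := fun v => ((0, (v.2.1.2.2, v.2.2.2.2)), ((0, (0, 0)), (0, (0, 0))))
      map_add' := fun v w => by simp
      map_smul' := fun c v => by simp }
  have hG : IsChainMap (sigmaInvT (sigmaInvT N)) (ftInvT N) G := by
    refine .of ⟨fun v => ?_, fun v => ?_, fun p v hv => ?_⟩ fun v => ?_
    · rw [hlx, hlx']; ext <;> simp [G, lx, lx'] <;> module
    · rw [hrx, hrx']; ext <;> simp [G, rx, rx', N.lx_rx]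
    · refine ⟨?_, ⟨?_, ?_⟩, Submodule.smul_mem _ _ (Submodule.sub_mem _ ?_ ?_),
        Submodule.smul_mem _ _ (Submodule.sub_mem _ ?_ ?_)⟩
      · exact gr_cast (M := N) hv.1.1 (by ext <;> simp <;> omega)
      · exact gr_cast (M := N) hv.2.1.1 (by ext <;> simp)
      · exact gr_cast (M := N) hv.2.2.1 (by ext <;> simp)
      · exact gr_cast (M := N) hv.2.1.2.1 (by ext <;> simp)
      · exact gr_cast (M := N) (N.lx_mem _ _ (N.lx_mem _ _ hv.2.2.2.2)) (by ext <;> simp <;> omega)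
      · exact gr_cast (M := N) hv.2.1.2.2 (by ext <;> simp)
      · exact gr_cast (M := N) hv.2.2.2.1 (by ext <;> simp)
    · rw [hd, hd']
      ext <;> simp [G, d, d', N.d_lx] <;> module
  have hF : IsChainMap (ftInvT N) (sigmaInvT (sigmaInvT N)) F := by
    refine .of ⟨fun v => ?_, fun v => ?_, fun p v hv => ?_⟩ fun v => ?_
    · rw [hlx, hlx']; ext <;> simp [F, lx, lx']
    · rw [hrx, hrx']; ext <;> simp [F, rx, rx']
    · refine ⟨⟨?_, Submodule.neg_mem _ ?_, Submodule.neg_mem _ ?_⟩,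
        ⟨?_, Submodule.smul_mem _ _ ?_, Submodule.zero_mem _⟩,
        ⟨?_, Submodule.smul_mem _ _ ?_, Submodule.zero_mem _⟩⟩
      · exact gr_cast (M := N) hv.1 (by ext <;> simp <;> omega)
      · exact gr_cast (M := N) hv.2.1.1 (by ext <;> simp)
      · exact gr_cast (M := N) hv.2.1.2 (by ext <;> simp)
      · exact gr_cast (M := N) hv.2.1.1 (by ext <;> simp)
      · exact gr_cast (M := N) hv.2.2.1 (by ext <;> simp)
      · exact gr_cast (M := N) hv.2.1.2 (by ext <;> simp)
      · exact gr_cast (M := N) hv.2.2.2 (by ext <;> simp)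
    · rw [hd, hd']
      ext <;> simp [F, d, d'] <;> module
  refine ⟨F, hF, G, hG, .of_eq (by ext <;> simp [F, G] <;> module), ?_⟩
  refine ⟨-H, IsBimodMap.neg ⟨fun v => ?_, fun v => ?_, fun p v hv => ?_⟩, ?_⟩
  · rw [hlx, hlx]; simp [H, lx]
  · rw [hrx, hrx]; simp [H, rx]
  · refine ⟨⟨Submodule.zero_mem _, ?_, ?_⟩, ⟨Submodule.zero_mem _, Submodule.zero_mem _,
      Submodule.zero_mem _⟩, Submodule.zero_mem _, Submodule.zero_mem _, Submodule.zero_mem _⟩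
    · exact gr_cast (M := N) hv.2.1.2.2 (by ext <;> simp)
    · exact gr_cast (M := N) hv.2.2.2.2 (by ext <;> simp)
  · apply LinearMap.ext; intro v
    change F (G v) - v = (sigmaInvT (sigmaInvT N)).d (-H v) + -H ((sigmaInvT (sigmaInvT N)).d v)
    rw [hd, hd]
    ext <;> simp [F, G, H, d] <;> module

/-! ### The full twist and its inverse -/

theorem ft_hequiv_sigma_sq : HEquiv FT (tensor sigma sigma) :=
  (tensor_unit FT).symm.trans <| (ft_tensor unit).trans <| (ftT_sigmaT_sigmaT unit).trans <|
    (sigmaT_hequiv ((sigma_tensor unit).symm.trans (tensor_unit sigma))).trans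
      (sigma_tensor sigma).symm

theorem ftInv_hequiv_sigmaInv_sq : HEquiv FTinv (tensor sigmaInv sigmaInv) :=
  (tensor_unit FTinv).symm.trans <| (ftInv_tensor unit).trans <|
    (ftInvT_sigmaInvT_sigmaInvT unit).trans <|
    (sigmaInvT_hequiv ((sigmaInv_tensor unit).symm.trans (tensor_unit sigmaInv))).trans
      (sigmaInv_tensor sigmaInv).symm

/-- The product `σ σ σ⁻¹ σ⁻¹` collapses from the inside. Nested coordinate functors applied to an
arbitrary complex take the place of the associativity of the tensor product. -/
theorem ft_tensor_ftInv : HEquiv (tensor FT FTinv) unit := by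
  have h : HEquiv FTinv (sigmaInvT (sigmaInvT unit)) :=
    (tensor_unit FTinv).symm.trans ((ftInv_tensor unit).trans (ftInvT_sigmaInvT_sigmaInvT unit))
  exact (ft_tensor FTinv).trans <| (ftT_sigmaT_sigmaT FTinv).trans <|
    (sigmaT_hequiv ((sigmaT_hequiv h).trans (sigmaT_sigmaInvT (sigmaInvT unit)))).trans
      (sigmaT_sigmaInvT unit)

/-! ### Homotopies of arbitrary degree, homotopy retracts -/

/-- `f` and `g`, of degree `k`, differ by the boundary of a homotopy. -/
def HomotopicDeg (k : ℤ × ℤ) (M N : BimCpx) (f g : M.V →ₗ[ℂ] N.V) : Prop :=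
  ∃ h : M.V →ₗ[ℂ] N.V, IsBimodMap M N (k + (-1, 0)) h ∧ ∀ v, f v - g v = N.d (h v) + h (M.d v)

/-- `M` is a homotopy retract of `N`. -/
structure Retract (M N : BimCpx) where
  i : M.V →ₗ[ℂ] N.V
  p : N.V →ₗ[ℂ] M.V
  h : N.V →ₗ[ℂ] N.V
  i_chain : IsChainMap M N i
  p_chain : IsChainMap N M p
  h_bimod : IsBimodMap N N (-1, 0) h
  -- This equality is strict, so identities between maps of the small complexes pass to the
  -- conjugates `i ∘ _ ∘ p` without correction terms.
  p_i : ∀ v, p (i v) = v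
  i_p : ∀ v, i (p v) = v - (N.d (h v) + h (N.d v))

/-- Homotopy retracts compose. -/
def Retract.trans {L M N : BimCpx} (r : Retract L M) (s : Retract M N) : Retract L N where
  i := s.i ∘ₗ r.i
  p := r.p ∘ₗ s.p
  h := s.h + s.i ∘ₗ r.h ∘ₗ s.p
  i_chain := s.i_chain.comp r.i_chain
  p_chain := r.p_chain.comp s.p_chain
  h_bimod := s.h_bimod.add ((s.i_chain.toIsBimodMap.comp
    (r.h_bimod.comp s.p_chain.toIsBimodMap)).congr_deg (by simp))
  p_i v := by simp [s.p_i, r.p_i]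
  i_p v := by
    have h1 := r.i_p (s.p v)
    have h2 := s.i_p v
    simp only [LinearMap.comp_apply, LinearMap.add_apply, h1, map_sub, map_add, h2,
      s.i_chain.map_d, s.p_chain.map_d]
    abel

/-- An isomorphism is a homotopy retract. -/
def Retract.ofEquiv {M N : BimCpx} (e : N.V ≃ₗ[ℂ] M.V) (he : IsChainMap N M e.toLinearMap) :
    Retract M N where
  i := e.symm.toLinearMap
  p := e.toLinearMap
  h := 0
  i_chain := he.symm
  p_chain := he
  h_bimod := .zero
  p_i v := by simp
  i_p v := by simp

/-- The map `FT⁻¹ ⊗ f`, with a scalar on the middle term. -/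
def ftInvTMap {M N : BimCpx} (c : ℂ) (f : M.V →ₗ[ℂ] N.V) :
    (ftInvT M).V →ₗ[ℂ] (ftInvT N).V := f.prodMap ((c • f.prodMap f).prodMap (f.prodMap f))

theorem ftInvTMap_apply {M N : BimCpx} (c : ℂ) (f : M.V →ₗ[ℂ] N.V)
    (v : M.V × V2 M.V × V2 M.V) : ftInvTMap c f v =
      (f v.1, (c • f v.2.1.1, c • f v.2.1.2), (f v.2.2.1, f v.2.2.2)) := rfl

theorem ftInvTMap_bimod {M N : BimCpx} {p : ℤ × ℤ} {f : M.V →ₗ[ℂ] N.V} (c : ℂ)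
    (hf : IsBimodMap M N p f) : IsBimodMap (ftInvT M) (ftInvT N) p (ftInvTMap c f) where
  map_lx v := Prod.ext (hf.map_lx v.1) (Prod.ext (((btMap_bimod hf).smul c).map_lx v.2.1)
    ((btMap_bimod hf).map_lx v.2.2))
  map_rx v := Prod.ext (hf.map_rx v.1) (Prod.ext (((btMap_bimod hf).smul c).map_rx v.2.1)
    ((btMap_bimod hf).map_rx v.2.2))
  map_gr _ _ hv := ⟨hf.map_gr' hv.1, ((btMap_bimod hf).smul c).map_gr' hv.2.1,
    (btMap_bimod hf).map_gr' hv.2.2⟩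

/-- `FT⁻¹ ⊗ M` is a homotopy retract of `FT⁻¹ ⊗ N` if `M` is one of `N`. -/
def Retract.ftInvT {M N : BimCpx} (r : Retract M N) : Retract (ftInvT M) (ftInvT N) where
  i := ftInvTMap 1 r.i
  p := ftInvTMap 1 r.p
  -- The middle term of `FT⁻¹` is the one in odd degree; the homotopy changes sign there.
  h := ftInvTMap (-1) r.h
  i_chain := .of (ftInvTMap_bimod 1 r.i_chain.toIsBimodMap) fun v => by
    rw [ftInvT_d, ftInvT_d, ftInvTMap_apply, ftInvTMap_apply]
    simp [r.i_chain.map_d, r.i_chain.map_lx]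
  p_chain := .of (ftInvTMap_bimod 1 r.p_chain.toIsBimodMap) fun v => by
    rw [ftInvT_d, ftInvT_d, ftInvTMap_apply, ftInvTMap_apply]
    simp [r.p_chain.map_d, r.p_chain.map_lx]
  h_bimod := ftInvTMap_bimod _ r.h_bimod
  p_i v := by
    rw [ftInvTMap_apply, ftInvTMap_apply]; simp [r.p_i]
  i_p v := by
    rw [ftInvT_d, ftInvT_d, ftInvTMap_apply, ftInvTMap_apply, ftInvTMap_apply, ftInvTMap_apply]
    refine eq_mk ?_ (eq_mk (eq_mk ?_ ?_) (eq_mk ?_ ?_))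
    all_goals simp [r.i_p, r.h_bimod.map_lx]
    all_goals try module

/-! ### Minimal models of the powers of `FT⁻¹` -/

/-- A complex `M` with a quasi-isomorphism `lam` onto a complex `U` without differential, together
with a contraction `chi` onto `U` which is linear over `R^s` on the left. -/
structure Model where
  M : BimCpx
  U : BimCpx
  lam : M.V →ₗ[ℂ] U.V
  iota : U.V →ₗ[ℂ] M.V
  chi : M.V →ₗ[ℂ] M.V
  U_d : ∀ u, U.d u = 0
  lam_bimod : IsBimodMap M U 0 lam
  lam_d : ∀ v, lam (M.d v) = 0
  iota_rx : ∀ u, iota (U.rx u) = M.rx (iota u)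
  -- On the left, `iota` and `chi` commute with `x²` but in general not with `x`. This suffices:
  -- applied coordinatewise on `B ⊗ M`, they become linear over `R` on both sides.
  iota_sq : ∀ u, iota (U.lx (U.lx u)) = M.lx (M.lx (iota u))
  iota_mem : ∀ p u, u ∈ U.gr p → iota u ∈ M.gr p
  d_iota : ∀ u, M.d (iota u) = 0
  chi_rx : ∀ v, chi (M.rx v) = M.rx (chi v)
  chi_sq : ∀ v, chi (M.lx (M.lx v)) = M.lx (M.lx (chi v))
  chi_mem : ∀ p v, v ∈ M.gr p → chi v ∈ M.gr (p + (-1, 0))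
  lam_iota : ∀ u, lam (iota u) = u
  lam_chi : ∀ v, lam (chi v) = 0
  chi_iota : ∀ u, chi (iota u) = 0
  chi_chi : ∀ v, chi (chi v) = 0
  d_chi : ∀ v, M.d (chi v) = v - iota (lam v) - chi (M.d v)

namespace Model

variable (A : Model)

/-- The total space of the complex `A.stepM`. -/
abbrev SV : Type := A.M.V × V2 A.U.V × V2 A.U.V

/-- The complex `[M → B ⊗ U → B ⊗ U]`. -/
abbrev stepM : BimCpx :=
  withD (dirSum (shift (-2, 2) A.M) (dirSum (shift (-1, 1) (BT A.U)) (shift (0, -1) (BT A.U))))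
    (LinearMap.prod (A.M.d ∘ₗ LinearMap.fst ℂ A.M.V (V2 A.U.V × V2 A.U.V))
      (LinearMap.prod
        (btComult A.U ∘ₗ A.lam ∘ₗ LinearMap.fst ℂ A.M.V (V2 A.U.V × V2 A.U.V))
        (btDelta A.U ∘ₗ LinearMap.fst ℂ (V2 A.U.V) (V2 A.U.V) ∘ₗ
          LinearMap.snd ℂ A.M.V (V2 A.U.V × V2 A.U.V))))
    (fun v => by
      have h2 := (btDelta_bimod A.U).map_lx v.2.1
      refine Prod.ext (A.M.d_lx v.1) (Prod.ext ?_ h2)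
      exact (congrArg (btComult A.U) (A.lam_bimod.map_lx v.1)).trans
        ((btComult_bimod A.U).map_lx (A.lam v.1)))
    (fun v => by
      have h2 := (btDelta_bimod A.U).map_rx v.2.1
      refine Prod.ext (A.M.d_rx v.1) (Prod.ext ?_ h2)
      exact (congrArg (btComult A.U) (A.lam_bimod.map_rx v.1)).trans
        ((btComult_bimod A.U).map_rx (A.lam v.1)))
    (fun p v hv => ⟨gr_cast (M := A.M) (A.M.d_mem _ _ hv.1) (by abel),
      gr_cast (M := BT A.U) ((btComult_bimod A.U).map_gr _ _ (A.lam_bimod.map_gr _ _ hv.1))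
        (by ext <;> simp <;> omega),
      gr_cast (M := BT A.U) ((btDelta_bimod A.U).map_gr _ _ hv.2.1)
        (by ext <;> simp; omega)⟩)
    (fun v => by
      refine Prod.ext (A.M.d_d v.1) (Prod.ext ?_ ?_)
      · exact (congrArg (btComult A.U) (A.lam_d v.1)).trans (map_zero _)
      · change btDelta A.U (btComult A.U (A.lam v.1)) = 0
        simp [btDelta_apply, btComult_apply])

theorem stepM_d (v : A.SV) : A.stepM.d v = (A.M.d v.1, (A.U.lx (A.lam v.1), A.lam v.1),
    ((1 / 2 : ℂ) • (A.U.lx (A.U.lx v.2.1.2) - A.U.lx v.2.1.1),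
      (1 / 2 : ℂ) • (v.2.1.1 - A.U.lx v.2.1.2))) := rfl

theorem stepM_lx (v : A.SV) : A.stepM.lx v = (A.M.lx v.1, (A.U.lx (A.U.lx v.2.1.2), v.2.1.1),
    (A.U.lx (A.U.lx v.2.2.2), v.2.2.1)) := rfl

theorem stepM_rx (v : A.SV) : A.stepM.rx v = (A.M.rx v.1, (A.U.rx v.2.1.1, A.U.rx v.2.1.2),
    (A.U.rx v.2.2.1, A.U.rx v.2.2.2)) := rfl

/-- The augmentation of `A.stepM`. -/
def stepLam : A.SV →ₗ[ℂ] A.U.V where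
  toFun v := v.2.2.1 + A.U.lx v.2.2.2
  map_add' v w := by simp; abel
  map_smul' c v := by simp

/-- The section of `A.stepLam`. -/
def stepIota : A.U.V →ₗ[ℂ] A.SV where
  toFun u := (0, (0, 0), (u, 0))
  map_add' v w := by simp
  map_smul' c v := by simp

/-- The contraction of `A.stepM`. -/
def stepChi : A.SV →ₗ[ℂ] A.SV where
  -- The coordinate of `x ⊗ 1` inverts `comult` on the first copy of `B ⊗ U` and, doubled because of
  -- the `1/2` in `delta`, splits `delta` on the second. Taking this coordinate is linear only over
  -- `R^s` on the left.
  toFun v := (A.chi v.1 + A.iota v.2.1.2, ((2 : ℂ) • v.2.2.2, 0), (0, 0))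
  map_add' v w := by ext <;> simp; abel
  map_smul' c v := by ext <;> simp <;> module

theorem stepLam_apply (v : A.SV) : A.stepLam v = v.2.2.1 + A.U.lx v.2.2.2 := rfl

theorem stepIota_apply (u : A.U.V) : A.stepIota u = (0, (0, 0), (u, 0)) := rfl

theorem stepChi_apply (v : A.SV) :
    A.stepChi v = (A.chi v.1 + A.iota v.2.1.2, ((2 : ℂ) • v.2.2.2, 0), (0, 0)) := rfl

/-- The model `[M → B ⊗ U → B ⊗ U]`. -/
def step : Model where
  M := A.stepM
  -- Multiplication identifies the cokernel of `delta` on the last term with `q⁻¹ U`, so the `k`-th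
  -- model has `U = q^(-k) R`.
  U := shift (0, -2) A.U
  lam := A.stepLam
  iota := A.stepIota
  chi := A.stepChi
  U_d u := (congrArg (parity 0 • ·) (A.U_d u)).trans (smul_zero _)
  lam_bimod :=
    { map_lx := fun v => by
        rw [stepM_lx, stepLam_apply, stepLam_apply]; simp [add_comm]
      map_rx := fun v => by
        rw [stepM_rx, stepLam_apply, stepLam_apply]; simp [A.U.lx_rx]
      map_gr := fun p v hv => Submodule.add_mem _
        (gr_cast (M := A.U) hv.2.2.1 (by ext <;> simp; omega))
        (gr_cast (M := A.U) (A.U.lx_mem _ _ hv.2.2.2) (by ext <;> simp)) }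
  lam_d v := by rw [stepM_d, stepLam_apply]; simp; module
  iota_rx u := by rw [stepM_rx, stepIota_apply, stepIota_apply]; simp
  iota_sq u := by rw [stepM_lx, stepM_lx, stepIota_apply, stepIota_apply]; simp
  iota_mem p u hu := ⟨Submodule.zero_mem _, ⟨Submodule.zero_mem _, Submodule.zero_mem _⟩,
    gr_cast (M := A.U) hu (by ext <;> simp; omega), Submodule.zero_mem _⟩
  d_iota u := by rw [stepM_d, stepIota_apply]; simp
  chi_rx v := by
    rw [stepM_rx, stepM_rx, stepChi_apply, stepChi_apply]; simp [A.chi_rx, A.iota_rx]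
  chi_sq v := by
    rw [stepM_lx, stepM_lx, stepM_lx, stepM_lx, stepChi_apply, stepChi_apply]
    simp [A.chi_sq, A.iota_sq]
  chi_mem p v hv := ⟨Submodule.add_mem _
      (gr_cast (M := A.M) (A.chi_mem _ _ hv.1) (by ext <;> simp; omega))
      (gr_cast (M := A.M) (A.iota_mem _ _ hv.2.1.2) (by ext <;> simp <;> omega)),
    ⟨Submodule.smul_mem _ _ (gr_cast (M := A.U) hv.2.2.2 (by ext <;> simp)),
      Submodule.zero_mem _⟩, Submodule.zero_mem _, Submodule.zero_mem _⟩
  lam_iota u := by rw [stepIota_apply, stepLam_apply]; simp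
  lam_chi v := by rw [stepChi_apply, stepLam_apply]; simp
  chi_iota u := by rw [stepIota_apply, stepChi_apply]; simp
  chi_chi v := by rw [stepChi_apply, stepChi_apply]; simp [A.chi_chi, A.chi_iota]
  d_chi v := by
    rw [stepM_d, stepM_d, stepChi_apply, stepChi_apply, stepLam_apply, stepIota_apply]
    ext <;> simp [A.d_chi, A.d_iota, A.lam_iota, A.lam_chi] <;> module

/-! ### The model of `FT⁻¹ ⊗ M` -/

/-- The projection of `FT⁻¹ ⊗ M` onto its model. -/
def modelQ : A.M.V × V2 A.M.V × V2 A.M.V →ₗ[ℂ] A.SV where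
  toFun v := (v.1, (A.lam v.2.1.1, A.lam v.2.1.2), (A.lam v.2.2.1, A.lam v.2.2.2))
  map_add' v w := by simp
  map_smul' c v := by simp

/-- The inclusion of the model into `FT⁻¹ ⊗ M`. -/
def modelJ : A.SV →ₗ[ℂ] A.M.V × V2 A.M.V × V2 A.M.V where
  -- Homological perturbation: the coordinatewise `iota` does not commute with `comult` and `delta`,
  -- which involve the left action of `x`. The terms with `chi` are the successive corrections; they
  -- stop after two steps because `FT⁻¹` has three terms. The contributions of `chi (x² _)` are
  -- absent since `chi` commutes with `x²` and kills the images of `iota` and `chi`.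
  toFun v := (v.1,
    (A.iota v.2.1.1 + A.chi (A.M.lx v.1), A.iota v.2.1.2 + A.chi v.1),
    (A.iota v.2.2.1 + (1 / 2 : ℂ) • A.chi (A.M.lx (A.chi (A.M.lx v.1) + A.iota v.2.1.1)),
      A.iota v.2.2.2 + (1 / 2 : ℂ) • A.chi (A.M.lx (A.chi v.1 + A.iota v.2.1.2))))
  map_add' v w := by ext <;> simp <;> module
  map_smul' c v := by ext <;> simp <;> module

/-- The homotopy on `FT⁻¹ ⊗ M` which contracts it onto its model. -/
def modelH : A.M.V × V2 A.M.V × V2 A.M.V →ₗ[ℂ] A.M.V × V2 A.M.V × V2 A.M.V where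
  toFun v := (0, (-A.chi v.2.1.1, -A.chi v.2.1.2),
    (A.chi v.2.2.1 - (1 / 2 : ℂ) • A.chi (A.M.lx (A.chi v.2.1.1)),
      A.chi v.2.2.2 - (1 / 2 : ℂ) • A.chi (A.M.lx (A.chi v.2.1.2))))
  map_add' v w := by ext <;> simp <;> module
  map_smul' c v := by ext <;> simp <;> module

theorem ftInvT_lx (M : BimCpx) (v : M.V × V2 M.V × V2 M.V) : (SBim2.ftInvT M).lx v =
    (M.lx v.1, (M.lx (M.lx v.2.1.2), v.2.1.1), (M.lx (M.lx v.2.2.2), v.2.2.1)) := rfl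

theorem ftInvT_rx (M : BimCpx) (v : M.V × V2 M.V × V2 M.V) : (SBim2.ftInvT M).rx v =
    (M.rx v.1, (M.rx v.2.1.1, M.rx v.2.1.2), (M.rx v.2.2.1, M.rx v.2.2.2)) := rfl

theorem modelQ_apply (v : A.M.V × V2 A.M.V × V2 A.M.V) : A.modelQ v =
    (v.1, (A.lam v.2.1.1, A.lam v.2.1.2), (A.lam v.2.2.1, A.lam v.2.2.2)) := rfl

theorem modelJ_apply (v : A.SV) : A.modelJ v = (v.1,
    (A.iota v.2.1.1 + A.chi (A.M.lx v.1), A.iota v.2.1.2 + A.chi v.1),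
    (A.iota v.2.2.1 + (1 / 2 : ℂ) • A.chi (A.M.lx (A.chi (A.M.lx v.1) + A.iota v.2.1.1)),
      A.iota v.2.2.2 + (1 / 2 : ℂ) • A.chi (A.M.lx (A.chi v.1 + A.iota v.2.1.2)))) := rfl

theorem modelH_apply (v : A.M.V × V2 A.M.V × V2 A.M.V) : A.modelH v =
    (0, (-A.chi v.2.1.1, -A.chi v.2.1.2),
    (A.chi v.2.2.1 - (1 / 2 : ℂ) • A.chi (A.M.lx (A.chi v.2.1.1)),
      A.chi v.2.2.2 - (1 / 2 : ℂ) • A.chi (A.M.lx (A.chi v.2.1.2)))) := rfl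

theorem chix_mem {p : ℤ × ℤ} {v : A.M.V} (hv : v ∈ A.M.gr p) :
    A.chi (A.M.lx v) ∈ A.M.gr (p + (-1, 2)) :=
  gr_cast (M := A.M) (A.chi_mem _ _ (A.M.lx_mem _ _ hv)) (by ext <;> simp)

theorem modelQ_chain : IsChainMap (SBim2.ftInvT A.M) A.stepM A.modelQ := by
  refine .of ⟨fun v => ?_, fun v => ?_, fun p v hv => ?_⟩ fun v => ?_
  · rw [ftInvT_lx, stepM_lx, modelQ_apply, modelQ_apply]; simp [A.lam_bimod.map_lx]
  · rw [ftInvT_rx, stepM_rx, modelQ_apply, modelQ_apply]; simp [A.lam_bimod.map_rx]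
  · exact ⟨gr_cast (M := A.M) hv.1 (by simp),
      ⟨gr_cast (M := A.U) (A.lam_bimod.map_gr _ _ hv.2.1.1) (by ext <;> simp),
        gr_cast (M := A.U) (A.lam_bimod.map_gr _ _ hv.2.1.2) (by ext <;> simp)⟩,
      gr_cast (M := A.U) (A.lam_bimod.map_gr _ _ hv.2.2.1) (by ext <;> simp),
      gr_cast (M := A.U) (A.lam_bimod.map_gr _ _ hv.2.2.2) (by ext <;> simp)⟩
  · rw [ftInvT_d, stepM_d, modelQ_apply, modelQ_apply]; simp [A.lam_bimod.map_lx, A.lam_d]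

theorem modelJ_chain : IsChainMap A.stepM (SBim2.ftInvT A.M) A.modelJ := by
  refine .of ⟨fun v => ?_, fun v => ?_, fun p v hv => ?_⟩ fun v => ?_
  · rw [ftInvT_lx, stepM_lx, modelJ_apply, modelJ_apply]; simp [A.iota_sq, A.chi_sq]
  · rw [ftInvT_rx, stepM_rx, modelJ_apply, modelJ_apply]
    simp [A.iota_rx, A.chi_rx, A.M.lx_rx]
  · refine ⟨gr_cast (M := A.M) hv.1 (by simp),
      ⟨Submodule.add_mem _ (gr_cast (M := A.M) (A.iota_mem _ _ hv.2.1.1) (by ext <;> simp))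
        (gr_cast (M := A.M) (A.chix_mem hv.1) (by ext <;> simp <;> omega)),
        Submodule.add_mem _ (gr_cast (M := A.M) (A.iota_mem _ _ hv.2.1.2) (by ext <;> simp))
        (gr_cast (M := A.M) (A.chi_mem _ _ hv.1) (by ext <;> simp <;> omega))⟩,
      Submodule.add_mem _ (gr_cast (M := A.M) (A.iota_mem _ _ hv.2.2.1) (by ext <;> simp))
        (Submodule.smul_mem _ _ (gr_cast (M := A.M) (A.chix_mem (Submodule.add_mem _
          (A.chix_mem hv.1) (gr_cast (M := A.M) (A.iota_mem _ _ hv.2.1.1) ?_)))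
          ?_)),
      Submodule.add_mem _ (gr_cast (M := A.M) (A.iota_mem _ _ hv.2.2.2) (by ext <;> simp))
        (Submodule.smul_mem _ _ (gr_cast (M := A.M) (A.chix_mem (Submodule.add_mem _
          (A.chi_mem _ _ hv.1) (gr_cast (M := A.M) (A.iota_mem _ _ hv.2.1.2) ?_)))
          ?_))⟩
    all_goals ext <;> simp <;> omega
  · rw [ftInvT_d, stepM_d, modelJ_apply, modelJ_apply]
    ext <;> simp [A.d_chi, A.d_iota, A.lam_iota, A.lam_chi, A.M.d_lx,
      A.lam_bimod.map_lx, A.iota_sq, A.chi_sq] <;> try module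

/-- The model of `FT⁻¹ ⊗ M` as a homotopy retract. -/
def retract : Retract A.stepM (SBim2.ftInvT A.M) where
  i := A.modelJ
  p := A.modelQ
  h := A.modelH
  i_chain := A.modelJ_chain
  p_chain := A.modelQ_chain
  h_bimod := by
    refine ⟨fun v => ?_, fun v => ?_, fun p v hv => ?_⟩
    · rw [ftInvT_lx, ftInvT_lx, modelH_apply, modelH_apply]
      simp [A.chi_sq]
    · rw [ftInvT_rx, ftInvT_rx, modelH_apply, modelH_apply]
      simp [A.chi_rx, A.M.lx_rx]
    · refine ⟨Submodule.zero_mem _,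
        ⟨Submodule.neg_mem _ (gr_cast (M := A.M) (A.chi_mem _ _ hv.2.1.1) ?_),
          Submodule.neg_mem _ (gr_cast (M := A.M) (A.chi_mem _ _ hv.2.1.2) ?_)⟩,
        Submodule.sub_mem _ (gr_cast (M := A.M) (A.chi_mem _ _ hv.2.2.1) ?_)
          (Submodule.smul_mem _ _ (gr_cast (M := A.M)
            (A.chix_mem (A.chi_mem _ _ hv.2.1.1)) ?_)),
        Submodule.sub_mem _ (gr_cast (M := A.M) (A.chi_mem _ _ hv.2.2.2) ?_)
          (Submodule.smul_mem _ _ (gr_cast (M := A.M)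
            (A.chix_mem (A.chi_mem _ _ hv.2.1.2)) ?_))⟩
      all_goals ext <;> simp <;> omega
  p_i v := by
    rw [modelJ_apply, modelQ_apply]
    simp [A.lam_iota, A.lam_chi]
  i_p v := by
    rw [ftInvT_d, ftInvT_d, modelJ_apply, modelQ_apply, modelH_apply, modelH_apply]
    ext <;> simp [A.d_chi, A.d_iota, A.lam_iota, A.lam_chi, A.M.d_lx,
      A.lam_bimod.map_lx, A.iota_sq, A.chi_sq] <;> try module

end Model

/-! ### Chain maps of arbitrary (even) degree -/

/-- `f` is a morphism of complexes of degree `k`, up to the sign conventions for odd degrees. -/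
structure IsChainDeg (k : ℤ × ℤ) (M N : BimCpx) (f : M.V →ₗ[ℂ] N.V) : Prop where
  bimod : IsBimodMap M N k f
  map_d : ∀ v, f (M.d v) = N.d (f v)

theorem IsChainMap.deg {M N : BimCpx} {f : M.V →ₗ[ℂ] N.V} (hf : IsChainMap M N f) :
    IsChainDeg 0 M N f := ⟨hf.toIsBimodMap, hf.map_d⟩

theorem IsChainDeg.comp {j k : ℤ × ℤ} {L M N : BimCpx} {g : M.V →ₗ[ℂ] N.V} {f : L.V →ₗ[ℂ] M.V}
    (hg : IsChainDeg j M N g) (hf : IsChainDeg k L M f) : IsChainDeg (k + j) L N (g ∘ₗ f) :=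
  ⟨hg.bimod.comp hf.bimod, fun v => by simp [hf.map_d, hg.map_d]⟩

theorem IsChainDeg.congr {j k : ℤ × ℤ} {M N : BimCpx} {f : M.V →ₗ[ℂ] N.V}
    (hf : IsChainDeg j M N f) (h : j = k) : IsChainDeg k M N f := h ▸ hf

namespace HomotopicDeg

variable {k j : ℤ × ℤ} {L M N : BimCpx} {f g l : M.V →ₗ[ℂ] N.V}

theorem of_eq (h : ∀ v, f v = g v) : HomotopicDeg k M N f g := ⟨0, .zero, fun v => by simp [h]⟩

theorem congr (h : HomotopicDeg j M N f g) (e : j = k) : HomotopicDeg k M N f g := e ▸ h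

theorem trans (h : HomotopicDeg k M N f g) (h' : HomotopicDeg k M N g l) :
    HomotopicDeg k M N f l := by
  obtain ⟨s, hs, e⟩ := h
  obtain ⟨t, ht, e'⟩ := h'
  refine ⟨s + t, hs.add ht, fun v => ?_⟩
  rw [← sub_add_sub_cancel (f v) (g v) (l v), e, e']
  simp; abel

theorem smul (c : ℂ) (h : HomotopicDeg k M N f g) : HomotopicDeg k M N (c • f) (c • g) := by
  obtain ⟨s, hs, e⟩ := h
  refine ⟨c • s, hs.smul c, fun v => ?_⟩
  simp [← smul_sub, e]

theorem comp_left {u : N.V →ₗ[ℂ] L.V} (h : HomotopicDeg k M N f g) (hu : IsChainDeg j N L u) :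
    HomotopicDeg (k + j) M L (u ∘ₗ f) (u ∘ₗ g) := by
  obtain ⟨s, hs, e⟩ := h
  refine ⟨u ∘ₗ s, (hu.bimod.comp hs).congr_deg (by abel), fun v => ?_⟩
  simp [← map_sub, e, hu.map_d]

theorem comp_right {u : L.V →ₗ[ℂ] M.V} (h : HomotopicDeg k M N f g) (hu : IsChainDeg j L M u) :
    HomotopicDeg (j + k) L N (f ∘ₗ u) (g ∘ₗ u) := by
  obtain ⟨s, hs, e⟩ := h
  refine ⟨s ∘ₗ u, (hs.comp hu.bimod).congr_deg (by abel), fun v => ?_⟩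
  simp [e, hu.map_d]

end HomotopicDeg

/-! ### The eigenmaps in coordinates -/

/-- The map `FT⁻¹ ⊗ N → N` induced by the multiplication on the last term. -/
def projZ (N : BimCpx) : N.V × V2 N.V × V2 N.V →ₗ[ℂ] N.V where
  toFun v := v.2.2.1 + N.lx v.2.2.2
  map_add' v w := by simp; abel
  map_smul' c v := by simp

theorem projZ_apply (N : BimCpx) (v : N.V × V2 N.V × V2 N.V) :
    projZ N v = v.2.2.1 + N.lx v.2.2.2 := rfl

/-- The projection of `FT⁻¹ ⊗ N` onto its first term. -/
def projW (N : BimCpx) : N.V × V2 N.V × V2 N.V →ₗ[ℂ] N.V := LinearMap.fst ℂ _ _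

theorem projZ_chain (N : BimCpx) : IsChainDeg (0, 2) (ftInvT N) N (projZ N) := by
  refine ⟨⟨fun v => ?_, fun v => ?_, fun p v hv => ?_⟩, fun v => ?_⟩
  · rw [Model.ftInvT_lx, projZ_apply, projZ_apply]; simp [add_comm]
  · rw [Model.ftInvT_rx, projZ_apply, projZ_apply]; simp [N.lx_rx]
  · exact Submodule.add_mem _ (gr_cast (M := N) hv.2.2.1 (by ext <;> simp; omega))
      (gr_cast (M := N) (N.lx_mem _ _ hv.2.2.2) (by ext <;> simp))
  · rw [ftInvT_d, projZ_apply, projZ_apply]; simp [N.d_lx]; module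

theorem projW_chain (N : BimCpx) : IsChainDeg (2, -2) (ftInvT N) N (projW N) := by
  refine ⟨⟨fun v => rfl, fun v => rfl, fun p v hv => ?_⟩, fun v => rfl⟩
  exact gr_cast (M := N) hv.1 (by ext <;> simp; omega)

/-! ### The eigenmaps on the models -/

/-- The eigenmap `z : A.step → A` and a homotopy `kap` for multiplication by `x` on the image of
the eigenmap `w`. -/
structure Eigen (A : Model) where
  z : A.SV →ₗ[ℂ] A.M.V
  kap : A.SV →ₗ[ℂ] A.M.V
  z_chain : IsChainDeg (0, 2) A.stepM A.M z
  kap_bimod : IsBimodMap A.stepM A.M (1, 0) kap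
  -- The projection `v ↦ v.1` is the eigenmap `w` of the model, so this says that `kap` is a
  -- null-homotopy of `x w`.
  kap_d : ∀ v : A.SV, kap (A.stepM.d v) = A.M.lx v.1 - A.M.d (kap v)
  lam_z : ∀ v, A.lam (z v) = A.stepLam v
  lam_kap : ∀ v : A.SV, A.lam (kap v) = (1 / 2 : ℂ) • (v.2.1.1 + A.U.lx v.2.1.2)
  -- Here and in `kap_kap`, `v` lies two stages above `A.M`. The tuples `(z v.1, v.2.1, v.2.2)` and
  -- `(kap v.1, v.1.2.2, (1/2) v.2.1)` are the values of the eigenmap and of the homotopy one stage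
  -- up; they are written out because these maps are only defined from the present data.
  kap_z : ∀ v : A.SV × V2 A.U.V × V2 A.U.V,
    kap (z v.1, v.2.1, v.2.2) = z (kap v.1, v.1.2.2, (1 / 2 : ℂ) • v.2.1)
  kap_kap : ∀ v : A.SV × V2 A.U.V × V2 A.U.V,
    kap (kap v.1, v.1.2.2, (1 / 2 : ℂ) • v.2.1) = (1 / 2 : ℂ) • z v.1
  -- Restricting `projZ` along the perturbed inclusion `modelJ` of the next stage gives half of the
  -- left side on the first term. The identity says that the transferred eigenmap is `z` again
  -- there, which makes the induction close up.
  chi_z : ∀ v : A.SV, A.stepChi (A.stepM.lx (A.stepChi (A.stepM.lx v)))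
    + A.stepM.lx (A.stepChi (A.stepM.lx (A.stepChi v))) = ((2 : ℂ) • z v, (0, 0), (0, 0))
  projZ_homotopic : HomotopicDeg (0, 2) (ftInvT A.M) A.M (projZ A.M) (z ∘ₗ A.modelQ)

/-- The trivial model of a complex without differential. -/
def Model.base (U : BimCpx) (hU : ∀ u, U.d u = 0) : Model where
  M := U
  U := U
  lam := LinearMap.id
  iota := LinearMap.id
  chi := 0
  U_d := hU
  lam_bimod := .id
  lam_d := hU
  iota_rx _ := rfl
  iota_sq _ := rfl
  iota_mem _ _ hu := hu
  d_iota := hU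
  chi_rx v := by simp
  chi_sq v := by simp
  chi_mem p v _ := Submodule.zero_mem _
  lam_iota _ := rfl
  lam_chi _ := rfl
  chi_iota _ := rfl
  chi_chi _ := rfl
  d_chi v := by simp

/-- The homotopy `kap` on the trivial model. -/
def baseKap (U : BimCpx) : U.V × V2 U.V × V2 U.V →ₗ[ℂ] U.V where
  toFun v := (1 / 2 : ℂ) • (v.2.1.1 + U.lx v.2.1.2)
  map_add' v w := by simp; module
  map_smul' c v := by simp; module

/-- The eigenmaps on the trivial model. -/
def Eigen.base (U : BimCpx) (hU : ∀ u, U.d u = 0) : Eigen (Model.base U hU) where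
  z := projZ U
  kap := baseKap U
  z_chain := by
    refine ⟨⟨?_, ?_, fun p v hv => ?_⟩, ?_⟩
    · change ∀ v : U.V × V2 U.V × V2 U.V,
        U.lx (U.lx v.2.2.2) + U.lx v.2.2.1 = U.lx (v.2.2.1 + U.lx v.2.2.2)
      simp [add_comm]
    · change ∀ v : U.V × V2 U.V × V2 U.V,
        U.rx v.2.2.1 + U.lx (U.rx v.2.2.2) = U.rx (v.2.2.1 + U.lx v.2.2.2)
      simp [U.lx_rx]
    · exact Submodule.add_mem _ (gr_cast (M := U) hv.2.2.1 (by ext <;> simp; omega))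
        (gr_cast (M := U) (U.lx_mem _ _ hv.2.2.2) (by ext <;> simp))
    · change ∀ v : U.V × V2 U.V × V2 U.V, (1 / 2 : ℂ) • (U.lx (U.lx v.2.1.2) - U.lx v.2.1.1)
        + U.lx ((1 / 2 : ℂ) • (v.2.1.1 - U.lx v.2.1.2)) = U.d (projZ U v)
      intro v
      rw [hU]; simp; module
  kap_bimod := by
    refine ⟨?_, ?_, fun p v hv => ?_⟩
    · change ∀ v : U.V × V2 U.V × V2 U.V, (1 / 2 : ℂ) • (U.lx (U.lx v.2.1.2) + U.lx v.2.1.1) =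
        U.lx ((1 / 2 : ℂ) • (v.2.1.1 + U.lx v.2.1.2))
      simp [add_comm]
    · change ∀ v : U.V × V2 U.V × V2 U.V, (1 / 2 : ℂ) • (U.rx v.2.1.1 + U.lx (U.rx v.2.1.2)) =
        U.rx ((1 / 2 : ℂ) • (v.2.1.1 + U.lx v.2.1.2))
      simp [U.lx_rx]
    · exact Submodule.smul_mem _ _ (Submodule.add_mem _
        (gr_cast (M := U) hv.2.1.1 (by ext <;> simp))
        (gr_cast (M := U) (U.lx_mem _ _ hv.2.1.2) (by ext <;> simp; omega)))
  kap_d := by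
    change ∀ v : U.V × V2 U.V × V2 U.V,
      (1 / 2 : ℂ) • (U.lx v.1 + U.lx v.1) = U.lx v.1 - U.d (baseKap U v)
    intro v
    rw [hU]; module
  lam_z _ := rfl
  lam_kap _ := rfl
  kap_z := by
    change ∀ v : (U.V × V2 U.V × V2 U.V) × V2 U.V × V2 U.V,
      (1 / 2 : ℂ) • (v.2.1.1 + U.lx v.2.1.2)
      = (1 / 2 : ℂ) • v.2.1.1 + U.lx ((1 / 2 : ℂ) • v.2.1.2)
    simp
  kap_kap v := rfl
  chi_z := by
    change ∀ v : U.V × V2 U.V × V2 U.V, (((0 : U.V) + (2 : ℂ) • v.2.2.1,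
        ((2 : ℂ) • (0 : U.V), (0 : U.V)), ((0 : U.V), (0 : U.V))) : U.V × V2 U.V × V2 U.V)
      + (U.lx (0 + (2 : ℂ) • v.2.2.2), (U.lx (U.lx 0), (2 : ℂ) • 0), (U.lx (U.lx 0), 0))
      = ((2 : ℂ) • (v.2.2.1 + U.lx v.2.2.2), (0, 0), (0, 0))
    simp
  projZ_homotopic := .of_eq fun _ => rfl

namespace Eigen

variable {A : Model} (E : Eigen A)

/-- The eigenmap `z` on the next model. -/
def stepZ : A.SV × V2 A.U.V × V2 A.U.V →ₗ[ℂ] A.SV := E.z.prodMap LinearMap.id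

/-- The homotopy `kap` on the next model. -/
def stepKap : A.SV × V2 A.U.V × V2 A.U.V →ₗ[ℂ] A.SV where
  -- The homotopy moves the terms one place along the chain of copies of `B`: the last old term
  -- becomes the middle one, and half of the first new term becomes the last one.
  toFun v := (E.kap v.1, v.1.2.2, (1 / 2 : ℂ) • v.2.1)
  map_add' v w := by simp
  map_smul' c v := Prod.ext (map_smul _ _ _) (Prod.ext rfl (smul_comm _ _ _))

theorem stepKap_apply (v : A.SV × V2 A.U.V × V2 A.U.V) :
    E.stepKap v = (E.kap v.1, v.1.2.2, (1 / 2 : ℂ) • v.2.1) := rfl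

theorem step_stepM_lx (v : A.SV × V2 A.U.V × V2 A.U.V) :
    A.step.stepM.lx v = (A.stepM.lx v.1, (A.U.lx (A.U.lx v.2.1.2), v.2.1.1),
    (A.U.lx (A.U.lx v.2.2.2), v.2.2.1)) := rfl

theorem step_stepM_rx (v : A.SV × V2 A.U.V × V2 A.U.V) :
    A.step.stepM.rx v = (A.stepM.rx v.1, (A.U.rx v.2.1.1, A.U.rx v.2.1.2),
    (A.U.rx v.2.2.1, A.U.rx v.2.2.2)) := rfl

theorem stepChi_lx_stepIota (u : A.U.V) :
    A.stepChi (A.stepM.lx (A.stepIota u)) = (0, ((2 : ℂ) • u, 0), (0, 0)) := by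
  rw [Model.stepIota_apply, Model.stepM_lx, Model.stepChi_apply]; simp

/-- Inside the old part the relation is inherited. Where old and new terms meet, `lam_kap` combines
the half of `comult` coming from the new term with the differential out of the old part to give left
multiplication by `x`. -/
theorem stepKap_d (v : A.SV × V2 A.U.V × V2 A.U.V) :
    E.stepKap (A.step.stepM.d v) = A.stepM.lx v.1 - A.stepM.d (E.stepKap v) := by
  change ((E.kap (A.stepM.d v.1), (A.stepM.d v.1).2.2,
    (1 / 2 : ℂ) • ((A.U.lx (A.stepLam v.1), A.stepLam v.1) : V2 A.U.V)) : A.SV) = _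
  rw [E.kap_d, Model.stepM_d A v.1, Model.stepM_lx A v.1, Model.stepM_d A (E.stepKap v),
    stepKap_apply, Model.stepLam_apply]
  ext <;> simp [E.lam_kap] <;> module

theorem stepKap_lx (v : A.SV × V2 A.U.V × V2 A.U.V) :
    E.stepKap (A.step.stepM.lx v) = A.stepM.lx (E.stepKap v) := by
  refine Prod.ext (E.kap_bimod.map_lx v.1) (Prod.ext rfl ?_)
  change (1 / 2 : ℂ) • ((A.U.lx (A.U.lx v.2.1.2), v.2.1.1) : V2 A.U.V)
    = (A.U.lx (A.U.lx ((1 / 2 : ℂ) • v.2.1.2)), (1 / 2 : ℂ) • v.2.1.1)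
  simp

theorem stepKap_rx (v : A.SV × V2 A.U.V × V2 A.U.V) :
    E.stepKap (A.step.stepM.rx v) = A.stepM.rx (E.stepKap v) := by
  refine Prod.ext (E.kap_bimod.map_rx v.1) (Prod.ext rfl ?_)
  change (1 / 2 : ℂ) • ((A.U.rx v.2.1.1, A.U.rx v.2.1.2) : V2 A.U.V)
    = (A.U.rx ((1 / 2 : ℂ) • v.2.1.1), A.U.rx ((1 / 2 : ℂ) • v.2.1.2))
  simp

theorem stepZ_d (v : A.SV × V2 A.U.V × V2 A.U.V) :
    E.stepZ (A.step.stepM.d v) = A.stepM.d (E.stepZ v) := by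
  refine Prod.ext (E.z_chain.map_d v.1) (Prod.ext ?_ rfl)
  exact (congrArg (fun u => (A.U.lx u, u)) (E.lam_z v.1)).symm

theorem lx_mk_right (u : A.U.V) :
    A.stepM.lx ((0, ((2 : ℂ) • u, 0), (0, 0)) : A.SV) = (0, (0, (2 : ℂ) • u), (0, 0)) := by
  rw [Model.stepM_lx]; simp

theorem stepChi_lx_add (a : A.SV) (u : A.U.V) : A.stepChi (A.stepM.lx (a + A.stepIota u))
    = A.stepChi (A.stepM.lx a) + (0, ((2 : ℂ) • u, 0), (0, 0)) := by
  rw [← stepChi_lx_stepIota, ← map_add A.stepChi]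
  exact congrArg A.stepChi (map_add A.stepM.lx a (A.stepIota u))

/-- On the old component the relation of the previous stage contributes `2 z`; the terms with
`stepIota` add twice the identity on the two new copies of `B ⊗ U`. Together these give `2 stepZ`.
-/
theorem stepChi_z (v : A.SV × V2 A.U.V × V2 A.U.V) :
    A.step.stepChi (A.step.stepM.lx (A.step.stepChi (A.step.stepM.lx v)))
      + A.step.stepM.lx (A.step.stepChi (A.step.stepM.lx (A.step.stepChi v)))
      = ((2 : ℂ) • E.stepZ v, (0, 0), (0, 0)) := by
  refine Prod.ext ?_ (Prod.ext (Prod.ext ?_ ?_) (Prod.ext ?_ ?_))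
  · change A.stepChi (A.stepM.lx (A.stepChi (A.stepM.lx v.1) + A.stepIota v.2.1.1))
        + A.stepIota ((2 : ℂ) • v.2.2.1)
      + A.stepM.lx (A.stepChi (A.stepM.lx (A.stepChi v.1 + A.stepIota v.2.1.2))
        + A.stepIota ((2 : ℂ) • v.2.2.2)) = (2 : ℂ) • ((E.z v.1, v.2.1, v.2.2) : A.SV)
    rw [stepChi_lx_add, stepChi_lx_add, map_add A.stepM.lx, map_add A.stepM.lx, lx_mk_right,
      eq_sub_of_add_eq (E.chi_z v.1), Model.stepM_lx A (A.stepIota _), Model.stepIota_apply,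
      Model.stepIota_apply]
    ext <;> simp
  · change (2 : ℂ) • (0 : A.U.V) + A.U.lx (A.U.lx 0) = 0
    simp
  · change (0 : A.U.V) + (2 : ℂ) • 0 = 0
    simp
  · change (0 : A.U.V) + A.U.lx (A.U.lx 0) = 0
    simp
  · exact add_zero (0 : A.U.V)

/-- Here `π` plays the role of `iota ∘ lam`. With this reading `G` is `projZ` after the perturbation
homotopy `modelH`, and the subtracted expression is `projZ` after `modelJ ∘ modelQ`. The identity is
thus the image of the retraction formula under the chain map `projZ`, isolated from the data of a
model so that it needs only three relations. -/
theorem projZ_sub_eq_boundary {N : BimCpx} {χ π : N.V →ₗ[ℂ] N.V}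
    (hd : ∀ v, N.d (χ v) = v - π v - χ (N.d v)) (hπ : ∀ v, π (N.lx (χ v)) = 0)
    (hsq : ∀ v, χ (N.lx (N.lx v)) = N.lx (N.lx (χ v))) (G : N.V × V2 N.V × V2 N.V →ₗ[ℂ] N.V)
    (hG : ∀ v, G v = χ v.2.2.1 + N.lx (χ v.2.2.2)
      - (1 / 2 : ℂ) • (χ (N.lx (χ v.2.1.1)) + N.lx (χ (N.lx (χ v.2.1.2)))))
    (v : N.V × V2 N.V × V2 N.V) :
    projZ N v - ((1 / 2 : ℂ) • (χ (N.lx (χ (N.lx v.1))) + N.lx (χ (N.lx (χ v.1))))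
      + (1 / 2 : ℂ) • (χ (N.lx (π v.2.1.1)) + N.lx (χ (N.lx (π v.2.1.2))))
      + (π v.2.2.1 + N.lx (π v.2.2.2))) = N.d (G v) + G ((ftInvT N).d v) := by
  rw [ftInvT_d, hG, hG, projZ_apply]
  simp only [map_sub, map_add, map_smul, map_neg, N.d_lx, hd, hπ, hsq, map_zero]
  module

/-- A homotopy between the two possible eigenmaps `z`. -/
def stepG : A.stepM.V × V2 A.stepM.V × V2 A.stepM.V →ₗ[ℂ] A.stepM.V where
  toFun v := A.stepChi v.2.2.1 + A.stepM.lx (A.stepChi v.2.2.2)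
    - (1 / 2 : ℂ) • (A.stepChi (A.stepM.lx (A.stepChi v.2.1.1))
      + A.stepM.lx (A.stepChi (A.stepM.lx (A.stepChi v.2.1.2))))
  map_add' v w := by simp only [Prod.fst_add, Prod.snd_add, map_add]; module
  map_smul' c v := by
    simp only [Prod.smul_fst, Prod.smul_snd, map_smul, RingHom.id_apply]; module

theorem stepG_apply (v : A.stepM.V × V2 A.stepM.V × V2 A.stepM.V) :
    stepG v = A.stepChi v.2.2.1 + A.stepM.lx (A.stepChi v.2.2.2)
    - (1 / 2 : ℂ) • (A.stepChi (A.stepM.lx (A.stepChi v.2.1.1))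
      + A.stepM.lx (A.stepChi (A.stepM.lx (A.stepChi v.2.1.2)))) := rfl

theorem stepG_bimod : IsBimodMap (ftInvT A.stepM) A.stepM ((0, 2) + (-1, 0)) stepG := by
  have hsq := A.step.chi_sq
  have hrx := A.step.chi_rx
  refine ⟨?_, ?_, fun p v hv => ?_⟩
  · change ∀ v : A.stepM.V × V2 A.stepM.V × V2 A.stepM.V,
      stepG ((ftInvT A.stepM).lx v) = A.stepM.lx (stepG v)
    intro v
    change ∀ v, A.stepChi (A.stepM.lx (A.stepM.lx v)) = A.stepM.lx (A.stepM.lx (A.stepChi v))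
      at hsq
    rw [Model.ftInvT_lx, stepG_apply, stepG_apply]
    simp only [map_sub, map_add, map_smul, hsq]
    module
  · change ∀ v : A.stepM.V × V2 A.stepM.V × V2 A.stepM.V,
      stepG ((ftInvT A.stepM).rx v) = A.stepM.rx (stepG v)
    intro v
    change ∀ v, A.stepChi (A.stepM.rx v) = A.stepM.rx (A.stepChi v) at hrx
    rw [Model.ftInvT_rx, stepG_apply, stepG_apply]
    simp only [map_sub, map_add, map_smul, hrx, A.stepM.lx_rx]
  · have h0 := A.step.chi_mem
    have h1 := A.stepM.lx_mem
    have h2 := fun p v hv => A.step.chix_mem (p := p) (v := v) hv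
    refine Submodule.sub_mem _ (Submodule.add_mem _ (gr_cast (M := A.stepM) (h0 _ _ hv.2.2.1) ?_)
      (gr_cast (M := A.stepM) (h1 _ _ (h0 _ _ hv.2.2.2)) ?_)) (Submodule.smul_mem _ _
      (Submodule.add_mem _ (gr_cast (M := A.stepM) (h2 _ _ (h0 _ _ hv.2.1.1)) ?_)
        (gr_cast (M := A.stepM) (h1 _ _ (h2 _ _ (h0 _ _ hv.2.1.2))) ?_)))
    all_goals ext <;> simp <;> omega

theorem stepG_boundary (v : A.stepM.V × V2 A.stepM.V × V2 A.stepM.V) :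
    projZ A.stepM v - E.stepZ (A.step.modelQ v)
      = A.stepM.d (stepG v) + stepG ((ftInvT A.stepM).d v) := by
  rw [← projZ_sub_eq_boundary (χ := A.stepChi) (π := A.stepIota ∘ₗ A.stepLam) A.step.d_chi
    (fun v => ?_) A.step.chi_sq stepG stepG_apply v]
  · congr 1
    rw [E.chi_z v.1]
    change (E.z v.1, (A.stepLam v.2.1.1, A.stepLam v.2.1.2),
      (A.stepLam v.2.2.1, A.stepLam v.2.2.2)) =
      (1 / 2 : ℂ) • (((2 : ℂ) • E.z v.1, (0, 0), (0, 0)) : A.SV)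
        + (1 / 2 : ℂ) • (A.stepChi (A.stepM.lx (A.stepIota (A.stepLam v.2.1.1)))
          + A.stepM.lx (A.stepChi (A.stepM.lx (A.stepIota (A.stepLam v.2.1.2)))))
        + (A.stepIota (A.stepLam v.2.2.1) + A.stepM.lx (A.stepIota (A.stepLam v.2.2.2)))
    rw [stepChi_lx_stepIota, stepChi_lx_stepIota, lx_mk_right, Model.stepIota_apply,
      Model.stepIota_apply, Model.stepM_lx]
    ext <;> simp
  · refine (congrArg A.stepIota ((A.step.lam_bimod.map_lx (A.stepChi v)).trans ?_)).trans
      (map_zero A.stepIota)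
    exact (congrArg A.U.lx (A.step.lam_chi v)).trans (map_zero A.U.lx)

/-- The eigenmaps on the next model. -/
def step : Eigen A.step where
  z := E.stepZ
  kap := E.stepKap
  z_chain := by
    refine ⟨⟨fun v => ?_, fun v => ?_, fun p v hv => ?_⟩, E.stepZ_d⟩
    · refine (congrArg E.stepZ (step_stepM_lx v)).trans ?_
      exact Prod.ext (E.z_chain.bimod.map_lx _) rfl
    · refine (congrArg E.stepZ (step_stepM_rx v)).trans ?_
      exact Prod.ext (E.z_chain.bimod.map_rx _) rfl
    · exact ⟨gr_cast (M := A.M) (E.z_chain.bimod.map_gr _ _ hv.1) (by abel),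
        ⟨gr_cast (M := A.U) hv.2.1.1 (by ext <;> simp),
          gr_cast (M := A.U) hv.2.1.2 (by ext <;> simp <;> omega)⟩,
        gr_cast (M := A.U) hv.2.2.1 (by ext <;> simp <;> omega),
        gr_cast (M := A.U) hv.2.2.2 (by ext <;> simp)⟩
  kap_bimod := by
    refine ⟨E.stepKap_lx, E.stepKap_rx, fun p v hv => ?_⟩
    exact ⟨gr_cast (M := A.M) (E.kap_bimod.map_gr _ _ hv.1) (by abel),
        ⟨gr_cast (M := A.U) hv.1.2.2.1 (by ext <;> simp <;> omega),
          gr_cast (M := A.U) hv.1.2.2.2 (by ext <;> simp <;> omega)⟩,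
        Submodule.smul_mem _ _ (gr_cast (M := A.U) hv.2.1.1 (by ext <;> simp <;> omega)),
        Submodule.smul_mem _ _ (gr_cast (M := A.U) hv.2.1.2 (by ext <;> simp <;> omega))⟩
  kap_d := E.stepKap_d
  lam_z _ := rfl
  lam_kap := by
    change ∀ v : A.SV × V2 A.U.V × V2 A.U.V, (1 / 2 : ℂ) • v.2.1.1
      + A.U.lx ((1 / 2 : ℂ) • v.2.1.2) = (1 / 2 : ℂ) • (v.2.1.1 + A.U.lx v.2.1.2)
    simp
  kap_z v := Prod.ext (E.kap_z v.1) rfl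
  kap_kap v := Prod.ext (E.kap_kap v.1) rfl
  chi_z := E.stepChi_z
  projZ_homotopic := ⟨stepG, stepG_bimod, E.stepG_boundary⟩

end Eigen

/-! ### Pairings between `FT` and `FT⁻¹` -/

theorem unit_eq_zero {p : ℤ × ℤ} {f : ℂ[X]} (hf : f ∈ unit.gr p) (h : p.1 ≠ 0 ∨ p.2 < 0) :
    f = 0 := by
  ext n
  by_contra hn
  have := hf n hn
  subst this
  simp at h
  omega

theorem unit_eq_C {f : ℂ[X]} (hf : f ∈ unit.gr 0) : f = Polynomial.C (f.coeff 0) := by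
  ext n
  rw [Polynomial.coeff_C]
  split_ifs with h
  · rw [h]
  · by_contra hn
    have := hf n hn
    simp [Prod.ext_iff] at this
    omega

theorem poly_hom_zero {W : Type*} [AddCommGroup W] [Module ℂ W] (T : ℂ[X] →ₗ[ℂ] W)
    (h : ∀ n : ℕ, T (Polynomial.X ^ n) = 0) (f : ℂ[X]) : T f = 0 := by
  induction f using Polynomial.induction_on' with
  | add f g hf hg => rw [map_add, hf, hg, add_zero]
  | monomial n a =>
    rw [← Polynomial.C_mul_X_pow_eq_monomial, ← Polynomial.smul_eq_C_mul, map_smul, h, smul_zero]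

/-- The element `f ⊗ g` of `B`. -/
def bt (f g : ℂ[X]) : B.V := (tmul 2 f g : TensorV 2 unit unit)

theorem bt_lx (f g : ℂ[X]) : B.lx (bt f g) = bt (Polynomial.X * f) g := rfl

theorem bt_rx (f g : ℂ[X]) : B.rx (bt f g) = bt f (Polynomial.X * g) := rfl

/-- The linear map `f ↦ f ⊗ g`. -/
def btL (g : ℂ[X]) : ℂ[X] →ₗ[ℂ] B.V :=
  Submodule.mkQ _ ∘ₗ (TensorProduct.mk ℂ ℂ[X] ℂ[X]).flip g

/-- The linear map `g ↦ f ⊗ g`. -/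
def btR (f : ℂ[X]) : ℂ[X] →ₗ[ℂ] B.V := Submodule.mkQ _ ∘ₗ TensorProduct.mk ℂ ℂ[X] ℂ[X] f

theorem btR_apply (f g : ℂ[X]) : btR f g = bt f g := rfl

/-- `B` is generated by `1 ⊗ 1` and `x ⊗ 1` as a right module. -/
theorem B_right_zero {W : Type*} [AddCommGroup W] [Module ℂ W] {φ : B.V →ₗ[ℂ] W} {S : W →ₗ[ℂ] W}
    (h : ∀ b, φ (B.rx b) = S (φ b)) (h0 : φ (bt 1 1) = 0) (h1 : φ (bt Polynomial.X 1) = 0)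
    (b : B.V) : φ b = 0 := by
  have hn : ∀ n : ℕ, φ (bt (Polynomial.X ^ n) 1) = 0 ∧ φ (bt (Polynomial.X ^ (n + 1)) 1) = 0 := by
    intro n
    induction n with
    | zero => simpa using ⟨h0, h1⟩
    | succ n ih =>
      refine ⟨ih.2, ?_⟩
      have : bt (Polynomial.X ^ (n + 1 + 1)) 1 = B.lx (B.lx (bt (Polynomial.X ^ n) 1)) := by
        rw [bt_lx, bt_lx, pow_succ', pow_succ']
      rw [this, B_sq, h, h, ih.1, map_zero, map_zero]
  refine B_ext (f := φ) (g := 0) (fun f g => ?_) b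
  refine poly_hom_zero (φ ∘ₗ btR f) (fun n => ?_) g
  rw [LinearMap.comp_apply, btR_apply]
  induction n with
  | zero =>
    rw [pow_zero]
    exact poly_hom_zero (φ ∘ₗ btL 1) (fun n => (hn n).1) f
  | succ n ih => rw [pow_succ', ← bt_rx, h, ih, map_zero]

theorem FTinv_right_zero {W : Type*} [AddCommGroup W] [Module ℂ W] {φ : FTinv.V →ₗ[ℂ] W}
    {S : W →ₗ[ℂ] W} (h : ∀ b, φ (FTinv.rx b) = S (φ b)) (h0 : φ (ftInvI0 (1 : ℂ[X])) = 0)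
    (h1 : φ (ftInvI1 (bt 1 1)) = 0) (h1' : φ (ftInvI1 (bt Polynomial.X 1)) = 0)
    (h2 : φ (ftInvI2 (bt 1 1)) = 0) (h2' : φ (ftInvI2 (bt Polynomial.X 1)) = 0)
    (u : FTinv.V) : φ u = 0 := by
  rw [← ftInv_eta u, map_add, map_add]
  have e0 : φ (ftInvI0 (ftInvP0 u)) = 0 := by
    refine poly_hom_zero (φ ∘ₗ ftInvI0) (fun n => ?_) (ftInvP0 u : ℂ[X])
    induction n with
    | zero => rw [pow_zero]; exact h0
    | succ n ih =>
      rw [pow_succ']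
      have : ftInvI0 (Polynomial.X * Polynomial.X ^ n : ℂ[X])
        = FTinv.rx (ftInvI0 (Polynomial.X ^ n : ℂ[X])) := ftInvI0_rx _
      rw [LinearMap.comp_apply, this, h]
      exact (congrArg S ih).trans (map_zero S)
  have e1 := B_right_zero (φ := φ ∘ₗ ftInvI1) (S := S)
    (fun b => (congrArg φ (ftInvI1_rx b)).trans (h _)) h1 h1' (ftInvP1 u)
  have e2 := B_right_zero (φ := φ ∘ₗ ftInvI2) (S := S)
    (fun b => (congrArg φ (ftInvI2_rx b)).trans (h _)) h2 h2' (ftInvP2 u)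
  rw [LinearMap.comp_apply] at e1 e2
  rw [e0, e1, e2, add_zero, add_zero]

theorem bt_one_mem : bt 1 1 ∈ B.gr (0, -1) :=
  tmul_mem' 2 (M := unit) (N := unit) one_mem one_mem (by ext <;> simp)

theorem bt_X_mem : bt Polynomial.X 1 ∈ B.gr (0, 1) := by
  have := B.lx_mem _ _ bt_one_mem
  rw [bt_lx, mul_one] at this
  exact gr_cast this (by ext <;> simp)

theorem ftI0_mem {p : ℤ × ℤ} {b : B.V} (hb : b ∈ B.gr p) : ftI0 b ∈ FT.gr (p + (0, 1)) :=
  ⟨gr_cast (M := B) hb (by abel), Submodule.zero_mem _, Submodule.zero_mem _⟩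

theorem ftI1_mem {p : ℤ × ℤ} {b : B.V} (hb : b ∈ B.gr p) : ftI1 b ∈ FT.gr (p + (1, -1)) :=
  ⟨Submodule.zero_mem _, gr_cast (M := B) hb (by abel), Submodule.zero_mem _⟩

theorem ftI2_mem {p : ℤ × ℤ} {f : unit.V} (hf : f ∈ unit.gr p) : ftI2 f ∈ FT.gr (p + (2, -2)) :=
  ⟨Submodule.zero_mem _, Submodule.zero_mem _, gr_cast (M := unit) hf (by abel)⟩

theorem ftInvI0_mem {p : ℤ × ℤ} {f : unit.V} (hf : f ∈ unit.gr p) :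
    ftInvI0 f ∈ FTinv.gr (p + (-2, 2)) :=
  ⟨gr_cast (M := unit) hf (by abel), Submodule.zero_mem _, Submodule.zero_mem _⟩

theorem ftInvI1_mem {p : ℤ × ℤ} {b : B.V} (hb : b ∈ B.gr p) :
    ftInvI1 b ∈ FTinv.gr (p + (-1, 1)) :=
  ⟨Submodule.zero_mem _, gr_cast (M := B) hb (by abel), Submodule.zero_mem _⟩

theorem ftInvI2_mem {p : ℤ × ℤ} {b : B.V} (hb : b ∈ B.gr p) :
    ftInvI2 b ∈ FTinv.gr (p + (0, -1)) :=
  ⟨Submodule.zero_mem _, Submodule.zero_mem _, gr_cast (M := B) hb (by abel)⟩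

section Pairing

variable {ε : (tensor FT FTinv).V →ₗ[ℂ] unit.V}

/-- The pairing `(l, u) ↦ ε (l ⊗ u)`. -/
def pairing (ε : (tensor FT FTinv).V →ₗ[ℂ] unit.V) (l : FT.V) : FTinv.V →ₗ[ℂ] ℂ[X] :=
  ε ∘ₗ tmulL FTinv l

theorem pairing_apply (l : FT.V) (u : FTinv.V) : pairing ε l u = ε (tmul 1 l u) := rfl

theorem pairing_add (l l' : FT.V) (u : FTinv.V) :
    pairing ε (l + l') u = pairing ε l u + pairing ε l' u := by
  rw [pairing_apply, add_tmul', map_add]; rfl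

theorem pairing_smul (c : ℂ) (l : FT.V) (u : FTinv.V) :
    pairing ε (c • l) u = c • pairing ε l u := by
  have := smul_tmul_smul 1 (M := FT) (N := FTinv) c 1 l u
  rw [one_smul, mul_one] at this
  rw [pairing_apply, this, map_smul]; rfl

theorem pairing_rx_left (l : FT.V) (u : FTinv.V) :
    pairing ε (FT.rx l) u = pairing ε l (FTinv.lx u) := congrArg ε (tmul_rx l u)

variable (hε : IsChainMap (tensor FT FTinv) unit ε)
include hε

theorem pairing_lx_left (l : FT.V) (u : FTinv.V) :
    pairing ε (FT.lx l) u = Polynomial.X * pairing ε l u := hε.map_lx (tmul 1 l u)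

theorem pairing_rx (l : FT.V) (u : FTinv.V) :
    pairing ε l (FTinv.rx u) = Polynomial.X * pairing ε l u := hε.map_rx (tmul 1 l u)

theorem pairing_mem {a b c : ℤ × ℤ} {l : FT.V} {u : FTinv.V} (hl : l ∈ FT.gr a)
    (hu : u ∈ FTinv.gr b) (h : a + b = c) : pairing ε l u ∈ unit.gr c := by
  have := hε.map_gr _ _ (tmul_mem 1 hl hu)
  rw [add_zero, h] at this
  exact this

theorem pairing_eq_zero {a b : ℤ × ℤ} {l : FT.V} {u : FTinv.V} (hl : l ∈ FT.gr a)
    (hu : u ∈ FTinv.gr b) (h : (a + b).1 ≠ 0 ∨ (a + b).2 < 0) : pairing ε l u = 0 :=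
  unit_eq_zero (pairing_mem hε hl hu rfl) h

theorem pairing_d {a : ℤ × ℤ} {l : FT.V} (hl : l ∈ FT.gr a) (u : FTinv.V) :
    pairing ε (FT.d l) u + parity a.1 • pairing ε l (FTinv.d u) = 0 := by
  have := hε.map_d (tmul 1 l u)
  change ε (tensorD 1 FT FTinv (tmul 1 l u)) = 0 at this
  rw [tensorD_tmul, map_add, FT.sgn_eq _ _ hl] at this
  rw [← pairing_smul]
  exact this

/-- `B` is generated by `1 ⊗ 1` as a bimodule. Left multiplications come out of the pairing, and
right multiplications move to the second argument, which is why the vanishing is assumed for every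
`u`. -/
theorem pairing_left_zero {j : B.V →ₗ[ℂ] FT.V} (hl : ∀ b, j (B.lx b) = FT.lx (j b))
    (hr : ∀ b, j (B.rx b) = FT.rx (j b)) (h : ∀ u, pairing ε (j (bt 1 1)) u = 0)
    (b : B.V) (u : FTinv.V) : pairing ε (j b) u = 0 := by
  let T : FTinv.V → (B.V →ₗ[ℂ] ℂ[X]) := fun u =>
    { toFun := fun b => pairing ε (j b) u
      map_add' := fun b b' => by rw [map_add, pairing_add]
      map_smul' := fun c b => by rw [map_smul, pairing_smul]; rfl }
  refine B_ext (f := T u) (g := 0) (fun f g => ?_) b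
  refine poly_hom_zero (T u ∘ₗ btL g) (fun n => ?_) f
  change pairing ε (j (bt (Polynomial.X ^ n) g)) u = 0
  induction n with
  | zero =>
    rw [pow_zero]
    refine poly_hom_zero (T u ∘ₗ btR 1) (fun n => ?_) g
    change pairing ε (j (bt 1 (Polynomial.X ^ n))) u = 0
    induction n generalizing u with
    | zero => rw [pow_zero]; exact h u
    | succ n ih => rw [pow_succ', ← bt_rx, hr, pairing_rx_left, ih]
  | succ n ih => rw [pow_succ', ← bt_lx, hl, pairing_lx_left hε, ih, mul_zero]

end Pairing

/-! ### The scalar attached to an arbitrary identification `ε` -/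

/-- The two eigenmaps are evaluated by the pairing with the same nonzero scalar. -/
theorem exists_scalar {ε : (tensor FT FTinv).V →ₗ[ℂ] unit.V}
    (hε : IsHomotopyEquiv (tensor FT FTinv) unit ε) :
    ∃ c : ℂ, c ≠ 0 ∧ (∀ u, mate ε eigenW u = c • ftInvP0 u) ∧
      ∀ u, mate ε eigenZ u = c • mult (ftInvP2 u) := by
  have h := hε.1
  -- Values of the pairing lie in `R`, hence in homological degree `0` and nonnegative internal
  -- degree; these two would have internal degree `-1`.
  have z11 : pairing ε (ftI1 (bt 1 1)) (ftInvI1 (bt 1 1)) = 0 :=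
    pairing_eq_zero h (ftI1_mem bt_one_mem) (ftInvI1_mem bt_one_mem) (by simp)
  have z02 : pairing ε (ftI0 (bt 1 1)) (ftInvI2 (bt 1 1)) = 0 :=
    pairing_eq_zero h (ftI0_mem bt_one_mem) (ftInvI2_mem bt_one_mem) (by simp)
  have hw1 : eigenW (1 : ℂ[X]) = ftI2 (1 : ℂ[X]) := rfl
  have hz1 : eigenZ (1 : ℂ[X]) = ftI0 (B.lx (bt 1 1) + B.rx (bt 1 1)) := rfl
  have hw1m : eigenW (1 : ℂ[X]) ∈ FT.gr (2, -2) := gr_cast (M := FT) (ftI2_mem one_mem) (by simp)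
  have hz1m : eigenZ (1 : ℂ[X]) ∈ FT.gr (0, 2) :=
    gr_cast (M := FT) (ftI0_mem (Submodule.add_mem _ (B.lx_mem _ _ bt_one_mem)
      (B.rx_mem _ _ bt_one_mem))) (by ext <;> simp)
  set W := pairing ε (eigenW (1 : ℂ[X])) (ftInvI0 (1 : ℂ[X])) with hW
  -- The chain map equation is evaluated on `1 ⊗ 1` in the middle term of `FT` and `1` in the first
  -- term of `FT⁻¹`. The contribution that contains `z11` drops out.
  have hWA : W = pairing ε (ftI1 (bt 1 1)) (ftInvI1 (bt Polynomial.X 1)) := by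
    have := pairing_d h (ftI1_mem bt_one_mem) (ftInvI0 (1 : ℂ[X]))
    have e1 : FT.d (ftI1 (bt 1 1)) = eigenW (1 : ℂ[X]) :=
      Prod.ext rfl (Prod.ext (map_zero delta) ((mult_tmul 1 1).trans (mul_one 1)))
    have e2 : FTinv.d (ftInvI0 (1 : ℂ[X]))
        = ftInvI1 (B.lx (bt 1 1)) + FTinv.rx (ftInvI1 (bt 1 1)) := by
      rw [← ftInvI1_rx, ← map_add]
      exact Prod.ext rfl (Prod.ext rfl (map_zero delta))
    rw [e1, e2, map_add, pairing_rx h, z11, mul_zero, add_zero, bt_lx, mul_one] at this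
    simp only [Prod.fst_add, zero_add, parity_one, neg_one_smul] at this
    exact eq_of_sub_eq_zero ((sub_eq_add_neg _ _).trans this)
  -- The same equation on `1 ⊗ 1` in the first term of `FT` and `1 ⊗ 1` in the middle term of
  -- `FT⁻¹`. Both differentials are `delta`, so their common factor `1/2` cancels.
  have hAB : pairing ε (ftI1 (bt 1 1)) (ftInvI1 (bt Polynomial.X 1))
      = pairing ε (ftI0 (bt 1 1)) (ftInvI2 (bt Polynomial.X 1)) := by
    have := pairing_d h (ftI0_mem bt_one_mem) (ftInvI1 (bt 1 1))
    have hδ : delta (bt 1 1) = (1 / 2 : ℂ) • (B.lx (bt 1 1) + (-1 : ℂ) • B.rx (bt 1 1)) := by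
      rw [neg_one_smul, ← sub_eq_add_neg]; rfl
    have e1 : FT.d (ftI0 (bt 1 1))
        = (1 / 2 : ℂ) • (FT.lx (ftI1 (bt 1 1)) + (-1 : ℂ) • FT.rx (ftI1 (bt 1 1))) := by
      rw [← ftI1_rx, ← ftI1_lx, ← map_smul, ← map_add, ← map_smul, ← hδ]
      exact Prod.ext rfl (Prod.ext rfl (map_zero mult))
    have e2 : FTinv.d (ftInvI1 (bt 1 1))
        = (1 / 2 : ℂ) • (FTinv.lx (ftInvI2 (bt 1 1)) + (-1 : ℂ) • FTinv.rx (ftInvI2 (bt 1 1))) := by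
      rw [← ftInvI2_rx, ← ftInvI2_lx, ← map_smul, ← map_add, ← map_smul, ← hδ]
      exact Prod.ext rfl (Prod.ext (map_zero comult) rfl)
    rw [e1, e2, map_smul, map_add, map_smul, pairing_smul, pairing_add, pairing_smul, pairing_rx h,
      pairing_lx_left h, pairing_rx_left, z11, z02, ← ftInvI1_lx, ← ftInvI2_lx, bt_lx, mul_one,
      mul_zero, smul_zero, zero_add, add_zero] at this
    simp only [Prod.fst_add, zero_add, parity_zero, one_smul, ← smul_add, add_zero] at this
    have := (smul_eq_zero_iff_right (by norm_num : (1 / 2 : ℂ) ≠ 0)).1 this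
    rw [neg_one_smul] at this
    exact (eq_of_neg_add_eq_zero this)
  have hZB : pairing ε (eigenZ (1 : ℂ[X])) (ftInvI2 (bt 1 1))
      = pairing ε (ftI0 (bt 1 1)) (ftInvI2 (bt Polynomial.X 1)) := by
    rw [hz1, map_add, ftI0_lx, ftI0_rx, pairing_add, pairing_lx_left h, pairing_rx_left, z02,
      mul_zero, zero_add, ← ftInvI2_lx, bt_lx, mul_one]
  have hWC : W = Polynomial.C (W.coeff 0) :=
    unit_eq_C (pairing_mem h hw1m (ftInvI0_mem one_mem) (by ext <;> simp))
  -- If the scalar were zero, then by `hWA` and `hAB` no pair of generators would be left on which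
  -- `ε` can be nonzero, and `ε` would vanish.
  have hW0 : W.coeff 0 ≠ 0 := by
    intro hc
    rw [hc, map_zero] at hWC
    have p0 := pairing_left_zero h ftI0_lx ftI0_rx fun u =>
      FTinv_right_zero (φ := pairing ε (ftI0 (bt 1 1))) (S := LinearMap.mulLeft ℂ Polynomial.X)
        (pairing_rx h _)
        (pairing_eq_zero h (ftI0_mem bt_one_mem) (ftInvI0_mem one_mem) (by simp))
        (pairing_eq_zero h (ftI0_mem bt_one_mem) (ftInvI1_mem bt_one_mem) (by simp))
        (pairing_eq_zero h (ftI0_mem bt_one_mem) (ftInvI1_mem bt_X_mem) (by simp))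
        z02 (by rw [← hAB, ← hWA, hWC]) u
    have p1 := pairing_left_zero h ftI1_lx ftI1_rx fun u =>
      FTinv_right_zero (φ := pairing ε (ftI1 (bt 1 1))) (S := LinearMap.mulLeft ℂ Polynomial.X)
        (pairing_rx h _)
        (pairing_eq_zero h (ftI1_mem bt_one_mem) (ftInvI0_mem one_mem) (by simp))
        z11 (by rw [← hWA, hWC])
        (pairing_eq_zero h (ftI1_mem bt_one_mem) (ftInvI2_mem bt_one_mem) (by simp))
        (pairing_eq_zero h (ftI1_mem bt_one_mem) (ftInvI2_mem bt_X_mem) (by simp)) u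
    have p2 : ∀ (f : ℂ[X]) u, pairing ε (ftI2 f) u = 0 := by
      intro f u
      have hone := FTinv_right_zero (φ := pairing ε (ftI2 (1 : ℂ[X])))
        (S := LinearMap.mulLeft ℂ Polynomial.X) (pairing_rx h _) hWC
        (pairing_eq_zero h (ftI2_mem one_mem) (ftInvI1_mem bt_one_mem) (by simp))
        (pairing_eq_zero h (ftI2_mem one_mem) (ftInvI1_mem bt_X_mem) (by simp))
        (pairing_eq_zero h (ftI2_mem one_mem) (ftInvI2_mem bt_one_mem) (by simp))
        (pairing_eq_zero h (ftI2_mem one_mem) (ftInvI2_mem bt_X_mem) (by simp)) u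
      let T : ℂ[X] →ₗ[ℂ] ℂ[X] :=
        { toFun := fun f => pairing ε (ftI2 f) u
          map_add' := fun b b' => (congrArg (pairing ε · u) (map_add ftI2 b b')).trans
            (pairing_add _ _ _)
          map_smul' := fun c b => (congrArg (pairing ε · u) (map_smul ftI2 c b)).trans
            (pairing_smul _ _ _) }
      refine poly_hom_zero T (fun n => ?_) f
      change pairing ε (ftI2 (Polynomial.X ^ n : ℂ[X])) u = 0
      induction n with
      | zero => rw [pow_zero]; exact hone
      | succ n ih =>
        rw [pow_succ']
        have : ftI2 (Polynomial.X * Polynomial.X ^ n : ℂ[X])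
          = FT.lx (ftI2 (Polynomial.X ^ n : ℂ[X])) := ftI2_lx _
        rw [this, pairing_lx_left h, ih, mul_zero]
    have hzero : ε = 0 := by
      refine tensorV_ext fun l u => ?_
      change pairing ε l u = 0
      rw [← ft_eta l, pairing_add, pairing_add, p0, p1, p2, add_zero, add_zero]
    -- With `ε = 0`, the homotopy between `ε ∘ g` and the identity of `R`, whose differential is
    -- zero, forces `-1 = 0`.
    obtain ⟨-, g, -, -, s, -, e⟩ := hε
    have := LinearMap.congr_fun e (1 : ℂ[X])
    rw [hzero] at this
    simp at this
  refine ⟨W.coeff 0, hW0, fun u => ?_, fun u => ?_⟩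
  · have := FTinv_right_zero
      (φ := pairing ε (eigenW (1 : ℂ[X])) - W.coeff 0 • ftInvP0)
      (S := LinearMap.mulLeft ℂ Polynomial.X) ?_ ?_ ?_ ?_ ?_ ?_ u
    · exact sub_eq_zero.1 this
    · intro b
      rw [LinearMap.sub_apply, LinearMap.sub_apply, map_sub, pairing_rx h]
      congr 1
      exact (map_smul (LinearMap.mulLeft ℂ (Polynomial.X : ℂ[X])) _ _).symm
    · refine sub_eq_zero.2 (hWC.trans ?_)
      refine (mul_one _).symm.trans (Polynomial.smul_eq_C_mul _).symm
    · exact sub_eq_zero.2 ((pairing_eq_zero h hw1m (ftInvI1_mem bt_one_mem) (by simp)).trans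
        (smul_zero (W.coeff 0)).symm)
    · exact sub_eq_zero.2 ((pairing_eq_zero h hw1m (ftInvI1_mem bt_X_mem) (by simp)).trans
        (smul_zero (W.coeff 0)).symm)
    · exact sub_eq_zero.2 ((pairing_eq_zero h hw1m (ftInvI2_mem bt_one_mem) (by simp)).trans
        (smul_zero (W.coeff 0)).symm)
    · exact sub_eq_zero.2 ((pairing_eq_zero h hw1m (ftInvI2_mem bt_X_mem) (by simp)).trans
        (smul_zero (W.coeff 0)).symm)
  · have := FTinv_right_zero
      (φ := pairing ε (eigenZ (1 : ℂ[X])) - W.coeff 0 • mult ∘ₗ ftInvP2)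
      (S := LinearMap.mulLeft ℂ Polynomial.X) ?_ ?_ ?_ ?_ ?_ ?_ u
    · exact sub_eq_zero.1 this
    · intro b
      rw [LinearMap.sub_apply, LinearMap.sub_apply, map_sub, pairing_rx h]
      congr 1
      refine Eq.trans ?_ (map_smul (LinearMap.mulLeft ℂ (Polynomial.X : ℂ[X])) _ _).symm
      exact congrArg (W.coeff 0 • ·) (mult_rx (ftInvP2 b))
    · exact sub_eq_zero.2 ((pairing_eq_zero h hz1m (ftInvI0_mem one_mem) (by simp)).trans
        ((congrArg (W.coeff 0 • ·) (map_zero mult)).trans (smul_zero (W.coeff 0))).symm)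
    · exact sub_eq_zero.2 ((pairing_eq_zero h hz1m (ftInvI1_mem bt_one_mem) (by simp)).trans
        ((congrArg (W.coeff 0 • ·) (map_zero mult)).trans (smul_zero (W.coeff 0))).symm)
    · exact sub_eq_zero.2 ((pairing_eq_zero h hz1m (ftInvI1_mem bt_X_mem) (by simp)).trans
        ((congrArg (W.coeff 0 • ·) (map_zero mult)).trans (smul_zero (W.coeff 0))).symm)
    · refine sub_eq_zero.2 ((hZB.trans (hAB.symm.trans hWA.symm)).trans (hWC.trans ?_))
      refine ((mul_one _).symm.trans (Polynomial.smul_eq_C_mul _).symm).trans ?_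
      exact congrArg (W.coeff 0 • ·) ((mult_tmul 1 1).trans (mul_one 1)).symm
    -- Left and right multiplication by `x` agree on `x ⊗ 1 + 1 ⊗ x`, so the value on the generator
    -- `x ⊗ 1` follows from the value on `1 ⊗ 1`.
    · have e1 : FT.lx (eigenZ (1 : ℂ[X])) = FT.rx (eigenZ (1 : ℂ[X])) := by
        rw [hz1, ← ftI0_lx, ← ftI0_rx, map_add B.lx, map_add B.rx, B_sq, B.lx_rx, add_comm]
      have e2 : ftInvI2 (bt Polynomial.X 1) = FTinv.lx (ftInvI2 (bt 1 1)) := by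
        rw [← ftInvI2_lx, bt_lx, mul_one]
      rw [LinearMap.sub_apply, e2, ← pairing_rx_left, ← e1, pairing_lx_left h,
        hZB.trans (hAB.symm.trans hWA.symm), ← e2, sub_eq_zero, hWC, mul_comm]
      refine (Polynomial.smul_eq_C_mul _).symm.trans ?_
      rw [Polynomial.coeff_C_zero]
      exact congrArg (W.coeff 0 • ·) ((mult_tmul Polynomial.X 1).trans (mul_one _)).symm

/-- The maps induced by the eigenmaps in coordinates. -/
theorem contract_eq {ε : (tensor FT FTinv).V →ₗ[ℂ] unit.V}
    (hε : IsHomotopyEquiv (tensor FT FTinv) unit ε) :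
    ∃ c : ℂ, c ≠ 0 ∧ ∀ N : BimCpx,
      (∀ v, contract (mate ε eigenW) (mate_rx hε eigenW) N v = c • projW N (ftInvEquiv N v)) ∧
      ∀ v, contract (mate ε eigenZ) (mate_rx hε eigenZ) N v = c • projZ N (ftInvEquiv N v) := by
  obtain ⟨c, hc, hw, hz⟩ := exists_scalar hε
  refine ⟨c, hc, fun N => ⟨?_, ?_⟩⟩
  · refine LinearMap.congr_fun (g := c • projW N ∘ₗ (ftInvEquiv N).toLinearMap)
      (tensorV_ext fun u n => ?_)
    change Polynomial.aeval N.lx (mate ε eigenW u : ℂ[X]) n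
      = c • Polynomial.aeval N.lx (ftInvP0 u : ℂ[X]) n
    rw [hw]
    exact LinearMap.congr_fun (map_smul (Polynomial.aeval N.lx) c (ftInvP0 u : ℂ[X])) n
  · refine LinearMap.congr_fun (g := c • projZ N ∘ₗ (ftInvEquiv N).toLinearMap)
      (tensorV_ext fun u n => ?_)
    change Polynomial.aeval N.lx (mate ε eigenZ u : ℂ[X]) n = c • btMult N (actB N (ftInvP2 u) n)
    rw [hz, ← aeval_mult]
    exact LinearMap.congr_fun (map_smul (Polynomial.aeval N.lx) c (mult (ftInvP2 u) : ℂ[X])) n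

/-! ### The tower of minimal models -/

/-- A sequence of complexes with the structure of the minimal models of the powers of `FT⁻¹`. -/
structure Tower where
  M : ℕ → BimCpx
  z : ∀ k, (M (k + 1)).V →ₗ[ℂ] (M k).V
  w : ∀ k, (M (k + 1)).V →ₗ[ℂ] (M k).V
  kap : ∀ k, (M (k + 1)).V →ₗ[ℂ] (M k).V
  inl : ∀ k, (M k).V →ₗ[ℂ] (M (k + 1)).V
  tail : ∀ k, (M (k + 1)).V →ₗ[ℂ] (M (k + 2)).V
  z_chain : ∀ k, IsChainDeg (0, 2) (M (k + 1)) (M k) (z k)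
  w_chain : ∀ k, IsChainDeg (2, -2) (M (k + 1)) (M k) (w k)
  kap_bimod : ∀ k, IsBimodMap (M (k + 1)) (M k) (1, 0) (kap k)
  kap_d : ∀ k v, kap k ((M (k + 1)).d v) = (M k).lx (w k v) - (M k).d (kap k v)
  w_z : ∀ k v, w k (z (k + 1) v) = z k (w (k + 1) v)
  kap_z : ∀ k v, kap k (z (k + 1) v) = z k (kap (k + 1) v)
  kap_w : ∀ k v, kap k (w (k + 1) v) = w k (kap (k + 1) v)
  kap_kap : ∀ k v, kap k (kap (k + 1) v) = (1 / 2 : ℂ) • z k (w (k + 1) v)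
  -- The maps `inl` and `tail` are splittings of bigraded bimodules; compatibility with the
  -- differentials is not asked for and fails in the models.
  inl_bimod : ∀ k, IsBimodMap (M k) (M (k + 1)) (-2, 2) (inl k)
  tail_bimod : ∀ k, IsBimodMap (M (k + 1)) (M (k + 2)) (0, -2) (tail k)
  w_inl : ∀ k v, w k (inl k v) = v
  z_inl : ∀ k v, z (k + 1) (inl (k + 1) v) = inl k (z k v)
  w_tail : ∀ k v, w (k + 1) (tail k v) = 0
  z_tail : ∀ k v, z (k + 1) (tail k v) = v - inl k (w k v)
  inl_w : ∀ k v, inl (k + 1) (w (k + 1) v) + tail k (z (k + 1) v) = v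
  -- No chain condition on `f` is needed. This rigidity disposes of the unknown long entry of an
  -- arbitrary convolution.
  hom_zero : ∀ k f, IsBimodMap (M (k + 2)) (M k) (1, 0) f → ∀ v, f v = 0

/-- The minimal model of `FT^(-k)`. -/
def model : ℕ → Model
  | 0 => Model.base unit fun _ => rfl
  | k + 1 => (model k).step

/-- The eigenmaps on the minimal models. -/
def eigen : (k : ℕ) → Eigen (model k)
  | 0 => Eigen.base unit fun _ => rfl
  | k + 1 => (eigen k).step

/-! ### Generators of the minimal models -/

/-- `U` is `q^(-k) R`, generated as a right module in the single degree `(0, -2k)`. -/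
theorem model_U_gen (k : ℕ) {W : Type*} [AddCommGroup W] [Module ℂ W]
    (f : (model k).U.V →ₗ[ℂ] W) {S : W →ₗ[ℂ] W} (hS : ∀ u, f ((model k).U.rx u) = S (f u))
    (h : ∀ u, u ∈ (model k).U.gr (0, -2 * (k : ℤ)) → f u = 0) (u : (model k).U.V) : f u = 0 := by
  induction k with
  | zero =>
    have h1 : f (1 : ℂ[X]) = 0 := h _ one_mem
    refine poly_hom_zero f (fun n => ?_) (u : ℂ[X])
    induction n with
    | zero => rw [pow_zero]; exact h1
    | succ n ih =>
      rw [pow_succ']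
      exact (hS (Polynomial.X ^ n : ℂ[X])).trans ((congrArg S ih).trans (map_zero S))
  | succ k ih =>
    refine ih f hS (fun u hu => h u ?_) u
    exact gr_cast (M := (model k).U) hu (by ext <;> simp; omega)

theorem V2_gen {U N : BimCpx} {n : ℤ}
    (hU : ∀ g : U.V →ₗ[ℂ] N.V, (∀ u, g (U.rx u) = N.rx (g u)) →
      (∀ u ∈ U.gr (0, n), g u = 0) → ∀ u, g u = 0)
    (g : V2 U.V →ₗ[ℂ] N.V) (gl : ∀ b : V2 U.V, g (U.lx (U.lx b.2), b.1) = N.lx (g b))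
    (gr : ∀ b : V2 U.V, g (U.rx b.1, U.rx b.2) = N.rx (g b))
    (g0 : ∀ u ∈ U.gr (0, n), g (u, 0) = 0) (b : V2 U.V) : g b = 0 := by
  have e0 : ∀ u, g (u, 0) = 0 := by
    refine hU (g ∘ₗ LinearMap.inl ℂ U.V U.V) (fun u => ?_) g0
    have := gr (u, 0)
    simp only [map_zero] at this
    exact this
  have e1 : ∀ u, g (0, u) = 0 := by
    intro u
    have := gl (u, 0)
    simp only [e0, map_zero] at this
    exact this
  have : b = (b.1, 0) + (0, b.2) := by simp
  rw [this, map_add, e0, e1, add_zero]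

/-- The weight of a bidegree `(i, a)` is `2i + a`. In each of the three terms, the shift together
with the degree of `1 ⊗ 1` in `B`, if present, lowers the weight by exactly `2`. Generators of
weight `n` thus give generators of weight `n - 2`. -/
theorem Model.stepM_gen (A : Model) {n : ℤ} {N : BimCpx} (f : A.SV →ₗ[ℂ] N.V)
    (hl : ∀ v : A.SV, f (A.stepM.lx v) = N.lx (f v))
    (hr : ∀ v : A.SV, f (A.stepM.rx v) = N.rx (f v))
    (hM : ∀ g : A.M.V →ₗ[ℂ] N.V, (∀ u, g (A.M.lx u) = N.lx (g u)) →
      (∀ u, g (A.M.rx u) = N.rx (g u)) →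
      (∀ p u, 2 * p.1 + p.2 = n → u ∈ A.M.gr p → g u = 0) → ∀ u, g u = 0)
    (hU : ∀ g : A.U.V →ₗ[ℂ] N.V, (∀ u, g (A.U.rx u) = N.rx (g u)) →
      (∀ u ∈ A.U.gr (0, n), g u = 0) → ∀ u, g u = 0)
    (h : ∀ (p : ℤ × ℤ) (v : A.SV), 2 * p.1 + p.2 = n - 2 → v ∈ A.stepM.gr p → f v = 0)
    (v : A.SV) : f v = 0 := by
  have h1 : ∀ m : A.M.V, f (m, ((0, 0), (0, 0))) = 0 := by
    refine hM (f ∘ₗ LinearMap.inl ℂ A.M.V (V2 A.U.V × V2 A.U.V)) (fun u => ?_) (fun u => ?_)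
      (fun p u hp hu => ?_)
    · refine Eq.trans (congrArg f ?_) (hl (u, ((0, 0), (0, 0))))
      rw [Model.stepM_lx]; simp; rfl
    · refine Eq.trans (congrArg f ?_) (hr (u, ((0, 0), (0, 0))))
      rw [Model.stepM_rx]; simp; rfl
    · refine h (p + (-2, 2)) (u, ((0, 0), (0, 0))) (by simp; omega)
        ⟨gr_cast (M := A.M) hu (by abel), ?_⟩
      exact Submodule.zero_mem _
  have h2 : ∀ b : V2 A.U.V, f (0, (b, (0, 0))) = 0 := by
    refine V2_gen hU (f ∘ₗ LinearMap.inr ℂ A.M.V (V2 A.U.V × V2 A.U.V) ∘ₗ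
      LinearMap.inl ℂ (V2 A.U.V) (V2 A.U.V)) (fun b => ?_) (fun b => ?_) (fun u hu => ?_)
    · refine Eq.trans (congrArg f ?_) (hl (0, (b, (0, 0))))
      rw [Model.stepM_lx]; simp; rfl
    · refine Eq.trans (congrArg f ?_) (hr (0, (b, (0, 0))))
      rw [Model.stepM_rx]; simp; rfl
    · refine h (-1, n) (0, ((u, 0), (0, 0))) (by simp; omega) ⟨Submodule.zero_mem _,
        ⟨gr_cast (M := A.U) hu (by ext <;> simp), ?_⟩, ?_⟩ <;> exact Submodule.zero_mem _
  have h3 : ∀ b : V2 A.U.V, f (0, ((0, 0), b)) = 0 := by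
    refine V2_gen hU (f ∘ₗ LinearMap.inr ℂ A.M.V (V2 A.U.V × V2 A.U.V) ∘ₗ
      LinearMap.inr ℂ (V2 A.U.V) (V2 A.U.V)) (fun b => ?_) (fun b => ?_) (fun u hu => ?_)
    · refine Eq.trans (congrArg f ?_) (hl (0, ((0, 0), b)))
      rw [Model.stepM_lx]; simp; rfl
    · refine Eq.trans (congrArg f ?_) (hr (0, ((0, 0), b)))
      rw [Model.stepM_rx]; simp; rfl
    · refine h (0, n - 2) (0, ((0, 0), (u, 0))) (by simp) ⟨Submodule.zero_mem _,
        ?_, ⟨gr_cast (M := A.U) hu (by ext <;> simp; ring), ?_⟩⟩ <;> exact Submodule.zero_mem _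
  have hv : v = (v.1, ((0, 0), (0, 0))) + ((0, (v.2.1, (0, 0))) + (0, ((0, 0), v.2.2))) := by
    ext <;> simp
  rw [hv, map_add, map_add, h1, h2, h3, add_zero, add_zero]

theorem model_gen (k : ℕ) {N : BimCpx} (f : (model k).M.V →ₗ[ℂ] N.V)
    (hl : ∀ u, f ((model k).M.lx u) = N.lx (f u)) (hr : ∀ u, f ((model k).M.rx u) = N.rx (f u))
    (h : ∀ p u, 2 * p.1 + p.2 = -2 * (k : ℤ) → u ∈ (model k).M.gr p → f u = 0)
    (u : (model k).M.V) : f u = 0 := by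
  induction k with
  | zero => exact model_U_gen 0 f hr (fun u hu => h (0, 0) u (by simp) hu) u
  | succ k ih =>
    refine (model k).stepM_gen (n := -2 * (k : ℤ)) f hl hr ih
      (fun g gr g0 => model_U_gen k g gr g0) (fun p v hp hv => h p v ?_ hv) u
    push_cast; omega

theorem Model.inl_lx (A : Model) (v : A.M.V) : ((A.M.lx v, ((0, 0), (0, 0))) : A.SV) =
    A.stepM.lx (v, ((0, 0), (0, 0))) := by
  rw [Model.stepM_lx]; simp

theorem Model.inl_rx (A : Model) (v : A.M.V) : ((A.M.rx v, ((0, 0), (0, 0))) : A.SV) =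
    A.stepM.rx (v, ((0, 0), (0, 0))) := by
  rw [Model.stepM_rx]; simp

theorem prod_split {V W : Type*} [AddCommGroup V] [AddCommGroup W] (v : V × W) :
    (v.1, 0) + (0, v.2) = v := by simp

/-! ### Lower bounds for the degrees of the minimal models -/

theorem model_U_bound (k : ℕ) (p : ℤ × ℤ) (u : (model k).U.V) (hp : 2 * p.1 + p.2 < -2 * (k : ℤ))
    (hu : u ∈ (model k).U.gr p) : u = 0 := by
  induction k generalizing p with
  | zero => exact unit_eq_zero hu (by simp at hp; omega)
  | succ k ih => exact ih (p - (0, -2)) u (by simp at hp ⊢; omega) hu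

/-- The weight of the generators bounds all weights from below, since `x` has weight `2`. In
coordinates, the terms over `1 ⊗ 1` lower the weight of `U` by `2` and those over `x ⊗ 1` preserve
it. -/
theorem model_bound (k : ℕ) (p : ℤ × ℤ) (v : (model k).M.V) (hp : 2 * p.1 + p.2 < -2 * (k : ℤ))
    (hv : v ∈ (model k).M.gr p) : v = 0 := by
  induction k generalizing p with
  | zero => exact model_U_bound 0 p v hp hv
  | succ k ih =>
    push_cast at hp
    refine Prod.ext (ih _ _ ?_ hv.1) (Prod.ext (Prod.ext (model_U_bound k _ _ ?_ hv.2.1.1)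
      (model_U_bound k _ _ ?_ hv.2.1.2)) (Prod.ext (model_U_bound k _ _ ?_ hv.2.2.1)
      (model_U_bound k _ _ ?_ hv.2.2.2)))
    all_goals simp; omega

/-- The tower of the minimal models. -/
def tower : Tower where
  M k := (model k).M
  z k := (eigen k).z
  w k := LinearMap.fst ℂ (model k).M.V _
  kap k := (eigen k).kap
  inl k := LinearMap.inl ℂ (model k).M.V (V2 (model k).U.V × V2 (model k).U.V)
  tail k := LinearMap.inr ℂ (model k).SV (V2 (model k).U.V × V2 (model k).U.V) ∘ₗ
    LinearMap.snd ℂ (model k).M.V (V2 (model k).U.V × V2 (model k).U.V)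
  z_chain k := (eigen k).z_chain
  w_chain k := ⟨⟨fun _ => rfl, fun _ => rfl, fun p v hv =>
    gr_cast (M := (model k).M) hv.1 (by ext <;> simp; omega)⟩, fun _ => rfl⟩
  kap_bimod k := (eigen k).kap_bimod
  kap_d k := (eigen k).kap_d
  w_z k v := rfl
  kap_z k := (eigen k).kap_z
  kap_w k v := rfl
  kap_kap k := (eigen k).kap_kap
  inl_bimod k := by
    refine ⟨fun v => ?_, fun v => ?_, fun p v hv => ⟨gr_cast (M := (model k).M) hv (by abel), ?_⟩⟩
    · exact (model k).inl_lx v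
    · exact (model k).inl_rx v
    · exact Submodule.zero_mem _
  tail_bimod k := by
    refine ⟨fun v => ?_, fun v => ?_, fun p v hv => ⟨Submodule.zero_mem _, ⟨?_, ?_⟩, ?_, ?_⟩⟩
    · exact Prod.ext (map_zero (model k).step.M.lx).symm rfl
    · exact Prod.ext (map_zero (model k).step.M.rx).symm rfl
    · exact gr_cast (M := (model k).U) hv.2.1.1 (by ext <;> simp)
    · exact gr_cast (M := (model k).U) hv.2.1.2 (by ext <;> simp <;> omega)
    · exact gr_cast (M := (model k).U) hv.2.2.1 (by ext <;> simp <;> omega)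
    · exact gr_cast (M := (model k).U) hv.2.2.2 (by ext <;> simp)
  w_inl k v := rfl
  z_inl k v := rfl
  w_tail k v := rfl
  z_tail k := by
    change ∀ v : (model k).SV, (((eigen k).z 0, v.2.1, v.2.2) : (model k).SV) = v - (v.1, (0, 0))
    intro v
    rw [map_zero]
    ext <;> simp
  inl_w k := by
    exact prod_split (V := (model k).SV) (W := V2 (model k).U.V × V2 (model k).U.V)
  hom_zero k f hf := by
    -- A generator of weight `-2k-4` goes to weight `-2k-2` under a map of degree `(1, 0)`, below
    -- the bound `-2k` of the target.
    refine model_gen (k + 2) f hf.map_lx hf.map_rx fun p u hp hu => ?_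
    refine model_bound k _ _ ?_ (hf.map_gr p u hu)
    push_cast at hp
    simp; omega

/-! ### Comparison of `FT^(-k)` and its eigenmaps with the models -/

/-- The minimal models are homotopy retracts. -/
def ret : (k : ℕ) → Retract (tower.M k) (FTpow k)
  | 0 => ⟨LinearMap.id, LinearMap.id, 0, .id, .id, .zero, fun _ => rfl, fun v => by
      change v = v - (_ + _); simp⟩
  | k + 1 => ((model k).retract.trans (ret k).ftInvT).trans
      (.ofEquiv (ftInvEquiv (FTpow k)) (ftInvEquiv_chain (FTpow k)))

theorem Retract.homotopic {M N L : BimCpx} (r : Retract M N) {j : ℤ × ℤ} {f : L.V →ₗ[ℂ] N.V}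
    (hf : IsChainDeg j L N f) : HomotopicDeg j L N f (r.i ∘ₗ r.p ∘ₗ f) := by
  refine ⟨r.h ∘ₗ f, (r.h_bimod.comp hf.bimod), fun v => ?_⟩
  simp [r.i_p, hf.map_d]

theorem projZ_natural {M N : BimCpx} (f : N.V →ₗ[ℂ] M.V) (hf : ∀ v, f (N.lx v) = M.lx (f v))
    (v : N.V × V2 N.V × V2 N.V) : f (projZ N v) = projZ M (ftInvTMap 1 f v) := by
  rw [projZ_apply, projZ_apply, ftInvTMap_apply, map_add, hf]

/-- The maps induced by the eigenmaps are homotopic to multiples of those of the models. -/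
theorem eigenStep_homotopic {ε : (tensor FT FTinv).V →ₗ[ℂ] unit.V}
    (hε : IsHomotopyEquiv (tensor FT FTinv) unit ε) :
    ∃ c : ℂ, c ≠ 0 ∧ ∀ k,
      HomotopicDeg (2, -2) (FTpow (k + 1)) (FTpow k) (eigenStep hε eigenW k)
        (c • (ret k).i ∘ₗ tower.w k ∘ₗ (ret (k + 1)).p) ∧
      HomotopicDeg (0, 2) (FTpow (k + 1)) (FTpow k) (eigenStep hε eigenZ k)
        (c • (ret k).i ∘ₗ tower.z k ∘ₗ (ret (k + 1)).p) := by
  obtain ⟨c, hc, h⟩ := contract_eq hε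
  refine ⟨c, hc, fun k => ⟨?_, ?_⟩⟩
  · have h1 := (ret k).homotopic ((projW_chain (FTpow k)).comp (ftInvEquiv_chain (FTpow k)).deg)
    refine (HomotopicDeg.of_eq (g := c • projW (FTpow k) ∘ₗ (ftInvEquiv (FTpow k)).toLinearMap)
      (h (FTpow k)).1).trans (((h1.congr (zero_add _)).smul c).trans (.of_eq fun v => ?_))
    rfl
  · have h1 := (ret k).homotopic ((projZ_chain (FTpow k)).comp (ftInvEquiv_chain (FTpow k)).deg)
    -- After compression by `i p` on the target, naturality of `projZ` moves `p` inside, where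
    -- `projZ` on the model may be replaced by `z`. For `w` no such replacement is needed: it is a
    -- projection throughout.
    have h2 := (((eigen k).projZ_homotopic.comp_right
      ((ret k).ftInvT.p_chain.deg.comp (ftInvEquiv_chain (FTpow k)).deg)).comp_left
      (ret k).i_chain.deg).congr (k := (0, 2)) (by simp)
    refine (HomotopicDeg.of_eq (g := c • projZ (FTpow k) ∘ₗ (ftInvEquiv (FTpow k)).toLinearMap)
      (h (FTpow k)).2).trans (((h1.congr (zero_add _)).smul c).trans
        ((HomotopicDeg.of_eq fun v => congrArg (fun y => c • (ret k).i y) ?_).trans (h2.smul c)))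
    exact projZ_natural (ret k).p (ret k).p_chain.deg.bimod.map_lx _

/-! ### Construction of convolutions -/

/-- The family `v (m + k)`, for `m = 0, 1, …`. -/
def shiftDown (V : ℕ → Type) [∀ m, AddCommGroup (V m)] [∀ m, Module ℂ (V m)] (k : ℕ) :
    (DirectSum ℕ V) →ₗ[ℂ] (DirectSum ℕ fun m => V (m + k)) where
  toFun v := DFinsupp.comapDomain (· + k) (add_left_injective k) v
  map_add' v w := DFinsupp.comapDomain_add _ _ v w
  map_smul' c v := DFinsupp.comapDomain_smul _ _ c v

/-- The operator on the direct sum with the entries `a m` from the term `m + k` to the term `m`. -/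
def lowering {P : ℕ → BimCpx} {k : ℕ} (a : ∀ m, (P (m + k)).V →ₗ[ℂ] (P m).V) :
    (totalSum P).V →ₗ[ℂ] (totalSum P).V :=
  (DFinsupp.mapRange.linearMap a : (DirectSum ℕ fun m => (P (m + k)).V) →ₗ[ℂ] _) ∘ₗ
    shiftDown (fun m => (P m).V) k

theorem lowering_apply {P : ℕ → BimCpx} {k : ℕ} (a : ∀ m, (P (m + k)).V →ₗ[ℂ] (P m).V)
    (v : (totalSum P).V) (m : ℕ) :
    (lowering a v : DirectSum ℕ fun m => (P m).V) m
      = a m ((v : DirectSum ℕ fun m => (P m).V) (m + k)) := rfl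

theorem lowering_bimod {P : ℕ → BimCpx} {k : ℕ} {a : ∀ m, (P (m + k)).V →ₗ[ℂ] (P m).V}
    {i : ℤ} (h : ∀ m, IsBimodMap (P (m + k)) (P m) (i, 0) (a m)) :
    IsBimodMap (totalSum P) (totalSum P) (k + i, 0) (lowering a) where
  map_lx v := DFinsupp.ext fun m => (h m).map_lx _
  map_rx v := DFinsupp.ext fun m => (h m).map_rx _
  map_gr p v hv m := gr_cast (M := P m) ((h m).map_gr _ _ (hv (m + k))) (by
    ext <;> simp; ring)

theorem entry_apply (P : ℕ → BimCpx) (D : (totalSum P).V →ₗ[ℂ] (totalSum P).V) (m n : ℕ)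
    (v : (P m).V) : entry P D m n v
      = (D (DirectSum.lof ℂ ℕ (fun m => (P m).V) m v) : DirectSum ℕ fun m => (P m).V) n := rfl

theorem entry_lowering {P : ℕ → BimCpx} {k : ℕ} (a : ∀ m, (P (m + k)).V →ₗ[ℂ] (P m).V) (n : ℕ) :
    entry P (lowering a) (n + k) n = a n := by
  ext v
  rw [entry_apply, lowering_apply, DirectSum.lof_apply]

theorem entry_lowering_ne {P : ℕ → BimCpx} {k : ℕ} (a : ∀ m, (P (m + k)).V →ₗ[ℂ] (P m).V)
    {m n : ℕ} (h : m ≠ n + k) : entry P (lowering a) m n = 0 := by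
  ext v
  rw [entry_apply, lowering_apply, DirectSum.lof_eq_of, DirectSum.of_eq_of_ne _ _ _ h.symm,
    map_zero, LinearMap.zero_apply]

/-- A convolution with three nonzero entries off the diagonal. -/
theorem exists_convolution {P : ℕ → BimCpx} {f a : ∀ m, (P (m + 1)).V →ₗ[ℂ] (P m).V}
    (b : ∀ m, (P (m + 2)).V →ₗ[ℂ] (P m).V) (g : ∀ m, (P (m + 3)).V →ₗ[ℂ] (P m).V)
    (haf : ∀ m, Homotopic (P (m + 1)) (P m) (a m) (f m))
    (ha : ∀ m, IsChainDeg 0 (P (m + 1)) (P m) (a m))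
    (hb : ∀ m, IsBimodMap (P (m + 2)) (P m) (-1, 0) (b m))
    (hg : ∀ m, IsChainDeg (-2, 0) (P (m + 3)) (P m) (g m))
    (hab : ∀ m v, (P m).d (b m v) + b m ((P (m + 2)).d v) = a m (a (m + 1) v))
    (h3 : ∀ m v, a m (b (m + 1) v) = b m (a (m + 2) v))
    (h4 : ∀ m v, b m (b (m + 2) v) + a m (g (m + 1) v) + g m (a (m + 3) v) = 0)
    (h5 : ∀ m v, b m (g (m + 2) v) = g m (b (m + 3) v))
    (h6 : ∀ m v, g m (g (m + 3) v) = 0) : Nonempty (Convolution P f) := by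
  -- The differential of the term in position `-m` carries the sign `(-1)^m`. This choice turns `d
  -- b' + b' d` into `-(d b + b d)`, which cancels `a a` by `hab`.
  let b' : ∀ m, (P (m + 2)).V →ₗ[ℂ] (P m).V := fun m => (-parity (-(m : ℤ))) • b m
  let D : (totalSum P).V →ₗ[ℂ] (totalSum P).V :=
    (totalSum P).d + lowering a + lowering b' + lowering g
  have hpar : ∀ m : ℕ, parity (-((m + 1 : ℕ) : ℤ)) = -parity (-(m : ℤ)) := by
    intro m
    have := parity_succ (-((m + 1 : ℕ) : ℤ))
    rw [show (-((m + 1 : ℕ) : ℤ)) + 1 = -(m : ℤ) by push_cast; ring] at this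
    rw [this, neg_neg]
  have hdiag : ∀ m n, m ≠ n → entry P (totalSum P).d m n = 0 := by
    intro m n h
    ext v
    change parity (-(n : ℤ)) • (P n).d (DirectSum.lof ℂ ℕ (fun m => (P m).V) m v n) = 0
    rw [DirectSum.lof_eq_of, DirectSum.of_eq_of_ne _ _ _ h.symm, map_zero, smul_zero]
  have hD : ∀ m n, entry P D m n = entry P (totalSum P).d m n + entry P (lowering a) m n
      + entry P (lowering b') m n + entry P (lowering g) m n := fun _ _ => rfl
  refine ⟨⟨D, ?_, fun v => ?_, fun m n h => ?_, fun m => ?_, fun m => ?_⟩⟩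
  · refine ((IsBimodMap.d.add ?_).add ?_).add ?_
    · exact lowering_bimod (i := 0) fun m => (ha m).bimod
    · exact lowering_bimod (i := -1) fun m => (hb m).smul _
    · exact lowering_bimod (i := -2) fun m => (hg m).bimod
  · refine DFinsupp.ext fun m => ?_
    -- Here `e` is the sign of the term `m`, and neighbouring terms have opposite signs. The
    -- components of `D²` that lower the index by `3`, `4`, `5`, `6` vanish by `h3`, `h4`, `h5`,
    -- `h6`; in the drops by `1` and `3`, the commutators of `a` and `g` with `d` also cancel.
    have key : ∀ (e : ℂ), e * e = 1 → ∀ (v : ∀ n, (P n).V),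
      e • (P m).d (e • (P m).d (v m) + a m (v (m + 1)) + (-e) • b m (v (m + 2)) + g m (v (m + 3)))
      + a m ((-e) • (P (m + 1)).d (v (m + 1)) + a (m + 1) (v (m + 2))
          + e • b (m + 1) (v (m + 3)) + g (m + 1) (v (m + 4)))
      + (-e) • b m (e • (P (m + 2)).d (v (m + 2)) + a (m + 2) (v (m + 3))
          + (-e) • b (m + 2) (v (m + 4)) + g (m + 2) (v (m + 5)))
      + g m ((-e) • (P (m + 3)).d (v (m + 3)) + a (m + 3) (v (m + 4))
          + e • b (m + 3) (v (m + 5)) + g (m + 3) (v (m + 6))) = 0 := by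
      intro e he v
      have e2 := hab m (v (m + 2))
      have e4 := h4 m (v (m + 4))
      simp only [map_add, map_neg, map_smul, smul_neg, smul_add, smul_smul, (P m).d_d,
        (ha m).map_d, (hg m).map_d,
        h3, h5, h6, neg_mul, neg_neg, he, smul_zero, neg_smul, one_smul, ← e2]
      refine Eq.trans ?_ e4
      abel
    have p1 := hpar m
    have p2 : parity (-((m + 2 : ℕ) : ℤ)) = parity (-(m : ℤ)) := by
      rw [hpar (m + 1), hpar m, neg_neg]
    have p3 : parity (-((m + 3 : ℕ) : ℤ)) = -parity (-(m : ℤ)) := by rw [hpar (m + 2), p2]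
    have := key _ (parity_mul_self (-(m : ℤ))) fun n => (v : DirectSum ℕ fun m => (P m).V) n
    refine Eq.trans ?_ this
    change parity (-(m : ℤ)) • (P m).d (parity (-(m : ℤ)) • (P m).d (v m) + a m (v (m + 1))
        + (-parity (-(m : ℤ))) • b m (v (m + 2)) + g m (v (m + 3)))
      + a m (parity (-((m + 1 : ℕ) : ℤ)) • (P (m + 1)).d (v (m + 1)) + a (m + 1) (v (m + 2))
          + (-parity (-((m + 1 : ℕ) : ℤ))) • b (m + 1) (v (m + 3)) + g (m + 1) (v (m + 4)))
      + (-parity (-(m : ℤ))) • b m (parity (-((m + 2 : ℕ) : ℤ)) • (P (m + 2)).d (v (m + 2))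
          + a (m + 2) (v (m + 3))
          + (-parity (-((m + 2 : ℕ) : ℤ))) • b (m + 2) (v (m + 4)) + g (m + 2) (v (m + 5)))
      + g m (parity (-((m + 3 : ℕ) : ℤ)) • (P (m + 3)).d (v (m + 3)) + a (m + 3) (v (m + 4))
          + (-parity (-((m + 3 : ℕ) : ℤ))) • b (m + 3) (v (m + 5)) + g (m + 3) (v (m + 6))) = _
    rw [p1, p2, p3, neg_neg]
  · rw [hD, hdiag m n h.ne, entry_lowering_ne _ (by omega), entry_lowering_ne _ (by omega),
      entry_lowering_ne _ (by omega)]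
    simp
  · rw [hD, entry_lowering_ne _ (by omega), entry_lowering_ne _ (by omega),
      entry_lowering_ne _ (by omega), add_zero, add_zero, add_zero]
    ext v
    change parity (-(m : ℤ)) • (P m).d (DirectSum.lof ℂ ℕ (fun m => (P m).V) m v m) = _
    rw [DirectSum.lof_apply]
    rfl
  · refine (Homotopic.of_eq ?_).trans (haf m)
    rw [hD, hdiag _ _ (by omega), entry_lowering, entry_lowering_ne _ (by omega),
      entry_lowering_ne _ (by omega), zero_add, add_zero, add_zero]

/-! ### Matrices of maps -/

section Matrices

variable {M M₁ M₂ N N₁ N₂ : BimCpx} {k l p q : ℤ × ℤ}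

theorem IsBimodMap.shift {f : M.V →ₗ[ℂ] N.V} (hf : IsBimodMap M N p f) (h : p + l = k + q) :
    IsBimodMap (shift k M) (shift l N) q f where
  map_lx := hf.map_lx
  map_rx := hf.map_rx
  map_gr a v hv := gr_cast (M := N) (hf.map_gr _ _ hv) (by
    rw [show q = p + l - k by rw [h]; abel]; abel)

theorem IsChainDeg.shift {f : M.V →ₗ[ℂ] N.V} (hf : IsChainDeg p M N f) (h : p + l = k + q)
    (hkl : parity k.1 = parity l.1) : IsChainDeg q (shift k M) (shift l N) f :=
  ⟨hf.bimod.shift h, fun v => by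
    change f (parity k.1 • M.d v) = parity l.1 • N.d (f v)
    rw [map_smul, hf.map_d, hkl]⟩

theorem HomotopicDeg.shift {f g : M.V →ₗ[ℂ] N.V} (hf : HomotopicDeg p M N f g)
    (h : p + l = k + q) (hk : parity k.1 = 1) (hl : parity l.1 = 1) :
    HomotopicDeg q (shift k M) (shift l N) f g := by
  obtain ⟨s, hs, e⟩ := hf
  refine ⟨s, hs.shift (by rw [add_right_comm, h]; abel), fun v => ?_⟩
  change _ = parity l.1 • N.d (s v) + s (parity k.1 • M.d v)
  rw [e, hk, hl, one_smul, one_smul]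

theorem IsBimodMap.shift_left {f : M.V →ₗ[ℂ] N.V} (hf : IsBimodMap M N p f) (h : p = k + q) :
    IsBimodMap (SBim2.shift k M) N q f where
  map_lx := hf.map_lx
  map_rx := hf.map_rx
  map_gr a v hv := gr_cast (M := N) (hf.map_gr _ _ hv) (by rw [h]; abel)

theorem IsChainDeg.shift_left {f : M.V →ₗ[ℂ] N.V} (hf : IsChainDeg p M N f) (h : p = k + q)
    (hk : parity k.1 = 1) : IsChainDeg q (SBim2.shift k M) N f :=
  ⟨hf.bimod.shift_left h, fun v => by
    change f (parity k.1 • M.d v) = N.d (f v)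
    rw [hk, one_smul, hf.map_d]⟩

theorem HomotopicDeg.shift_left {f g : M.V →ₗ[ℂ] N.V} (hf : HomotopicDeg p M N f g)
    (h : p = k + q) (hk : parity k.1 = 1) : HomotopicDeg q (SBim2.shift k M) N f g := by
  obtain ⟨s, hs, e⟩ := hf
  refine ⟨s, hs.shift_left (by rw [h]; abel), fun v => ?_⟩
  change _ = N.d (s v) + s (parity k.1 • M.d v)
  rw [e, hk, one_smul]

theorem IsChainDeg.smul {f : M.V →ₗ[ℂ] N.V} (hf : IsChainDeg p M N f) (c : ℂ) :
    IsChainDeg p M N (c • f) := ⟨hf.bimod.smul c, fun v => by simp [hf.map_d]⟩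

theorem IsChainDeg.neg {f : M.V →ₗ[ℂ] N.V} (hf : IsChainDeg p M N f) :
    IsChainDeg p M N (-f) := ⟨hf.bimod.neg, fun v => by simp [hf.map_d]⟩

theorem mat_apply {V₁ V₂ W₁ W₂ : Type} [AddCommGroup V₁] [Module ℂ V₁] [AddCommGroup V₂]
    [Module ℂ V₂] [AddCommGroup W₁] [Module ℂ W₁] [AddCommGroup W₂] [Module ℂ W₂]
    (a : V₁ →ₗ[ℂ] W₁) (b : V₂ →ₗ[ℂ] W₁) (c : V₁ →ₗ[ℂ] W₂) (e : V₂ →ₗ[ℂ] W₂) (v : V₁ × V₂) :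
    mat a b c e v = (a v.1 + b v.2, c v.1 + e v.2) := rfl

variable {a a' : M₁.V →ₗ[ℂ] N₁.V} {b b' : M₂.V →ₗ[ℂ] N₁.V} {c c' : M₁.V →ₗ[ℂ] N₂.V}
  {e e' : M₂.V →ₗ[ℂ] N₂.V}

theorem IsBimodMap.coprod {f : M₁.V →ₗ[ℂ] N.V} {g : M₂.V →ₗ[ℂ] N.V} (hf : IsBimodMap M₁ N p f)
    (hg : IsBimodMap M₂ N p g) : IsBimodMap (dirSum M₁ M₂) N p (f.coprod g) where
  map_lx v := by
    change f (M₁.lx v.1) + g (M₂.lx v.2) = N.lx (f v.1 + g v.2)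
    rw [hf.map_lx, hg.map_lx, map_add]
  map_rx v := by
    change f (M₁.rx v.1) + g (M₂.rx v.2) = N.rx (f v.1 + g v.2)
    rw [hf.map_rx, hg.map_rx, map_add]
  map_gr r v hv := Submodule.add_mem _ (hf.map_gr r _ hv.1) (hg.map_gr r _ hv.2)

theorem IsBimodMap.prod {f : M.V →ₗ[ℂ] N₁.V} {g : M.V →ₗ[ℂ] N₂.V} (hf : IsBimodMap M N₁ p f)
    (hg : IsBimodMap M N₂ p g) : IsBimodMap M (dirSum N₁ N₂) p (f.prod g) where
  map_lx v := Prod.ext (hf.map_lx v) (hg.map_lx v)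
  map_rx v := Prod.ext (hf.map_rx v) (hg.map_rx v)
  map_gr r v hv := ⟨hf.map_gr r v hv, hg.map_gr r v hv⟩

theorem IsBimodMap.mat (ha : IsBimodMap M₁ N₁ p a) (hb : IsBimodMap M₂ N₁ p b)
    (hc : IsBimodMap M₁ N₂ p c) (he : IsBimodMap M₂ N₂ p e) :
    IsBimodMap (dirSum M₁ M₂) (dirSum N₁ N₂) p (mat a b c e) :=
  (ha.coprod hb).prod (hc.coprod he)

theorem IsChainDeg.coprod {f : M₁.V →ₗ[ℂ] N.V} {g : M₂.V →ₗ[ℂ] N.V} (hf : IsChainDeg p M₁ N f)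
    (hg : IsChainDeg p M₂ N g) : IsChainDeg p (dirSum M₁ M₂) N (f.coprod g) :=
  ⟨hf.bimod.coprod hg.bimod, fun v => by
    change f (M₁.d v.1) + g (M₂.d v.2) = N.d (f v.1 + g v.2)
    rw [hf.map_d, hg.map_d, map_add]⟩

theorem IsChainDeg.prod {f : M.V →ₗ[ℂ] N₁.V} {g : M.V →ₗ[ℂ] N₂.V} (hf : IsChainDeg p M N₁ f)
    (hg : IsChainDeg p M N₂ g) : IsChainDeg p M (dirSum N₁ N₂) (f.prod g) :=
  ⟨hf.bimod.prod hg.bimod, fun v => Prod.ext (hf.map_d v) (hg.map_d v)⟩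

theorem IsChainDeg.mat (ha : IsChainDeg p M₁ N₁ a) (hb : IsChainDeg p M₂ N₁ b)
    (hc : IsChainDeg p M₁ N₂ c) (he : IsChainDeg p M₂ N₂ e) :
    IsChainDeg p (dirSum M₁ M₂) (dirSum N₁ N₂) (SBim2.mat a b c e) :=
  (ha.coprod hb).prod (hc.coprod he)

theorem HomotopicDeg.coprod {f f' : M₁.V →ₗ[ℂ] N.V} {g g' : M₂.V →ₗ[ℂ] N.V}
    (hf : HomotopicDeg p M₁ N f f') (hg : HomotopicDeg p M₂ N g g') :
    HomotopicDeg p (dirSum M₁ M₂) N (f.coprod g) (f'.coprod g') := by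
  obtain ⟨s, hs, e⟩ := hf
  obtain ⟨t, ht, e'⟩ := hg
  refine ⟨s.coprod t, hs.coprod ht, fun v => ?_⟩
  change f v.1 + g v.2 - (f' v.1 + g' v.2)
    = N.d (s v.1 + t v.2) + (s (M₁.d v.1) + t (M₂.d v.2))
  rw [map_add, add_sub_add_comm, e, e']
  abel

theorem HomotopicDeg.prod {f f' : M.V →ₗ[ℂ] N₁.V} {g g' : M.V →ₗ[ℂ] N₂.V}
    (hf : HomotopicDeg p M N₁ f f') (hg : HomotopicDeg p M N₂ g g') :
    HomotopicDeg p M (dirSum N₁ N₂) (f.prod g) (f'.prod g') := by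
  obtain ⟨s, hs, e⟩ := hf
  obtain ⟨t, ht, e'⟩ := hg
  exact ⟨s.prod t, hs.prod ht, fun v => Prod.ext (e v) (e' v)⟩

theorem HomotopicDeg.mat (ha : HomotopicDeg p M₁ N₁ a a') (hb : HomotopicDeg p M₂ N₁ b b')
    (hc : HomotopicDeg p M₁ N₂ c c') (he : HomotopicDeg p M₂ N₂ e e') :
    HomotopicDeg p (dirSum M₁ M₂) (dirSum N₁ N₂) (SBim2.mat a b c e) (SBim2.mat a' b' c' e') :=
  (ha.coprod hb).prod (hc.coprod he)

theorem HomotopicDeg.homotopic {f g : M.V →ₗ[ℂ] N.V} (h : HomotopicDeg 0 M N f g) :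
    Homotopic M N f g := by
  obtain ⟨s, hs, e⟩ := h
  exact ⟨s, hs.congr_deg (zero_add _), LinearMap.ext e⟩

theorem IsBimodMap.lx_deg : IsChainDeg (0, 2) M M M.lx := ⟨.lx, fun v => (M.d_lx v).symm⟩

theorem IsChainDeg.zero : IsChainDeg p M N 0 := ⟨.zero, fun v => by simp⟩

end Matrices

/-! ### The Koszul complex of the minimal models -/

theorem parity_two_mul (n : ℤ) : parity (2 * n) = 1 := by
  simp [parity, Int.negOnePow_two_mul]

theorem parity_smul_add (j : ℕ) (k : ℤ × ℤ) : parity (j • (qdeg + tdeg) + k).1 = parity k.1 := by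
  rw [Prod.fst_add, parity_add,
    show (j • (qdeg + tdeg)).1 = 2 * (j : ℤ) by simp [qdeg, tdeg, mul_comm],
    parity_two_mul, one_mul]

theorem parity_smul (j : ℕ) : parity (j • (qdeg + tdeg)).1 = 1 := by
  simpa [parity_zero] using parity_smul_add j 0

/-- The objects of the Koszul complex of the minimal models. -/
def modelAt : Pos → BimCpx
  | .ev 0 => tower.M 0
  | .ev (j + 1) => dirSum (shift ((j + 1) • (qdeg + tdeg)) (tower.M (j + 2)))
      (shift ((j + 1) • (qdeg + tdeg)) (tower.M (j + 1)))
  | .od j => dirSum (shift (j • (qdeg + tdeg) + qdeg) (tower.M (j + 1)))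
      (shift (j • (qdeg + tdeg) + tdeg) (tower.M (j + 1)))

theorem modelAt_d_ev (j : ℕ) (v : (tower.M (j + 2)).V × (tower.M (j + 1)).V) :
    (modelAt (.ev (j + 1))).d v = ((tower.M (j + 2)).d v.1, (tower.M (j + 1)).d v.2) := by
  change ((parity ((j + 1) • (qdeg + tdeg)).1 • (tower.M (j + 2)).d v.1 : (tower.M (j + 2)).V),
    (parity ((j + 1) • (qdeg + tdeg)).1 • (tower.M (j + 1)).d v.2 : (tower.M (j + 1)).V)) = _
  rw [parity_smul, one_smul, one_smul]

theorem modelAt_d_od (j : ℕ) (v : (tower.M (j + 1)).V × (tower.M (j + 1)).V) :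
    (modelAt (.od j)).d v = ((tower.M (j + 1)).d v.1, (tower.M (j + 1)).d v.2) := by
  change ((parity (j • (qdeg + tdeg) + qdeg).1 • (tower.M (j + 1)).d v.1 : (tower.M (j + 1)).V),
    (parity (j • (qdeg + tdeg) + tdeg).1 • (tower.M (j + 1)).d v.2 : (tower.M (j + 1)).V)) = _
  rw [parity_smul_add, parity_smul_add, parity_zero, parity_two, one_smul, one_smul]

variable (c : ℂ)

/-- The differential of the Koszul complex of the minimal models. -/
def modelA : (i : Pos) → (modelAt i.next).V →ₗ[ℂ] (modelAt i).V
  | .ev 0 => LinearMap.coprod (c • tower.z 0) (c • tower.w 0)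
  | .od j => mat (c • tower.w (j + 1)) 0 (-(c • tower.z (j + 1))) (tower.M (j + 1)).lx
  | .ev (j + 1) => mat (tower.M (j + 2)).lx 0 (c • tower.z (j + 1)) (c • tower.w (j + 1))

/-- The homotopy for the square of `modelA`. -/
def modelB : (i : Pos) → (modelAt i.next.next).V →ₗ[ℂ] (modelAt i).V
  | .ev 0 => LinearMap.coprod (0 : (tower.M 2).V →ₗ[ℂ] _) (c • tower.kap 0)
  | .od j => mat (c • tower.kap (j + 1)) 0 0 (c • tower.kap (j + 1))
  | .ev (j + 1) => mat (c • tower.kap (j + 2)) 0 0 (c • tower.kap (j + 1))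

/-- The second homotopy of the Koszul complex of the minimal models. -/
def modelG : (i : Pos) → (modelAt i.next.next.next).V →ₗ[ℂ] (modelAt i).V
  | .ev 0 => 0
  | .od j => mat (0 : (tower.M (j + 3)).V →ₗ[ℂ] _) 0 0 ((-(c / 2)) • tower.z (j + 1))
  | .ev (j + 1) => mat ((-(c / 2)) • tower.z (j + 2)) 0 0 (0 : (tower.M (j + 3)).V →ₗ[ℂ] _)

theorem modelAB_zero (v : (tower.M 2).V × (tower.M 1).V) :
    (tower.M 0).d (c • tower.kap 0 v.2) + c • tower.kap 0 ((tower.M 1).d v.2)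
      = c • tower.z 0 (c • tower.w 1 v.1 + 0)
        + c • tower.w 0 (-(c • tower.z 1 v.1) + (tower.M 1).lx v.2) := by
  have := (tower.w_chain 0).bimod.map_lx v.2
  simp [tower.kap_d, smul_sub, tower.w_z, this]

theorem modelB_zero (v : (tower.M 2).V × (tower.M 1).V) :
    modelB c (.ev 0) v = c • tower.kap 0 v.2 := zero_add _

/-- Both orders of multiplying the two matrices give the scalar matrix `c x w`: the off-diagonal
entries cancel because `z` commutes with `w` and with `x`. Then `kap_d` writes `x w` as a boundary.
-/
theorem modelAB : ∀ (i : Pos) (v : (modelAt i.next.next).V), (modelAt i).d (modelB c i v)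
    + modelB c i ((modelAt i.next.next).d v) = modelA c i (modelA c i.next v)
  | .ev 0 => by
    intro v
    have h1 := congrArg (tower.M 0).d (modelB_zero c v)
    have h2 := (congrArg (modelB c (.ev 0)) (modelAt_d_ev 0 v)).trans (modelB_zero c _)
    exact (congrArg₂ (fun x y : (tower.M 0).V => x + y) h1 h2).trans (modelAB_zero c v)
  | .od j => by
    change ∀ v : (tower.M (j + 2)).V × (tower.M (j + 2)).V,
      (modelAt (.od j)).d (c • tower.kap (j + 1) v.1 + 0, 0 + c • tower.kap (j + 1) v.2)
      + modelB c (.od j) ((modelAt (.od (j + 1))).d v)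
        = (c • tower.w (j + 1) ((tower.M (j + 2)).lx v.1 + 0) + 0,
          -(c • tower.z (j + 1) ((tower.M (j + 2)).lx v.1 + 0)) + (tower.M (j + 1)).lx
            (c • tower.z (j + 1) v.1 + c • tower.w (j + 1) v.2))
    intro v
    rw [modelAt_d_od, modelAt_d_od]
    change ((tower.M (j + 1)).d (c • tower.kap (j + 1) v.1 + 0),
      (tower.M (j + 1)).d (0 + c • tower.kap (j + 1) v.2))
      + (c • tower.kap (j + 1) ((tower.M (j + 2)).d v.1) + 0,
        0 + c • tower.kap (j + 1) ((tower.M (j + 2)).d v.2)) = _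
    have h1 := (tower.w_chain (j + 1)).bimod.map_lx
    have h2 := (tower.z_chain (j + 1)).bimod.map_lx
    simp [tower.kap_d, smul_sub, h1, h2]
  | .ev (j + 1) => by
    change ∀ v : (tower.M (j + 3)).V × (tower.M (j + 2)).V,
      (modelAt (.ev (j + 1))).d (c • tower.kap (j + 2) v.1 + 0, 0 + c • tower.kap (j + 1) v.2)
      + modelB c (.ev (j + 1)) ((modelAt (.ev (j + 2))).d v)
        = ((tower.M (j + 2)).lx (c • tower.w (j + 2) v.1 + 0) + 0,
          c • tower.z (j + 1) (c • tower.w (j + 2) v.1 + 0) + c • tower.w (j + 1)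
            (-(c • tower.z (j + 2) v.1) + (tower.M (j + 2)).lx v.2))
    intro v
    rw [modelAt_d_ev, modelAt_d_ev]
    change ((tower.M (j + 2)).d (c • tower.kap (j + 2) v.1 + 0),
      (tower.M (j + 1)).d (0 + c • tower.kap (j + 1) v.2))
      + (c • tower.kap (j + 2) ((tower.M (j + 3)).d v.1) + 0,
        0 + c • tower.kap (j + 1) ((tower.M (j + 2)).d v.2)) = _
    have h1 := (tower.w_chain (j + 1)).bimod.map_lx
    simp [tower.kap_d, smul_sub, tower.w_z, h1]

theorem modelBA : ∀ (i : Pos) (v : (modelAt i.next.next.next).V),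
    modelA c i (modelB c i.next v) = modelB c i (modelA c i.next.next v)
  | .ev 0 => by
    change ∀ v : (tower.M 2).V × (tower.M 2).V,
      c • tower.z 0 (c • tower.kap 1 v.1 + 0) + c • tower.w 0 (0 + c • tower.kap 1 v.2)
        = 0 + c • tower.kap 0 (c • tower.z 1 v.1 + c • tower.w 1 v.2)
    intro v
    simp [tower.kap_z, tower.kap_w]
  | .od j => by
    change ∀ v : (tower.M (j + 3)).V × (tower.M (j + 2)).V,
      ((c • tower.w (j + 1) (c • tower.kap (j + 2) v.1 + 0) + 0,
        -(c • tower.z (j + 1) (c • tower.kap (j + 2) v.1 + 0)) + (tower.M (j + 1)).lx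
          (0 + c • tower.kap (j + 1) v.2)) : (tower.M (j + 1)).V × (tower.M (j + 1)).V)
      = (c • tower.kap (j + 1) (c • tower.w (j + 2) v.1 + 0) + 0,
        0 + c • tower.kap (j + 1) (-(c • tower.z (j + 2) v.1) + (tower.M (j + 2)).lx v.2))
    intro v
    have h1 := (tower.kap_bimod (j + 1)).map_lx
    simp [tower.kap_z, tower.kap_w, h1]
  | .ev (j + 1) => by
    change ∀ v : (tower.M (j + 3)).V × (tower.M (j + 3)).V,
      (((tower.M (j + 2)).lx (c • tower.kap (j + 2) v.1 + 0) + 0,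
        c • tower.z (j + 1) (c • tower.kap (j + 2) v.1 + 0) + c • tower.w (j + 1)
          (0 + c • tower.kap (j + 2) v.2)) : (tower.M (j + 2)).V × (tower.M (j + 1)).V)
      = (c • tower.kap (j + 2) ((tower.M (j + 3)).lx v.1 + 0) + 0,
        0 + c • tower.kap (j + 1) (c • tower.z (j + 2) v.1 + c • tower.w (j + 2) v.2))
    intro v
    have h1 := (tower.kap_bimod (j + 2)).map_lx
    simp [tower.kap_z, tower.kap_w, h1]

/-- The square of the first homotopy is `c² kap² = (c²/2) z w` on both summands. Since `w` and `z`
occur as entries of the matrices, a corner entry `-(c/2) z` composed with them on the two sides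
cancels it; this determines the constant in `modelG`. -/
theorem modelBB : ∀ (i : Pos) (v : (modelAt i.next.next.next.next).V),
    modelB c i (modelB c i.next.next v) + modelA c i (modelG c i.next v)
      + modelG c i (modelA c i.next.next.next v) = 0
  | .ev 0 => by
    change ∀ v : (tower.M 3).V × (tower.M 2).V,
      (0 + c • tower.kap 0 (0 + c • tower.kap 1 v.2)) + (c • tower.z 0 (0 + 0)
        + c • tower.w 0 (0 + (-(c / 2)) • tower.z 1 v.2)) + 0 = 0
    intro v
    simp [tower.kap_kap, tower.w_z]
    module
  | .od j => by
    change ∀ v : (tower.M (j + 3)).V × (tower.M (j + 3)).V,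
      (((c • tower.kap (j + 1) (c • tower.kap (j + 2) v.1 + 0) + 0,
        0 + c • tower.kap (j + 1) (0 + c • tower.kap (j + 2) v.2)) :
          (tower.M (j + 1)).V × (tower.M (j + 1)).V)
      + (c • tower.w (j + 1) ((-(c / 2)) • tower.z (j + 2) v.1 + 0) + 0,
        -(c • tower.z (j + 1) ((-(c / 2)) • tower.z (j + 2) v.1 + 0))
          + (tower.M (j + 1)).lx (0 + 0)))
      + (0 + 0, 0 + (-(c / 2)) • tower.z (j + 1) (c • tower.z (j + 2) v.1
          + c • tower.w (j + 2) v.2)) = 0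
    intro v
    simp [tower.kap_kap, tower.w_z]
    constructor <;> module
  | .ev (j + 1) => by
    change ∀ v : (tower.M (j + 4)).V × (tower.M (j + 3)).V,
      (((c • tower.kap (j + 2) (c • tower.kap (j + 3) v.1 + 0) + 0,
        0 + c • tower.kap (j + 1) (0 + c • tower.kap (j + 2) v.2)) :
          (tower.M (j + 2)).V × (tower.M (j + 1)).V)
      + ((tower.M (j + 2)).lx (0 + 0) + 0, c • tower.z (j + 1) (0 + 0)
          + c • tower.w (j + 1) (0 + (-(c / 2)) • tower.z (j + 2) v.2)))
      + ((-(c / 2)) • tower.z (j + 2) (c • tower.w (j + 3) v.1 + 0) + 0, 0 + 0) = 0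
    intro v
    simp [tower.kap_kap, tower.w_z]
    constructor <;> module

theorem modelBG : ∀ (i : Pos) (v : (modelAt i.next.next.next.next.next).V),
    modelB c i (modelG c i.next.next v) = modelG c i (modelB c i.next.next.next v)
  | .ev 0 => by
    change ∀ v : (tower.M 3).V × (tower.M 3).V, 0 + c • tower.kap 0 (0 + 0) = 0
    simp
  | .od j => by
    change ∀ v : (tower.M (j + 4)).V × (tower.M (j + 3)).V,
      ((c • tower.kap (j + 1) (0 + 0) + 0, 0 + c • tower.kap (j + 1) (0 + (-(c / 2)) •
        tower.z (j + 2) v.2)) : (tower.M (j + 1)).V × (tower.M (j + 1)).V)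
      = (0 + 0, 0 + (-(c / 2)) • tower.z (j + 1) (0 + c • tower.kap (j + 2) v.2))
    intro v
    simp [tower.kap_z]
    module
  | .ev (j + 1) => by
    change ∀ v : (tower.M (j + 4)).V × (tower.M (j + 4)).V,
      ((c • tower.kap (j + 2) ((-(c / 2)) • tower.z (j + 3) v.1 + 0) + 0,
        0 + c • tower.kap (j + 1) (0 + 0)) : (tower.M (j + 2)).V × (tower.M (j + 1)).V)
      = ((-(c / 2)) • tower.z (j + 2) (c • tower.kap (j + 3) v.1 + 0) + 0, 0 + 0)
    intro v
    simp [tower.kap_z]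
    module

/-- The corner occupied by `modelG` alternates with the parity of the position, and consecutive
factors of this composite occupy opposite corners. -/
theorem modelGG : ∀ (i : Pos) (v : (modelAt i.next.next.next.next.next.next).V),
    modelG c i (modelG c i.next.next.next v) = 0
  | .ev 0 => fun _ => rfl
  | .od j => by
    change ∀ v : (tower.M (j + 4)).V × (tower.M (j + 4)).V,
      ((0 + 0, 0 + (-(c / 2)) • tower.z (j + 1) (0 + 0)) :
        (tower.M (j + 1)).V × (tower.M (j + 1)).V) = 0
    simp
  | .ev (j + 1) => by
    change ∀ v : (tower.M (j + 5)).V × (tower.M (j + 4)).V,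
      (((-(c / 2)) • tower.z (j + 2) (0 + 0) + 0, 0 + 0) :
        (tower.M (j + 2)).V × (tower.M (j + 1)).V) = 0
    simp

theorem parity_smul_add_even (j : ℕ) {k : ℤ × ℤ} (h : parity k.1 = 1) :
    parity (j • (qdeg + tdeg) + k).1 = 1 := (parity_smul_add j k).trans h

theorem modelA_chain : ∀ i : Pos, IsChainDeg 0 (modelAt i.next) (modelAt i) (modelA c i)
  | .ev 0 => by
    refine IsChainDeg.coprod ?_ ?_
    · exact ((tower.z_chain 0).smul c).shift_left (by simp) (parity_smul_add_even _ parity_zero)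
    · exact ((tower.w_chain 0).smul c).shift_left (by simp) (parity_smul_add_even _ parity_two)
  | .od j => by
    have e1 := parity_smul (j + 1)
    have e2 := parity_smul_add_even j (k := qdeg) parity_zero
    have e3 := parity_smul_add_even j (k := tdeg) parity_two
    refine IsChainDeg.mat ?_ .zero ?_ ?_
    · exact ((tower.w_chain (j + 1)).smul c).shift (by ext <;> simp; ring) (e1.trans e2.symm)
    · exact ((tower.z_chain (j + 1)).smul c).neg.shift (by ext <;> simp; ring) (e1.trans e3.symm)
    · exact IsBimodMap.lx_deg.shift (by ext <;> simp; ring) (e1.trans e3.symm)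
  | .ev (j + 1) => by
    have e1 := parity_smul (j + 1)
    have e2 := parity_smul_add_even (j + 1) (k := qdeg) parity_zero
    have e3 := parity_smul_add_even (j + 1) (k := tdeg) parity_two
    refine IsChainDeg.mat ?_ .zero ?_ ?_
    · exact IsBimodMap.lx_deg.shift (by ext <;> simp) (e2.trans e1.symm)
    · exact ((tower.z_chain (j + 1)).smul c).shift (by ext <;> simp) (e2.trans e1.symm)
    · exact ((tower.w_chain (j + 1)).smul c).shift (by ext <;> simp; ring) (e3.trans e1.symm)

theorem modelB_bimod : ∀ i : Pos, IsBimodMap (modelAt i.next.next) (modelAt i) (-1, 0) (modelB c i)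
  | .ev 0 => IsBimodMap.coprod .zero (((tower.kap_bimod 0).smul c).shift_left (by ext <;> simp))
  | .od j => by
    refine IsBimodMap.mat ?_ .zero .zero ?_
    · exact ((tower.kap_bimod (j + 1)).smul c).shift (by ext <;> simp; ring)
    · exact ((tower.kap_bimod (j + 1)).smul c).shift (by ext <;> simp; ring)
  | .ev (j + 1) => by
    refine IsBimodMap.mat ?_ .zero .zero ?_
    · exact ((tower.kap_bimod (j + 2)).smul c).shift (by ext <;> simp; ring)
    · exact ((tower.kap_bimod (j + 1)).smul c).shift (by ext <;> simp; ring)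

theorem modelG_chain : ∀ i : Pos,
    IsChainDeg (-2, 0) (modelAt i.next.next.next) (modelAt i) (modelG c i)
  | .ev 0 => .zero
  | .od j => by
    have e1 := parity_smul (j + 2)
    have e3 := parity_smul_add_even j (k := tdeg) parity_two
    refine IsChainDeg.mat .zero .zero .zero ?_
    exact ((tower.z_chain (j + 1)).smul _).shift (by ext <;> simp; ring) (e1.trans e3.symm)
  | .ev (j + 1) => by
    have e1 := parity_smul (j + 1)
    have e2 := parity_smul_add_even (j + 2) (k := qdeg) parity_zero
    refine IsChainDeg.mat ?_ .zero .zero .zero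
    exact ((tower.z_chain (j + 2)).smul _).shift (by ext <;> simp; ring) (e2.trans e1.symm)

/-! ### Transfer to the powers of `FT⁻¹` -/

/-- The inclusion of the Koszul complex of the minimal models. -/
def modelI : (i : Pos) → (modelAt i).V →ₗ[ℂ] (koszulAt i).V
  | .ev 0 => (ret 0).i
  | .ev (j + 1) => mat (ret (j + 2)).i 0 0 (ret (j + 1)).i
  | .od j => mat (ret (j + 1)).i 0 0 (ret (j + 1)).i

/-- The projection to the Koszul complex of the minimal models. -/
def modelP : (i : Pos) → (koszulAt i).V →ₗ[ℂ] (modelAt i).V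
  | .ev 0 => (ret 0).p
  | .ev (j + 1) => mat (ret (j + 2)).p 0 0 (ret (j + 1)).p
  | .od j => mat (ret (j + 1)).p 0 0 (ret (j + 1)).p

theorem modelI_chain : ∀ i : Pos, IsChainDeg 0 (modelAt i) (koszulAt i) (modelI i)
  | .ev 0 => (ret 0).i_chain.deg
  | .ev (j + 1) => .mat ((ret (j + 2)).i_chain.deg.shift (by abel) rfl) .zero .zero
      ((ret (j + 1)).i_chain.deg.shift (by abel) rfl)
  | .od j => .mat ((ret (j + 1)).i_chain.deg.shift (by abel) rfl) .zero .zero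
      ((ret (j + 1)).i_chain.deg.shift (by abel) rfl)

theorem modelP_chain : ∀ i : Pos, IsChainDeg 0 (koszulAt i) (modelAt i) (modelP i)
  | .ev 0 => (ret 0).p_chain.deg
  | .ev (j + 1) => .mat ((ret (j + 2)).p_chain.deg.shift (by abel) rfl) .zero .zero
      ((ret (j + 1)).p_chain.deg.shift (by abel) rfl)
  | .od j => .mat ((ret (j + 1)).p_chain.deg.shift (by abel) rfl) .zero .zero
      ((ret (j + 1)).p_chain.deg.shift (by abel) rfl)

theorem prodMap_retract {M₁ M₂ N₁ N₂ : Type} [AddCommGroup M₁] [Module ℂ M₁] [AddCommGroup M₂]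
    [Module ℂ M₂] [AddCommGroup N₁] [Module ℂ N₁] [AddCommGroup N₂] [Module ℂ N₂]
    {i₁ : M₁ →ₗ[ℂ] N₁} {i₂ : M₂ →ₗ[ℂ] N₂} {p₁ : N₁ →ₗ[ℂ] M₁} {p₂ : N₂ →ₗ[ℂ] M₂}
    (h₁ : ∀ v, p₁ (i₁ v) = v) (h₂ : ∀ v, p₂ (i₂ v) = v) (v : M₁ × M₂) :
    mat p₁ 0 0 p₂ (mat i₁ 0 0 i₂ v) = v := by
  ext <;> simp [mat_apply, h₁, h₂]

theorem modelP_I : ∀ (i : Pos) (v : (modelAt i).V), modelP i (modelI i v) = v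
  | .ev 0 => (ret 0).p_i
  | .ev (j + 1) => prodMap_retract (ret (j + 2)).p_i (ret (j + 1)).p_i
  | .od j => prodMap_retract (ret (j + 1)).p_i (ret (j + 1)).p_i

section Conjugation

variable {M₁ M₂ N₁ N₂ K₁ K₂ L₁ L₂ : BimCpx} {p : ℤ × ℤ}
  {a : K₁.V →ₗ[ℂ] L₁.V} {b : K₂.V →ₗ[ℂ] L₁.V} {c : K₁.V →ₗ[ℂ] L₂.V} {e : K₂.V →ₗ[ℂ] L₂.V}
  {a' : M₁.V →ₗ[ℂ] N₁.V} {b' : M₂.V →ₗ[ℂ] N₁.V} {c' : M₁.V →ₗ[ℂ] N₂.V} {e' : M₂.V →ₗ[ℂ] N₂.V}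
  {i₁ : N₁.V →ₗ[ℂ] L₁.V} {i₂ : N₂.V →ₗ[ℂ] L₂.V} {p₁ : K₁.V →ₗ[ℂ] M₁.V} {p₂ : K₂.V →ₗ[ℂ] M₂.V}

theorem HomotopicDeg.mat_conj (ha : HomotopicDeg p K₁ L₁ a (i₁ ∘ₗ a' ∘ₗ p₁))
    (hb : HomotopicDeg p K₂ L₁ b (i₁ ∘ₗ b' ∘ₗ p₂)) (hc : HomotopicDeg p K₁ L₂ c (i₂ ∘ₗ c' ∘ₗ p₁))
    (he : HomotopicDeg p K₂ L₂ e (i₂ ∘ₗ e' ∘ₗ p₂)) :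
    HomotopicDeg p (dirSum K₁ K₂) (dirSum L₁ L₂) (SBim2.mat a b c e)
      (SBim2.mat i₁ 0 0 i₂ ∘ₗ SBim2.mat a' b' c' e' ∘ₗ SBim2.mat p₁ 0 0 p₂) := by
  have := ha.mat hb hc he
  refine this.trans (.of_eq fun v => ?_)
  simp only [LinearMap.comp_apply, mat_apply, LinearMap.zero_apply, add_zero, zero_add, map_add]

theorem HomotopicDeg.coprod_conj (ha : HomotopicDeg p K₁ L₁ a (i₁ ∘ₗ a' ∘ₗ p₁))
    (hb : HomotopicDeg p K₂ L₁ b (i₁ ∘ₗ b' ∘ₗ p₂)) :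
    HomotopicDeg p (dirSum K₁ K₂) L₁ (a.coprod b)
      (i₁ ∘ₗ a'.coprod b' ∘ₗ SBim2.mat p₁ 0 0 p₂) := by
  refine (ha.coprod hb).trans (.of_eq fun v => ?_)
  simp only [LinearMap.comp_apply, mat_apply, LinearMap.zero_apply, add_zero, zero_add, map_add,
    LinearMap.coprod_apply]

end Conjugation

section Existence

variable {ε : (tensor FT FTinv).V →ₗ[ℂ] unit.V} (hε : IsHomotopyEquiv (tensor FT FTinv) unit ε)

/-- The constant `c` compares the eigenmaps with those of the minimal models. -/
def IsScalar (c : ℂ) : Prop := ∀ k,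
  HomotopicDeg (2, -2) (FTpow (k + 1)) (FTpow k) (eigenStep hε eigenW k)
    ((ret k).i ∘ₗ (c • tower.w k) ∘ₗ (ret (k + 1)).p) ∧
  HomotopicDeg (0, 2) (FTpow (k + 1)) (FTpow k) (eigenStep hε eigenZ k)
    ((ret k).i ∘ₗ (c • tower.z k) ∘ₗ (ret (k + 1)).p)

theorem exists_isScalar : ∃ c : ℂ, c ≠ 0 ∧ IsScalar hε c := by
  obtain ⟨c, hc, h⟩ := eigenStep_homotopic hε
  refine ⟨c, hc, fun k => ⟨(h k).1.trans (.of_eq fun v => ?_), (h k).2.trans (.of_eq fun v => ?_)⟩⟩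
  · exact (map_smul (ret k).i c _).symm
  · exact (map_smul (ret k).i c _).symm

theorem lx_homotopic (k : ℕ) : HomotopicDeg (0, 2) (FTpow k) (FTpow k) (FTpow k).lx
    ((ret k).i ∘ₗ (tower.M k).lx ∘ₗ (ret k).p) :=
  ((ret k).homotopic IsBimodMap.lx_deg).trans (.of_eq fun v =>
    congrArg (ret k).i ((ret k).p_chain.deg.bimod.map_lx v))

theorem IsScalar.neg_z {hε : IsHomotopyEquiv (tensor FT FTinv) unit ε} {c : ℂ}
    (h : IsScalar hε c) (k : ℕ) :
    HomotopicDeg (0, 2) (FTpow (k + 1)) (FTpow k) (-eigenStep hε eigenZ k)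
      ((ret k).i ∘ₗ (-(c • tower.z k)) ∘ₗ (ret (k + 1)).p) :=
  ((HomotopicDeg.of_eq fun v => (neg_one_smul ℂ _).symm).trans ((h k).2.smul (-1))).trans
    (.of_eq fun v => (neg_one_smul ℂ _).trans (map_neg (ret k).i _).symm)

theorem zero_homotopic {p : ℤ × ℤ} {K L M N : BimCpx} (i : N.V →ₗ[ℂ] L.V) (q : K.V →ₗ[ℂ] M.V) :
    HomotopicDeg p K L 0 (i ∘ₗ (0 : M.V →ₗ[ℂ] N.V) ∘ₗ q) :=
  .of_eq fun _ => (map_zero i).symm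

theorem modelA_homotopic {c : ℂ} (h : IsScalar hε c) : ∀ i : Pos,
    HomotopicDeg 0 (koszulAt i.next) (koszulAt i) (koszulMapAt hε i)
      (modelI i ∘ₗ modelA c i ∘ₗ modelP i.next)
  | .ev 0 => HomotopicDeg.coprod_conj
      ((h 0).2.shift_left (by simp) (parity_smul_add_even _ parity_zero))
      ((h 0).1.shift_left (by simp) (parity_smul_add_even _ parity_two))
  | .od j => by
    have e1 := parity_smul (j + 1)
    have e2 := parity_smul_add_even j (k := qdeg) parity_zero
    have e3 := parity_smul_add_even j (k := tdeg) parity_two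
    exact HomotopicDeg.mat_conj ((h (j + 1)).1.shift (by ext <;> simp; ring) e1 e2)
      (zero_homotopic _ _) ((h.neg_z (j + 1)).shift (by ext <;> simp; ring) e1 e3)
      ((lx_homotopic (j + 1)).shift (by ext <;> simp; ring) e1 e3)
  | .ev (j + 1) => by
    have e1 := parity_smul (j + 1)
    have e2 := parity_smul_add_even (j + 1) (k := qdeg) parity_zero
    have e3 := parity_smul_add_even (j + 1) (k := tdeg) parity_two
    exact HomotopicDeg.mat_conj ((lx_homotopic (j + 2)).shift (by ext <;> simp) e2 e1)
      (zero_homotopic _ _) ((h (j + 1)).2.shift (by ext <;> simp) e2 e1)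
      ((h (j + 1)).1.shift (by ext <;> simp; ring) e3 e1)

theorem transferAB (c : ℂ) (i : Pos) (v : (koszulAt i.next.next).V) :
    (koszulAt i).d (modelI i (modelB c i (modelP i.next.next v)))
      + modelI i (modelB c i (modelP i.next.next ((koszulAt i.next.next).d v)))
      = modelI i (modelA c i (modelP i.next (modelI i.next (modelA c i.next
        (modelP i.next.next v))))) := by
  rw [modelP_I, ← modelAB, map_add, (modelI_chain i).map_d, (modelP_chain i.next.next).map_d]

/-- Conjugation by the retracts preserves all relations: between two factors the composite `p ∘ i`
is the identity. Only the comparison of the entries with the prescribed maps is up to homotopy, as a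
convolution allows. -/
theorem convolution_nonempty : Nonempty (Convolution koszul (koszulMap hε)) := by
  obtain ⟨c, -, h⟩ := exists_isScalar hε
  refine exists_convolution
    (a := fun m => modelI (Pos.of m) ∘ₗ modelA c (Pos.of m) ∘ₗ modelP (Pos.of m).next)
    (fun m => modelI (Pos.of m) ∘ₗ modelB c (Pos.of m) ∘ₗ modelP (Pos.of m).next.next)
    (fun m => modelI (Pos.of m) ∘ₗ modelG c (Pos.of m) ∘ₗ modelP (Pos.of m).next.next.next)
    (fun m => (modelA_homotopic hε h (Pos.of m)).homotopic.symm) (fun m => ?_) (fun m => ?_)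
    (fun m => ?_) (fun m v => ?_) (fun m v => ?_) (fun m v => ?_) (fun m v => ?_) (fun m v => ?_)
  · exact (((modelI_chain _).comp ((modelA_chain c (Pos.of m)).comp (modelP_chain _))).congr
      (by simp))
  · exact (((modelI_chain _).bimod.comp ((modelB_bimod c (Pos.of m)).comp
      (modelP_chain _).bimod)).congr_deg (by simp))
  · exact (((modelI_chain _).comp ((modelG_chain c (Pos.of m)).comp (modelP_chain _))).congr
      (by simp))
  · exact transferAB c (Pos.of m) v
  · change modelI (Pos.of m) (modelA c _ (modelP _ (modelI _ (modelB c _ (modelP _ _)))))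
      = modelI (Pos.of m) (modelB c _ (modelP _ (modelI _ (modelA c _ (modelP _ _)))))
    rw [modelP_I, modelP_I]
    exact congrArg (modelI (Pos.of m)) (modelBA c (Pos.of m) _)
  · change modelI (Pos.of m) (modelB c _ (modelP _ (modelI _ (modelB c _ (modelP _ _)))))
      + modelI (Pos.of m) (modelA c _ (modelP _ (modelI _ (modelG c _ (modelP _ _)))))
      + modelI (Pos.of m) (modelG c _ (modelP _ (modelI _ (modelA c _ (modelP _ _))))) = 0
    rw [modelP_I, modelP_I, modelP_I, ← map_add, ← map_add]
    exact (congrArg (modelI (Pos.of m)) (modelBB c (Pos.of m) _)).trans (map_zero _)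
  · change modelI (Pos.of m) (modelB c _ (modelP _ (modelI _ (modelG c _ (modelP _ _)))))
      = modelI (Pos.of m) (modelG c _ (modelP _ (modelI _ (modelB c _ (modelP _ _)))))
    rw [modelP_I, modelP_I]
    exact congrArg (modelI (Pos.of m)) (modelBG c (Pos.of m) _)
  · change modelI (Pos.of m) (modelG c _ (modelP _ (modelI _ (modelG c _ (modelP _ _))))) = 0
    rw [modelP_I]
    exact (congrArg (modelI (Pos.of m)) (modelGG c (Pos.of m) _)).trans (map_zero _)

end Existence

/-! ### Soergel bimodules -/

/-- The class ignores differentials, so `FT⁻¹` is a summand, through the identity maps, of the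
direct sum of its three terms. -/
theorem isSoergel_FTinv : IsSoergel FTinv := by
  refine .summand (dirSum (shift (-2, 2) unit) (dirSum (shift (-1, 1) B) (shift (0, -1) B))) FTinv
    (LinearMap.id : FTinv.V →ₗ[ℂ] FTinv.V) (LinearMap.id : FTinv.V →ₗ[ℂ] FTinv.V)
    ⟨fun _ => rfl, fun _ => rfl, fun p v hv => gr_cast (M := FTinv) hv (add_zero p).symm⟩
    ⟨fun _ => rfl, fun _ => rfl, fun p v hv => gr_cast (M := FTinv) hv (add_zero p).symm⟩ rfl ?_
  exact .dirSum _ _ (.shift (-2, 2) _ .unit)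
    (.dirSum _ _ (.shift (-1, 1) _ .bottSamelson) (.shift (0, -1) _ .bottSamelson))

theorem isSoergel_FTpow : ∀ k, IsSoergel (FTpow k)
  | 0 => .unit
  | k + 1 => .tensor _ _ isSoergel_FTinv (isSoergel_FTpow k)

theorem isSoergel_koszulAt : ∀ i, IsSoergel (koszulAt i)
  | .ev 0 => .unit
  | .ev (j + 1) => .dirSum _ _ (.shift _ _ (isSoergel_FTpow (j + 2)))
      (.shift _ _ (isSoergel_FTpow (j + 1)))
  | .od j => .dirSum _ _ (.shift _ _ (isSoergel_FTpow (j + 1)))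
      (.shift _ _ (isSoergel_FTpow (j + 1)))

/-! ### The eigenmaps are chain maps -/

theorem eigenZ_chain : IsChainMap (shift qdeg unit) FT eigenZ := by
  refine .of ⟨fun v => Prod.ext (comult_lx v) ?_, fun v => Prod.ext (comult_rx v) ?_,
    fun p v hv => ⟨?_, Submodule.zero_mem _, Submodule.zero_mem _⟩⟩ fun v => ?_
  · exact Prod.ext (map_zero B.lx).symm (map_zero unit.lx).symm
  · exact Prod.ext (map_zero B.rx).symm (map_zero unit.rx).symm
  · exact gr_cast (M := B) (comult_mem hv) (by ext <;> simp; omega)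
  · refine Eq.trans (congrArg eigenZ (smul_zero (parity 0))) ((map_zero eigenZ).trans ?_)
    exact Prod.ext rfl (Prod.ext (delta_comult v).symm (map_zero mult).symm)

theorem eigenW_chain : IsChainMap (shift tdeg unit) FT eigenW := by
  refine .of ⟨fun v => ?_, fun v => ?_, fun p v hv => ⟨?_, ?_, ?_⟩⟩ fun v => ?_
  · exact Prod.ext (map_zero B.lx).symm (Prod.ext (map_zero B.lx).symm rfl)
  · exact Prod.ext (map_zero B.rx).symm (Prod.ext (map_zero B.rx).symm rfl)
  · exact Submodule.zero_mem _
  · exact Submodule.zero_mem _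
  · exact gr_cast (M := unit) hv (by ext <;> simp)
  · refine Eq.trans (congrArg eigenW (smul_zero (parity 2))) ((map_zero eigenW).trans ?_)
    exact Prod.ext rfl (Prod.ext (map_zero delta).symm (map_zero mult).symm)

/-! ### Complexes with three steps -/

/-- A homotopy for a retract that satisfies the side conditions. -/
theorem Retract.exists_special {M N : BimCpx} (r : Retract M N) :
    ∃ h : N.V →ₗ[ℂ] N.V, IsBimodMap N N (-1, 0) h ∧ (∀ v, r.p (h v) = 0) ∧
      (∀ v, h (r.i v) = 0) ∧ ∀ v, r.i (r.p v) = v - (N.d (h v) + h (N.d v)) := by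
  -- The idempotent complementary to `i p` commutes with `d`. Replacing `h` by `e h e` enforces both
  -- side conditions and keeps the homotopy formula.
  let e : N.V →ₗ[ℂ] N.V := LinearMap.id - r.i ∘ₗ r.p
  have he : IsBimodMap N N 0 e := IsBimodMap.id.sub
    ((r.i_chain.deg.bimod.comp r.p_chain.deg.bimod).congr_deg (zero_add 0))
  have hd : ∀ v, e (N.d v) = N.d (e v) := fun v => by
    simp [e, r.i_chain.map_d, r.p_chain.map_d]
  have hpe : ∀ v, r.p (e v) = 0 := fun v => by simp [e, r.p_i]
  have hei : ∀ v, e (r.i v) = 0 := fun v => by simp [e, r.p_i]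
  have hee : ∀ v, e (e v) = e v := fun v => by
    have : e (e v) = e v - r.i (r.p (e v)) := rfl
    rw [this, hpe, map_zero, sub_zero]
  refine ⟨e ∘ₗ r.h ∘ₗ e, ((he.comp (r.h_bimod.comp he))).congr_deg (by simp), fun v => hpe _,
    fun v => ?_, fun v => ?_⟩
  · simp [hei]
  · have h1 : r.i (r.p v) = v - e v := by simp [e]
    have h2 : ∀ w, N.d (r.h w) + r.h (N.d w) = e w := fun w => by simp [e, r.i_p]
    change _ = v - (N.d (e (r.h (e v))) + e (r.h (e (N.d v))))
    rw [hd, ← hd, ← map_add, h2, hee, hee, h1]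

/-- The maps of a complex with the three steps `A₂`, `A₁ ⊕ A₁`, `A₀`. -/
structure BlockData (A₂ A₁ A₀ : BimCpx) where
  f₁ : A₂.V →ₗ[ℂ] A₁.V
  f₂ : A₂.V →ₗ[ℂ] A₁.V
  g₁ : A₁.V →ₗ[ℂ] A₀.V
  g₂ : A₁.V →ₗ[ℂ] A₀.V
  u : A₂.V →ₗ[ℂ] A₀.V
  f₁_chain : IsChainDeg (2, -2) A₂ A₁ f₁
  f₂_chain : IsChainDeg (0, 2) A₂ A₁ f₂
  g₁_chain : IsChainDeg (0, 2) A₁ A₀ g₁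
  g₂_chain : IsChainDeg (2, -2) A₁ A₀ g₂
  u_bimod : IsBimodMap A₂ A₀ (1, 0) u
  rel : ∀ v, u (A₂.d v) + A₀.d (u v) + (g₁ (f₁ v) + g₂ (f₂ v)) = 0

namespace BlockData

variable {A₂ A₁ A₀ : BimCpx} (X Y : BlockData A₂ A₁ A₀)

/-- The bigraded bimodule underlying a complex with three steps. -/
abbrev sum (A₂ A₁ A₀ : BimCpx) : BimCpx :=
  -- The two shifts of `A₁` are those for which all entries `f₁`, `f₂`, `g₁`, `g₂` of the
  -- differential acquire degree `(1, 0)`.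
  dirSum A₂ (dirSum (shift (-1, 2) A₁) (dirSum (shift (1, -2) A₁) A₀))

/-- The space underlying a complex with three steps. -/
abbrev BV (A₂ A₁ A₀ : BimCpx) : Type := A₂.V × A₁.V × A₁.V × A₀.V

/-- The differential of a complex with three steps. -/
def D : BV A₂ A₁ A₀ →ₗ[ℂ] BV A₂ A₁ A₀ where
  toFun v := (A₂.d v.1, X.f₁ v.1 - A₁.d v.2.1, X.f₂ v.1 - A₁.d v.2.2.1,
    X.u v.1 + (X.g₁ v.2.1 + X.g₂ v.2.2.1) + A₀.d v.2.2.2)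
  map_add' v w := by ext <;> simp <;> abel
  map_smul' c v := by ext <;> simp [smul_sub]

theorem D_apply (v : BV A₂ A₁ A₀) : X.D v = (A₂.d v.1, X.f₁ v.1 - A₁.d v.2.1,
    X.f₂ v.1 - A₁.d v.2.2.1, X.u v.1 + (X.g₁ v.2.1 + X.g₂ v.2.2.1) + A₀.d v.2.2.2) := rfl

theorem D_lx (v : BV A₂ A₁ A₀) : X.D (A₂.lx v.1, A₁.lx v.2.1, A₁.lx v.2.2.1, A₀.lx v.2.2.2)
    = (A₂.lx (X.D v).1, A₁.lx (X.D v).2.1, A₁.lx (X.D v).2.2.1, A₀.lx (X.D v).2.2.2) := by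
  simp [D_apply, X.f₁_chain.bimod.map_lx, X.f₂_chain.bimod.map_lx, X.g₁_chain.bimod.map_lx,
    X.g₂_chain.bimod.map_lx, X.u_bimod.map_lx, BimCpx.d_lx]

theorem D_rx (v : BV A₂ A₁ A₀) : X.D (A₂.rx v.1, A₁.rx v.2.1, A₁.rx v.2.2.1, A₀.rx v.2.2.2)
    = (A₂.rx (X.D v).1, A₁.rx (X.D v).2.1, A₁.rx (X.D v).2.2.1, A₀.rx (X.D v).2.2.2) := by
  simp [D_apply, X.f₁_chain.bimod.map_rx, X.f₂_chain.bimod.map_rx, X.g₁_chain.bimod.map_rx,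
    X.g₂_chain.bimod.map_rx, X.u_bimod.map_rx, BimCpx.d_rx]

theorem D_D (v : BV A₂ A₁ A₀) : X.D (X.D v) = 0 := by
  simp only [D_apply, map_add, map_sub, A₂.d_d, A₁.d_d, A₀.d_d, X.f₁_chain.map_d,
    X.f₂_chain.map_d, X.g₁_chain.map_d, X.g₂_chain.map_d]
  refine Prod.ext rfl (Prod.ext (by simp) (Prod.ext (by simp) ?_))
  refine Eq.trans ?_ (X.rel v.1)
  dsimp only
  abel

/-- A complex with three steps. -/
def block : BimCpx :=
  withD (sum A₂ A₁ A₀) X.D X.D_lx X.D_rx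
    (fun p v hv => by
      refine ⟨A₂.d_mem _ _ hv.1, Submodule.sub_mem _ ?_ ?_, Submodule.sub_mem _ ?_ ?_,
        Submodule.add_mem _ (Submodule.add_mem _ ?_ (Submodule.add_mem _ ?_ ?_)) ?_⟩
      · exact gr_cast (M := A₁) (X.f₁_chain.bimod.map_gr _ _ hv.1) (by ext <;> simp <;> omega)
      · exact gr_cast (M := A₁) (A₁.d_mem _ _ hv.2.1) (by ext <;> simp)
      · exact gr_cast (M := A₁) (X.f₂_chain.bimod.map_gr _ _ hv.1) (by ext <;> simp)
      · exact gr_cast (M := A₁) (A₁.d_mem _ _ hv.2.2.1) (by ext <;> simp)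
      · exact X.u_bimod.map_gr _ _ hv.1
      · exact gr_cast (M := A₀) (X.g₁_chain.bimod.map_gr _ _ hv.2.1) (by ext <;> simp)
      · exact gr_cast (M := A₀) (X.g₂_chain.bimod.map_gr _ _ hv.2.2.1) (by ext <;> simp; omega)
      · exact A₀.d_mem _ _ hv.2.2.2)
    X.D_D

/-- A unipotent change of coordinates. -/
def unipotent (φ₁ φ₂ : A₂.V →ₗ[ℂ] A₁.V) (ψ₁ ψ₂ : A₁.V →ₗ[ℂ] A₀.V) (θ : A₂.V →ₗ[ℂ] A₀.V) :
    BV A₂ A₁ A₀ ≃ₗ[ℂ] BV A₂ A₁ A₀ where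
  toFun v := (v.1, v.2.1 + φ₁ v.1, v.2.2.1 + φ₂ v.1,
    v.2.2.2 + (ψ₁ v.2.1 + ψ₂ v.2.2.1) + θ v.1)
  invFun v := (v.1, v.2.1 - φ₁ v.1, v.2.2.1 - φ₂ v.1,
    v.2.2.2 - (ψ₁ (v.2.1 - φ₁ v.1) + ψ₂ (v.2.2.1 - φ₂ v.1)) - θ v.1)
  map_add' v w := by ext <;> simp <;> abel
  map_smul' c v := by ext <;> simp
  left_inv v := by ext <;> simp; abel
  right_inv v := by ext <;> simp; abel

theorem unipotent_apply (φ₁ φ₂ : A₂.V →ₗ[ℂ] A₁.V) (ψ₁ ψ₂ : A₁.V →ₗ[ℂ] A₀.V)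
    (θ : A₂.V →ₗ[ℂ] A₀.V) (v : BV A₂ A₁ A₀) : unipotent φ₁ φ₂ ψ₁ ψ₂ θ v =
      (v.1, v.2.1 + φ₁ v.1, v.2.2.1 + φ₂ v.1, v.2.2.2 + (ψ₁ v.2.1 + ψ₂ v.2.2.1) + θ v.1) := rfl

variable {X Y}

/-- The change of coordinates by `φ` and `ψ` alters the short maps by boundaries. All corrections
meet only in the long entry, where `θ` must absorb what is left. -/
theorem hequiv {φ₁ φ₂ : A₂.V →ₗ[ℂ] A₁.V} {ψ₁ ψ₂ : A₁.V →ₗ[ℂ] A₀.V} {θ : A₂.V →ₗ[ℂ] A₀.V}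
    (bφ₁ : IsBimodMap A₂ A₁ (1, -2) φ₁) (bφ₂ : IsBimodMap A₂ A₁ (-1, 2) φ₂)
    (bψ₁ : IsBimodMap A₁ A₀ (-1, 2) ψ₁) (bψ₂ : IsBimodMap A₁ A₀ (1, -2) ψ₂)
    (bθ : IsBimodMap A₂ A₀ 0 θ)
    (hφ₁ : ∀ v, X.f₁ v = Y.f₁ v - (A₁.d (φ₁ v) + φ₁ (A₂.d v)))
    (hφ₂ : ∀ v, X.f₂ v = Y.f₂ v - (A₁.d (φ₂ v) + φ₂ (A₂.d v)))
    (hψ₁ : ∀ v, X.g₁ v = Y.g₁ v + (A₀.d (ψ₁ v) + ψ₁ (A₁.d v)))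
    (hψ₂ : ∀ v, X.g₂ v = Y.g₂ v + (A₀.d (ψ₂ v) + ψ₂ (A₁.d v)))
    (hθ : ∀ v, X.u v + (ψ₁ (X.f₁ v) + ψ₂ (X.f₂ v)) + θ (A₂.d v)
      = Y.u v + (Y.g₁ (φ₁ v) + Y.g₂ (φ₂ v)) + A₀.d (θ v)) : HEquiv X.block Y.block := by
  refine HEquiv.of_equiv (M := X.block) (N := Y.block) (e := unipotent φ₁ φ₂ ψ₁ ψ₂ θ)
    (.of ⟨?_, ?_, fun p v hv => ?_⟩ ?_)
  · change ∀ v : BV A₂ A₁ A₀, unipotent φ₁ φ₂ ψ₁ ψ₂ θ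
      (A₂.lx v.1, A₁.lx v.2.1, A₁.lx v.2.2.1, A₀.lx v.2.2.2)
      = (A₂.lx (unipotent φ₁ φ₂ ψ₁ ψ₂ θ v).1, A₁.lx (unipotent φ₁ φ₂ ψ₁ ψ₂ θ v).2.1,
        A₁.lx (unipotent φ₁ φ₂ ψ₁ ψ₂ θ v).2.2.1, A₀.lx (unipotent φ₁ φ₂ ψ₁ ψ₂ θ v).2.2.2)
    intro v
    simp [unipotent_apply, bφ₁.map_lx, bφ₂.map_lx, bψ₁.map_lx, bψ₂.map_lx, bθ.map_lx]
  · change ∀ v : BV A₂ A₁ A₀, unipotent φ₁ φ₂ ψ₁ ψ₂ θ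
      (A₂.rx v.1, A₁.rx v.2.1, A₁.rx v.2.2.1, A₀.rx v.2.2.2)
      = (A₂.rx (unipotent φ₁ φ₂ ψ₁ ψ₂ θ v).1, A₁.rx (unipotent φ₁ φ₂ ψ₁ ψ₂ θ v).2.1,
        A₁.rx (unipotent φ₁ φ₂ ψ₁ ψ₂ θ v).2.2.1, A₀.rx (unipotent φ₁ φ₂ ψ₁ ψ₂ θ v).2.2.2)
    intro v
    simp [unipotent_apply, bφ₁.map_rx, bφ₂.map_rx, bψ₁.map_rx, bψ₂.map_rx, bθ.map_rx]
  · refine ⟨gr_cast (M := A₂) hv.1 (by simp), Submodule.add_mem _ ?_ ?_, Submodule.add_mem _ ?_ ?_,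
      Submodule.add_mem _ (Submodule.add_mem _ ?_ (Submodule.add_mem _ ?_ ?_)) ?_⟩
    · exact gr_cast (M := A₁) hv.2.1 (by ext <;> simp)
    · exact gr_cast (M := A₁) (bφ₁.map_gr _ _ hv.1) (by ext <;> simp; omega)
    · exact gr_cast (M := A₁) hv.2.2.1 (by ext <;> simp)
    · exact gr_cast (M := A₁) (bφ₂.map_gr _ _ hv.1) (by ext <;> simp; omega)
    · exact gr_cast (M := A₀) hv.2.2.2 (by ext <;> simp)
    · exact gr_cast (M := A₀) (bψ₁.map_gr _ _ hv.2.1) (by ext <;> simp)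
    · exact gr_cast (M := A₀) (bψ₂.map_gr _ _ hv.2.2.1) (by ext <;> simp)
    · exact gr_cast (M := A₀) (bθ.map_gr _ _ hv.1) (by ext <;> simp)
  · change ∀ v : BV A₂ A₁ A₀, unipotent φ₁ φ₂ ψ₁ ψ₂ θ (X.D v) = Y.D (unipotent φ₁ φ₂ ψ₁ ψ₂ θ v)
    intro v
    have h := hθ v.1
    simp only [D_apply, unipotent_apply]
    refine Prod.ext rfl (Prod.ext ?_ (Prod.ext ?_ ?_))
    · simp only [hφ₁, map_add]; abel
    · simp only [hφ₂, map_add]; abel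
    · simp only [map_add, map_sub]
      rw [hψ₁, hψ₂]
      rw [← sub_eq_zero] at h ⊢
      refine Eq.trans ?_ h
      abel

end BlockData

/-! ### Contraction of the standard block and of its perturbations -/

namespace BlockData

variable {A₂ A₁ A₀ : BimCpx} (τ : Tower) (k : ℕ) (c : ℂ) (r₂ : Retract (τ.M (k + 2)) A₂)
  (r₁ : Retract (τ.M (k + 1)) A₁) (r₀ : Retract (τ.M k) A₀)

/-- The complex with three steps given by the eigenmaps. -/
def standard : BlockData A₂ A₁ A₀ where
  f₁ := r₁.i ∘ₗ (c • τ.w (k + 1)) ∘ₗ r₂.p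
  f₂ := r₁.i ∘ₗ (-(c • τ.z (k + 1))) ∘ₗ r₂.p
  g₁ := r₀.i ∘ₗ (c • τ.z k) ∘ₗ r₁.p
  g₂ := r₀.i ∘ₗ (c • τ.w k) ∘ₗ r₁.p
  u := 0
  f₁_chain := (r₁.i_chain.deg.comp (((τ.w_chain (k + 1)).smul c).comp r₂.p_chain.deg)).congr
    (by simp)
  f₂_chain := (r₁.i_chain.deg.comp (((τ.z_chain (k + 1)).smul c).neg.comp r₂.p_chain.deg)).congr
    (by simp)
  g₁_chain := (r₀.i_chain.deg.comp (((τ.z_chain k).smul c).comp r₁.p_chain.deg)).congr (by simp)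
  g₂_chain := (r₀.i_chain.deg.comp (((τ.w_chain k).smul c).comp r₁.p_chain.deg)).congr (by simp)
  u_bimod := .zero
  rel v := by simp [r₁.p_i, τ.w_z]

/-- The contraction of the standard complex with three steps, up to a nilpotent term. -/
def standardS (h₂ : A₂.V →ₗ[ℂ] A₂.V) (h₁ : A₁.V →ₗ[ℂ] A₁.V) (h₀ : A₀.V →ₗ[ℂ] A₀.V) :
    BV A₂ A₁ A₀ →ₗ[ℂ] BV A₂ A₁ A₀ where
  -- The terms with `c⁻¹` split the sequence: `inl - tail` inverts `(w, -z)` by `inl_w`, and `inl`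
  -- into the second summand is a section of `(z, w)`. The remaining terms contract each complex
  -- onto its model.
  toFun v := (h₂ v.1 + c⁻¹ • r₂.i (τ.inl (k + 1) (r₁.p v.2.1) - τ.tail k (r₁.p v.2.2.1)),
    -h₁ v.2.1, -h₁ v.2.2.1 + c⁻¹ • r₁.i (τ.inl k (r₀.p v.2.2.2)), h₀ v.2.2.2)
  map_add' v w := by ext <;> simp [smul_sub] <;> abel
  map_smul' a v := by ext <;> simp [smul_sub, smul_comm a]

/-- The nilpotent term. -/
def standardN : BV A₂ A₁ A₀ →ₗ[ℂ] BV A₂ A₁ A₀ where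
  toFun v := (c⁻¹ • (A₂.d (r₂.i (τ.inl (k + 1) (r₁.p v.2.1) - τ.tail k (r₁.p v.2.2.1)))
      - r₂.i (τ.inl (k + 1) (r₁.p (A₁.d v.2.1)) - τ.tail k (r₁.p (A₁.d v.2.2.1)))),
    0, c⁻¹ • (r₁.i (τ.inl k (r₀.p (A₀.d v.2.2.2))) - A₁.d (r₁.i (τ.inl k (r₀.p v.2.2.2)))), 0)
  map_add' v w := by ext <;> simp [smul_sub] <;> abel
  map_smul' a v := by ext <;> simp [smul_sub, smul_comm a]

/-- The operator measures the failure of the splittings to be chain maps. It sends the last term to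
the middle and the middle to the first term, so three applications leave nothing. -/
theorem standardN_cube (v : BV A₂ A₁ A₀) :
    standardN τ k c r₂ r₁ r₀ (standardN τ k c r₂ r₁ r₀ (standardN τ k c r₂ r₁ r₀ v)) = 0 := by
  ext <;> simp [standardN]

/-- Modulo the error `standardN`, the splitting contributes `i p` on every term and the homotopies
contribute `id - i p`. The side conditions `p h = 0` and `h i = 0` remove the mixed products. -/
theorem standard_commutator (hc : c ≠ 0) {h₂ : A₂.V →ₗ[ℂ] A₂.V} {h₁ : A₁.V →ₗ[ℂ] A₁.V}
    {h₀ : A₀.V →ₗ[ℂ] A₀.V}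
    (p₂ : ∀ v, r₂.p (h₂ v) = 0) (i₁ : ∀ v, h₁ (r₁.i v) = 0) (p₁ : ∀ v, r₁.p (h₁ v) = 0)
    (i₀ : ∀ v, h₀ (r₀.i v) = 0)
    (e₂ : ∀ v, r₂.i (r₂.p v) = v - (A₂.d (h₂ v) + h₂ (A₂.d v)))
    (e₁ : ∀ v, r₁.i (r₁.p v) = v - (A₁.d (h₁ v) + h₁ (A₁.d v)))
    (e₀ : ∀ v, r₀.i (r₀.p v) = v - (A₀.d (h₀ v) + h₀ (A₀.d v))) (v : BV A₂ A₁ A₀) :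
    (standard τ k c r₂ r₁ r₀).D (standardS τ k c r₂ r₁ r₀ h₂ h₁ h₀ v)
      + standardS τ k c r₂ r₁ r₀ h₂ h₁ h₀ ((standard τ k c r₂ r₁ r₀).D v)
      = v + standardN τ k c r₂ r₁ r₀ v := by
  obtain ⟨x, a, b, z⟩ := v
  simp only [D_apply, standardS, standardN, standard, LinearMap.coe_mk, AddHom.coe_mk,
    LinearMap.comp_apply, LinearMap.smul_apply, LinearMap.neg_apply, LinearMap.zero_apply]
  refine Prod.ext ?_ (Prod.ext ?_ (Prod.ext ?_ ?_))
  · have h := e₂ x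
    rw [← τ.inl_w k (r₂.p x), map_add] at h
    simp [r₁.p_i, hc, smul_sub, smul_smul]
    rw [← sub_eq_zero] at h ⊢
    refine Eq.trans ?_ h
    abel
  · have h := e₁ a
    simp [r₂.p_i, p₂, i₁, hc, smul_sub, smul_smul, τ.w_inl, τ.w_tail]
    rw [h]; abel
  · have h := e₁ b
    simp [r₂.p_i, r₁.p_i, r₀.p_i, p₂, i₁, hc, smul_sub, smul_smul, τ.z_inl, τ.z_tail]
    rw [h]; abel
  · have h := e₀ z
    simp [r₁.p_i, p₁, i₀, hc, smul_sub, smul_smul, τ.w_inl]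
    rw [h]; abel

theorem standardS_bimod {h₂ : A₂.V →ₗ[ℂ] A₂.V} {h₁ : A₁.V →ₗ[ℂ] A₁.V} {h₀ : A₀.V →ₗ[ℂ] A₀.V}
    (b₂ : IsBimodMap A₂ A₂ (-1, 0) h₂) (b₁ : IsBimodMap A₁ A₁ (-1, 0) h₁)
    (b₀ : IsBimodMap A₀ A₀ (-1, 0) h₀) :
    IsBimodMap (sum A₂ A₁ A₀) (sum A₂ A₁ A₀) (-1, 0)
      (standardS (A₂ := A₂) (A₁ := A₁) (A₀ := A₀) τ k c r₂ r₁ r₀ h₂ h₁ h₀) := by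
  have s₁ := r₂.i_chain.deg.bimod.comp ((τ.inl_bimod (k + 1)).comp r₁.p_chain.deg.bimod)
  have s₂ := r₂.i_chain.deg.bimod.comp ((τ.tail_bimod k).comp r₁.p_chain.deg.bimod)
  have s₃ := r₁.i_chain.deg.bimod.comp ((τ.inl_bimod k).comp r₀.p_chain.deg.bimod)
  refine ⟨?_, ?_, fun p v hv => ⟨Submodule.add_mem _ (b₂.map_gr _ _ hv.1)
    (Submodule.smul_mem _ _ ?_), Submodule.neg_mem _ ?_, Submodule.add_mem _
      (Submodule.neg_mem _ ?_) (Submodule.smul_mem _ _ ?_), b₀.map_gr _ _ hv.2.2.2⟩⟩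
  · change ∀ v : BV A₂ A₁ A₀, standardS τ k c r₂ r₁ r₀ h₂ h₁ h₀
      (A₂.lx v.1, A₁.lx v.2.1, A₁.lx v.2.2.1, A₀.lx v.2.2.2) =
      (A₂.lx (standardS τ k c r₂ r₁ r₀ h₂ h₁ h₀ v).1,
        A₁.lx (standardS τ k c r₂ r₁ r₀ h₂ h₁ h₀ v).2.1,
        A₁.lx (standardS τ k c r₂ r₁ r₀ h₂ h₁ h₀ v).2.2.1,
        A₀.lx (standardS τ k c r₂ r₁ r₀ h₂ h₁ h₀ v).2.2.2)
    intro v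
    have t₁ := s₁.map_lx
    have t₂ := s₂.map_lx
    have t₃ := s₃.map_lx
    simp only [LinearMap.comp_apply] at t₁ t₂ t₃
    simp [standardS, b₂.map_lx, b₁.map_lx, b₀.map_lx, t₁, t₂, t₃]
  · change ∀ v : BV A₂ A₁ A₀, standardS τ k c r₂ r₁ r₀ h₂ h₁ h₀
      (A₂.rx v.1, A₁.rx v.2.1, A₁.rx v.2.2.1, A₀.rx v.2.2.2) =
      (A₂.rx (standardS τ k c r₂ r₁ r₀ h₂ h₁ h₀ v).1,
        A₁.rx (standardS τ k c r₂ r₁ r₀ h₂ h₁ h₀ v).2.1,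
        A₁.rx (standardS τ k c r₂ r₁ r₀ h₂ h₁ h₀ v).2.2.1,
        A₀.rx (standardS τ k c r₂ r₁ r₀ h₂ h₁ h₀ v).2.2.2)
    intro v
    have t₁ := s₁.map_rx
    have t₂ := s₂.map_rx
    have t₃ := s₃.map_rx
    simp only [LinearMap.comp_apply] at t₁ t₂ t₃
    simp [standardS, b₂.map_rx, b₁.map_rx, b₀.map_rx, t₁, t₂, t₃]
  · rw [map_sub]
    exact Submodule.sub_mem _
      (gr_cast (M := A₂) (s₁.map_gr _ _ hv.2.1) (by ext <;> simp <;> omega))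
      (gr_cast (M := A₂) (s₂.map_gr _ _ hv.2.2.1) (by ext <;> simp <;> omega))
  · exact gr_cast (M := A₁) (b₁.map_gr _ _ hv.2.1) (by ext <;> simp)
  · exact gr_cast (M := A₁) (b₁.map_gr _ _ hv.2.2.1) (by ext <;> simp <;> omega)
  · exact gr_cast (M := A₁) (s₃.map_gr _ _ hv.2.2.2) (by ext <;> simp <;> omega)

theorem standard_contractible (hc : c ≠ 0) : Contractible (standard τ k c r₂ r₁ r₀).block := by
  obtain ⟨h₂, b₂, p₂, -, e₂⟩ := r₂.exists_special
  obtain ⟨h₁, b₁, p₁, i₁, e₁⟩ := r₁.exists_special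
  obtain ⟨h₀, b₀, -, i₀, e₀⟩ := r₀.exists_special
  refine contractible_of_bijective (M := (standard τ k c r₂ r₁ r₀).block)
    (standardS (A₂ := A₂) (A₁ := A₁) (A₀ := A₀) τ k c r₂ r₁ r₀ h₂ h₁ h₀) ?_ ?_
  · have := standardS_bimod (A₂ := A₂) (A₁ := A₁) (A₀ := A₀) τ k c r₂ r₁ r₀ b₂ b₁ b₀
    exact ⟨this.map_lx, this.map_rx, this.map_gr⟩
  · have h := bijective_one_add (standardN τ k c r₂ r₁ r₀) fun v =>
      ⟨3, standardN_cube τ k c r₂ r₁ r₀ v⟩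
    have h' : (standard τ k c r₂ r₁ r₀).D ∘ₗ standardS τ k c r₂ r₁ r₀ h₂ h₁ h₀
        + standardS τ k c r₂ r₁ r₀ h₂ h₁ h₀ ∘ₗ (standard τ k c r₂ r₁ r₀).D
        = LinearMap.id + standardN τ k c r₂ r₁ r₀ :=
      LinearMap.ext (standard_commutator τ k c r₂ r₁ r₀ hc p₂ i₁ p₁ i₀ e₂ e₁ e₀)
    rw [← h'] at h
    exact h

variable {τ k c r₂ r₁ r₀}

/-- A complex with three steps is contractible if its maps are homotopic to the eigenmaps. -/
theorem contractible (X : BlockData A₂ A₁ A₀) (hc : c ≠ 0)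
    (hf₁ : HomotopicDeg (2, -2) A₂ A₁ X.f₁ (standard τ k c r₂ r₁ r₀).f₁)
    (hf₂ : HomotopicDeg (0, 2) A₂ A₁ X.f₂ (standard τ k c r₂ r₁ r₀).f₂)
    (hg₁ : HomotopicDeg (0, 2) A₁ A₀ X.g₁ (standard τ k c r₂ r₁ r₀).g₁)
    (hg₂ : HomotopicDeg (2, -2) A₁ A₀ X.g₂ (standard τ k c r₂ r₁ r₀).g₂) :
    Contractible X.block := by
  obtain ⟨φ₁, bφ₁, eφ₁⟩ := hf₁
  obtain ⟨φ₂, bφ₂, eφ₂⟩ := hf₂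
  obtain ⟨ψ₁, bψ₁, eψ₁⟩ := hg₁
  obtain ⟨ψ₂, bψ₂, eψ₂⟩ := hg₂
  let Y := standard τ k c r₂ r₁ r₀
  -- The long entry after the homotopies of the short maps have been absorbed. Comparing the
  -- relations of `X` and `Y` shows that it anticommutes with the differentials.
  let u : A₂.V →ₗ[ℂ] A₀.V := X.u + (ψ₁ ∘ₗ X.f₁ + ψ₂ ∘ₗ X.f₂) + (Y.g₁ ∘ₗ φ₁ + Y.g₂ ∘ₗ φ₂)
  have bu : IsBimodMap A₂ A₀ (1, 0) u := by
    refine (X.u_bimod.add (IsBimodMap.add ?_ ?_)).add (IsBimodMap.add ?_ ?_)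
    · exact (bψ₁.comp X.f₁_chain.bimod).congr_deg (by simp)
    · exact (bψ₂.comp X.f₂_chain.bimod).congr_deg (by simp)
    · exact (Y.g₁_chain.bimod.comp bφ₁).congr_deg (by simp)
    · exact (Y.g₂_chain.bimod.comp bφ₂).congr_deg (by simp)
  have hu : ∀ v, u (A₂.d v) = - A₀.d (u v) := by
    intro v
    have a1 := congrArg Y.g₁ (eφ₁ v)
    have a2 := congrArg Y.g₂ (eφ₂ v)
    have a3 := eψ₁ (X.f₁ v)
    have a4 := eψ₂ (X.f₂ v)
    have a5 := X.rel v
    have a6 : (0 : A₀.V) + A₀.d 0 + (Y.g₁ (Y.f₁ v) + Y.g₂ (Y.f₂ v)) = 0 := Y.rel v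
    simp only [map_sub, map_add, map_zero, Y.g₁_chain.map_d, Y.g₂_chain.map_d] at a1 a2 a6
    simp only [u, LinearMap.add_apply, LinearMap.comp_apply, map_add, X.f₁_chain.map_d,
      X.f₂_chain.map_d]
    linear_combination (norm := module) a5 - a6 - a1 - a2 - a3 - a4
  have h0 : ∀ v, r₀.p (u (r₂.i v)) = 0 :=
    τ.hom_zero k (r₀.p ∘ₗ u ∘ₗ r₂.i) ((r₀.p_chain.deg.bimod.comp
      (bu.comp r₂.i_chain.deg.bimod)).congr_deg (by simp))
  -- Compression of `u` to the models vanishes by `hom_zero`. Rewriting first the target and then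
  -- the source by `id = i p + d h + h d` leaves only boundary terms, and `θ` collects the two
  -- homotopies involved.
  let θ : A₂.V →ₗ[ℂ] A₀.V := r₀.h ∘ₗ u - r₀.i ∘ₗ r₀.p ∘ₗ u ∘ₗ r₂.h
  have bθ : IsBimodMap A₂ A₀ 0 θ := by
    refine IsBimodMap.sub ?_ ?_
    · exact (r₀.h_bimod.comp bu).congr_deg (by simp)
    · exact (r₀.i_chain.deg.bimod.comp (r₀.p_chain.deg.bimod.comp
        (bu.comp r₂.h_bimod))).congr_deg (by simp)
  have hθ : ∀ v, u v + θ (A₂.d v) = A₀.d (θ v) := by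
    intro v
    have a1 := r₀.i_p (u v)
    have a2 := congrArg (fun y => r₀.i (r₀.p (u y))) (r₂.i_p v)
    simp only [h0, map_sub, map_add, map_zero, hu, map_neg, r₀.p_chain.map_d,
      r₀.i_chain.map_d] at a2
    simp only [θ, LinearMap.sub_apply, LinearMap.comp_apply, hu, map_sub, map_neg]
    linear_combination (norm := module) -a1 - a2
  refine .of_hequiv (hequiv (Y := Y) (φ₁ := -φ₁) (φ₂ := -φ₂) (ψ₁ := ψ₁) (ψ₂ := ψ₂) (θ := θ)
    (bφ₁.congr_deg (by simp)).neg (bφ₂.congr_deg (by simp)).neg (bψ₁.congr_deg (by simp))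
    (bψ₂.congr_deg (by simp)) bθ (fun v => ?_) (fun v => ?_) (fun v => ?_) (fun v => ?_)
    (fun v => ?_)) (standard_contractible τ k c r₂ r₁ r₀ hc)
  · have := eφ₁ v
    simp only [LinearMap.neg_apply, map_neg]
    linear_combination (norm := module) this
  · have := eφ₂ v
    simp only [LinearMap.neg_apply, map_neg]
    linear_combination (norm := module) this
  · linear_combination (norm := module) eψ₁ v
  · linear_combination (norm := module) eψ₂ v
  · have a1 := hθ v
    have a2 : Y.u v = 0 := rfl
    simp only [u, LinearMap.add_apply, LinearMap.comp_apply] at a1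
    simp only [LinearMap.neg_apply, map_neg, a2]
    linear_combination (norm := module) a1

end BlockData

/-! ### Triangular complexes -/

/-- A vector supported in indices below `k` is moved strictly down at every application, hence is
killed by the `k`-th power. Finite supports are essential: on the direct product this would fail. -/
theorem locally_nilpotent_of_lower {V : ℕ → Type} [∀ m, AddCommGroup (V m)] [∀ m, Module ℂ (V m)]
    (n : DirectSum ℕ V →ₗ[ℂ] DirectSum ℕ V)
    (hn : ∀ j m x, j ≤ m → n (DirectSum.lof ℂ ℕ V j x) m = 0) (v : DirectSum ℕ V) :
    ∃ k, (n ^ k) v = 0 := by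
  classical
  have step : ∀ k (v : DirectSum ℕ V), (∀ m, k + 1 ≤ m → v m = 0) → ∀ m, k ≤ m → n v m = 0 := by
    intro k v hv m hm
    rw [← DirectSum.sum_support_of v, map_sum, DFinsupp.finsetSum_apply]
    refine Finset.sum_eq_zero fun j hj => hn j m _ ?_
    by_contra hc
    exact (DFinsupp.mem_support_iff.1 hj) (hv j (by omega))
  have key : ∀ k (v : DirectSum ℕ V), (∀ m, k ≤ m → v m = 0) → (n ^ k) v = 0 := by
    intro k
    induction k with
    | zero => exact fun v hv => DFinsupp.ext fun m => hv m (Nat.zero_le m)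
    | succ k ih =>
      intro v hv
      rw [pow_succ, Module.End.mul_apply]
      exact ih _ (step k v hv)
  refine ⟨(DFinsupp.support v).sup id + 1, key _ v fun m hm => ?_⟩
  by_contra hc
  have : m ≤ (DFinsupp.support v).sup id :=
    Finset.le_sup (f := id) (DFinsupp.mem_support_iff.2 hc)
  omega

/-- A complex with a triangular differential is contractible if the diagonal entries are. -/
theorem contractible_of_triangular {T : BimCpx} {E : ℕ → BimCpx} (e : T.V ≃ₗ[ℂ] (bigSum E).V)
    (he : IsBimodMap T (bigSum E) 0 e.toLinearMap)
    (hdiag : ∀ j x, (e (T.d (e.symm (DirectSum.lof ℂ ℕ (fun m => (E m).V) j x))) :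
      DirectSum ℕ fun m => (E m).V) j = (E j).d x)
    (htri : ∀ j n x, j < n → (e (T.d (e.symm (DirectSum.lof ℂ ℕ (fun m => (E m).V) j x))) :
      DirectSum ℕ fun m => (E m).V) n = 0)
    (hE : ∀ j, Contractible (E j)) : Contractible T := by
  choose h hb hh using hE
  have hh' : ∀ j x, (E j).d (h j x) + h j ((E j).d x) = x := fun j x => by
    have := LinearMap.congr_fun (hh j) x
    simpa using this.symm
  let S' : (bigSum E).V →ₗ[ℂ] (bigSum E).V := DFinsupp.mapRange.linearMap h
  let D' : (bigSum E).V →ₗ[ℂ] (bigSum E).V := e.toLinearMap ∘ₗ T.d ∘ₗ e.symm.toLinearMap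
  have bS' : IsBimodMap (bigSum E) (bigSum E) (-1, 0) S' :=
    ⟨fun v => DFinsupp.ext fun m => (hb m).map_lx _, fun v => DFinsupp.ext fun m => (hb m).map_rx _,
      fun p v hv m => (hb m).map_gr _ _ (hv m)⟩
  -- The contractions of the diagonal entries make `D' S' + S' D'` equal to the identity on the
  -- diagonal. The difference `n` therefore strictly lowers the index.
  let n : (bigSum E).V →ₗ[ℂ] (bigSum E).V := D' ∘ₗ S' + S' ∘ₗ D' - LinearMap.id
  have hS' : ∀ j x, S' (DirectSum.lof ℂ ℕ (fun m => (E m).V) j x)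
      = DirectSum.lof ℂ ℕ (fun m => (E m).V) j (h j x) := fun j x =>
    DFinsupp.mapRange_single (hf := fun i => map_zero (h i))
  have hn : ∀ j m x, j ≤ m → (n (DirectSum.lof ℂ ℕ (fun m => (E m).V) j x) :
      DirectSum ℕ fun m => (E m).V) m = 0 := by
    intro j m x hjm
    have h1 : (n (DirectSum.lof ℂ ℕ (fun m => (E m).V) j x) : DirectSum ℕ fun m => (E m).V) m
        = (D' (DirectSum.lof ℂ ℕ (fun m => (E m).V) j (h j x)) : DirectSum ℕ fun m => (E m).V) m
        + h m ((D' (DirectSum.lof ℂ ℕ (fun m => (E m).V) j x) : DirectSum ℕ fun m => (E m).V) m)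
        - DirectSum.lof ℂ ℕ (fun m => (E m).V) j x m := by
      rw [← hS']; rfl
    rw [h1]
    rcases hjm.eq_or_lt with rfl | hlt
    · have a1 := hdiag j (h j x)
      have a2 := hdiag j x
      refine (congrArg₂ (fun y z => y + h j z - _) a1 a2).trans ?_
      rw [DirectSum.lof_apply, hh', sub_self]
    · have a1 := htri j m (h j x) hlt
      have a2 := htri j m x hlt
      refine (congrArg₂ (fun y z => y + h m z - _) a1 a2).trans ?_
      rw [DirectSum.lof_eq_of, DirectSum.of_eq_of_ne _ _ _ hlt.ne', map_zero, add_zero, sub_zero]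
  have hbij := bijective_one_add n (locally_nilpotent_of_lower n hn)
  have hsymm := he.symm
  refine contractible_of_bijective (e.symm.toLinearMap ∘ₗ S' ∘ₗ e.toLinearMap) ?_ ?_
  · exact (hsymm.comp (bS'.comp he)).congr_deg (by simp)
  · have : T.d ∘ₗ (e.symm.toLinearMap ∘ₗ S' ∘ₗ e.toLinearMap)
        + (e.symm.toLinearMap ∘ₗ S' ∘ₗ e.toLinearMap) ∘ₗ T.d
        = e.symm.toLinearMap ∘ₗ (LinearMap.id + n) ∘ₗ e.toLinearMap := by
      ext v
      simp [n, D']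
    rw [this]
    exact e.symm.bijective.comp (hbij.comp e.bijective)

/-! ### Coordinates indexed by positions -/

/-- The position `-i.idx`. -/
def Pos.idx : Pos → ℕ
  | ev j => 2 * j
  | od j => 2 * j + 1

theorem Pos.idx_next : ∀ i : Pos, i.next.idx = i.idx + 1
  | ev _ => rfl
  | od _ => rfl

theorem Pos.idx_of : ∀ m, (Pos.of m).idx = m
  | 0 => rfl
  | m + 1 => by rw [Pos.of, Pos.idx_next, Pos.idx_of]

theorem Pos.idx_injective : Function.Injective Pos.idx := by
  rintro (i | i) (j | j) h <;> simp only [Pos.idx] at h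
  · rw [show i = j by omega]
  · omega
  · omega
  · rw [show i = j by omega]

/-- The numbering of the positions. -/
def posEquiv : Pos ≃ ℕ where
  toFun := Pos.idx
  invFun := Pos.of
  left_inv i := Pos.idx_injective (Pos.idx_of _)
  right_inv := Pos.idx_of

instance : DecidableEq Pos := posEquiv.injective.decidableEq

/-- The direct sum over all positions, indexed in two ways. -/
def reindex : (DirectSum Pos fun i => (koszulAt i).V) ≃ₗ[ℂ] (totalSum koszul).V :=
  DirectSum.lequivCongrLeft ℂ posEquiv

/-- The coordinate at a position. -/
def coord (i : Pos) : (totalSum koszul).V →ₗ[ℂ] (koszulAt i).V :=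
  DirectSum.component ℂ Pos (fun i => (koszulAt i).V) i ∘ₗ reindex.symm.toLinearMap

/-- The inclusion of the term at a position. -/
def incl (i : Pos) : (koszulAt i).V →ₗ[ℂ] (totalSum koszul).V :=
  reindex.toLinearMap ∘ₗ DirectSum.lof ℂ Pos (fun i => (koszulAt i).V) i

theorem coord_of (m : ℕ) (v : (totalSum koszul).V) :
    coord (Pos.of m) v = (v : DirectSum ℕ fun m => (koszul m).V) m := by
  obtain ⟨w, rfl⟩ := reindex.surjective v
  change DirectSum.component ℂ Pos (fun i => (koszulAt i).V) (Pos.of m)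
    (reindex.symm (reindex w)) = _
  rw [reindex.symm_apply_apply]
  exact (DirectSum.lequivCongrLeft_apply ℂ posEquiv w m).symm

theorem coord_incl_self (i : Pos) (x : (koszulAt i).V) : coord i (incl i x) = x := by
  simp [coord, incl, DirectSum.component.lof_self]

theorem coord_incl_ne {i k : Pos} (h : i ≠ k) (x : (koszulAt i).V) : coord k (incl i x) = 0 := by
  simp only [coord, incl, LinearMap.comp_apply, LinearEquiv.coe_coe, LinearEquiv.symm_apply_apply]
  change DirectSum.lof ℂ Pos (fun i => (koszulAt i).V) i x k = 0
  rw [DirectSum.lof_eq_of, DirectSum.of_eq_of_ne _ _ _ h.symm]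

theorem incl_of (m : ℕ) (x : (koszulAt (Pos.of m)).V) :
    incl (Pos.of m) x = DirectSum.lof ℂ ℕ (fun m => (koszul m).V) m x := by
  refine DFinsupp.ext fun n => (coord_of n _).symm.trans ?_
  by_cases h : m = n
  · subst h
    exact (coord_incl_self _ x).trans (DirectSum.lof_apply (M := fun m => (koszul m).V) ℂ m x).symm
  · have h' : Pos.of m ≠ Pos.of n := fun e => h (by simpa [Pos.idx_of] using congrArg Pos.idx e)
    exact (coord_incl_ne h' x).trans
      (DirectSum.of_eq_of_ne (β := fun m => (koszul m).V) m n x (Ne.symm h)).symm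

theorem Pos.exists_of (i : Pos) : ∃ m, Pos.of m = i := ⟨i.idx, posEquiv.left_inv i⟩

theorem coord_bimod (i : Pos) : IsBimodMap (totalSum koszul) (koszulAt i) (i.idx, 0) (coord i) := by
  obtain ⟨m, rfl⟩ := i.exists_of
  refine ⟨fun v => ?_, fun v => ?_, fun p v hv => ?_⟩
  · rw [coord_of, coord_of]; rfl
  · rw [coord_of, coord_of]; rfl
  · rw [coord_of]
    exact gr_cast (M := koszul m) (hv m) (by ext <;> simp [Pos.idx_of])

theorem incl_bimod (i : Pos) :
    IsBimodMap (koszulAt i) (totalSum koszul) (-(i.idx : ℤ), 0) (incl i) := by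
  refine ⟨fun v => DFinsupp.ext fun n => ?_, fun v => DFinsupp.ext fun n => ?_,
    fun p v hv n => ?_⟩
  · rw [← coord_of, ← coord_of, (coord_bimod _).map_lx]
    by_cases h : i = Pos.of n
    · subst h; rw [coord_incl_self, coord_incl_self]
    · rw [coord_incl_ne h, coord_incl_ne h, map_zero]
  · rw [← coord_of, ← coord_of, (coord_bimod _).map_rx]
    by_cases h : i = Pos.of n
    · subst h; rw [coord_incl_self, coord_incl_self]
    · rw [coord_incl_ne h, coord_incl_ne h, map_zero]
  · rw [← coord_of]
    by_cases h : i = Pos.of n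
    · subst h
      rw [coord_incl_self]
      exact gr_cast (M := koszul n) hv (by ext <;> simp [Pos.idx_of])
    · rw [coord_incl_ne h]
      exact Submodule.zero_mem _

theorem eq_zero_of_coord {v : (totalSum koszul).V} (h : ∀ i, coord i v = 0) : v = 0 :=
  DFinsupp.ext fun m => (coord_of m v).symm.trans (h _)

namespace Convolution

variable {f : ∀ m, (koszul (m + 1)).V →ₗ[ℂ] (koszul m).V} (T : Convolution koszul f)

/-- The entries of the differential, indexed by positions. -/
def posEntry (i k : Pos) : (koszulAt i).V →ₗ[ℂ] (koszulAt k).V := coord k ∘ₗ T.D ∘ₗ incl i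

theorem posEntry_of (m n : ℕ) : T.posEntry (Pos.of m) (Pos.of n) = entry koszul T.D m n := by
  ext x
  exact (coord_of n _).trans (congrArg (fun v => (T.D v : DirectSum ℕ fun m => (koszul m).V) n)
    (incl_of m x))

theorem posEntry_lt {i k : Pos} (h : i.idx < k.idx) : T.posEntry i k = 0 := by
  obtain ⟨m, rfl⟩ := i.exists_of
  obtain ⟨n, rfl⟩ := k.exists_of
  rw [Pos.idx_of, Pos.idx_of] at h
  rw [posEntry_of, T.entry_lt m n h]
  rfl

theorem posEntry_self (i : Pos) (x : (koszulAt i).V) :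
    T.posEntry i i x = parity i.idx • (koszulAt i).d x := by
  obtain ⟨m, rfl⟩ := i.exists_of
  rw [posEntry_of, T.entry_diag, Pos.idx_of]
  change parity (-(m : ℤ)) • (koszulAt (Pos.of m)).d x = _
  rw [parity, Int.negOnePow_neg]
  rfl

theorem posEntry_bimod (i k : Pos) :
    IsBimodMap (koszulAt i) (koszulAt k) (1 - i.idx + k.idx, 0) (T.posEntry i k) :=
  ((coord_bimod k).comp (T.bimod.comp (incl_bimod i))).congr_deg (by ext <;> simp; ring)

end Convolution

theorem posEntry_homotopic {ε : (tensor FT FTinv).V →ₗ[ℂ] unit.V}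
    {hε : IsHomotopyEquiv (tensor FT FTinv) unit ε} (T : Convolution koszul (koszulMap hε))
    (i : Pos) :
    Homotopic (koszulAt i.next) (koszulAt i) (T.posEntry i.next i) (koszulMapAt hε i) := by
  obtain ⟨m, rfl⟩ := i.exists_of
  have := T.entry_succ m
  rw [← T.posEntry_of] at this
  exact this

/-! ### The diagonal blocks of a triangular differential -/

theorem map_eq_zero_of_lower {V : ℕ → Type} [∀ m, AddCommGroup (V m)] [∀ m, Module ℂ (V m)]
    {W : Type*} [AddCommGroup W] [Module ℂ W] (n : DirectSum ℕ V →ₗ[ℂ] W) {k : ℕ}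
    (hn : ∀ j x, j < k → n (DirectSum.lof ℂ ℕ V j x) = 0) {v : DirectSum ℕ V}
    (hv : ∀ m, k ≤ m → v m = 0) : n v = 0 := by
  classical
  rw [← DirectSum.sum_support_of v, map_sum]
  refine Finset.sum_eq_zero fun j hj => hn j _ ?_
  by_contra hc
  exact (DFinsupp.mem_support_iff.1 hj) (hv j (by omega))

/-- For a triangular operator, the part of `D y` outside index `j` lies in smaller indices and
cannot return to `j`. So the diagonal entry of `D²` is the square of the diagonal entry. -/
theorem diagonal_sq {V : ℕ → Type} [∀ m, AddCommGroup (V m)] [∀ m, Module ℂ (V m)]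
    (D : DirectSum ℕ V →ₗ[ℂ] DirectSum ℕ V) (hD : ∀ v, D (D v) = 0)
    (htri : ∀ i j x, i < j → D (DirectSum.lof ℂ ℕ V i x) j = 0) (j : ℕ) (y : V j) :
    D (DirectSum.lof ℂ ℕ V j (D (DirectSum.lof ℂ ℕ V j y) j)) j = 0 := by
  let w := D (DirectSum.lof ℂ ℕ V j y)
  have h : (DirectSum.component ℂ ℕ V j ∘ₗ D) (w - DirectSum.lof ℂ ℕ V j (w j)) = 0 := by
    refine map_eq_zero_of_lower _ (k := j) (fun i x hi => htri i j x hi) fun m hm => ?_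
    rcases hm.eq_or_lt with rfl | hlt
    · change w j - DirectSum.lof ℂ ℕ V j (w j) j = 0
      rw [DirectSum.lof_apply, sub_self]
    · change w m - DirectSum.lof ℂ ℕ V j (w j) m = 0
      rw [DirectSum.lof_eq_of, DirectSum.of_eq_of_ne _ _ _ hlt.ne', sub_zero]
      exact htri j m y hlt
  rw [map_sub, sub_eq_zero] at h
  refine Eq.trans h.symm ?_
  change D (D _) j = 0
  rw [hD]
  rfl

/-- A locally finite family of linear maps. -/
def toDirectSum {V : Type} {W : ℕ → Type} [AddCommGroup V] [Module ℂ V]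
    [∀ m, AddCommGroup (W m)] [∀ m, Module ℂ (W m)] (φ : ∀ n, V →ₗ[ℂ] W n)
    (h : ∀ v, ∃ N, ∀ n, N ≤ n → φ n v = 0) : V →ₗ[ℂ] DirectSum ℕ W where
  toFun v := ⟨fun n => φ n v, Trunc.mk ⟨(Finset.range (h v).choose).val, fun n => by
    by_cases hn : n < (h v).choose
    · exact .inl (Finset.mem_range.2 hn)
    · exact .inr ((h v).choose_spec n (not_lt.1 hn))⟩⟩
  map_add' v w := DFinsupp.ext fun n => map_add (φ n) v w
  map_smul' c v := DFinsupp.ext fun n => map_smul (φ n) c v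

namespace BlockData

/-- Construction of a complex with three steps from a differential. -/
def ofSq {A₂ A₁ A₀ : BimCpx} {f₁ f₂ : A₂.V →ₗ[ℂ] A₁.V} {g₁ g₂ : A₁.V →ₗ[ℂ] A₀.V}
    {u : A₂.V →ₗ[ℂ] A₀.V} (hf₁ : IsBimodMap A₂ A₁ (2, -2) f₁) (hf₂ : IsBimodMap A₂ A₁ (0, 2) f₂)
    (hg₁ : IsBimodMap A₁ A₀ (0, 2) g₁) (hg₂ : IsBimodMap A₁ A₀ (2, -2) g₂)
    (hu : IsBimodMap A₂ A₀ (1, 0) u) (D : BV A₂ A₁ A₀ → BV A₂ A₁ A₀)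
    (hD : ∀ v, D v = (A₂.d v.1, f₁ v.1 - A₁.d v.2.1, f₂ v.1 - A₁.d v.2.2.1,
      u v.1 + (g₁ v.2.1 + g₂ v.2.2.1) + A₀.d v.2.2.2)) (hsq : ∀ v, D (D v) = 0) :
    BlockData A₂ A₁ A₀ where
  f₁ := f₁
  f₂ := f₂
  g₁ := g₁
  g₂ := g₂
  u := u
  f₁_chain := ⟨hf₁, fun v => by
    have := congrArg (fun y => y.2.1) (hsq (v, 0, 0, 0))
    simpa [hD, sub_eq_zero] using this⟩
  f₂_chain := ⟨hf₂, fun v => by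
    have := congrArg (fun y => y.2.2.1) (hsq (v, 0, 0, 0))
    simpa [hD, sub_eq_zero] using this⟩
  g₁_chain := ⟨hg₁, fun v => by
    have := congrArg (fun y => y.2.2.2) (hsq (0, v, 0, 0))
    simp only [hD, map_zero, map_neg, zero_sub, zero_add, add_zero, sub_zero, neg_zero] at this
    exact neg_add_eq_zero.1 this⟩
  g₂_chain := ⟨hg₂, fun v => by
    have := congrArg (fun y => y.2.2.2) (hsq (0, 0, v, 0))
    simp only [hD, map_zero, map_neg, zero_sub, zero_add, add_zero, sub_zero, neg_zero] at this
    exact neg_add_eq_zero.1 this⟩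
  u_bimod := hu
  rel v := by
    have := congrArg (fun y => y.2.2.2) (hsq (v, 0, 0, 0))
    simp only [hD, map_zero, add_zero, sub_zero] at this
    refine Eq.trans ?_ this
    abel

end BlockData

/-! ### The terms of a block -/

/-- The projection of the term in position `-2j-2` to its first summand. -/
def prX (j : ℕ) : (koszulAt (.ev (j + 1))).V →ₗ[ℂ] (FTpow (j + 2)).V :=
  LinearMap.fst ℂ (FTpow (j + 2)).V (FTpow (j + 1)).V

/-- The inclusion of the first summand of the term in position `-2j-2`. -/
def inX (j : ℕ) : (FTpow (j + 2)).V →ₗ[ℂ] (koszulAt (.ev (j + 1))).V :=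
  LinearMap.inl ℂ (FTpow (j + 2)).V (FTpow (j + 1)).V

/-- The first projection of the term in position `-2j-1`. -/
def prY₁ (j : ℕ) : (koszulAt (.od j)).V →ₗ[ℂ] (FTpow (j + 1)).V :=
  LinearMap.fst ℂ (FTpow (j + 1)).V (FTpow (j + 1)).V

/-- The second projection of the term in position `-2j-1`. -/
def prY₂ (j : ℕ) : (koszulAt (.od j)).V →ₗ[ℂ] (FTpow (j + 1)).V :=
  LinearMap.snd ℂ (FTpow (j + 1)).V (FTpow (j + 1)).V

/-- The first inclusion into the term in position `-2j-1`. -/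
def inY₁ (j : ℕ) : (FTpow (j + 1)).V →ₗ[ℂ] (koszulAt (.od j)).V :=
  LinearMap.inl ℂ (FTpow (j + 1)).V (FTpow (j + 1)).V

/-- The second inclusion into the term in position `-2j-1`. -/
def inY₂ (j : ℕ) : (FTpow (j + 1)).V →ₗ[ℂ] (koszulAt (.od j)).V :=
  LinearMap.inr ℂ (FTpow (j + 1)).V (FTpow (j + 1)).V

/-- The projection of the term in position `-2j` to its last summand. -/
def prZ : (j : ℕ) → (koszulAt (.ev j)).V →ₗ[ℂ] (FTpow j).V
  | 0 => LinearMap.id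
  | j + 1 => LinearMap.snd ℂ (FTpow (j + 2)).V (FTpow (j + 1)).V

/-- The inclusion of the last summand of the term in position `-2j`. -/
def inZ : (j : ℕ) → (FTpow j).V →ₗ[ℂ] (koszulAt (.ev j)).V
  | 0 => LinearMap.id
  | j + 1 => LinearMap.inr ℂ (FTpow (j + 2)).V (FTpow (j + 1)).V

theorem smul_parity_one {M : BimCpx} {k : ℤ × ℤ} (hk : parity k.1 = 1) (v : M.V) : parity k.1 • v = v := by
  rw [hk, one_smul]

theorem prX_inX (j : ℕ) (x : (FTpow (j + 2)).V) : prX j (inX j x) = x := rfl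

theorem prX_inZ (j : ℕ) (x : (FTpow (j + 1)).V) : prX j (inZ (j + 1) x) = 0 := rfl

theorem prZ_inX (j : ℕ) (x : (FTpow (j + 2)).V) : prZ (j + 1) (inX j x) = 0 := rfl

theorem prZ_inZ : ∀ (j : ℕ) (x : (FTpow j).V), prZ j (inZ j x) = x
  | 0, _ => rfl
  | _ + 1, _ => rfl

theorem prY₁_in (j : ℕ) (x y : (FTpow (j + 1)).V) : prY₁ j (inY₁ j x + inY₂ j y) = x :=
  add_zero x

theorem prY₂_in (j : ℕ) (x y : (FTpow (j + 1)).V) : prY₂ j (inY₁ j x + inY₂ j y) = y :=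
  zero_add y

theorem dirSum_inl_chain {M₁ M₂ : BimCpx} {k l p : ℤ × ℤ} (hk : parity k.1 = 1) (h : p = k) :
    IsChainDeg p M₁ (dirSum (shift k M₁) (shift l M₂)) (LinearMap.inl ℂ M₁.V M₂.V) := by
  subst h
  refine ⟨⟨fun v => ?_, fun v => ?_, fun a v hv => ⟨?_, Submodule.zero_mem _⟩⟩, fun v => ?_⟩
  · exact Prod.ext rfl (map_zero M₂.lx).symm
  · exact Prod.ext rfl (map_zero M₂.rx).symm
  · exact gr_cast (M := M₁) hv (by simp)
  · exact Prod.ext (smul_parity_one hk _).symm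
      ((smul_zero _).symm.trans (congrArg (parity l.1 • ·) (map_zero M₂.d).symm))

theorem dirSum_inr_chain {M₁ M₂ : BimCpx} {k l p : ℤ × ℤ} (hl : parity l.1 = 1) (h : p = l) :
    IsChainDeg p M₂ (dirSum (shift k M₁) (shift l M₂)) (LinearMap.inr ℂ M₁.V M₂.V) := by
  subst h
  refine ⟨⟨fun v => ?_, fun v => ?_, fun a v hv => ⟨Submodule.zero_mem _, ?_⟩⟩, fun v => ?_⟩
  · exact Prod.ext (map_zero M₁.lx).symm rfl
  · exact Prod.ext (map_zero M₁.rx).symm rfl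
  · exact gr_cast (M := M₂) hv (by simp)
  · exact Prod.ext ((smul_zero _).symm.trans (congrArg (parity k.1 • ·) (map_zero M₁.d).symm))
      (smul_parity_one hl _).symm

theorem dirSum_fst_chain {M₁ M₂ : BimCpx} {k l p : ℤ × ℤ} (hk : parity k.1 = 1) (h : p = -k) :
    IsChainDeg p (dirSum (shift k M₁) (shift l M₂)) M₁ (LinearMap.fst ℂ M₁.V M₂.V) := by
  subst h
  exact ⟨⟨fun v => rfl, fun v => rfl, fun a v hv => gr_cast (M := M₁) hv.1 (sub_eq_add_neg _ _)⟩,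
    fun v => smul_parity_one hk _⟩

theorem dirSum_snd_chain {M₁ M₂ : BimCpx} {k l p : ℤ × ℤ} (hl : parity l.1 = 1) (h : p = -l) :
    IsChainDeg p (dirSum (shift k M₁) (shift l M₂)) M₂ (LinearMap.snd ℂ M₁.V M₂.V) := by
  subst h
  exact ⟨⟨fun v => rfl, fun v => rfl, fun a v hv => gr_cast (M := M₂) hv.2 (sub_eq_add_neg _ _)⟩,
    fun v => smul_parity_one hl _⟩

theorem prX_chain (j : ℕ) : IsChainDeg (-(2 * j + 2), 0) (koszulAt (.ev (j + 1))) (FTpow (j + 2))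
    (prX j) := dirSum_fst_chain (parity_smul _) (by ext <;> simp; ring)

theorem inX_chain (j : ℕ) : IsChainDeg (2 * j + 2, 0) (FTpow (j + 2)) (koszulAt (.ev (j + 1)))
    (inX j) := dirSum_inl_chain (parity_smul _) (by ext <;> simp; ring)

theorem prY₁_chain (j : ℕ) : IsChainDeg (-(2 * j), -2) (koszulAt (.od j)) (FTpow (j + 1))
    (prY₁ j) := dirSum_fst_chain (parity_smul_add_even j parity_zero) (by ext <;> simp; ring)

theorem prY₂_chain (j : ℕ) : IsChainDeg (-(2 * j + 2), 2) (koszulAt (.od j)) (FTpow (j + 1))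
    (prY₂ j) := dirSum_snd_chain (parity_smul_add_even j parity_two) (by ext <;> simp; ring)

theorem inY₁_chain (j : ℕ) : IsChainDeg (2 * j, 2) (FTpow (j + 1)) (koszulAt (.od j))
    (inY₁ j) := dirSum_inl_chain (parity_smul_add_even j parity_zero) (by ext <;> simp; ring)

theorem inY₂_chain (j : ℕ) : IsChainDeg (2 * j + 2, -2) (FTpow (j + 1)) (koszulAt (.od j))
    (inY₂ j) := dirSum_inr_chain (parity_smul_add_even j parity_two) (by ext <;> simp; ring)

theorem prZ_chain : ∀ j : ℕ, IsChainDeg (-(2 * j), 0) (koszulAt (.ev j)) (FTpow j) (prZ j)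
  | 0 => IsChainMap.id.deg
  | j + 1 => dirSum_snd_chain (parity_smul (j + 1)) (by ext <;> simp; ring)

theorem inZ_chain : ∀ j : ℕ, IsChainDeg (2 * j, 0) (FTpow j) (koszulAt (.ev j)) (inZ j)
  | 0 => IsChainMap.id.deg
  | j + 1 => dirSum_inr_chain (parity_smul (j + 1)) (by ext <;> simp; ring)

/-! ### Decomposition of the total complex into blocks -/

/-- The space of the `j`-th block. -/
abbrev BlockV (j : ℕ) : Type := BlockData.BV (FTpow (j + 2)) (FTpow (j + 1)) (FTpow j)

/-- The projection to the `j`-th block. -/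
def blockCoord (j : ℕ) : (totalSum koszul).V →ₗ[ℂ] BlockV j :=
  (prX j ∘ₗ coord (.ev (j + 1))).prod ((prY₁ j ∘ₗ coord (.od j)).prod
    ((prY₂ j ∘ₗ coord (.od j)).prod (prZ j ∘ₗ coord (.ev j))))

theorem blockCoord_apply (j : ℕ) (v : (totalSum koszul).V) : blockCoord j v =
    (prX j (coord (.ev (j + 1)) v), prY₁ j (coord (.od j) v), prY₂ j (coord (.od j) v),
      prZ j (coord (.ev j) v)) := rfl

/-- The inclusion of the `j`-th block. -/
def blockIncl (j : ℕ) : BlockV j →ₗ[ℂ] (totalSum koszul).V where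
  toFun y := incl (.ev (j + 1)) (inX j y.1) + incl (.od j) (inY₁ j y.2.1 + inY₂ j y.2.2.1)
    + incl (.ev j) (inZ j y.2.2.2)
  map_add' v w := by simp; abel
  map_smul' c v := by simp

theorem blockIncl_apply (j : ℕ) (y : BlockV j) : blockIncl j y =
    incl (.ev (j + 1)) (inX j y.1) + incl (.od j) (inY₁ j y.2.1 + inY₂ j y.2.2.1)
      + incl (.ev j) (inZ j y.2.2.2) := rfl

theorem map_blockIncl {W : Type} [AddCommGroup W] [Module ℂ W] (ψ : (totalSum koszul).V →ₗ[ℂ] W)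
    (j : ℕ) (y : BlockV j) : ψ (blockIncl j y) = ψ (incl (.ev (j + 1)) (inX j y.1))
      + ψ (incl (.od j) (inY₁ j y.2.1 + inY₂ j y.2.2.1)) + ψ (incl (.ev j) (inZ j y.2.2.2)) := by
  rw [blockIncl_apply, map_add, map_add]

theorem blockCoord_incl_self (j : ℕ) (y : BlockV j) : blockCoord j (blockIncl j y) = y := by
  have h1 : coord (.ev (j + 1)) (blockIncl j y) = inX j y.1 := by
    rw [map_blockIncl, coord_incl_self, coord_incl_ne (by simp), coord_incl_ne (by simp),
      add_zero, add_zero]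
  have h2 : coord (.od j) (blockIncl j y) = inY₁ j y.2.1 + inY₂ j y.2.2.1 := by
    rw [map_blockIncl, coord_incl_self, coord_incl_ne (by simp), coord_incl_ne (by simp),
      zero_add, add_zero]
  have h3 : coord (.ev j) (blockIncl j y) = inZ j y.2.2.2 := by
    rw [map_blockIncl, coord_incl_self, coord_incl_ne (by simp), coord_incl_ne (by simp),
      zero_add, zero_add]
  rw [blockCoord_apply, h1, h2, h3, prX_inX, prY₁_in, prY₂_in, prZ_inZ]

theorem blockCoord_incl_ne {j n : ℕ} (h : j ≠ n) (y : BlockV j) :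
    blockCoord n (blockIncl j y) = 0 := by
  have h1 : ∀ w, coord (.od n) (incl (.od j) w) = 0 := fun w => coord_incl_ne (by simpa using h) w
  have h2 : ∀ w, coord (.ev (n + 1)) (incl (.ev (j + 1)) w) = 0 :=
    fun w => coord_incl_ne (by simpa using h) w
  have h3 : ∀ w, coord (.ev n) (incl (.ev j) w) = 0 := fun w => coord_incl_ne (by simpa using h) w
  have h4 : prX n (coord (.ev (n + 1)) (incl (.ev j) (inZ j y.2.2.2))) = 0 := by
    by_cases e : j = n + 1
    · subst e
      rw [coord_incl_self, prX_inZ]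
    · rw [coord_incl_ne (by simpa using e), map_zero]
  have h5 : prZ n (coord (.ev n) (incl (.ev (j + 1)) (inX j y.1))) = 0 := by
    by_cases e : j + 1 = n
    · subst e
      rw [coord_incl_self, prZ_inX]
    · rw [coord_incl_ne (by simpa using e), map_zero]
  have a1 : prX n (coord (.ev (n + 1)) (blockIncl j y)) = 0 := by
    rw [map_blockIncl, h2, coord_incl_ne (by simp), zero_add, zero_add, h4]
  have a2 : coord (.od n) (blockIncl j y) = 0 := by
    rw [map_blockIncl, h1, coord_incl_ne (by simp), coord_incl_ne (by simp), zero_add, zero_add]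
  have a3 : prZ n (coord (.ev n) (blockIncl j y)) = 0 := by
    rw [map_blockIncl, h3, coord_incl_ne (i := .od j) (by simp), add_zero, add_zero, h5]
  rw [blockCoord_apply, a1, a2, a3, map_zero, map_zero]
  rfl

theorem exists_coord_bound (v : (totalSum koszul).V) :
    ∃ N, ∀ i : Pos, N ≤ i.idx → coord i v = 0 := by
  classical
  refine ⟨(DFinsupp.support (v : DirectSum ℕ fun m => (koszul m).V)).sup id + 1, fun i hi => ?_⟩
  obtain ⟨m, rfl⟩ := i.exists_of
  rw [Pos.idx_of] at hi
  rw [coord_of]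
  by_contra hc
  have : m ≤ (DFinsupp.support (v : DirectSum ℕ fun m => (koszul m).V)).sup id :=
    Finset.le_sup (f := id) (DFinsupp.mem_support_iff.2 hc)
  omega

theorem exists_blockCoord_bound (v : (totalSum koszul).V) :
    ∃ N, ∀ n, N ≤ n → blockCoord n v = 0 := by
  obtain ⟨N, h⟩ := exists_coord_bound v
  refine ⟨N, fun n hn => ?_⟩
  rw [blockCoord_apply, h _ (by simp [Pos.idx]; omega), h _ (by simp [Pos.idx]; omega),
    h _ (by simp [Pos.idx]; omega)]
  simp

theorem eq_zero_of_blockCoord {v : (totalSum koszul).V} (h : ∀ n, blockCoord n v = 0) : v = 0 := by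
  refine eq_zero_of_coord fun i => ?_
  match i with
  | .ev 0 => exact congrArg (fun y => y.2.2.2) (h 0)
  | .ev (j + 1) =>
    exact Prod.ext (congrArg (fun y => y.1) (h j)) (congrArg (fun y => y.2.2.2) (h (j + 1)))
  | .od j => exact Prod.ext (congrArg (fun y => y.2.1) (h j)) (congrArg (fun y => y.2.2.1) (h j))

/-- The decomposition into blocks. -/
def blockMap : (totalSum koszul).V →ₗ[ℂ] DirectSum ℕ BlockV :=
  toDirectSum blockCoord exists_blockCoord_bound

theorem blockMap_apply (v : (totalSum koszul).V) (n : ℕ) : blockMap v n = blockCoord n v := rfl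

theorem blockMap_incl (j : ℕ) (y : BlockV j) :
    blockMap (blockIncl j y) = DirectSum.lof ℂ ℕ BlockV j y := by
  refine DFinsupp.ext fun n => (blockMap_apply _ n).trans ?_
  by_cases h : j = n
  · subst h
    exact (blockCoord_incl_self j y).trans (DirectSum.lof_apply (M := BlockV) ℂ j y).symm
  · exact (blockCoord_incl_ne h y).trans
      (DirectSum.of_eq_of_ne (β := BlockV) j n y (Ne.symm h)).symm

theorem blockMap_bijective : Function.Bijective blockMap := by
  constructor
  · rw [injective_iff_map_eq_zero]
    intro v hv
    refine eq_zero_of_blockCoord fun n => ?_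
    rw [← blockMap_apply, hv]
    rfl
  · intro w
    induction w using DirectSum.induction_on with
    | zero => exact ⟨0, map_zero _⟩
    | of j y => exact ⟨blockIncl j y, blockMap_incl j y⟩
    | add x y hx hy =>
      obtain ⟨a, rfl⟩ := hx
      obtain ⟨b, rfl⟩ := hy
      exact ⟨a + b, map_add _ _ _⟩

/-- The decomposition into blocks, as an equivalence. -/
def blockEquiv : (totalSum koszul).V ≃ₗ[ℂ] DirectSum ℕ BlockV :=
  .ofBijective blockMap blockMap_bijective

theorem blockEquiv_symm_lof (j : ℕ) (y : BlockV j) :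
    blockEquiv.symm (DirectSum.lof ℂ ℕ BlockV j y) = blockIncl j y :=
  (LinearEquiv.symm_apply_eq _).2 (blockMap_incl j y).symm

namespace Convolution

variable {f : ∀ m, (koszul (m + 1)).V →ₗ[ℂ] (koszul m).V} (T : Convolution koszul f)

theorem coord_D_blockIncl (k : Pos) (j : ℕ) (y : BlockV j) : coord k (T.D (blockIncl j y)) =
    T.posEntry (.ev (j + 1)) k (inX j y.1)
      + T.posEntry (.od j) k (inY₁ j y.2.1 + inY₂ j y.2.2.1)
      + T.posEntry (.ev j) k (inZ j y.2.2.2) := map_blockIncl (coord k ∘ₗ T.D) j y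

theorem posEntry_eq_zero {i k : Pos} (h : i.idx < k.idx) (x : (koszulAt i).V) :
    T.posEntry i k x = 0 := by
  rw [T.posEntry_lt h]; rfl

theorem posEntry_ev (j : ℕ) (x : (koszulAt (.ev j)).V) :
    T.posEntry (.ev j) (.ev j) x = (koszulAt (.ev j)).d x := by
  have : parity ((Pos.ev j).idx : ℤ) = 1 := by simp [Pos.idx, parity_two_mul]
  rw [posEntry_self, this, one_smul]

theorem posEntry_od (j : ℕ) (x : (koszulAt (.od j)).V) :
    T.posEntry (.od j) (.od j) x = -(koszulAt (.od j)).d x := by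
  have : ((Pos.od j).idx : ℤ) = 2 * (j : ℤ) + 1 := by simp [Pos.idx]
  rw [posEntry_self, this, parity_succ, parity_two_mul, neg_smul, one_smul]

/-- An entry into a later block would move to the left or stay in one position. The only position
shared by two blocks is `-2j-2`, with summands in blocks `j` and `j+1`; there the entry is the
differential of a direct sum, which does not mix the summands. -/
theorem blockCoord_D_lt {j n : ℕ} (h : j < n) (y : BlockV j) :
    blockCoord n (T.D (blockIncl j y)) = 0 := by
  have h5 : prZ n (T.posEntry (.ev (j + 1)) (.ev n) (inX j y.1)) = 0 := by
    by_cases e : j + 1 = n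
    · subst e
      rw [posEntry_ev, ← (inX_chain j).map_d, prZ_inX]
    · rw [T.posEntry_eq_zero (by simp only [Pos.idx]; omega), map_zero]
  have a1 : coord (.ev (n + 1)) (T.D (blockIncl j y)) = 0 := by
    rw [coord_D_blockIncl, T.posEntry_eq_zero (by simp only [Pos.idx]; omega),
      T.posEntry_eq_zero (by simp only [Pos.idx]; omega),
      T.posEntry_eq_zero (by simp only [Pos.idx]; omega), add_zero, add_zero]
  have a2 : coord (.od n) (T.D (blockIncl j y)) = 0 := by
    rw [coord_D_blockIncl, T.posEntry_eq_zero (by simp only [Pos.idx]; omega),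
      T.posEntry_eq_zero (by simp only [Pos.idx]; omega),
      T.posEntry_eq_zero (by simp only [Pos.idx]; omega), add_zero, add_zero]
  have a3 : prZ n (coord (.ev n) (T.D (blockIncl j y))) = 0 := by
    rw [coord_D_blockIncl, T.posEntry_eq_zero (i := .od j) (by simp only [Pos.idx]; omega),
      T.posEntry_eq_zero (i := .ev j) (by simp only [Pos.idx]; omega), add_zero, add_zero, h5]
  rw [blockCoord_apply, a1, a2, a3, map_zero, map_zero, map_zero]
  rfl

theorem blockCoord_D_self (j : ℕ) (y : BlockV j) : blockCoord j (T.D (blockIncl j y)) =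
    ((FTpow (j + 2)).d y.1,
      prY₁ j (T.posEntry (.ev (j + 1)) (.od j) (inX j y.1)) - (FTpow (j + 1)).d y.2.1,
      prY₂ j (T.posEntry (.ev (j + 1)) (.od j) (inX j y.1)) - (FTpow (j + 1)).d y.2.2.1,
      prZ j (T.posEntry (.ev (j + 1)) (.ev j) (inX j y.1))
        + (prZ j (T.posEntry (.od j) (.ev j) (inY₁ j y.2.1))
          + prZ j (T.posEntry (.od j) (.ev j) (inY₂ j y.2.2.1)))
        + (FTpow j).d y.2.2.2) := by
  have a1 : prX j (coord (.ev (j + 1)) (T.D (blockIncl j y))) = (FTpow (j + 2)).d y.1 := by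
    rw [coord_D_blockIncl, T.posEntry_eq_zero (i := .od j) (by simp only [Pos.idx]; omega),
      T.posEntry_eq_zero (i := .ev j) (by simp only [Pos.idx]; omega), add_zero, add_zero,
      posEntry_ev, ← (inX_chain j).map_d, prX_inX]
  have a2 : coord (.od j) (T.D (blockIncl j y)) = T.posEntry (.ev (j + 1)) (.od j) (inX j y.1)
      - (inY₁ j ((FTpow (j + 1)).d y.2.1) + inY₂ j ((FTpow (j + 1)).d y.2.2.1)) := by
    rw [coord_D_blockIncl, T.posEntry_eq_zero (i := .ev j) (by simp only [Pos.idx]; omega),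
      add_zero, posEntry_od, map_add, ← (inY₁_chain j).map_d, ← (inY₂_chain j).map_d,
      sub_eq_add_neg]
  have a3 : prZ j (coord (.ev j) (T.D (blockIncl j y))) =
      prZ j (T.posEntry (.ev (j + 1)) (.ev j) (inX j y.1))
        + (prZ j (T.posEntry (.od j) (.ev j) (inY₁ j y.2.1))
          + prZ j (T.posEntry (.od j) (.ev j) (inY₂ j y.2.2.1)))
        + (FTpow j).d y.2.2.2 := by
    rw [coord_D_blockIncl, posEntry_ev, ← (inZ_chain j).map_d, map_add, map_add, map_add, map_add,
      prZ_inZ]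
  rw [blockCoord_apply, a1, a2, a3, map_sub, map_sub, prY₁_in, prY₂_in]

theorem blockEquiv_D_lof (j n : ℕ) (y : BlockV j) :
    blockEquiv (T.D (blockEquiv.symm (DirectSum.lof ℂ ℕ BlockV j y))) n
      = blockCoord n (T.D (blockIncl j y)) :=
  congrArg (fun v => blockCoord n (T.D v)) (blockEquiv_symm_lof j y)

/-- Thanks to triangularity each diagonal block is a complex in its own right, so the relations
required of `BlockData` can be read off from `D² = 0`. -/
theorem blockCoord_D_sq (j : ℕ) (y : BlockV j) :
    blockCoord j (T.D (blockIncl j (blockCoord j (T.D (blockIncl j y))))) = 0 := by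
  have := diagonal_sq (blockEquiv.toLinearMap ∘ₗ T.D ∘ₗ blockEquiv.symm.toLinearMap)
    (fun v => ?_) (fun i j x hij => (T.blockEquiv_D_lof i j x).trans (T.blockCoord_D_lt hij x)) j y
  · refine Eq.trans ?_ this
    refine Eq.trans ?_ (T.blockEquiv_D_lof j j _).symm
    exact congrArg (fun v => blockCoord j (T.D (blockIncl j v))) (T.blockEquiv_D_lof j j y).symm
  · refine Eq.trans (congrArg (fun v => blockEquiv (T.D v)) (blockEquiv.symm_apply_apply _)) ?_
    exact (congrArg blockEquiv (T.sq_zero _)).trans (map_zero blockEquiv)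

/-- The complex with three steps in the `j`-th block. -/
def blockData (j : ℕ) : BlockData (FTpow (j + 2)) (FTpow (j + 1)) (FTpow j) :=
  .ofSq (f₁ := prY₁ j ∘ₗ T.posEntry (.ev (j + 1)) (.od j) ∘ₗ inX j)
    (f₂ := prY₂ j ∘ₗ T.posEntry (.ev (j + 1)) (.od j) ∘ₗ inX j)
    (g₁ := prZ j ∘ₗ T.posEntry (.od j) (.ev j) ∘ₗ inY₁ j)
    (g₂ := prZ j ∘ₗ T.posEntry (.od j) (.ev j) ∘ₗ inY₂ j)
    (u := prZ j ∘ₗ T.posEntry (.ev (j + 1)) (.ev j) ∘ₗ inX j)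
    (((prY₁_chain j).bimod.comp ((T.posEntry_bimod _ _).comp (inX_chain j).bimod)).congr_deg (by
      ext <;> simp [Pos.idx]; ring))
    (((prY₂_chain j).bimod.comp ((T.posEntry_bimod _ _).comp (inX_chain j).bimod)).congr_deg (by
      ext <;> simp [Pos.idx]; ring))
    (((prZ_chain j).bimod.comp ((T.posEntry_bimod _ _).comp (inY₁_chain j).bimod)).congr_deg (by
      ext <;> simp [Pos.idx]))
    (((prZ_chain j).bimod.comp ((T.posEntry_bimod _ _).comp (inY₂_chain j).bimod)).congr_deg (by
      ext <;> simp [Pos.idx]))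
    (((prZ_chain j).bimod.comp ((T.posEntry_bimod _ _).comp (inX_chain j).bimod)).congr_deg (by
      ext <;> simp [Pos.idx]; ring))
    (fun y => blockCoord j (T.D (blockIncl j y))) (T.blockCoord_D_self j) (T.blockCoord_D_sq j)

theorem blockEquiv_bimod : IsBimodMap T.total (bigSum fun j => (T.blockData j).block) 0
    blockEquiv.toLinearMap := by
  have hX := fun n => (prX_chain n).bimod.comp (coord_bimod (.ev (n + 1)))
  have hY₁ := fun n => (prY₁_chain n).bimod.comp (coord_bimod (.od n))
  have hY₂ := fun n => (prY₂_chain n).bimod.comp (coord_bimod (.od n))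
  have hZ := fun n => (prZ_chain n).bimod.comp (coord_bimod (.ev n))
  refine ⟨fun v => DFinsupp.ext fun n => ?_, fun v => DFinsupp.ext fun n => ?_,
    fun p v hv n => ?_⟩
  · exact Prod.ext ((hX n).map_lx v) (Prod.ext ((hY₁ n).map_lx v)
      (Prod.ext ((hY₂ n).map_lx v) ((hZ n).map_lx v)))
  · exact Prod.ext ((hX n).map_rx v) (Prod.ext ((hY₁ n).map_rx v)
      (Prod.ext ((hY₂ n).map_rx v) ((hZ n).map_rx v)))
  · refine ⟨gr_cast (M := FTpow (n + 2)) ((hX n).map_gr p v hv) ?_,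
      gr_cast (M := FTpow (n + 1)) ((hY₁ n).map_gr p v hv) ?_,
      gr_cast (M := FTpow (n + 1)) ((hY₂ n).map_gr p v hv) ?_,
      gr_cast (M := FTpow n) ((hZ n).map_gr p v hv) ?_⟩
    all_goals ext <;> simp [Pos.idx] <;> ring

theorem contractible_total (hT : ∀ j, Contractible (T.blockData j).block) :
    Contractible T.total :=
  contractible_of_triangular (T := T.total) (E := fun j => (T.blockData j).block)
    blockEquiv T.blockEquiv_bimod
    (fun j x => (T.blockEquiv_D_lof j j x).trans (T.blockCoord_D_self j x))
    (fun j n x h => (T.blockEquiv_D_lof j n x).trans (T.blockCoord_D_lt h x)) hT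

end Convolution

/-! ### Contractibility of all total complexes -/

section

variable {ε : (tensor FT FTinv).V →ₗ[ℂ] unit.V}

theorem Homotopic.deg {M N : BimCpx} {f g : M.V →ₗ[ℂ] N.V} (h : Homotopic M N f g) :
    HomotopicDeg 0 M N f g := by
  obtain ⟨s, hs, e⟩ := h
  exact ⟨s, hs.congr_deg (zero_add _).symm, LinearMap.congr_fun e⟩

variable {hε : IsHomotopyEquiv (tensor FT FTinv) unit ε}

theorem prY₁_koszulMapAt (j : ℕ) (x : (FTpow (j + 2)).V) :
    prY₁ j (koszulMapAt hε (.od j) (inX j x)) = eigenStep hε eigenW (j + 1) x :=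
  add_zero (eigenStep hε eigenW (j + 1) x)

theorem prY₂_koszulMapAt (j : ℕ) (x : (FTpow (j + 2)).V) :
    prY₂ j (koszulMapAt hε (.od j) (inX j x)) = (-eigenStep hε eigenZ (j + 1)) x :=
  (congrArg ((-eigenStep hε eigenZ (j + 1)) x + ·) (map_zero (FTpow (j + 1)).lx)).trans (add_zero _)

theorem prZ_koszulMapAt₁ : ∀ (j : ℕ) (x : (FTpow (j + 1)).V),
    prZ j (koszulMapAt hε (.ev j) (inY₁ j x)) = eigenStep hε eigenZ j x
  | 0, x => (congrArg (eigenStep hε eigenZ 0 x + ·) (map_zero (eigenStep hε eigenW 0))).trans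
      (add_zero _)
  | j + 1, x => (congrArg (eigenStep hε eigenZ (j + 1) x + ·)
      (map_zero (eigenStep hε eigenW (j + 1)))).trans (add_zero _)

theorem prZ_koszulMapAt₂ : ∀ (j : ℕ) (x : (FTpow (j + 1)).V),
    prZ j (koszulMapAt hε (.ev j) (inY₂ j x)) = eigenStep hε eigenW j x
  | 0, x => (congrArg (· + eigenStep hε eigenW 0 x) (map_zero (eigenStep hε eigenZ 0))).trans
      (zero_add _)
  | j + 1, x => (congrArg (· + eigenStep hε eigenW (j + 1) x)
      (map_zero (eigenStep hε eigenZ (j + 1)))).trans (zero_add _)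

/-- Every total complex of the Koszul-type complex is contractible. -/
theorem Convolution.contractible (T : Convolution koszul (koszulMap hε)) :
    Contractible T.total := by
  refine T.contractible_total fun j => ?_
  obtain ⟨c, hc, h⟩ := exists_isScalar hε
  -- The inclusions and projections of the summands are chain maps of some degree, so the homotopies
  -- supplied by the convolution restrict to the short entries of the block.
  have hX := (posEntry_homotopic T (.od j)).deg.comp_right (inX_chain j)
  have hY₁ := (posEntry_homotopic T (.ev j)).deg.comp_right (inY₁_chain j)
  have hY₂ := (posEntry_homotopic T (.ev j)).deg.comp_right (inY₂_chain j)
  refine (T.blockData j).contractible (τ := tower) (k := j) (c := c) (r₂ := ret (j + 2))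
    (r₁ := ret (j + 1)) (r₀ := ret j) hc ?_ ?_ ?_ ?_
  · exact (((hX.comp_left (prY₁_chain j)).congr (by ext <;> simp)).trans
      (.of_eq (prY₁_koszulMapAt j))).trans (h (j + 1)).1
  · exact (((hX.comp_left (prY₂_chain j)).congr (by ext <;> simp)).trans
      (.of_eq (prY₂_koszulMapAt j))).trans (h.neg_z (j + 1))
  · exact (((hY₁.comp_left (prZ_chain j)).congr (by ext <;> simp)).trans
      (.of_eq (prZ_koszulMapAt₁ j))).trans (h j).2
  · exact (((hY₂.comp_left (prZ_chain j)).congr (by ext <;> simp)).trans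
      (.of_eq (prZ_koszulMapAt₂ j))).trans (h j).1

end

end SBim2

end

theorem mainTheorem9 :
    -- the complexes `FT` and `FT⁻¹` are the full twist `σ²` and its inverse, mutually inverse
    (∃ φ, SBim2.IsHomotopyEquiv SBim2.FT (SBim2.tensor SBim2.sigma SBim2.sigma) φ) ∧
    (∃ ψ, SBim2.IsHomotopyEquiv SBim2.FTinv
      (SBim2.tensor SBim2.sigmaInv SBim2.sigmaInv) ψ) ∧
    (∃ ε, SBim2.IsHomotopyEquiv (SBim2.tensor SBim2.FT SBim2.FTinv) SBim2.unit ε) ∧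
    -- the eigenmaps `z : q 1 → FT` and `w : t 1 → FT` are morphisms of complexes
    SBim2.IsChainMap (SBim2.shift SBim2.qdeg SBim2.unit) SBim2.FT SBim2.eigenZ ∧
    SBim2.IsChainMap (SBim2.shift SBim2.tdeg SBim2.unit) SBim2.FT SBim2.eigenW ∧
    -- all objects are bounded complexes of Soergel bimodules
    (∀ m, SBim2.IsSoergel (SBim2.koszul m)) ∧
    -- for every identification `ε : FT ⊗ FT⁻¹ ≃ 1` the infinite Koszul-type complex exists as an
    -- object, and it is contractible
    ∀ (ε : (SBim2.tensor SBim2.FT SBim2.FTinv).V →ₗ[ℂ] SBim2.unit.V)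
      (hε : SBim2.IsHomotopyEquiv (SBim2.tensor SBim2.FT SBim2.FTinv) SBim2.unit ε),
      Nonempty (SBim2.Convolution SBim2.koszul (SBim2.koszulMap hε)) ∧
      ∀ T : SBim2.Convolution SBim2.koszul (SBim2.koszulMap hε), SBim2.Contractible T.total := by
  exact ⟨SBim2.ft_hequiv_sigma_sq, SBim2.ftInv_hequiv_sigmaInv_sq, SBim2.ft_tensor_ftInv,
    SBim2.eigenZ_chain, SBim2.eigenW_chain, fun m => SBim2.isSoergel_koszulAt (SBim2.Pos.of m),
    fun ε hε => ⟨SBim2.convolution_nonempty hε, fun T => T.contractible⟩⟩
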